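/- **Setting.** Let $\ell\ge 1$, $c_1,\dots,c_\ell\in\mathbb R$ with $c_\ell>0$, $V(x)=(-1)^{\ell+1}c_\ell x^{2\ell}+\sum_{j=1}^{\ell-1}c_jx^{2j}$, and $\beta>0$. Write $\langle f\rangle=\int_0^\infty f(x)\,dx$ and $T\psi(w)=\int_0^\infty \ln|w^2-z^2|\,\psi(z)\,dz$ for $w\in\mathbb R$. For $b>0$ and a potential $V$ as above let $\varrho_{b,V}$ be the minimizer of $$\mathcal F[\varrho]=-\tfrac12\iint_{\mathbb R_+^2}\ln|x^2-y^2|\,\varrho(x)\varrho(y)\,dx\,dy-\int_{\mathbb R_+}\bigl(V(ix)+V(-ix)\bigr)\varrho(x)\,dx+\int_{\mathbb R_+}\varrho(x)\ln\bigl(x\varrho(x)\bigr)\,dx$$ among the densities $\varrho\ge 0$ on $\mathbb R_+$ with $\int_{\mathbb R_+}\varrho=b$ for which these three integrals converge absolutely; it is represented by the density that is continuous on $(0,\infty)$ and zero elsewhere. Let $\mu=\mu(b,V)$ be the constant in its Euler–Lagrange equation $$-T\varrho(x)-(V(ix)+V(-ix))+\ln x+\ln\varrho(x)+1-\mu=0,\qquad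 x>0 .$$ Put $\kappa=\partial_b\mu$, $\partial_\mu=\kappa^{-1}\partial_b$ (at fixed $V$), $\sigma=\partial_\mu\varrho$, $q_n=\kappa\langle\sigma w^{2n}\rangle$. Write $\varrho=\varrho_{\beta,V}$. Let $(1-T\varrho)^{-1}$ be the inverse on $L^2(\varrho\,dx)$, $(1-\varrho T)^{-1}$ the inverse on $L^2(dx/\varrho)$ (both spaces complex, on $\mathbb R_+$), and $[f]^{\rm dr}=(1-T\varrho)^{-1}f$. *Variation of parameters.* Let $W$ be a complex polynomial whose coefficients of degree $>2\ell$ are purely imaginary. A *branch in the direction $W$* is a pair of families $\varrho_{b,V+sW}$ (complex densities), $\mu(b,V+sW)\in\mathbb C$, for $(b,s)\in\mathbb R^2$ near $(\beta,0)$, such that $$\int_{\mathbb R_+}\varrho_{b,V+sW}=b,\qquad x\,\varrho_{b,V+sW}(x)=\exp\bigl(T\varrho_{b,V+sW}(x)+(V+sW)(ix)+(V+sW)(-ix)+\mu(b,V+sW)-1\bigr)\quad(x>0),$$ which agree with the minimizer and its constant whenever $V+sW$ is again a real potential of the form above (in particular for $s=0$), and which are $C^2$ in $(b,s)$ at $(\beta,0)$,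 the density with respect to the norm $\sup_{x>0}e^{-c_\ell x^{2\ell}/2}|\,\cdot\,|/\varrho$. The variable $t_n$ ($n\ge1$) is $s$ for $W=(-1)^{n+1}i\,x^{2n}$, i.e. $V\to V+(-1)^{n+1}it_nx^{2n}$. A *variable* $\odot$ is a parameter $s$ moving $(b,V)$ along $(\beta+sb_0,\,V+sW)$, with $b_0\in\mathbb R$ and $W$ as above, and $\partial_\odot=\frac{d}{ds}|_{s=0}$ along a branch; for $\odot=\beta$ take $b_0=1,W=0$, for $\odot=\mu$ take $b_0=\kappa^{-1},W=0$. **Proposition 5.1.** For every $\beta>0$ and $V$ as above the minimizer exists and is unique, it satisfies the Euler–Lagrange equation, and $\mu(b,V)$ and $\varrho_{b,V}(x)$, for each $x>0$, are differentiable in $b$ at $b=\beta$. Assume that $\kappa=\kappa(\beta,V)\neq0$. Then the inverses $(1-T\varrho)^{-1}$ and $(1-\varrho T)^{-1}$ exist on all of $L^2(\varrho\,dx)$ and $L^2(dx/\varrho)$, branches exist in every direction $W$, and the following holds for every branch. 1. For all $f\in L^2(\varrho\,dx)$: $(1-\varrho T)^{-1}[\varrho f]=\varrho(1-T\varrho)^{-1}[f]$.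 2. For all $f\in L^2(dx/\varrho)$ and $g\in L^2(\varrho\,dx)$: $\langle (1-\varrho T)^{-1}[f]\,g\rangle=\langle f\,[g]^{\rm dr}\rangle$, both integrals converging absolutely. 3. For every variable $\odot$, at every $x>0$, the following derivatives exist and $$\partial_\odot\partial_\mu\varrho=(1-\varrho T)^{-1}\bigl[\,(\partial_\odot\varrho)\,(1-T\varrho)^{-1}[1]\,\bigr].$$ 4. For all $f\in L^2(\varrho\,dx)$, the function $\langle\sigma f\rangle$ is differentiable in $b$ at $\beta$, and $\partial_\mu\langle\sigma f\rangle=\langle\sigma\,[1]^{\rm dr}[f]^{\rm dr}\rangle$, all integrals (for $b$ near $\beta$) converging absolutely. 5. For all $n\ge1$: $\partial_{t_n}\mu\bigl(\beta,V+(-1)^{n+1}it_nx^{2n}\bigr)\big|_{t_n=0}=2iq_n$. 6. For all $n\ge1$ and $\psi\in L^2(\varrho\,dx)$, with $\varrho_t=\varrho_{\beta,V+(-1)^{n+1}itx^{2n}}$: for $t$ near $0$ the equation $g=\psi+T(\varrho_tg)$ has a unique solution $g=(1-T\varrho_t)^{-1}\psi\in L^2(\varrho\,dx)$, and at every $x\ne0$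 $$\partial_t\bigl((1-T\varrho_t)^{-1}\psi\bigr)\big|_{t=0}=(1-T\varrho)^{-1}\Bigl[T\bigl(\partial_t\varrho_t|_{t=0}\,[\psi]^{\rm dr}\bigr)\Bigr].$$ -/

import Mathlib

open Set Filter Topology MeasureTheory Polynomial
open scoped BoundedContinuousFunction

noncomputable section

namespace Volterra

/-- The potential `V(x) = (-1)^(ℓ+1) c_ℓ x^(2ℓ) + ∑_{1 ≤ j < ℓ} c_j x^(2j)`, with real `c_j`, as a
complex polynomial (it is evaluated at imaginary points, and perturbed by complex polynomials). -/
def pot (ℓ : ℕ) (c : ℕ → ℝ) : ℂ[X] :=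
  C ((-1) ^ (ℓ + 1) * (c ℓ : ℂ)) * X ^ (2 * ℓ) + ∑ j ∈ Finset.Ico 1 ℓ, C (c j : ℂ) * X ^ (2 * j)

/-- The (real, confining) potentials for which the variational problem is posed. -/
def IsPotential (V : ℂ[X]) : Prop :=
  ∃ (ℓ : ℕ) (c : ℕ → ℝ), 1 ≤ ℓ ∧ 0 < c ℓ ∧ V = pot ℓ c

/-- `V(ix) + V(-ix)`. -/
def ext (V : ℂ[X]) (x : ℝ) : ℂ :=
  V.eval (Complex.I * x) + V.eval (-(Complex.I * x))

/-- Lebesgue measure on the half line `(0, ∞)`. -/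
def leb : Measure ℝ := volume.restrict (Ioi 0)

/-- The bracket `⟨f⟩ = ∫_{ℝ₊} f`. -/
def avg (f : ℝ → ℂ) : ℂ := ∫ x, f x ∂leb

/-- `(T ψ)(w) = ∫_{ℝ₊} ln |w² - z²| ψ(z) dz`, `w ∈ ℝ`, for real or complex `ψ`. -/
def T {E : Type*} [NormedAddCommGroup E] [NormedSpace ℝ E] (ψ : ℝ → E) (w : ℝ) : E :=
  ∫ z, Real.log |w ^ 2 - z ^ 2| • ψ z ∂leb

/-! ### The minimizer -/

/-- Densities `ϱ ≥ 0` on `ℝ₊`, of mass `b`, on which the functional is finite.  The terms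
`∫ ln(x) ϱ` and `∫ ϱ ln ϱ` are taken together as `∫ ϱ ln(x ϱ)`: separately they diverge at the
minimizer, whose density is of order `1 / (x ln² x)` at the origin. -/
structure IsCompetitor (b : ℝ) (V : ℂ[X]) (ϱ : ℝ → ℝ) : Prop where
  nonneg : ∀ x, 0 < x → 0 ≤ ϱ x
  integrable : Integrable ϱ leb
  mass : ∫ x, ϱ x ∂leb = b
  interaction : Integrable (fun p : ℝ × ℝ => Real.log |p.1 ^ 2 - p.2 ^ 2| * (ϱ p.1 * ϱ p.2))
    (leb.prod leb)
  potential : Integrable (fun x => (ext V x).re * ϱ x) leb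
  entropy : Integrable (fun x => ϱ x * Real.log (x * ϱ x)) leb

/-- The functional
`-½ ∬ ln|x²-y²| ϱ(x) ϱ(y) dx dy - ∫ (V(ix) + V(-ix) - ln x) ϱ(x) dx + ∫ ϱ ln ϱ dx`. -/
def energy (V : ℂ[X]) (ϱ : ℝ → ℝ) : ℝ :=
  -(1 / 2) * (∫ p : ℝ × ℝ, Real.log |p.1 ^ 2 - p.2 ^ 2| * (ϱ p.1 * ϱ p.2) ∂(leb.prod leb))
    - (∫ x, (ext V x).re * ϱ x ∂leb) + ∫ x, ϱ x * Real.log (x * ϱ x) ∂leb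

/-- `ϱ` minimizes the functional among all densities of mass `b`.  A density is only defined up to
null sets: `ϱ` is the representative which is continuous on `(0, ∞)` and vanishes elsewhere. -/
structure IsMinimizer (b : ℝ) (V : ℂ[X]) (ϱ : ℝ → ℝ) : Prop where
  competitor : IsCompetitor b V ϱ
  min : ∀ ϱ', IsCompetitor b V ϱ' → energy V ϱ ≤ energy V ϱ'
  cont : ContinuousOn ϱ (Ioi 0)
  zero : ∀ x, x ≤ 0 → ϱ x = 0

/-- The minimizer `ϱ = ϱ(b, V)`. -/
def rho (b : ℝ) (V : ℂ[X]) : ℝ → ℝ := Classical.epsilon (IsMinimizer b V)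

/-- The Euler-Lagrange equation with Lagrange multiplier `m`. -/
def EulerLagrange (V : ℂ[X]) (ϱ : ℝ → ℝ) (m : ℝ) : Prop :=
  ∀ x, 0 < x → -T ϱ x - (ext V x).re + Real.log x + Real.log (ϱ x) + 1 - m = 0

/-- The multiplier `μ(b, V)` in the Euler-Lagrange equation of the minimizer. -/
def mu (b : ℝ) (V : ℂ[X]) : ℝ := Classical.epsilon (EulerLagrange V (rho b V))

/-- `κ = ∂_b μ`. -/
def kappa (b : ℝ) (V : ℂ[X]) : ℝ := deriv (fun b' => mu b' V) b

/-- `σ = ∂_μ ϱ`, where `∂_μ = κ⁻¹ ∂_b` is the derivative with respect to `μ` at fixed `V`. -/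
def sigma (b : ℝ) (V : ℂ[X]) (x : ℝ) : ℝ := (kappa b V)⁻¹ * deriv (fun b' => rho b' V x) b

/-- `q_n = κ ⟨σ w^(2n)⟩`. -/
def q (n : ℕ) (b : ℝ) (V : ℂ[X]) : ℝ := kappa b V * ∫ w, sigma b V w * w ^ (2 * n) ∂leb

/-! ### Dressing -/

/-- The measure `ϱ(x) dx` on `ℝ₊`. -/
def meas (ϱ : ℝ → ℝ) : Measure ℝ := leb.withDensity (fun x => ENNReal.ofReal (ϱ x))

/-- `g = (1 - T r)⁻¹ f` in `L²(ϱ dx)`; here `r` is `ϱ` itself or a complex perturbation of it.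
(At the single point `w = 0` the integral defining `T` may diverge.) -/
def IsDressed (ϱ : ℝ → ℝ) (r : ℝ → ℂ) (f g : ℝ → ℂ) : Prop :=
  MemLp g 2 (meas ϱ) ∧ ∀ w, g w = f w + T (fun z => r z * g z) w

/-- `(1 - T r)⁻¹ f`. -/
def dressBy (ϱ : ℝ → ℝ) (r : ℝ → ℂ) (f : ℝ → ℂ) : ℝ → ℂ := Classical.epsilon (IsDressed ϱ r f)

/-- The dressing `f^dr = (1 - T ϱ)⁻¹ f`. -/
def dress (ϱ : ℝ → ℝ) (f : ℝ → ℂ) : ℝ → ℂ := dressBy ϱ (fun z => (ϱ z : ℂ)) f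

/-- `f ∈ L²(dx / ϱ)`, the dual of `L²(ϱ dx)` under the pairing `⟨f g⟩`. -/
def MemDual (ϱ : ℝ → ℝ) (f : ℝ → ℂ) : Prop := MemLp (fun x => f x / (ϱ x : ℂ)) 2 (meas ϱ)

/-- `h = (1 - ϱ T)⁻¹ f` in `L²(dx / ϱ)`. -/
def IsCodressed (ϱ : ℝ → ℝ) (f h : ℝ → ℂ) : Prop :=
  MemDual ϱ h ∧ ∀ w, h w = f w + (ϱ w : ℂ) * T h w

/-- `(1 - ϱ T)⁻¹ f`. -/
def codress (ϱ : ℝ → ℝ) (f : ℝ → ℂ) : ℝ → ℂ := Classical.epsilon (IsCodressed ϱ f)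

/-! ### Variation of the parameters

For a complex potential there is nothing to minimize; the perturbed `ϱ` and `μ` are then the
solutions of the Euler-Lagrange equation that continue the minimizer. -/

/-- `R b s`, `M b s` are the density `ϱ(b, V + s W)` and the multiplier `μ(b, V + s W)`, for `(b, s)`
near `(β, 0)`, `V = pot ℓ c`: they solve the Euler-Lagrange equation (written in exponential form)
with mass `b`, they are the minimizer and its multiplier as soon as `V + s W` is again a real
potential, and they are twice continuously differentiable in `(b, s)`, the density with respect to
the sup norm of `exp(-(c_ℓ / 2) x^(2ℓ)) R(x) / ϱ(x)`. -/
structure IsBranch (ℓ : ℕ) (c : ℕ → ℝ) (β : ℝ) (W : ℂ[X])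
    (R : ℝ → ℝ → ℝ → ℂ) (M : ℝ → ℝ → ℂ) : Prop where
  smooth : ∃ F : ℝ × ℝ → (Ioi (0 : ℝ) →ᵇ ℂ), ContDiffAt ℝ 2 F (β, 0) ∧
    ∀ᶠ p in 𝓝 ((β, 0) : ℝ × ℝ), ∀ x : Ioi (0 : ℝ),
      R p.1 p.2 x = (Real.exp (c ℓ / 2 * (x : ℝ) ^ (2 * ℓ)) * rho β (pot ℓ c) x : ℝ) * F p x
  smooth_mult : ContDiffAt ℝ 2 (fun p : ℝ × ℝ => M p.1 p.2) (β, 0)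
  mass : ∀ᶠ p in 𝓝 ((β, 0) : ℝ × ℝ), avg (R p.1 p.2) = (p.1 : ℂ)
  eulerLagrange : ∀ᶠ p in 𝓝 ((β, 0) : ℝ × ℝ), ∀ x : ℝ, 0 < x →
    (x : ℂ) * R p.1 p.2 x =
      Complex.exp (T (R p.1 p.2) x + ext (pot ℓ c + C (p.2 : ℂ) * W) x + M p.1 p.2 - 1)
  minimizer : ∀ᶠ p in 𝓝 ((β, 0) : ℝ × ℝ), IsPotential (pot ℓ c + C (p.2 : ℂ) * W) →
    (∀ x : ℝ, 0 < x → R p.1 p.2 x = (rho p.1 (pot ℓ c + C (p.2 : ℂ) * W) x : ℂ)) ∧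
    M p.1 p.2 = (mu p.1 (pot ℓ c + C (p.2 : ℂ) * W) : ℂ)

/-- Directions in which the potential may be varied: real changes of the coefficients up to degree
`2ℓ`, and imaginary changes of all coefficients. -/
def IsDirection (ℓ : ℕ) (W : ℂ[X]) : Prop := ∀ k, 2 * ℓ < k → (W.coeff k).re = 0

/-- The direction `(-1)^(n+1) i x^(2n)` of the variable `t_n`. -/
def timeDir (n : ℕ) : ℂ[X] := C ((-1) ^ (n + 1) * Complex.I) * X ^ (2 * n)

end Volterra

end

noncomputable section

namespace Volterra

open scoped ENNReal NNReal InnerProductSpace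

/-! ### The kernel `ln |x² - z²|` -/

/-! Everything rests on the splitting ln|x²−z²| = 2 max(ln x, ln z) − sk(x,z). The short-range part
sk is nonnegative, scale invariant and has only a logarithmic singularity on the diagonal. The
long-range part is the Green function of a one-dimensional problem in the variable ln x. The
densities that occur behave at worst like 1/(x ln² x) at the origin and decay quickly at infinity
(`env`). For them Schur's test with the weight `sw` makes T bounded on L²(ϱ dx), with room for a
growing weight w (`Adm.exists_schur`).

Sign of the energy. Frullani's formula, ln A = ∫ (e^{−t} − e^{−At}) dt/t with A = (x²−y²)², reduces
ln|x²−y²| to Gaussian kernels in x², which are positive definite. Hence ∫∫ ln|x²−y²| ψψ ≤ 0 for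
every neutral charge ψ (`integral_lk_nonpos`). Consequently 1 − T is coercive on neutral functions.
The bordered system h = f + Th + m, ∫h = b, with unknowns h and m, is therefore uniquely solvable
without any assumption on κ (`bordE`).

Minimizer. One starts from an explicit density r that satisfies the Euler–Lagrange equation up to a
bounded error, and looks for ϱ = r e^v. Then y = e^v − 1 is neutral for r dx and ln(1+y) = f + Ty +
m with f bounded. With a truncated logarithm this is a strongly monotone Lipschitz equation on
neutral functions, solved by a contraction. An entropy estimate and a maximum principle for the
long-range potential bound ln(1+y) independently of the truncation, which can then be removed
(`Adm.exists_exp_solution`). The energy of a competitor exceeds that of the solution by minus half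
the interaction energy of the neutral difference plus a relative entropy. This gives minimality and
uniqueness (`IsEquilibrium.energy_le`).

Branches. Write the perturbed density as ϱ exp(sP + λη), with P(x) = W(ix) + W(−ix), λ = 1 + x^{2ℓ}
and η bounded. Solving the linear part by the bordered system turns the Euler–Lagrange equation into
η = K(G(s,η), b−β), where G has no first-order term in η at the origin. The implicit function
theorem in the space of bounded continuous functions applies (`exists_implicit`). Its local
uniqueness makes the solution real whenever the potential is, so that it is the minimizer.

Identities. The response h₁ to a unit of mass satisfies h₁ = Th₁ + κ, ∫h₁ϱ = 1. If κ ≠ 0, multiples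
of h₁ remove the constant m from the bordered system. So 1 − T is invertible on L²(ϱ dx), and the
dressing of 1 is h₁/κ. The formulas of the proposition then follow by differentiating the
exponential Euler–Lagrange equation once (the response) or twice (the derivative of ∂_μϱ), by the
symmetry of T (averages and the multiplier), and by differentiating an operator inverse (dressed
functions). -/

/-- The kernel of `T`. -/
def lk (x z : ℝ) : ℝ := Real.log |x ^ 2 - z ^ 2|

/-- The squared ratio of the smaller to the larger argument. -/
def rat (x z : ℝ) : ℝ := (min x z / max x z) ^ 2

/-- The short-range part of the kernel, `ln |x² - z²| = 2 max (ln x) (ln z) - sk x z`. -/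
def sk (x z : ℝ) : ℝ := -Real.log (1 - rat x z)

/-- A scale invariant majorant of the powers of `sk`. -/
def kap (x z : ℝ) : ℝ := rat x z * (1 - rat x z) ^ (-(1 / 2) : ℝ)

/-- Negative part of the logarithm. -/
def tt (x : ℝ) : ℝ := max (-Real.log x) 0

/-- Positive part of the logarithm. -/
def ll (x : ℝ) : ℝ := max (Real.log x) 0

/-- The envelope of the densities under consideration. -/
def env (z : ℝ) : ℝ := 1 / (z * (1 + tt z) ^ 2 * (max 1 z) ^ 2)

/-- The weight in Schur's test. -/
def sw (z : ℝ) : ℝ := √((1 + tt z) * max 1 z)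

lemma measurable_lk : Measurable (fun p : ℝ × ℝ => lk p.1 p.2) := by
  unfold lk; fun_prop

lemma measurable_lk_right (x : ℝ) : Measurable (lk x) :=
  measurable_lk.comp measurable_prodMk_left

lemma lk_comm (x z : ℝ) : lk x z = lk z x := by
  unfold lk; rw [abs_sub_comm]

lemma rat_comm (x z : ℝ) : rat x z = rat z x := by
  unfold rat; rw [min_comm, max_comm]

lemma sk_comm (x z : ℝ) : sk x z = sk z x := by
  unfold sk; rw [rat_comm]

lemma measurable_rat : Measurable (fun p : ℝ × ℝ => rat p.1 p.2) := by
  unfold rat; fun_prop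

lemma measurable_sk : Measurable (fun p : ℝ × ℝ => sk p.1 p.2) :=
  (Real.measurable_log.comp (measurable_const.sub measurable_rat)).neg

lemma measurable_kap : Measurable (fun p : ℝ × ℝ => kap p.1 p.2) := by
  have h := measurable_rat
  have h1 : Measurable (fun r : ℝ => r * (1 - r) ^ (-(1 / 2) : ℝ)) := by fun_prop
  exact h1.comp h

lemma measurable_sk_right (x : ℝ) : Measurable (fun z => sk x z) :=
  Measurable.of_uncurry_left (f := sk) measurable_sk

lemma measurable_kap_right (x : ℝ) : Measurable (fun z => kap x z) :=
  Measurable.of_uncurry_left (f := kap) measurable_kap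

lemma measurable_tt : Measurable tt := by unfold tt; fun_prop
lemma measurable_ll : Measurable ll := by unfold ll; fun_prop
lemma measurable_env : Measurable env := by
  unfold env; have := measurable_tt; fun_prop
lemma measurable_sw : Measurable sw := by
  unfold sw; have := measurable_tt; fun_prop

lemma tt_nonneg (x : ℝ) : 0 ≤ tt x := le_max_right _ _
lemma ll_nonneg (x : ℝ) : 0 ≤ ll x := le_max_right _ _

lemma tt_of_le {x : ℝ} (h0 : 0 < x) (h : x ≤ 1) : tt x = -Real.log x := by
  unfold tt; rw [max_eq_left]; have := Real.log_nonpos h0.le h; linarith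

lemma tt_of_ge {x : ℝ} (h : 1 ≤ x) : tt x = 0 := by
  unfold tt; rw [max_eq_right]; have := Real.log_nonneg h; linarith

lemma ll_of_le {x : ℝ} (h0 : 0 < x) (h : x ≤ 1) : ll x = 0 := by
  unfold ll; rw [max_eq_right]; exact Real.log_nonpos h0.le h

lemma ll_of_ge {x : ℝ} (h : 1 ≤ x) : ll x = Real.log x := by
  unfold ll; rw [max_eq_left]; exact Real.log_nonneg h

lemma one_le_sw (z : ℝ) : 1 ≤ sw z := by
  unfold sw
  rw [Real.one_le_sqrt]
  nlinarith [tt_nonneg z, le_max_left 1 z]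

lemma env_pos {z : ℝ} (hz : 0 < z) : 0 < env z := by
  unfold env
  have := tt_nonneg z
  have : 0 < max 1 z := lt_of_lt_of_le one_pos (le_max_left _ _)
  positivity

lemma rat_nonneg (x z : ℝ) : 0 ≤ rat x z := sq_nonneg _

lemma rat_le_one {x z : ℝ} (hx : 0 < x) (hz : 0 < z) : rat x z ≤ 1 := by
  unfold rat
  have hm : 0 < max x z := lt_max_of_lt_left hx
  have : min x z / max x z ≤ 1 := by
    rw [div_le_one hm]; exact min_le_max
  have h0 : 0 ≤ min x z / max x z := div_nonneg (le_min hx.le hz.le) hm.le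
  nlinarith

lemma rat_lt_one {x z : ℝ} (hx : 0 < x) (hz : 0 < z) (h : x ≠ z) : rat x z < 1 := by
  unfold rat
  have hm : 0 < max x z := lt_max_of_lt_left hx
  have : min x z / max x z < 1 := by
    rw [div_lt_one hm]; exact min_lt_max.2 h
  have h0 : 0 ≤ min x z / max x z := div_nonneg (le_min hx.le hz.le) hm.le
  nlinarith

lemma sk_nonneg {x z : ℝ} (hx : 0 < x) (hz : 0 < z) : 0 ≤ sk x z := by
  unfold sk
  have := Real.log_nonpos (x := 1 - rat x z) (by linarith [rat_le_one hx hz])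
    (by linarith [rat_nonneg x z])
  linarith

lemma kap_nonneg {x z : ℝ} (hx : 0 < x) (hz : 0 < z) : 0 ≤ kap x z :=
  mul_nonneg (rat_nonneg _ _) (Real.rpow_nonneg (by linarith [rat_le_one hx hz]) _)

lemma lk_eq {x z : ℝ} (hx : 0 < x) (hz : 0 < z) (h : x ≠ z) :
    lk x z = 2 * max (Real.log x) (Real.log z) - sk x z := by
  wlog hxz : x < z generalizing x z
  · rw [lk_comm, sk_comm, max_comm]
    exact this hz hx h.symm (lt_of_le_of_ne (not_lt.1 hxz) h.symm)
  have hlog : Real.log x ≤ Real.log z := Real.log_le_log hx hxz.le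
  unfold lk sk rat
  rw [max_eq_right hlog, min_eq_left hxz.le, max_eq_right hxz.le]
  have h1 : 0 < 1 - (x / z) ^ 2 := by
    have : x / z < 1 := (div_lt_one hz).2 hxz
    have h0 : 0 < x / z := div_pos hx hz
    nlinarith
  have : |x ^ 2 - z ^ 2| = z ^ 2 * (1 - (x / z) ^ 2) := by
    rw [abs_of_neg (by nlinarith)]
    field_simp
    ring
  rw [this, Real.log_mul (by positivity) h1.ne', Real.log_pow]
  push_cast
  ring

/-- Separates infinity (`ll`) from the origin (`tt`). The minimum matters: `tt` itself is not
integrable against `env` at the origin, whereas min(`tt x`, `tt z`) is bounded by the constant `tt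
x`. -/
lemma max_log (x z : ℝ) :
    max (Real.log x) (Real.log z) = max (ll x) (ll z) - min (tt x) (tt z) := by
  unfold ll tt
  rcases le_total (Real.log x) 0 with h1 | h1 <;> rcases le_total (Real.log z) 0 with h2 | h2 <;>
    rcases le_total (Real.log x) (Real.log z) with h3 | h3 <;>
    simp [h1, h2, h3] <;> linarith

/-- A logarithm is dominated by the power −1/8 of 1 − `rat`, and four such factors still give only
the integrable power −1/2; 4096 = 8⁴. The factor `rat`, which survives every power, provides the
decay when x and z are far apart on the logarithmic scale. -/
lemma sk_pow_le {x z : ℝ} (hx : 0 < x) (hz : 0 < z) {j : ℕ} (h1 : 1 ≤ j) (h4 : j ≤ 4) :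
    sk x z ^ j ≤ 4096 * kap x z := by
  rcases (rat_le_one hx hz).lt_or_eq with hlt | heq
  swap
  · unfold sk kap; rw [heq]; simp [show j ≠ 0 by omega, Real.zero_rpow]
  set q := rat x z with hq
  have hq0 : 0 ≤ q := rat_nonneg _ _
  set y := 1 - q with hy
  have hy0 : 0 < y := by linarith
  have hy1 : y ≤ 1 := by linarith
  -- From ln u ≤ u − 1 with u = y^{−1/8}, together with u − 1 ≤ u(1 − y), which holds because uy ≤
  -- 1.
  have hs : sk x z ≤ 8 * (q * y ^ (-(1 / 8) : ℝ)) := by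
    have e1 : sk x z = 8 * Real.log (y ^ (-(1 / 8) : ℝ)) := by
      rw [Real.log_rpow hy0]; unfold sk; rw [← hq, ← hy]; ring
    have e2 := Real.log_le_sub_one_of_pos (Real.rpow_pos_of_pos hy0 (-(1 / 8)))
    have e3 : y ≤ y ^ (1 / 8 : ℝ) := by
      conv_lhs => rw [← Real.rpow_one y]
      exact Real.rpow_le_rpow_of_exponent_ge hy0 hy1 (by norm_num)
    have e4 : y ^ (-(1 / 8) : ℝ) * y ^ (1 / 8 : ℝ) = 1 := by
      rw [← Real.rpow_add hy0]; norm_num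
    have e5 := Real.rpow_pos_of_pos hy0 (-(1 / 8))
    have e6 : y ^ (-(1 / 8) : ℝ) * y ≤ y ^ (-(1 / 8) : ℝ) * y ^ (1 / 8 : ℝ) := by gcongr
    have e7 : q = 1 - y := by rw [hy]; ring
    rw [e1, e7]
    nlinarith
  have hsk := sk_nonneg hx hz
  calc sk x z ^ j ≤ (8 * (q * y ^ (-(1 / 8) : ℝ))) ^ j := by gcongr
    _ = 8 ^ j * (q ^ j * (y ^ (-(1 / 8) : ℝ)) ^ j) := by rw [mul_pow, mul_pow]
    _ ≤ 8 ^ 4 * (q * y ^ (-(1 / 2) : ℝ)) := by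
      gcongr ?_ * (?_ * ?_)
      · exact pow_le_pow_right₀ (by norm_num) h4
      · exact pow_le_of_le_one hq0 (by linarith) (by omega)
      · rw [← Real.rpow_natCast, ← Real.rpow_mul hy0.le]
        apply Real.rpow_le_rpow_of_exponent_ge hy0 hy1
        have : (j : ℝ) ≤ 4 := by exact_mod_cast h4
        linarith
    _ = 4096 * kap x z := by rw [hy, hq]; unfold kap; norm_num

/-- The exponential is (1 − `rat`)^{−1/2}. Its integrability lets the short-range potential be
estimated by an entropy, through Young's inequality. -/
lemma exp_sk_le {x z : ℝ} (hx : 0 < x) (hz : 0 < z) :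
    Real.exp (sk x z / 2) ≤ 1 + kap x z := by
  rcases (rat_le_one hx hz).lt_or_eq with hlt | heq
  swap
  · unfold sk kap; rw [heq]; simp
  unfold kap
  set q := rat x z with hq
  have hq0 : 0 ≤ q := rat_nonneg _ _
  set y := 1 - q with hy
  have hy0 : 0 < y := by linarith
  have hy1 : y ≤ 1 := by linarith
  have e1 : Real.exp (sk x z / 2) = y ^ (-(1 / 2) : ℝ) := by
    rw [Real.rpow_def_of_pos hy0]; unfold sk; rw [← hq, ← hy]; ring_nf
  have e3 : y ≤ y ^ (1 / 2 : ℝ) := by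
    conv_lhs => rw [← Real.rpow_one y]
    exact Real.rpow_le_rpow_of_exponent_ge hy0 hy1 (by norm_num)
  have e4 : y ^ (-(1 / 2) : ℝ) * y ^ (1 / 2 : ℝ) = 1 := by
    rw [← Real.rpow_add hy0]; norm_num
  have e5 := Real.rpow_pos_of_pos hy0 (-(1 / 2))
  have e6 : y ^ (-(1 / 2) : ℝ) * y ≤ y ^ (-(1 / 2) : ℝ) * y ^ (1 / 2 : ℝ) := by gcongr
  have e7 : q = 1 - y := by rw [hy]; ring
  rw [e1, e7]
  nlinarith

lemma abs_lk_le {x z : ℝ} (hx : 0 < x) (hz : 0 < z) (h : x ≠ z) :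
    |lk x z| ≤ 2 * min (tt x) (tt z) + 2 * ll x + 2 * ll z + sk x z := by
  rw [lk_eq hx hz h, max_log]
  have h1 := sk_nonneg hx hz
  have h2 := ll_nonneg x
  have h3 := ll_nonneg z
  have h4 : 0 ≤ min (tt x) (tt z) := le_min (tt_nonneg _) (tt_nonneg _)
  have h5 : max (ll x) (ll z) ≤ ll x + ll z := max_le (by linarith) (by linarith)
  have h6 : 0 ≤ max (ll x) (ll z) := le_max_of_le_left h2
  rw [abs_le]; constructor <;> linarith

/-! ### Integrals of the kernel against the envelope -/

/-- For an increasing primitive the integral of the derivative is the measure of the image. No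
integrability or limit at a singular endpoint has to be checked beforehand. -/
lemma setLIntegral_deriv_le {g g' : ℝ → ℝ} {s : Set ℝ} {m M : ℝ} (hs : MeasurableSet s)
    (hc : Convex ℝ s) (hd : ∀ x ∈ s, HasDerivAt g (g' x) x)
    (h0 : ∀ x ∈ s, 0 ≤ g' x) (hb : ∀ x ∈ s, g x ∈ Icc m M) :
    ∫⁻ x in s, ENNReal.ofReal (g' x) ≤ ENNReal.ofReal (M - m) := by
  have hm : MonotoneOn g s := by
    apply monotoneOn_of_deriv_nonneg hc (fun x hx => (hd x hx).continuousAt.continuousWithinAt)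
    · intro x hx
      exact (hd x (interior_subset hx)).differentiableAt.differentiableWithinAt
    · intro x hx
      rw [(hd x (interior_subset hx)).deriv]; exact h0 x (interior_subset hx)
  rw [lintegral_deriv_eq_volume_image_of_monotoneOn hs (fun x hx => (hd x hx).hasDerivWithinAt) hm]
  calc volume (g '' s) ≤ volume (Icc m M) := measure_mono (by rintro _ ⟨x, hx, rfl⟩; exact hb x hx)
    _ = _ := Real.volume_Icc

lemma lintegral_leb_eq (F : ℝ → ℝ≥0∞) {x : ℝ} (hx : 0 < x) :
    ∫⁻ z, F z ∂leb = (∫⁻ z in Ioo 0 x, F z) + ∫⁻ z in Ioi x, F z := by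
  unfold leb
  rw [← Ioc_union_Ioi_eq_Ioi hx.le, lintegral_union measurableSet_Ioi,
    setLIntegral_congr Ioo_ae_eq_Ioc]
  exact disjoint_left.2 fun z hz hz' => absurd hz.2 (not_le.2 hz')

/-- On each side of x the integrand has an explicit primitive, −√(1−(z/x)²) on the left and
√(1−(x/z)²) on the right, each varying by at most one. By scale invariance the bound does not depend
on x. -/
lemma lintegral_kap_le {x : ℝ} (hx : 0 < x) :
    ∫⁻ z, ENNReal.ofReal (kap x z / z) ∂leb ≤ 2 := by
  have key : ∀ y : ℝ, 0 < y → (√y)⁻¹ = y ^ (-(1 / 2) : ℝ) := fun y hy => by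
    rw [Real.sqrt_eq_rpow, ← Real.rpow_neg hy.le]
  rw [lintegral_leb_eq _ hx]
  have h1 : ∫⁻ z in Ioo 0 x, ENNReal.ofReal (kap x z / z) ≤ ENNReal.ofReal (0 - (-1)) := by
    apply setLIntegral_deriv_le (g := fun z => -√(1 - (z / x) ^ 2)) measurableSet_Ioo
      (convex_Ioo 0 x)
    · intro z hz
      have hzx : z / x < 1 := (div_lt_one hx).2 hz.2
      have hzx0 : 0 < z / x := div_pos hz.1 hx
      have hy : 0 < 1 - (z / x) ^ 2 := by nlinarith
      have hd : HasDerivAt (fun z : ℝ => 1 - (z / x) ^ 2) (-(2 * (z / x) * (1 / x))) z := by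
        have := (((hasDerivAt_id z).div_const x).pow 2).const_sub 1
        simpa using this
      refine (hd.sqrt hy.ne').neg.congr_deriv ?_
      unfold kap rat
      rw [min_eq_right hz.2.le, max_eq_left hz.2.le, ← key _ hy]
      have := Real.sqrt_pos.2 hy
      have := hz.1
      field_simp
    · intro z hz
      exact div_nonneg (kap_nonneg hx hz.1) hz.1.le
    · intro z hz
      have hzx : z / x < 1 := (div_lt_one hx).2 hz.2
      have hzx0 : 0 < z / x := div_pos hz.1 hx
      refine ⟨?_, by simp [Real.sqrt_nonneg]⟩
      have : √(1 - (z / x) ^ 2) ≤ 1 := Real.sqrt_le_one.2 (by nlinarith)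
      linarith
  have h2 : ∫⁻ z in Ioi x, ENNReal.ofReal (kap x z / z) ≤ ENNReal.ofReal (1 - 0) := by
    apply setLIntegral_deriv_le (g := fun z => √(1 - (x / z) ^ 2)) measurableSet_Ioi
      (convex_Ioi x)
    · intro z hz
      have hz0 : 0 < z := hx.trans hz
      have hzx : x / z < 1 := (div_lt_one hz0).2 hz
      have hzx0 : 0 < x / z := div_pos hx hz0
      have hy : 0 < 1 - (x / z) ^ 2 := by nlinarith
      have hd : HasDerivAt (fun z : ℝ => 1 - (x / z) ^ 2) (-(2 * (x / z) * (-x / z ^ 2))) z := by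
        have h3 : HasDerivAt (fun z : ℝ => x / z) (-x / z ^ 2) z := by
          have := (hasDerivAt_inv hz0.ne').const_mul x
          refine (this.congr_deriv ?_).congr_of_eventuallyEq ?_
          · field_simp
          · exact Eventually.of_forall fun y => div_eq_mul_inv _ _
        have := (h3.pow 2).const_sub 1
        simpa using this
      refine (hd.sqrt hy.ne').congr_deriv ?_
      unfold kap rat
      rw [min_eq_left (le_of_lt hz), max_eq_right (le_of_lt hz), ← key _ hy]
      have := Real.sqrt_pos.2 hy
      field_simp
    · intro z hz
      have hz0 : 0 < z := hx.trans hz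
      exact div_nonneg (kap_nonneg hx hz0) hz0.le
    · intro z hz
      have hz0 : 0 < z := hx.trans hz
      refine ⟨Real.sqrt_nonneg _, Real.sqrt_le_one.2 (by nlinarith [sq_nonneg (x / z)])⟩
  calc _ ≤ ENNReal.ofReal (0 - (-1)) + ENNReal.ofReal (1 - 0) := add_le_add h1 h2
    _ = 2 := by norm_num

lemma one_sub_log_pos {z : ℝ} (h0 : 0 < z) (h1 : z ≤ 1) : 1 ≤ √(1 - Real.log z) := by
  rw [Real.one_le_sqrt]; linarith [Real.log_nonpos h0.le h1]

lemma hasDerivAt_sqrt_one_sub_log {z : ℝ} (h0 : 0 < z) (h1 : z ≤ 1) :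
    HasDerivAt (fun z => √(1 - Real.log z)) (-(1 / (2 * (z * √(1 - Real.log z))))) z := by
  have h := one_sub_log_pos h0 h1
  have hp : 0 < 1 - Real.log z := by linarith [Real.log_nonpos h0.le h1]
  refine (((Real.hasDerivAt_log h0.ne').const_sub 1).sqrt hp.ne').congr_deriv ?_
  field_simp

lemma lintegral_near_zero {x : ℝ} (h0 : 0 < x) (h1 : x ≤ 1) :
    ∫⁻ z in Ioo 0 x, ENNReal.ofReal (1 / (z * √(1 - Real.log z) ^ 3)) ≤
      ENNReal.ofReal (2 / √(1 - Real.log x)) := by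
  have := setLIntegral_deriv_le (s := Ioo 0 x) (g := fun z => 2 / √(1 - Real.log z))
    (g' := fun z => 1 / (z * √(1 - Real.log z) ^ 3)) (m := 0) (M := 2 / √(1 - Real.log x))
    measurableSet_Ioo (convex_Ioo 0 x) ?_ ?_ ?_
  · simpa using this
  · intro z hz
    have hs := one_sub_log_pos hz.1 (hz.2.le.trans h1)
    have hs0 : √(1 - Real.log z) ≠ 0 := by positivity
    have hz0 := hz.1
    refine ((hasDerivAt_const z (2 : ℝ)).div
      (hasDerivAt_sqrt_one_sub_log hz.1 (hz.2.le.trans h1)) hs0).congr_deriv ?_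
    field_simp
    ring
  · intro z hz
    have := hz.1
    positivity
  · intro z hz
    refine ⟨by positivity, ?_⟩
    have := one_sub_log_pos h0 h1
    have := Real.log_le_log hz.1 hz.2.le
    gcongr

lemma lintegral_near_one {x : ℝ} (h0 : 0 < x) :
    ∫⁻ z in Ioo x 1, ENNReal.ofReal (1 / (z * √(1 - Real.log z))) ≤
      ENNReal.ofReal (2 * √(1 - Real.log x)) := by
  have := setLIntegral_deriv_le (s := Ioo x 1) (g := fun z => -(2 * √(1 - Real.log z)))
    (g' := fun z => 1 / (z * √(1 - Real.log z))) (m := -(2 * √(1 - Real.log x))) (M := 0)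
    measurableSet_Ioo (convex_Ioo x 1) ?_ ?_ ?_
  · simpa using this
  · intro z hz
    have hz0 : 0 < z := h0.trans hz.1
    have hs := one_sub_log_pos hz0 hz.2.le
    refine ((hasDerivAt_sqrt_one_sub_log hz0 hz.2.le).const_mul 2).neg.congr_deriv ?_
    field_simp
  · intro z hz
    have hz0 : 0 < z := h0.trans hz.1
    positivity
  · intro z hz
    have hz0 : 0 < z := h0.trans hz.1
    have := Real.log_le_log h0 hz.1.le
    refine ⟨?_, by simp⟩
    have : √(1 - Real.log z) ≤ √(1 - Real.log x) := Real.sqrt_le_sqrt (by linarith)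
    linarith

lemma env_mul_sw_of_le {z : ℝ} (h0 : 0 < z) (h1 : z ≤ 1) :
    env z * sw z = 1 / (z * √(1 - Real.log z) ^ 3) := by
  have hs := one_sub_log_pos h0 h1
  have hp : 0 ≤ 1 - Real.log z := by linarith [Real.log_nonpos h0.le h1]
  unfold env sw
  rw [tt_of_le h0 h1, max_eq_left h1, ← sub_eq_add_neg, mul_one]
  have e : (1 - Real.log z) ^ 2 = √(1 - Real.log z) ^ 4 := by
    rw [show 4 = 2 * 2 by norm_num, pow_mul, Real.sq_sqrt hp]
  rw [e]
  field_simp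

lemma env_mul_sw_le {z : ℝ} (h0 : 0 < z) : env z * sw z ≤ 1 / z := by
  have h1 := one_le_sw z
  have h2 := tt_nonneg z
  have h3 := le_max_left 1 z
  have e : sw z ^ 2 = (1 + tt z) * max 1 z := Real.sq_sqrt (by positivity)
  have : sw z ≤ (1 + tt z) ^ 2 * max 1 z ^ 2 := by
    have e1 : 1 ≤ sw z ^ 2 := one_le_pow₀ h1
    rw [← mul_pow, ← e]
    nlinarith
  unfold env
  rw [div_mul_eq_mul_div, one_mul, div_le_div_iff₀ (by positivity) h0, one_mul]
  calc sw z * z ≤ ((1 + tt z) ^ 2 * max 1 z ^ 2) * z := by gcongr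
    _ = _ := by ring

lemma env_le {z : ℝ} (h0 : 0 < z) : env z ≤ 1 / z :=
  le_trans (le_mul_of_one_le_right (env_pos h0).le (one_le_sw z)) (env_mul_sw_le h0)

lemma one_add_ll_le {z : ℝ} (h : 1 ≤ z) : 1 + ll z ≤ 4 * √√z := by
  have hz : 0 < √√z := by positivity
  have e : Real.log z = 4 * Real.log (√√z) := by
    rw [Real.log_sqrt (by positivity), Real.log_sqrt (by positivity)]; ring
  rw [ll_of_ge h, e]
  linarith [Real.log_le_sub_one_of_pos hz]

lemma ll_le_sw {z : ℝ} (h0 : 0 < z) : ll z ≤ 2 * sw z := by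
  rcases le_total z 1 with h | h
  · rw [ll_of_le h0 h]; linarith [one_le_sw z]
  · rw [ll_of_ge h]
    have e : Real.log z = 2 * Real.log (√z) := by
      rw [Real.log_sqrt (by positivity)]; ring
    have : √z ≤ sw z := by
      unfold sw; rw [tt_of_ge h, max_eq_right h]; simp
    rw [e]
    linarith [Real.log_le_sub_one_of_pos (show 0 < √z by positivity)]

/-- For z > 1 the envelope is z⁻³ and the Schur weight √z, while 1 + ln z ≤ 4 z^{1/4}. -/
lemma env_mul_tail_le {z : ℝ} (h : 1 < z) : env z * (sw z * (1 + ll z) ^ 2) ≤ 16 * (1 / z ^ 2) := by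
  have h0 : 0 < z := one_pos.trans h
  have hs : 0 < √z := Real.sqrt_pos.2 h0
  have h1 : (1 + ll z) ^ 2 ≤ 16 * √z := by
    have := one_add_ll_le h.le
    have h2 := ll_nonneg z
    calc (1 + ll z) ^ 2 ≤ (4 * √√z) ^ 2 := by gcongr
      _ = 16 * √z := by rw [mul_pow, Real.sq_sqrt hs.le]; norm_num
  have h2 : sw z = √z := by unfold sw; rw [tt_of_ge h.le, max_eq_right h.le]; simp
  have h3 : env z = 1 / z ^ 3 := by unfold env; rw [tt_of_ge h.le, max_eq_right h.le]; ring
  rw [h2, h3]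
  calc 1 / z ^ 3 * (√z * (1 + ll z) ^ 2) ≤ 1 / z ^ 3 * (√z * (16 * √z)) := by gcongr
    _ = 1 / z ^ 3 * (16 * (√z * √z)) := by ring
    _ = 16 * (1 / z ^ 2) := by rw [Real.mul_self_sqrt h0.le]; field_simp

lemma lintegral_tail_le : ∫⁻ z in Ioi (1 : ℝ), ENNReal.ofReal (16 * (1 / z ^ 2)) ≤ 16 := by
  have := setLIntegral_deriv_le (s := Ioi 1) (g := fun z => -(16 * (1 / z)))
    (g' := fun z => 16 * (1 / z ^ 2)) (m := -16) (M := 0) measurableSet_Ioi (convex_Ioi 1) ?_ ?_ ?_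
  · simpa using this
  · intro z hz
    have hz0 : 0 < z := one_pos.trans hz
    have h := ((hasDerivAt_inv hz0.ne').const_mul 16).neg
    simp only [one_div]
    refine h.congr_deriv ?_
    ring
  · intro z hz
    positivity
  · intro z hz
    have hz0 : 0 < z := one_pos.trans hz
    have : 1 / z ≤ 1 := (div_le_one hz0).2 (le_of_lt hz)
    exact ⟨by linarith, by simp only [Left.neg_nonpos_iff]; positivity⟩

lemma lintegral_env_le :
    ∫⁻ z, ENNReal.ofReal (env z) * ENNReal.ofReal (sw z * (1 + ll z) ^ 2) ∂leb ≤ 18 := by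
  rw [lintegral_leb_eq _ one_pos]
  have h1 : ∫⁻ z in Ioo 0 1, ENNReal.ofReal (env z) * ENNReal.ofReal (sw z * (1 + ll z) ^ 2)
      ≤ 2 := by
    calc _ = ∫⁻ z in Ioo 0 1, ENNReal.ofReal (1 / (z * √(1 - Real.log z) ^ 3)) := by
          apply setLIntegral_congr_fun measurableSet_Ioo
          intro z hz
          simp only
          rw [← ENNReal.ofReal_mul (env_pos hz.1).le, ← mul_assoc,
            env_mul_sw_of_le hz.1 hz.2.le, ll_of_le hz.1 hz.2.le]
          simp
      _ ≤ _ := lintegral_near_zero one_pos le_rfl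
      _ = 2 := by simp
  have h2 : ∫⁻ z in Ioi 1, ENNReal.ofReal (env z) * ENNReal.ofReal (sw z * (1 + ll z) ^ 2)
      ≤ 16 := by
    refine le_trans (setLIntegral_mono' measurableSet_Ioi ?_) lintegral_tail_le
    intro z hz
    rw [← ENNReal.ofReal_mul (env_pos (one_pos.trans hz)).le]
    exact ENNReal.ofReal_le_ofReal (env_mul_tail_le hz)
  calc _ ≤ (2 : ℝ≥0∞) + 16 := add_le_add h1 h2
    _ = 18 := by norm_num

/-- In the variable τ = 1 + `tt z` the envelope on (0,1) becomes dτ/τ² and the kernel is at most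
min(t,τ) with t = 1 + `tt x`. This is homogeneous, with Schur weight √τ: the regions τ > t and τ < t
contribute at most 2√t each. Hence the factor √(1+`tt`) in `sw`. -/
lemma lintegral_min_le {x : ℝ} (hx : 0 < x) :
    ∫⁻ z, ENNReal.ofReal (env z) * ENNReal.ofReal (min (tt x) (tt z) * sw z) ∂leb ≤
      ENNReal.ofReal (4 * sw x) := by
  rcases le_or_gt 1 x with h1 | h1
  · have : ∀ z, ENNReal.ofReal (env z) * ENNReal.ofReal (min (tt x) (tt z) * sw z) = 0 := by
      intro z
      rw [tt_of_ge h1, min_eq_left (tt_nonneg z)]; simp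
    simp [this]
  have hs := one_sub_log_pos hx h1.le
  have hp : 0 ≤ 1 - Real.log x := by linarith [Real.log_nonpos hx.le h1.le]
  set s := √(1 - Real.log x) with hsdef
  have hsw : sw x = s := by
    unfold sw; rw [tt_of_le hx h1.le, max_eq_left h1.le, ← sub_eq_add_neg, mul_one]
  have hss : s ^ 2 = 1 - Real.log x := Real.sq_sqrt hp
  have htx : tt x = s ^ 2 - 1 := by rw [tt_of_le hx h1.le, hss]; ring
  rw [lintegral_leb_eq _ hx]
  have a1 : ∫⁻ z in Ioo 0 x, ENNReal.ofReal (env z) * ENNReal.ofReal (min (tt x) (tt z) * sw z)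
      ≤ ENNReal.ofReal (tt x * (2 / s)) := by
    calc _ ≤ ∫⁻ z in Ioo 0 x,
          ENNReal.ofReal (tt x) * ENNReal.ofReal (1 / (z * √(1 - Real.log z) ^ 3)) := by
          refine setLIntegral_mono' measurableSet_Ioo ?_
          intro z hz
          rw [← ENNReal.ofReal_mul (env_pos hz.1).le, ← ENNReal.ofReal_mul (tt_nonneg x),
            ← env_mul_sw_of_le hz.1 (hz.2.le.trans h1.le)]
          apply ENNReal.ofReal_le_ofReal
          have := env_pos hz.1
          have := one_le_sw z
          calc env z * (min (tt x) (tt z) * sw z) ≤ env z * (tt x * sw z) := by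
                gcongr; exact min_le_left _ _
            _ = _ := by ring
      _ = ENNReal.ofReal (tt x) * ∫⁻ z in Ioo 0 x,
          ENNReal.ofReal (1 / (z * √(1 - Real.log z) ^ 3)) :=
          lintegral_const_mul' _ _ ENNReal.ofReal_ne_top
      _ ≤ ENNReal.ofReal (tt x) * ENNReal.ofReal (2 / s) := by
          gcongr; exact lintegral_near_zero hx h1.le
      _ = _ := (ENNReal.ofReal_mul (tt_nonneg x)).symm
  have a2 : ∫⁻ z in Ioi x, ENNReal.ofReal (env z) * ENNReal.ofReal (min (tt x) (tt z) * sw z)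
      ≤ ENNReal.ofReal (2 * s) := by
    rw [← Ioo_union_Ici_eq_Ioi h1]
    refine (lintegral_union_le _ _ _).trans ?_
    have : ∫⁻ z in Ici 1, ENNReal.ofReal (env z) * ENNReal.ofReal (min (tt x) (tt z) * sw z)
        = 0 := by
      rw [setLIntegral_congr_fun (g := fun _ => 0) measurableSet_Ici]
      · simp
      · intro z hz
        simp only
        rw [tt_of_ge hz, min_eq_right (tt_nonneg x)]; simp
    rw [this, add_zero]
    refine le_trans (setLIntegral_mono' measurableSet_Ioo ?_) (lintegral_near_one hx)
    intro z hz
    have hz0 := hx.trans hz.1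
    rw [← ENNReal.ofReal_mul (env_pos hz0).le]
    apply ENNReal.ofReal_le_ofReal
    have e := env_mul_sw_of_le hz0 hz.2.le
    have hsz := one_sub_log_pos hz0 hz.2.le
    have hpz : 0 ≤ 1 - Real.log z := by linarith [Real.log_nonpos hz0.le hz.2.le]
    calc env z * (min (tt x) (tt z) * sw z) = min (tt x) (tt z) * (env z * sw z) := by ring
      _ ≤ √(1 - Real.log z) ^ 2 * (1 / (z * √(1 - Real.log z) ^ 3)) := by
          rw [e]
          gcongr
          rw [Real.sq_sqrt hpz]
          refine (min_le_right _ _).trans ?_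
          rw [tt_of_le hz0 hz.2.le]; linarith
      _ = 1 / (z * √(1 - Real.log z)) := by field_simp
  calc _ ≤ ENNReal.ofReal (tt x * (2 / s)) + ENNReal.ofReal (2 * s) := add_le_add a1 a2
    _ = ENNReal.ofReal (tt x * (2 / s) + 2 * s) :=
        (ENNReal.ofReal_add (mul_nonneg (tt_nonneg x) (by positivity)) (by positivity)).symm
    _ ≤ _ := by
        apply ENNReal.ofReal_le_ofReal
        rw [hsw, htx]
        have : (s ^ 2 - 1) * (2 / s) = 2 * s - 2 / s := by field_simp
        have : 0 < 2 / s := by positivity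
        linarith

/-- Since `env` times `sw` is at most 1/z, the scale-invariant majorant `kap` applies and the bound
is uniform in x; 8192 = 4096 · 2. -/
lemma lintegral_sk_pow_le {x : ℝ} (hx : 0 < x) {j : ℕ} (h1 : 1 ≤ j) (h4 : j ≤ 4) :
    ∫⁻ z, ENNReal.ofReal (env z) * ENNReal.ofReal (sk x z ^ j * sw z) ∂leb ≤ 8192 := by
  calc _ ≤ ∫⁻ z, ENNReal.ofReal 4096 * ENNReal.ofReal (kap x z / z) ∂leb := by
        refine setLIntegral_mono' measurableSet_Ioi ?_
        intro z hz
        have hz : 0 < z := hz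
        rw [← ENNReal.ofReal_mul (env_pos hz).le, ← ENNReal.ofReal_mul (by norm_num)]
        apply ENNReal.ofReal_le_ofReal
        have h2 := sk_pow_le hx hz h1 h4
        have h3 := env_mul_sw_le hz
        have h5 := sk_nonneg hx hz
        have h6 := env_pos hz
        have h7 := one_le_sw z
        have h8 := kap_nonneg hx hz
        calc env z * (sk x z ^ j * sw z) = sk x z ^ j * (env z * sw z) := by ring
          _ ≤ (4096 * kap x z) * (1 / z) := by gcongr
          _ = _ := by ring
    _ = ENNReal.ofReal 4096 * ∫⁻ z, ENNReal.ofReal (kap x z / z) ∂leb :=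
        lintegral_const_mul' _ _ ENNReal.ofReal_ne_top
    _ ≤ ENNReal.ofReal 4096 * 2 := by gcongr; exact lintegral_kap_le hx
    _ = 8192 := by norm_num

instance : NullSingletonClass leb := by unfold leb; infer_instance

lemma ae_leb_pos : ∀ᵐ z ∂leb, 0 < z := ae_restrict_mem measurableSet_Ioi

lemma ae_leb_ne (x : ℝ) : ∀ᵐ z ∂leb, x ≠ z := by
  have : ∀ᵐ z ∂leb, z ≠ x := by
    rw [ae_iff]; simp
  filter_upwards [this] with z hz using hz.symm

/-- Schur's test for the kernel `ln |x² - z²|`. -/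
lemma lintegral_lk_sw_le {x : ℝ} (hx : 0 < x) :
    ∫⁻ z, ENNReal.ofReal (env z) * ENNReal.ofReal (|lk x z| * sw z) ∂leb ≤
      ENNReal.ofReal (10000 * sw x) := by
  have hsx := one_le_sw x
  calc _ ≤ ∫⁻ z, (2 * (ENNReal.ofReal (env z) * ENNReal.ofReal (min (tt x) (tt z) * sw z)) +
          ENNReal.ofReal (4 * sw x + 2) *
            (ENNReal.ofReal (env z) * ENNReal.ofReal (sw z * (1 + ll z) ^ 2)) +
          ENNReal.ofReal (env z) * ENNReal.ofReal (sk x z ^ 1 * sw z)) ∂leb := by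
        apply lintegral_mono_ae
        filter_upwards [ae_leb_pos, ae_leb_ne x] with z hz hxz
        have h1 := abs_lk_le hx hz hxz
        have h2 := ll_le_sw hx
        have h3 := env_pos hz
        have h4 := one_le_sw z
        have h5 := ll_nonneg z
        have h6 := sk_nonneg hx hz
        have h7 : 0 ≤ min (tt x) (tt z) := le_min (tt_nonneg _) (tt_nonneg _)
        rw [← ENNReal.ofReal_mul h3.le, ← ENNReal.ofReal_mul h3.le, ← ENNReal.ofReal_mul h3.le,
          ← ENNReal.ofReal_mul h3.le, show (2 : ℝ≥0∞) = ENNReal.ofReal 2 by norm_num,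
          ← ENNReal.ofReal_mul (by norm_num), ← ENNReal.ofReal_mul (by positivity),
          ← ENNReal.ofReal_add (by positivity) (by positivity),
          ← ENNReal.ofReal_add (by positivity) (by positivity)]
        apply ENNReal.ofReal_le_ofReal
        have h8 : 2 * ll x + 2 * ll z ≤ (4 * sw x + 2) * (1 + ll z) ^ 2 := by
          have : 1 + ll z ≤ (1 + ll z) ^ 2 := by nlinarith
          calc 2 * ll x + 2 * ll z ≤ (4 * sw x + 2) * (1 + ll z) := by nlinarith
            _ ≤ _ := by gcongr
        calc env z * (|lk x z| * sw z)
            ≤ env z * ((2 * min (tt x) (tt z) + (4 * sw x + 2) * (1 + ll z) ^ 2 + sk x z)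
              * sw z) := by gcongr; linarith
          _ = _ := by ring
    _ = 2 * (∫⁻ z, ENNReal.ofReal (env z) * ENNReal.ofReal (min (tt x) (tt z) * sw z) ∂leb) +
          ENNReal.ofReal (4 * sw x + 2) *
            (∫⁻ z, ENNReal.ofReal (env z) * ENNReal.ofReal (sw z * (1 + ll z) ^ 2) ∂leb) +
          ∫⁻ z, ENNReal.ofReal (env z) * ENNReal.ofReal (sk x z ^ 1 * sw z) ∂leb := by
        have m1 := measurable_env
        have m2 := measurable_sw
        have m3 := measurable_tt
        have m4 := measurable_ll
        rw [lintegral_add_left, lintegral_add_left, lintegral_const_mul' _ _ (by norm_num),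
          lintegral_const_mul' _ _ ENNReal.ofReal_ne_top] <;> fun_prop
    _ ≤ 2 * ENNReal.ofReal (4 * sw x) + ENNReal.ofReal (4 * sw x + 2) * 18 + 8192 := by
        gcongr
        · exact lintegral_min_le hx
        · exact lintegral_env_le
        · exact lintegral_sk_pow_le hx le_rfl (by norm_num)
    _ = ENNReal.ofReal (2 * (4 * sw x) + (4 * sw x + 2) * 18 + 8192) := by
        rw [show (2 : ℝ≥0∞) = ENNReal.ofReal 2 by norm_num,
          show (18 : ℝ≥0∞) = ENNReal.ofReal 18 by norm_num,
          show (8192 : ℝ≥0∞) = ENNReal.ofReal 8192 by norm_num,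
          ← ENNReal.ofReal_mul (by positivity), ← ENNReal.ofReal_mul (by positivity),
          ← ENNReal.ofReal_add (by positivity) (by positivity),
          ← ENNReal.ofReal_add (by positivity) (by positivity)]
    _ ≤ _ := ENNReal.ofReal_le_ofReal (by linarith)

/-- Square integrability of the kernel. -/
lemma lintegral_lk_sq_le {x : ℝ} (hx : 0 < x) :
    ∫⁻ z, ENNReal.ofReal (env z) * ENNReal.ofReal (lk x z ^ 2) ∂leb ≤
      ENNReal.ofReal (100000 * (1 + tt x + ll x) ^ 2) := by
  have htx := tt_nonneg x
  have hlx := ll_nonneg x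
  set A := 1 + tt x + ll x with hA
  have hA1 : 1 ≤ A := by linarith
  calc _ ≤ ∫⁻ z, (ENNReal.ofReal (8 * A ^ 2) *
            (ENNReal.ofReal (env z) * ENNReal.ofReal (sw z * (1 + ll z) ^ 2)) +
          2 * (ENNReal.ofReal (env z) * ENNReal.ofReal (sk x z ^ 2 * sw z))) ∂leb := by
        apply lintegral_mono_ae
        filter_upwards [ae_leb_pos, ae_leb_ne x] with z hz hxz
        have h1 := abs_lk_le hx hz hxz
        have h3 := env_pos hz
        have h4 := one_le_sw z
        have h5 := ll_nonneg z
        have h6 := sk_nonneg hx hz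
        have h7 : min (tt x) (tt z) ≤ tt x := min_le_left _ _
        rw [← ENNReal.ofReal_mul h3.le, ← ENNReal.ofReal_mul h3.le, ← ENNReal.ofReal_mul h3.le,
          show (2 : ℝ≥0∞) = ENNReal.ofReal 2 by norm_num,
          ← ENNReal.ofReal_mul (by positivity), ← ENNReal.ofReal_mul (by positivity),
          ← ENNReal.ofReal_add (by positivity) (by positivity)]
        apply ENNReal.ofReal_le_ofReal
        have h8 : |lk x z| ≤ 2 * A * (1 + ll z) + sk x z := by nlinarith
        have h9 : lk x z ^ 2 ≤ 8 * A ^ 2 * (1 + ll z) ^ 2 + 2 * sk x z ^ 2 := by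
          rw [← sq_abs]
          calc |lk x z| ^ 2 ≤ (2 * A * (1 + ll z) + sk x z) ^ 2 := by gcongr
            _ ≤ _ := by nlinarith [sq_nonneg (2 * A * (1 + ll z) - sk x z)]
        calc env z * lk x z ^ 2
            ≤ env z * ((8 * A ^ 2 * (1 + ll z) ^ 2 + 2 * sk x z ^ 2) * sw z) := by
              gcongr
              refine h9.trans (le_mul_of_one_le_right (by positivity) h4)
          _ = _ := by ring
    _ = ENNReal.ofReal (8 * A ^ 2) *
            (∫⁻ z, ENNReal.ofReal (env z) * ENNReal.ofReal (sw z * (1 + ll z) ^ 2) ∂leb) +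
          2 * ∫⁻ z, ENNReal.ofReal (env z) * ENNReal.ofReal (sk x z ^ 2 * sw z) ∂leb := by
        have m1 := measurable_env
        have m2 := measurable_sw
        have m4 := measurable_ll
        rw [lintegral_add_left, lintegral_const_mul' _ _ ENNReal.ofReal_ne_top,
          lintegral_const_mul' _ _ (by norm_num)]
        fun_prop
    _ ≤ ENNReal.ofReal (8 * A ^ 2) * 18 + 2 * 8192 := by
        gcongr
        · exact lintegral_env_le
        · exact lintegral_sk_pow_le hx (by norm_num) (by norm_num)
    _ = ENNReal.ofReal (8 * A ^ 2 * 18 + 2 * 8192) := by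
        rw [show (2 : ℝ≥0∞) = ENNReal.ofReal 2 by norm_num,
          show (18 : ℝ≥0∞) = ENNReal.ofReal 18 by norm_num,
          show (8192 : ℝ≥0∞) = ENNReal.ofReal 8192 by norm_num,
          ← ENNReal.ofReal_mul (by positivity), ← ENNReal.ofReal_mul (by positivity),
          ← ENNReal.ofReal_add (by positivity) (by positivity)]
    _ ≤ _ := ENNReal.ofReal_le_ofReal (by nlinarith)

/-! ### Potentials of measures dominated by the envelope -/

/-- The measure `w² ν` is dominated by the envelope. -/
structure Adm (ν : Measure ℝ) (w : ℝ → ℝ) : Prop where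
  meas : Measurable w
  one_le : ∀ z, 1 ≤ w z
  ac : ν ≪ leb
  dom : ∃ K : ℝ≥0, ∀ F : ℝ → ℝ≥0∞, Measurable F →
    ∫⁻ z, ENNReal.ofReal (w z ^ 2) * F z ∂ν ≤ K * ∫⁻ z, ENNReal.ofReal (env z) * F z ∂leb

/-- The potential `∫ ln |x² - z²| h(z) dν(z)`. -/
def potl {E : Type*} [NormedAddCommGroup E] [NormedSpace ℝ E] (ν : Measure ℝ) (h : ℝ → E)
    (x : ℝ) : E := ∫ z, lk x z • h z ∂ν

lemma lintegral_mul_sq_le {α : Type*} [MeasurableSpace α] {μ : Measure α} {f g : α → ℝ≥0∞}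
    (hf : AEMeasurable f μ) (hg : AEMeasurable g μ) :
    (∫⁻ a, f a * g a ∂μ) ^ 2 ≤ (∫⁻ a, f a ^ 2 ∂μ) * ∫⁻ a, g a ^ 2 ∂μ := by
  have h := ENNReal.lintegral_mul_le_Lp_mul_Lq μ Real.HolderConjugate.two_two hf hg
  have e : ∀ u : ℝ≥0∞, (u ^ (1 / 2 : ℝ)) ^ 2 = u := fun u => by
    rw [← ENNReal.rpow_natCast, ← ENNReal.rpow_mul]; norm_num
  calc (∫⁻ a, f a * g a ∂μ) ^ 2 ≤ _ := pow_le_pow_left' h 2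
    _ = _ := by
      rw [mul_pow, e, e]
      simp only [ENNReal.rpow_ofNat]

lemma lk_abs (x z : ℝ) : lk |x| z = lk x z := by unfold lk; rw [sq_abs]

namespace Adm

variable {ν : Measure ℝ} {w : ℝ → ℝ}

lemma pos (hA : Adm ν w) (z : ℝ) : 0 < w z := lt_of_lt_of_le one_pos (hA.one_le z)

lemma ae_pos (hA : Adm ν w) : ∀ᵐ z ∂ν, 0 < z := hA.ac.ae_le ae_leb_pos

lemma ae_ne (hA : Adm ν w) (x : ℝ) : ∀ᵐ z ∂ν, x ≠ z := hA.ac.ae_le (ae_leb_ne x)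

/-- A bound for integrals against `w² ν`. -/
lemma exists_bound (hA : Adm ν w) : ∃ K : ℝ≥0, ∀ F : ℝ → ℝ, Measurable F → ∀ B : ℝ≥0∞,
    ∫⁻ z, ENNReal.ofReal (env z) * ENNReal.ofReal (F z) ∂leb ≤ B →
    ∫⁻ z, ENNReal.ofReal (w z ^ 2 * F z) ∂ν ≤ K * B := by
  obtain ⟨K, hK⟩ := hA.dom
  refine ⟨K, fun F hF B hB => ?_⟩
  calc ∫⁻ z, ENNReal.ofReal (w z ^ 2 * F z) ∂ν
      = ∫⁻ z, ENNReal.ofReal (w z ^ 2) * ENNReal.ofReal (F z) ∂ν := by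
        simp_rw [ENNReal.ofReal_mul (sq_nonneg _)]
    _ ≤ K * ∫⁻ z, ENNReal.ofReal (env z) * ENNReal.ofReal (F z) ∂leb :=
        hK _ hF.ennreal_ofReal
    _ ≤ _ := by gcongr

lemma memLp_of_lintegral (hA : Adm ν w) {F : ℝ → ℝ} (hF : Measurable F)
    (h : ∫⁻ z, ENNReal.ofReal (env z) * ENNReal.ofReal (F z ^ 2) ∂leb < ∞) :
    MemLp (fun z => w z * F z) 2 ν := by
  obtain ⟨K, hK⟩ := hA.exists_bound
  refine ⟨(hA.meas.mul hF).aestronglyMeasurable, ?_⟩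
  rw [eLpNorm_lt_top_iff_lintegral_rpow_enorm_lt_top (by norm_num) (by norm_num)]
  have := hK (fun z => F z ^ 2) (hF.pow_const 2) _ le_rfl
  refine lt_of_le_of_lt (le_of_eq ?_) (this.trans_lt (ENNReal.mul_lt_top (by simp) h))
  apply lintegral_congr
  intro z
  simp only [ENNReal.toReal_ofNat, ENNReal.rpow_ofNat]
  rw [← enorm_pow, Real.enorm_eq_ofReal_abs, abs_of_nonneg (sq_nonneg _), mul_pow]

lemma memLp_weight (hA : Adm ν w) : MemLp (fun z => w z * (1 + ll z)) 2 ν := by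
  have m := measurable_ll
  refine hA.memLp_of_lintegral (by fun_prop) (lt_of_le_of_lt (lintegral_mono fun z => ?_)
    (lintegral_env_le.trans_lt (by norm_num)))
  gcongr
  exact le_mul_of_one_le_left (sq_nonneg _) (one_le_sw z)

lemma memLp_w (hA : Adm ν w) : MemLp w 2 ν := by
  refine hA.memLp_weight.mono hA.meas.aestronglyMeasurable (Eventually.of_forall fun z => ?_)
  rw [norm_mul]
  refine le_mul_of_one_le_right (norm_nonneg _) ?_
  rw [Real.norm_eq_abs, abs_of_nonneg (by linarith [ll_nonneg z])]
  linarith [ll_nonneg z]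

lemma isFiniteMeasure (hA : Adm ν w) : IsFiniteMeasure ν := by
  have h1 : MemLp (fun _ : ℝ => (1 : ℝ)) 2 ν :=
    hA.memLp_w.mono aestronglyMeasurable_const (Eventually.of_forall fun z => by
      simp only [norm_one, Real.norm_eq_abs]; exact (hA.one_le z).trans (le_abs_self _))
  rw [memLp_const_iff (by norm_num) (by norm_num)] at h1
  exact ⟨by simpa using h1⟩

lemma memLp_lk (hA : Adm ν w) {x : ℝ} (hx : x ≠ 0) : MemLp (fun z => w z * lk x z) 2 ν := by
  simp_rw [← lk_abs x]
  exact hA.memLp_of_lintegral (measurable_lk_right _)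
    ((lintegral_lk_sq_le (abs_pos.2 hx)).trans_lt ENNReal.ofReal_lt_top)

/-- Quantitative `L²` bound for the kernel, away from the origin. -/
lemma exists_lk_bound (hA : Adm ν w) : ∃ C : ℝ, 0 ≤ C ∧ ∀ x, 0 < x →
    eLpNorm (fun z => w z * lk x z) 2 ν ≤ ENNReal.ofReal (C * (1 + tt x + ll x)) := by
  obtain ⟨K, hK⟩ := hA.exists_bound
  refine ⟨√(K * 100000), by positivity, fun x hx => ?_⟩
  have h0 : 0 ≤ 1 + tt x + ll x := by linarith [tt_nonneg x, ll_nonneg x]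
  rw [eLpNorm_eq_lintegral_rpow_enorm_toReal (by norm_num) (by norm_num)]
  simp only [ENNReal.toReal_ofNat, ENNReal.rpow_ofNat]
  have := hK (fun z => lk x z ^ 2) ((measurable_lk_right x).pow_const 2) _ (lintegral_lk_sq_le hx)
  have e : ∫⁻ z, ‖w z * lk x z‖ₑ ^ 2 ∂ν = ∫⁻ z, ENNReal.ofReal (w z ^ 2 * lk x z ^ 2) ∂ν := by
    apply lintegral_congr
    intro z
    rw [← enorm_pow, Real.enorm_eq_ofReal_abs, abs_of_nonneg (sq_nonneg _), mul_pow]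
  rw [e]
  calc _ ≤ (↑K * ENNReal.ofReal (100000 * (1 + tt x + ll x) ^ 2)) ^ (1 / 2 : ℝ) := by gcongr
    _ = (ENNReal.ofReal (√(K * 100000) * (1 + tt x + ll x)) ^ 2) ^ (1 / 2 : ℝ) := by
        congr 1
        rw [← ENNReal.ofReal_pow (by positivity), mul_pow, Real.sq_sqrt (by positivity),
          mul_assoc, ENNReal.ofReal_mul (by positivity)]
        simp
    _ = _ := by
        rw [← ENNReal.rpow_natCast, ← ENNReal.rpow_mul]; norm_num

lemma memLp_sk (hA : Adm ν w) {x : ℝ} (hx : 0 < x) : MemLp (fun z => w z * sk x z) 2 ν := by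
  refine hA.memLp_of_lintegral (measurable_sk_right _)
    (lt_of_le_of_lt (lintegral_mono fun z => ?_) ((lintegral_sk_pow_le hx (j := 2)
      (by norm_num) (by norm_num)).trans_lt (by norm_num)))
  gcongr
  exact le_mul_of_one_le_right (sq_nonneg _) (one_le_sw z)

/-- Uniform bounds for the short-range part of the kernel. -/
lemma exists_sk_bound (hA : Adm ν w) : ∃ C : ℝ, 0 ≤ C ∧ ∀ x, 0 < x → ∀ j : ℕ, 1 ≤ j → j ≤ 2 →
    eLpNorm (fun z => w z * sk x z ^ j) 2 ν ≤ ENNReal.ofReal C := by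
  obtain ⟨K, hK⟩ := hA.exists_bound
  refine ⟨√(K * 8192), by positivity, fun x hx j hj1 hj2 => ?_⟩
  rw [eLpNorm_eq_lintegral_rpow_enorm_toReal (by norm_num) (by norm_num)]
  simp only [ENNReal.toReal_ofNat, ENNReal.rpow_ofNat]
  have := hK (fun z => sk x z ^ (j * 2)) ((measurable_sk_right x).pow_const _) 8192 (by
    refine le_trans (lintegral_mono_ae ?_) (lintegral_sk_pow_le hx (j := j * 2)
      (by omega) (by omega))
    filter_upwards [ae_leb_pos] with z hz
    gcongr
    exact le_mul_of_one_le_right (pow_nonneg (sk_nonneg hx hz) _) (one_le_sw z))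
  have e : ∫⁻ z, ‖w z * sk x z ^ j‖ₑ ^ 2 ∂ν
      = ∫⁻ z, ENNReal.ofReal (w z ^ 2 * sk x z ^ (j * 2)) ∂ν := by
    apply lintegral_congr
    intro z
    rw [← enorm_pow, Real.enorm_eq_ofReal_abs, abs_of_nonneg (sq_nonneg _), mul_pow, ← pow_mul]
  rw [e]
  calc _ ≤ (↑K * (8192 : ℝ≥0∞)) ^ (1 / 2 : ℝ) := by gcongr
    _ = (ENNReal.ofReal (√(K * 8192)) ^ 2) ^ (1 / 2 : ℝ) := by
        congr 1
        rw [← ENNReal.ofReal_pow (by positivity), Real.sq_sqrt (by positivity),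
          ENNReal.ofReal_mul (by positivity)]
        simp
    _ = _ := by
        rw [← ENNReal.rpow_natCast, ← ENNReal.rpow_mul]; norm_num

/-- The kernel is bounded as an operator on `L²(ν)`, by Schur's test. -/
lemma exists_schur (hA : Adm ν w) : ∃ C : ℝ≥0, ∀ g : ℝ → ℝ≥0∞, Measurable g →
    ∫⁻ x, (∫⁻ z, ENNReal.ofReal (w z * |lk x z|) * g z ∂ν) ^ 2 ∂ν ≤ C * ∫⁻ z, g z ^ 2 ∂ν := by
  have := hA.isFiniteMeasure
  obtain ⟨K, hK⟩ := hA.exists_bound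
  have mw := hA.meas
  have ms := measurable_sw
  have hsw : ∀ z, 0 < sw z := fun z => lt_of_lt_of_le one_pos (one_le_sw z)
  have mk : Measurable (Function.uncurry lk) := measurable_lk
  have hA1 : ∀ x, 0 < x → ∫⁻ z, ENNReal.ofReal (w z ^ 2 * (|lk x z| * sw z)) ∂ν ≤
      K * ENNReal.ofReal (10000 * sw x) := fun x hx =>
    hK (fun z => |lk x z| * sw z) (by have := measurable_lk_right x; fun_prop) _
      (lintegral_lk_sw_le hx)
  refine ⟨K * 10000 * (K * 10000), fun g hg => ?_⟩
  have h1 : ∀ x, 0 < x → (∫⁻ z, ENNReal.ofReal (w z * |lk x z|) * g z ∂ν) ^ 2 ≤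
      (K * 10000) * ∫⁻ z, ENNReal.ofReal (|lk x z| * sw x) * (g z ^ 2 / ENNReal.ofReal (sw z))
        ∂ν := by
    intro x hx
    have mx := measurable_lk_right x
    -- The Schur splitting for Cauchy–Schwarz. The whole weight w goes with the first factor, whose
    -- square then carries w², exactly what the domination by the envelope controls.
    have e1 : ∀ z, ENNReal.ofReal (w z * |lk x z|) * g z =
        ENNReal.ofReal (w z * √(|lk x z| * sw z)) *
          (ENNReal.ofReal (√(|lk x z| / sw z)) * g z) := by
      intro z
      rw [← mul_assoc, ← ENNReal.ofReal_mul (mul_nonneg (hA.pos z).le (Real.sqrt_nonneg _)),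
        mul_assoc, ← Real.sqrt_mul (by have := hsw z; positivity)]
      congr 3
      rw [show |lk x z| * sw z * (|lk x z| / sw z) = |lk x z| ^ 2 by
        have := hsw z; field_simp, Real.sqrt_sq (abs_nonneg _)]
    simp_rw [e1]
    refine (lintegral_mul_sq_le (by fun_prop) (by fun_prop)).trans ?_
    have e2 : ∀ z, ENNReal.ofReal (w z * √(|lk x z| * sw z)) ^ 2 =
        ENNReal.ofReal (w z ^ 2 * (|lk x z| * sw z)) := by
      intro z
      rw [← ENNReal.ofReal_pow (mul_nonneg (hA.pos z).le (Real.sqrt_nonneg _)), mul_pow,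
        Real.sq_sqrt (by have := hsw z; positivity)]
    have e3 : ∀ z, ENNReal.ofReal (sw x) * (ENNReal.ofReal (√(|lk x z| / sw z)) * g z) ^ 2 =
        ENNReal.ofReal (|lk x z| * sw x) * (g z ^ 2 / ENNReal.ofReal (sw z)) := by
      intro z
      rw [mul_pow, ← ENNReal.ofReal_pow (Real.sqrt_nonneg _),
        Real.sq_sqrt (by have := hsw z; positivity), ENNReal.ofReal_div_of_pos (hsw z),
        mul_comm (|lk x z|), ENNReal.ofReal_mul (hsw x).le, div_eq_mul_inv, div_eq_mul_inv]
      ring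
    simp_rw [e2]
    calc _ ≤ (K * ENNReal.ofReal (10000 * sw x)) *
          ∫⁻ z, (ENNReal.ofReal (√(|lk x z| / sw z)) * g z) ^ 2 ∂ν := by
          gcongr; exact hA1 x hx
      _ = (K * 10000) * (ENNReal.ofReal (sw x) *
          ∫⁻ z, (ENNReal.ofReal (√(|lk x z| / sw z)) * g z) ^ 2 ∂ν) := by
          rw [ENNReal.ofReal_mul (by norm_num)]
          simp only [ENNReal.ofReal_ofNat]
          ring
      _ = _ := by
          rw [← lintegral_const_mul' _ _ ENNReal.ofReal_ne_top]
          simp_rw [e3]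
  calc ∫⁻ x, (∫⁻ z, ENNReal.ofReal (w z * |lk x z|) * g z ∂ν) ^ 2 ∂ν
      ≤ ∫⁻ x, (K * 10000) * ∫⁻ z, ENNReal.ofReal (|lk x z| * sw x) *
          (g z ^ 2 / ENNReal.ofReal (sw z)) ∂ν ∂ν := by
        apply lintegral_mono_ae
        filter_upwards [hA.ae_pos] with x hx using h1 x hx
    _ = (K * 10000) * ∫⁻ x, ∫⁻ z, ENNReal.ofReal (|lk x z| * sw x) *
          (g z ^ 2 / ENNReal.ofReal (sw z)) ∂ν ∂ν :=
        lintegral_const_mul' _ _ (ENNReal.mul_ne_top ENNReal.coe_ne_top (by norm_num))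
    _ = (K * 10000) * ∫⁻ z, ∫⁻ x, ENNReal.ofReal (|lk x z| * sw x) *
          (g z ^ 2 / ENNReal.ofReal (sw z)) ∂ν ∂ν := by
        rw [lintegral_lintegral_swap]
        have m1 : Measurable (Function.uncurry fun x z => ENNReal.ofReal (|lk x z| * sw x)) := by
          apply Measurable.ennreal_ofReal
          exact (measurable_lk.abs).mul (ms.comp measurable_fst)
        have m2 : Measurable fun z => g z ^ 2 / ENNReal.ofReal (sw z) := by fun_prop
        exact (m1.mul (m2.comp measurable_snd)).aemeasurable
    _ ≤ (K * 10000) * ∫⁻ z, (K * 10000) * g z ^ 2 ∂ν := by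
        gcongr (K * 10000) * ?_
        apply lintegral_mono_ae
        filter_upwards [hA.ae_pos] with z hz
        rw [lintegral_mul_const]
        swap
        · have := measurable_lk_right z
          simp_rw [fun x => lk_comm x z]; fun_prop
        -- The same bound with the roles of the variables exchanged. The missing factor w² is
        -- inserted at no cost, since it is at least one.
        have h2 : ∫⁻ x, ENNReal.ofReal (|lk x z| * sw x) ∂ν ≤ K * ENNReal.ofReal (10000 * sw z) := by
          refine (lintegral_mono fun x => ?_).trans (hA1 z hz)
          apply ENNReal.ofReal_le_ofReal
          rw [lk_comm]
          exact le_mul_of_one_le_left (by have := hsw x; positivity)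
            (one_le_pow₀ (hA.one_le x))
        have hne : ENNReal.ofReal (sw z) ≠ 0 := by simpa using hsw z
        calc _ ≤ (K * ENNReal.ofReal (10000 * sw z)) * (g z ^ 2 / ENNReal.ofReal (sw z)) := by
              gcongr
          _ = (K * 10000) * (ENNReal.ofReal (sw z) * (g z ^ 2 / ENNReal.ofReal (sw z))) := by
              rw [ENNReal.ofReal_mul (by norm_num)]
              simp only [ENNReal.ofReal_ofNat]
              ring
          _ = _ := by rw [ENNReal.mul_div_cancel hne ENNReal.ofReal_ne_top]
    _ = _ := by
        rw [lintegral_const_mul' _ _ (ENNReal.mul_ne_top ENNReal.coe_ne_top (by norm_num))]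
        push_cast
        ring

end Adm

/-! ### Potentials of weighted square integrable charges: bounds, decomposition, continuity. -/

namespace Adm

variable {ν : Measure ℝ} {w : ℝ → ℝ} {E : Type*} [NormedAddCommGroup E] [NormedSpace ℝ E]

/-- The weight moves from the charge to the kernel. Since w k is square integrable for the kernels
in use, charges that grow like w times an L² function still have potentials. -/
lemma smul_eq (hA : Adm ν w) (k : ℝ → ℝ) (h : ℝ → E) (z : ℝ) :
    k z • h z = (w z * k z) • ((w z)⁻¹ • h z) := by
  rw [smul_smul, mul_comm (w z), mul_assoc, mul_inv_cancel₀ (hA.pos z).ne', mul_one]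

lemma integrable_smul (hA : Adm ν w) {k : ℝ → ℝ} {h : ℝ → E}
    (hk : MemLp (fun z => w z * k z) 2 ν) (hh : MemLp (fun z => (w z)⁻¹ • h z) 2 ν) :
    Integrable (fun z => k z • h z) ν := by
  simp_rw [hA.smul_eq k h]
  exact memLp_one_iff_integrable.1 (hh.smul hk)

lemma norm_integral_smul_le (hA : Adm ν w) {k : ℝ → ℝ} {h : ℝ → E}
    (hk : MemLp (fun z => w z * k z) 2 ν) (hh : MemLp (fun z => (w z)⁻¹ • h z) 2 ν) :
    ‖∫ z, k z • h z ∂ν‖ ≤ (eLpNorm (fun z => w z * k z) 2 ν).toReal *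
      (eLpNorm (fun z => (w z)⁻¹ • h z) 2 ν).toReal := by
  refine (norm_integral_le_lintegral_norm _).trans ?_
  rw [← ENNReal.toReal_mul]
  apply ENNReal.toReal_mono (ENNReal.mul_ne_top hk.2.ne hh.2.ne)
  have := eLpNorm_smul_le_mul_eLpNorm (p := 2) (q := 2) (r := 1) hh.1 hk.1
  rw [eLpNorm_one_eq_lintegral_enorm] at this
  refine le_trans (le_of_eq ?_) this
  apply lintegral_congr
  intro z
  rw [ofReal_norm]
  congr 1
  exact hA.smul_eq k h z

lemma weighted_memLp (hA : Adm ν w) {h : ℝ → E} (hh : MemLp h 2 ν) :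
    MemLp (fun z => (w z)⁻¹ • h z) 2 ν := by
  refine hh.mono (hA.meas.inv.aestronglyMeasurable.smul hh.1) (Eventually.of_forall fun z => ?_)
  rw [norm_smul, norm_inv, Real.norm_of_nonneg (hA.pos z).le]
  exact mul_le_of_le_one_left (norm_nonneg _) (inv_le_one_of_one_le₀ (hA.one_le z))

lemma aesm (hA : Adm ν w) {h : ℝ → E} (hh : MemLp (fun z => (w z)⁻¹ • h z) 2 ν) :
    AEStronglyMeasurable h ν := by
  have : h = fun z => w z • ((w z)⁻¹ • h z) := by
    funext z; rw [smul_smul, mul_inv_cancel₀ (hA.pos z).ne', one_smul]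
  rw [this]
  exact hA.meas.aestronglyMeasurable.smul hh.1

lemma integrable_lk (hA : Adm ν w) {h : ℝ → E} (hh : MemLp (fun z => (w z)⁻¹ • h z) 2 ν)
    {x : ℝ} (hx : x ≠ 0) : Integrable (fun z => lk x z • h z) ν :=
  hA.integrable_smul (hA.memLp_lk hx) hh

lemma integrable_weighted (hA : Adm ν w) {h : ℝ → E} (hh : MemLp (fun z => (w z)⁻¹ • h z) 2 ν) :
    Integrable h ν := by
  have := hA.integrable_smul (k := fun _ => 1) (by simpa using hA.memLp_w) hh
  simpa using this

lemma integrable_log_weighted (hA : Adm ν w) {h : ℝ → E}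
    (hh : MemLp (fun z => (w z)⁻¹ • h z) 2 ν) : Integrable (fun z => (1 + ll z) • h z) ν :=
  hA.integrable_smul hA.memLp_weight hh

lemma integrable_sk (hA : Adm ν w) {h : ℝ → E} (hh : MemLp (fun z => (w z)⁻¹ • h z) 2 ν)
    {x : ℝ} (hx : 0 < x) : Integrable (fun z => sk x z • h z) ν :=
  hA.integrable_smul (hA.memLp_sk hx) hh

lemma abs_max_log_le (x z : ℝ) :
    |max (Real.log x) (Real.log z)| ≤ (1 + |Real.log x|) * (1 + ll z) := by
  have h1 : |max (Real.log x) (Real.log z)| ≤ |Real.log x| + ll z := by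
    unfold ll
    rw [abs_le]
    refine ⟨?_, max_le ?_ ?_⟩
    · have := le_max_left (Real.log x) (Real.log z)
      have := neg_abs_le (Real.log x)
      have := le_max_right (Real.log z) 0
      linarith
    · have := le_abs_self (Real.log x)
      have := le_max_right (Real.log z) 0
      linarith
    · have := abs_nonneg (Real.log x)
      have := le_max_left (Real.log z) 0
      linarith
  have := ll_nonneg z
  have := abs_nonneg (Real.log x)
  nlinarith

lemma integrable_max (hA : Adm ν w) {h : ℝ → E} (hh : MemLp (fun z => (w z)⁻¹ • h z) 2 ν)
    (x : ℝ) : Integrable (fun z => max (Real.log x) (Real.log z) • h z) ν := by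
  refine ((hA.integrable_log_weighted hh).norm.const_mul (1 + |Real.log x|)).mono' ?_ ?_
  · exact (Measurable.aestronglyMeasurable (by fun_prop)).smul (hA.aesm hh)
  · refine Eventually.of_forall fun z => ?_
    rw [norm_smul, norm_smul, ← mul_assoc]
    gcongr
    refine (abs_max_log_le x z).trans ?_
    gcongr
    exact le_abs_self _

lemma potl_eq (hA : Adm ν w) {h : ℝ → E} (hh : MemLp (fun z => (w z)⁻¹ • h z) 2 ν)
    {x : ℝ} (hx : 0 < x) :
    potl ν h x = (2 : ℝ) • (∫ z, max (Real.log x) (Real.log z) • h z ∂ν) -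
      ∫ z, sk x z • h z ∂ν := by
  have e := integral_sub ((hA.integrable_max hh x).smul (2 : ℝ)) (hA.integrable_sk hh hx)
  rw [← integral_smul]
  refine Eq.trans ?_ e
  apply integral_congr_ae
  filter_upwards [hA.ae_pos, hA.ae_ne x] with z hz hxz
  simp only [Pi.smul_apply]
  rw [lk_eq hx hz hxz, sub_smul, smul_smul]

lemma exists_potl_bound (hA : Adm ν w) : ∃ C : ℝ, 0 ≤ C ∧ ∀ h : ℝ → E,
    MemLp (fun z => (w z)⁻¹ • h z) 2 ν → ∀ x, 0 < x →
    ‖potl ν h x‖ ≤ C * (1 + tt x + ll x) * (eLpNorm (fun z => (w z)⁻¹ • h z) 2 ν).toReal := by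
  obtain ⟨C, hC0, hC⟩ := hA.exists_lk_bound
  refine ⟨C, hC0, fun h hh x hx => ?_⟩
  refine (hA.norm_integral_smul_le (hA.memLp_lk hx.ne') hh).trans ?_
  gcongr
  apply ENNReal.toReal_le_of_le_ofReal _ (hC x hx)
  have := tt_nonneg x
  have := ll_nonneg x
  positivity

lemma exists_skpotl_bound (hA : Adm ν w) : ∃ C : ℝ, 0 ≤ C ∧ ∀ h : ℝ → E,
    MemLp (fun z => (w z)⁻¹ • h z) 2 ν → ∀ x, 0 < x →
    ‖∫ z, sk x z • h z ∂ν‖ ≤ C * (eLpNorm (fun z => (w z)⁻¹ • h z) 2 ν).toReal := by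
  obtain ⟨C, hC0, hC⟩ := hA.exists_sk_bound
  refine ⟨C, hC0, fun h hh x hx => ?_⟩
  refine (hA.norm_integral_smul_le (hA.memLp_sk hx) hh).trans ?_
  gcongr
  apply ENNReal.toReal_le_of_le_ofReal hC0
  simpa using hC x hx 1 le_rfl (by norm_num)

lemma stronglyMeasurable_potl (hA : Adm ν w) {h : ℝ → E} (hh : AEStronglyMeasurable h ν) :
    StronglyMeasurable (potl ν h) := by
  have := hA.isFiniteMeasure
  have e : potl ν h = potl ν (hh.mk h) := by
    funext x
    apply integral_congr_ae
    filter_upwards [hh.ae_eq_mk] with z hz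
    rw [hz]
  rw [e]
  have : StronglyMeasurable (Function.uncurry fun x z => lk x z • hh.mk h z) :=
    measurable_lk.stronglyMeasurable.smul (hh.stronglyMeasurable_mk.comp_measurable measurable_snd)
  exact this.integral_prod_right

/-- The potential is a bounded operator on `L²(ν)`, even with the weight `w`. -/
lemma exists_memLp_potl (hA : Adm ν w) : ∃ C : ℝ≥0, ∀ h : ℝ → E,
    MemLp (fun z => (w z)⁻¹ • h z) 2 ν → MemLp (potl ν h) 2 ν ∧
    eLpNorm (potl ν h) 2 ν ≤ C * eLpNorm (fun z => (w z)⁻¹ • h z) 2 ν := by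
  obtain ⟨C, hC⟩ := hA.exists_schur
  refine ⟨NNReal.sqrt C, fun h hh => ?_⟩
  have key : eLpNorm (potl ν h) 2 ν ≤
      NNReal.sqrt C * eLpNorm (fun z => (w z)⁻¹ • h z) 2 ν := by
    rw [eLpNorm_eq_lintegral_rpow_enorm_toReal (by norm_num) (by norm_num),
      eLpNorm_eq_lintegral_rpow_enorm_toReal (by norm_num) (by norm_num)]
    simp only [ENNReal.toReal_ofNat, ENNReal.rpow_ofNat]
    obtain ⟨g, hgm, hge⟩ : AEMeasurable (fun z => ‖(w z)⁻¹ • h z‖ₑ) ν := hh.1.enorm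
    have h1 : ∀ x, ‖potl ν h x‖ₑ ≤ ∫⁻ z, ENNReal.ofReal (w z * |lk x z|) * g z ∂ν := by
      intro x
      refine (enorm_integral_le_lintegral_enorm _).trans (lintegral_mono_ae ?_)
      filter_upwards [hge] with z hz
      rw [hA.smul_eq (lk x) h, enorm_smul, hz, Real.enorm_eq_ofReal_abs, abs_mul,
        abs_of_pos (hA.pos z)]
    have h2 : ∫⁻ z, ‖(w z)⁻¹ • h z‖ₑ ^ 2 ∂ν = ∫⁻ z, g z ^ 2 ∂ν := by
      apply lintegral_congr_ae
      filter_upwards [hge] with z hz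
      rw [hz]
    rw [h2]
    calc (∫⁻ x, ‖potl ν h x‖ₑ ^ 2 ∂ν) ^ (1 / 2 : ℝ) ≤ (C * ∫⁻ z, g z ^ 2 ∂ν) ^ (1 / 2 : ℝ) := by
          gcongr
          refine le_trans (lintegral_mono fun x => ?_) (hC g hgm)
          gcongr
          exact h1 x
      _ = _ := by
          rw [ENNReal.mul_rpow_of_nonneg _ _ (by norm_num)]
          congr 1
          rw [← ENNReal.coe_rpow_of_nonneg _ (by norm_num), NNReal.sqrt_eq_rpow]
  refine ⟨⟨(hA.stronglyMeasurable_potl (hA.aesm hh)).aestronglyMeasurable, ?_⟩, key⟩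
  exact key.trans_lt (ENNReal.mul_lt_top ENNReal.coe_lt_top hh.2)

lemma potl_congr {h h' : ℝ → E} (e : h =ᵐ[ν] h') : potl ν h = potl ν h' := by
  funext x
  apply integral_congr_ae
  filter_upwards [e] with z hz
  rw [hz]

lemma continuousAt_sk {x z : ℝ} (hx : 0 < x) (hz : 0 < z) (h : x ≠ z) :
    ContinuousAt (fun x => sk x z) x := by
  unfold sk
  have h1 : ContinuousAt (fun x => rat x z) x := by
    unfold rat
    have : max x z ≠ 0 := (lt_max_of_lt_left hx).ne'
    have h2 : ContinuousAt (fun x : ℝ => min x z) x := by fun_prop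
    have h3 : ContinuousAt (fun x : ℝ => max x z) x := by fun_prop
    exact (h2.div h3 this).pow 2
  exact ((continuousAt_const.sub h1).log (sub_pos.2 (rat_lt_one hx hz h)).ne').neg

lemma continuousOn_max (hA : Adm ν w) {h : ℝ → E} (hh : MemLp (fun z => (w z)⁻¹ • h z) 2 ν) :
    ContinuousOn (fun x => ∫ z, max (Real.log x) (Real.log z) • h z ∂ν) (Ioi 0) := by
  intro x hx
  have hx : 0 < x := hx
  apply ContinuousAt.continuousWithinAt
  have hev : ∀ᶠ y in 𝓝 x, |Real.log y| ≤ |Real.log x| + 1 := by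
    have h1 : ContinuousAt (fun y => |Real.log y|) x := (Real.continuousAt_log hx.ne').abs
    exact (h1.eventually (gt_mem_nhds (lt_add_one _))).mono fun y hy => hy.le
  apply continuousAt_of_dominated
    (bound := fun z => (1 + (|Real.log x| + 1)) * ‖(1 + ll z) • h z‖)
  · exact Eventually.of_forall fun y => (hA.integrable_max hh y).1
  · filter_upwards [hev] with y hy
    refine Eventually.of_forall fun z => ?_
    rw [norm_smul, norm_smul, ← mul_assoc]
    have := ll_nonneg z
    gcongr
    refine (abs_max_log_le y z).trans ?_
    rw [Real.norm_of_nonneg (by linarith)]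
    gcongr
  · exact (hA.integrable_log_weighted hh).norm.const_mul _
  · refine Eventually.of_forall fun z => ?_
    exact ((Real.continuousAt_log hx.ne').max continuousAt_const).smul continuousAt_const

/-- Potentials are continuous on the half line. -/
lemma continuousOn_potl (hA : Adm ν w) {h : ℝ → E} (hh : MemLp (fun z => (w z)⁻¹ • h z) 2 ν) :
    ContinuousOn (potl ν h) (Ioi 0) := by
  have hsk : ContinuousOn (fun x => ∫ z, sk x z • h z ∂ν) (Ioi 0) := by
    obtain ⟨C, hC0, hC⟩ := hA.exists_sk_bound
    set B := (eLpNorm (fun z => (w z)⁻¹ • h z) 2 ν).toReal with hB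
    -- The singularity on the diagonal moves with x and rules out direct domination. Truncation at n
    -- + 1 costs at most sk²/(n+1), and sk² is bounded in weighted L² uniformly in x; this is the
    -- use of the case j = 2 of `exists_sk_bound`.
    have hu : TendstoUniformlyOn (fun (n : ℕ) x => ∫ z, min (sk x z) (n + 1) • h z ∂ν)
        (fun x => ∫ z, sk x z • h z ∂ν) atTop (Ioi 0) := by
      have hlim : Tendsto (fun n : ℕ => C * B * (1 / ((n : ℝ) + 1))) atTop (𝓝 0) := by
        have := (tendsto_one_div_add_atTop_nhds_zero_nat (𝕜 := ℝ)).const_mul (C * B)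
        simpa using this
      rw [Metric.tendstoUniformlyOn_iff]
      intro ε hε
      filter_upwards [hlim.eventually (gt_mem_nhds hε)] with n hn x hx
      have hx : 0 < x := hx
      refine lt_of_le_of_lt ?_ hn
      have hm : Integrable (fun z => min (sk x z) (n + 1) • h z) ν := by
        refine (hA.integrable_sk hh hx).mono ?_ ?_
        · have := measurable_sk_right x
          exact (Measurable.aestronglyMeasurable (by fun_prop)).smul (hA.aesm hh)
        · filter_upwards [hA.ae_pos] with z hz
          rw [norm_smul, norm_smul]
          have h1 := sk_nonneg hx hz
          gcongr
          rw [Real.norm_of_nonneg (by positivity), Real.norm_of_nonneg h1]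
          exact min_le_left _ _
      have hs2 : MemLp (fun z => w z * sk x z ^ 2) 2 ν :=
        ⟨(hA.meas.mul ((measurable_sk_right x).pow_const 2)).aestronglyMeasurable,
          (hC x hx 2 (by norm_num) le_rfl).trans_lt ENNReal.ofReal_lt_top⟩
      rw [dist_eq_norm, ← integral_sub (hA.integrable_sk hh hx) hm]
      have h2 : ∫ z, ‖sk x z ^ 2 • ‖h z‖‖ ∂ν ≤ C * B := by
        have hh' : MemLp (fun z => (w z)⁻¹ • ‖h z‖) 2 ν := by
          refine hh.norm.congr_norm (hA.meas.inv.aestronglyMeasurable.smul (hA.aesm hh).norm) ?_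
          refine Eventually.of_forall fun z => ?_
          simp [norm_smul]
        have h3 := hA.norm_integral_smul_le hs2 hh'
        have h4 : eLpNorm (fun z => (w z)⁻¹ • ‖h z‖) 2 ν = eLpNorm (fun z => (w z)⁻¹ • h z) 2 ν :=
          eLpNorm_congr_norm_ae (Eventually.of_forall fun z => by simp [norm_smul])
        rw [h4] at h3
        calc ∫ z, ‖sk x z ^ 2 • ‖h z‖‖ ∂ν = ∫ z, sk x z ^ 2 • ‖h z‖ ∂ν := by
              apply integral_congr_ae
              refine Eventually.of_forall fun z => ?_
              simp only [smul_eq_mul]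
              exact Real.norm_of_nonneg (by positivity)
          _ ≤ ‖∫ z, sk x z ^ 2 • ‖h z‖ ∂ν‖ := le_abs_self _
          _ ≤ _ := h3
          _ ≤ C * B := by
              gcongr
              exact ENNReal.toReal_le_of_le_ofReal hC0 (hC x hx 2 (by norm_num) le_rfl)
      have hi2 : Integrable (fun z => ‖sk x z ^ 2 • ‖h z‖‖) ν := by
        refine Integrable.norm (hA.integrable_smul hs2 ?_)
        refine hh.norm.congr_norm (hA.meas.inv.aestronglyMeasurable.smul (hA.aesm hh).norm) ?_
        refine Eventually.of_forall fun z => ?_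
        simp [norm_smul]
      calc ‖∫ z, (sk x z • h z - min (sk x z) (n + 1) • h z) ∂ν‖
          ≤ ∫ z, ‖sk x z ^ 2 • ‖h z‖‖ * (1 / ((n : ℝ) + 1)) ∂ν := by
            apply norm_integral_le_of_norm_le (hi2.mul_const _)
            filter_upwards [hA.ae_pos] with z hz
            have h1 := sk_nonneg hx hz
            rw [← sub_smul, norm_smul, norm_smul, norm_norm, mul_right_comm]
            gcongr
            rw [Real.norm_of_nonneg (sub_nonneg.2 (min_le_left _ _)),
              Real.norm_of_nonneg (by positivity), mul_one_div, le_div_iff₀ (by positivity)]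
            rcases le_total (sk x z) (n + 1) with h5 | h5
            · rw [min_eq_left h5, sub_self, zero_mul]; positivity
            · rw [min_eq_right h5]
              have : (0 : ℝ) ≤ n := Nat.cast_nonneg n
              nlinarith
        _ = (∫ z, ‖sk x z ^ 2 • ‖h z‖‖ ∂ν) * (1 / ((n : ℝ) + 1)) := integral_mul_const _ _
        _ ≤ _ := by gcongr
    refine hu.continuousOn (Eventually.frequently (Eventually.of_forall fun n => ?_))
    intro x hx
    have hx : 0 < x := hx
    apply ContinuousAt.continuousWithinAt
    apply continuousAt_of_dominated (bound := fun z => ((n : ℝ) + 1) * ‖h z‖)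
    · refine Eventually.of_forall fun y => ?_
      have := measurable_sk_right y
      exact (Measurable.aestronglyMeasurable (by fun_prop)).smul (hA.aesm hh)
    · filter_upwards [lt_mem_nhds hx] with y hy
      filter_upwards [hA.ae_pos] with z hz
      have h1 := sk_nonneg hy hz
      rw [norm_smul, Real.norm_of_nonneg (by positivity)]
      gcongr
      exact min_le_right _ _
    · exact (hA.integrable_weighted hh).norm.const_mul _
    · filter_upwards [hA.ae_pos, hA.ae_ne x] with z hz hxz
      exact ((continuousAt_sk hx hz hxz).min continuousAt_const).smul continuousAt_const
  refine (((hA.continuousOn_max hh).const_smul (2 : ℝ)).sub hsk).congr fun x hx => ?_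
  exact hA.potl_eq hh hx

end Adm

/-! ### Conditional positivity of the logarithmic energy -/

/-- Frullani's integrand for the exponential. -/
def frul (A t : ℝ) : ℝ := t⁻¹ * (Real.exp (-(1 * t)) - Real.exp (-(A * t)))

lemma abs_frul_le {A t : ℝ} (ht : 0 < t) :
    |frul A t| ≤ |A - 1| * Real.exp (-(min 1 A * t)) := by
  have key : ∀ a b : ℝ, a ≤ b → t⁻¹ * (Real.exp (-(a * t)) - Real.exp (-(b * t))) ≤
      (b - a) * Real.exp (-(a * t)) ∧
      0 ≤ t⁻¹ * (Real.exp (-(a * t)) - Real.exp (-(b * t))) := by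
    intro a b hab
    have h1 : Real.exp (-(b * t)) = Real.exp (-(a * t)) * Real.exp (-((b - a) * t)) := by
      rw [← Real.exp_add]; ring_nf
    have h2 := Real.add_one_le_exp (-((b - a) * t))
    have h3 : Real.exp (-((b - a) * t)) ≤ 1 := Real.exp_le_one_iff.2 (by nlinarith)
    have h4 := Real.exp_pos (-(a * t))
    constructor
    · rw [inv_mul_le_iff₀ ht, h1]
      nlinarith
    · apply mul_nonneg (inv_nonneg.2 ht.le)
      rw [h1]; nlinarith
  unfold frul
  rcases le_total 1 A with h | h
  · obtain ⟨h1, h2⟩ := key 1 A h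
    rw [min_eq_left h, abs_of_nonneg h2, abs_of_nonneg (by linarith)]
    exact h1
  · obtain ⟨h1, h2⟩ := key A 1 h
    rw [min_eq_right h, abs_sub_comm A, abs_of_nonneg (by linarith : 0 ≤ 1 - A), ← neg_sub,
      mul_neg, abs_neg, abs_of_nonneg h2]
    exact h1

lemma integrableOn_frul {A : ℝ} (hA : 0 < A) : IntegrableOn (frul A) (Ioi 0) := by
  have h := (integrableOn_exp_mul_Ioi (a := -(min 1 A)) (by
    have := lt_min one_pos hA; linarith) 0).const_mul |A - 1|
  refine h.mono' ?_ ?_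
  · apply Measurable.aestronglyMeasurable
    unfold frul; fun_prop
  · filter_upwards [ae_restrict_mem measurableSet_Ioi] with t ht
    have := abs_frul_le (A := A) ht
    rwa [← neg_mul] at this

lemma integral_frul {A : ℝ} (hA : 0 < A) : ∫ t in Ioi 0, frul A t = Real.log A := by
  have hc : Continuous fun t : ℝ => Real.exp (-t) := by fun_prop
  have hL : Tendsto (fun t : ℝ => Real.exp (-t)) (𝓝[>] 0) (𝓝 1) := by
    have := hc.tendsto 0
    simp only [neg_zero, Real.exp_zero] at this
    exact this.mono_left nhdsWithin_le_nhds
  have := Frullani.integral_Ioi_eq (f := fun t : ℝ => Real.exp (-t))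
    (hc.locallyIntegrable.locallyIntegrableOn _) one_pos hA hL
    Real.tendsto_exp_neg_atTop_nhds_zero (integrableOn_frul hA)
  simpa [frul] using this

/-- The integrand has a constant sign. Absolute convergence of the logarithmic energy is therefore
exactly what Fubini's theorem needs for Frullani's representation. -/
lemma integral_abs_frul {A : ℝ} (hA : 0 < A) : ∫ t in Ioi 0, |frul A t| = |Real.log A| := by
  rcases le_total 1 A with h | h
  · rw [abs_of_nonneg (Real.log_nonneg h), ← integral_frul hA]
    apply setIntegral_congr_fun measurableSet_Ioi
    intro t ht
    refine abs_of_nonneg (mul_nonneg (inv_nonneg.2 (le_of_lt ht)) (sub_nonneg.2 ?_))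
    have ht : 0 < t := ht
    exact Real.exp_le_exp.2 (by nlinarith)
  · rw [abs_of_nonpos (Real.log_nonpos hA.le h), ← integral_frul hA, ← integral_neg]
    apply setIntegral_congr_fun measurableSet_Ioi
    intro t ht
    have ht : 0 < t := ht
    refine abs_of_nonpos (mul_nonpos_of_nonneg_of_nonpos (inv_nonneg.2 ht.le) (sub_nonpos.2 ?_))
    exact Real.exp_le_exp.2 (by nlinarith)

/-- The Gaussian kernel is positive definite. -/
lemma integral_gauss_nonneg {μ : Measure ℝ} [SFinite μ] {ψ : ℝ → ℝ} (hψ : Integrable ψ μ)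
    {t : ℝ} (ht : 0 < t) :
    0 ≤ ∫ p : ℝ × ℝ, Real.exp (-(t * (p.1 ^ 2 - p.2 ^ 2) ^ 2)) * (ψ p.1 * ψ p.2) ∂(μ.prod μ) := by
  have hψψ : Integrable (fun p : ℝ × ℝ => ψ p.1 * ψ p.2) (μ.prod μ) := hψ.mul_prod hψ
  -- A Gaussian is a convolution of two Gaussians: completing the square in y recovers
  -- exp(−t(p₁²−p₂²)²) up to a positive constant. Integrating over p first gives a square for each
  -- y.
  set F : ℝ × ℝ → ℝ → ℝ := fun p y =>
    (Real.exp (-(2 * t) * (p.1 ^ 2 - y) ^ 2) * ψ p.1) *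
      (Real.exp (-(2 * t) * (p.2 ^ 2 - y) ^ 2) * ψ p.2) with hF
  have hF' : ∀ p y, F p y = Real.exp (-(4 * t) * (y - (p.1 ^ 2 + p.2 ^ 2) / 2) ^ 2) *
      (Real.exp (-(t * (p.1 ^ 2 - p.2 ^ 2) ^ 2)) * (ψ p.1 * ψ p.2)) := by
    intro p y
    have e : Real.exp (-(2 * t) * (p.1 ^ 2 - y) ^ 2) * Real.exp (-(2 * t) * (p.2 ^ 2 - y) ^ 2) =
        Real.exp (-(4 * t) * (y - (p.1 ^ 2 + p.2 ^ 2) / 2) ^ 2) *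
          Real.exp (-(t * (p.1 ^ 2 - p.2 ^ 2) ^ 2)) := by
      rw [← Real.exp_add, ← Real.exp_add]; congr 1; ring
    simp only [hF]
    rw [← mul_assoc (Real.exp _) (Real.exp _), ← e]; ring
  have hg : ∀ m : ℝ, ∫ y : ℝ, Real.exp (-(4 * t) * (y - m) ^ 2) = √(Real.pi / (4 * t)) := by
    intro m
    rw [integral_sub_right_eq_self (fun y : ℝ => Real.exp (-(4 * t) * y ^ 2)) m]
    exact integral_gaussian _
  have hgi : ∀ m : ℝ, Integrable fun y : ℝ => Real.exp (-(4 * t) * (y - m) ^ 2) := fun m =>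
    (integrable_exp_neg_mul_sq (b := 4 * t) (by positivity)).comp_sub_right m
  have hin : ∀ p : ℝ × ℝ, ∫ y, F p y = √(Real.pi / (4 * t)) *
      (Real.exp (-(t * (p.1 ^ 2 - p.2 ^ 2) ^ 2)) * (ψ p.1 * ψ p.2)) := by
    intro p
    simp_rw [hF']
    rw [integral_mul_const, hg]
  have hFm : AEStronglyMeasurable (Function.uncurry F) ((μ.prod μ).prod volume) := by
    have h1 : AEStronglyMeasurable (fun q : (ℝ × ℝ) × ℝ => ψ q.1.1 * ψ q.1.2)
        ((μ.prod μ).prod volume) := hψψ.1.comp_fst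
    have h2 : AEStronglyMeasurable (fun q : (ℝ × ℝ) × ℝ =>
        Real.exp (-(2 * t) * (q.1.1 ^ 2 - q.2) ^ 2) * Real.exp (-(2 * t) * (q.1.2 ^ 2 - q.2) ^ 2))
        ((μ.prod μ).prod volume) := Measurable.aestronglyMeasurable (by fun_prop)
    refine (h2.mul h1).congr (Eventually.of_forall fun q => ?_)
    simp only [hF, Function.uncurry, Pi.mul_apply]
    ring
  have hFi : Integrable (Function.uncurry F) ((μ.prod μ).prod volume) := by
    rw [integrable_prod_iff hFm]
    constructor
    · refine Eventually.of_forall fun p => ?_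
      simp only [Function.uncurry, hF']
      exact (hgi _).mul_const _
    · have : (fun p : ℝ × ℝ => ∫ y, ‖Function.uncurry F (p, y)‖) = fun p =>
          √(Real.pi / (4 * t)) * (Real.exp (-(t * (p.1 ^ 2 - p.2 ^ 2) ^ 2)) *
            ‖ψ p.1 * ψ p.2‖) := by
        funext p
        simp only [Function.uncurry, hF', norm_mul, Real.norm_of_nonneg (Real.exp_pos _).le]
        rw [integral_mul_const, hg]
      rw [this]
      apply Integrable.const_mul
      refine hψψ.norm.mono ?_ (Eventually.of_forall fun p => ?_)
      · exact (Measurable.aestronglyMeasurable (by fun_prop)).mul hψψ.1.norm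
      · rw [norm_mul, Real.norm_of_nonneg (Real.exp_pos _).le]
        refine mul_le_of_le_one_left (norm_nonneg _) (Real.exp_le_one_iff.2 ?_)
        have : 0 ≤ t * (p.1 ^ 2 - p.2 ^ 2) ^ 2 := by positivity
        linarith
  have hswap := integral_integral_swap hFi
  have hpos : 0 ≤ ∫ y, ∫ p, F p y ∂(μ.prod μ) := by
    apply integral_nonneg
    intro y
    simp only [hF]
    have := integral_prod_mul (μ := μ) (ν := μ)
      (fun x => Real.exp (-(2 * t) * (x ^ 2 - y) ^ 2) * ψ x)
      (fun x => Real.exp (-(2 * t) * (x ^ 2 - y) ^ 2) * ψ x)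
    simp only [Pi.zero_apply]
    rw [this]
    exact mul_self_nonneg _
  rw [← hswap] at hpos
  simp_rw [hin] at hpos
  rw [integral_const_mul] at hpos
  exact nonneg_of_mul_nonneg_right hpos (Real.sqrt_pos.2 (by have := Real.pi_pos; positivity))

/-- The logarithmic energy of a neutral charge is nonnegative. -/
theorem integral_lk_nonpos {μ : Measure ℝ} [SFinite μ] {ψ : ℝ → ℝ} (hψ : Integrable ψ μ)
    (h0 : ∫ x, ψ x ∂μ = 0) (hd : ∀ᵐ p ∂μ.prod μ, p.1 ^ 2 ≠ p.2 ^ 2)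
    (hi : Integrable (fun p : ℝ × ℝ => lk p.1 p.2 * (ψ p.1 * ψ p.2)) (μ.prod μ)) :
    ∫ p : ℝ × ℝ, lk p.1 p.2 * (ψ p.1 * ψ p.2) ∂(μ.prod μ) ≤ 0 := by
  have hψψ : Integrable (fun p : ℝ × ℝ => ψ p.1 * ψ p.2) (μ.prod μ) := hψ.mul_prod hψ
  -- With A = (p₁²−p₂²)² the exponent is a Gaussian in the squares of the variables, and ln A is
  -- twice the kernel.
  set F : ℝ × ℝ → ℝ → ℝ := fun p t => frul ((p.1 ^ 2 - p.2 ^ 2) ^ 2) t * (ψ p.1 * ψ p.2) with hF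
  have hu : ∀ p : ℝ × ℝ, p.1 ^ 2 ≠ p.2 ^ 2 → 0 < (p.1 ^ 2 - p.2 ^ 2) ^ 2 := fun p hp => by
    have := sub_ne_zero.2 hp; positivity
  have hlog : ∀ p : ℝ × ℝ, Real.log ((p.1 ^ 2 - p.2 ^ 2) ^ 2) = 2 * lk p.1 p.2 := fun p => by
    unfold lk; rw [Real.log_pow, Real.log_abs]; norm_num
  have hFm : AEStronglyMeasurable (Function.uncurry F)
      ((μ.prod μ).prod (volume.restrict (Ioi 0))) := by
    have h1 : AEStronglyMeasurable (fun q : (ℝ × ℝ) × ℝ => ψ q.1.1 * ψ q.1.2)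
        ((μ.prod μ).prod (volume.restrict (Ioi 0))) := hψψ.1.comp_fst
    have h2 : AEStronglyMeasurable (fun q : (ℝ × ℝ) × ℝ =>
        frul ((q.1.1 ^ 2 - q.1.2 ^ 2) ^ 2) q.2) ((μ.prod μ).prod (volume.restrict (Ioi 0))) := by
      apply Measurable.aestronglyMeasurable
      unfold frul; fun_prop
    exact h2.mul h1
  have hFi : Integrable (Function.uncurry F) ((μ.prod μ).prod (volume.restrict (Ioi 0))) := by
    rw [integrable_prod_iff hFm]
    constructor
    · filter_upwards [hd] with p hp
      simp only [Function.uncurry, hF]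
      exact (integrableOn_frul (hu p hp)).mul_const _
    · refine (hi.norm.const_mul 2).congr ?_
      filter_upwards [hd] with p hp
      simp only [Function.uncurry, hF, norm_mul, Real.norm_eq_abs]
      rw [integral_mul_const, integral_abs_frul (hu p hp), hlog, abs_mul]
      norm_num
      ring
  have hswap := integral_integral_swap hFi
  have e1 : ∫ p, (∫ t in Ioi 0, F p t) ∂(μ.prod μ) =
      2 * ∫ p : ℝ × ℝ, lk p.1 p.2 * (ψ p.1 * ψ p.2) ∂(μ.prod μ) := by
    rw [← integral_const_mul]
    apply integral_congr_ae
    filter_upwards [hd] with p hp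
    simp only [hF]
    rw [integral_mul_const, integral_frul (hu p hp), hlog, mul_assoc]
  -- For fixed t the term e^{−t} is paired with (∫ψ)² = 0. What remains is minus a Gaussian energy.
  have hneg : ∫ t in Ioi 0, ∫ p, F p t ∂(μ.prod μ) ≤ 0 := by
    apply setIntegral_nonpos measurableSet_Ioi
    intro t ht
    have ht : 0 < t := ht
    have hexp : Integrable (fun p : ℝ × ℝ =>
        Real.exp (-(t * (p.1 ^ 2 - p.2 ^ 2) ^ 2)) * (ψ p.1 * ψ p.2)) (μ.prod μ) := by
      refine hψψ.mono ?_ (Eventually.of_forall fun p => ?_)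
      · exact (Measurable.aestronglyMeasurable (by fun_prop)).mul hψψ.1
      · rw [norm_mul, Real.norm_of_nonneg (Real.exp_pos _).le]
        refine mul_le_of_le_one_left (norm_nonneg _) (Real.exp_le_one_iff.2 ?_)
        have : 0 ≤ t * (p.1 ^ 2 - p.2 ^ 2) ^ 2 := by positivity
        linarith
    have e2 : ∀ p, F p t = (t⁻¹ * Real.exp (-t)) * (ψ p.1 * ψ p.2) -
        t⁻¹ * (Real.exp (-(t * (p.1 ^ 2 - p.2 ^ 2) ^ 2)) * (ψ p.1 * ψ p.2)) := by
      intro p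
      simp only [hF, frul, one_mul]
      rw [mul_comm _ t]
      ring
    simp_rw [e2]
    rw [integral_sub (hψψ.const_mul _) (hexp.const_mul _), integral_const_mul, integral_const_mul,
      integral_prod_mul, h0]
    have := integral_gauss_nonneg hψ ht
    have : 0 ≤ t⁻¹ * ∫ p : ℝ × ℝ, Real.exp (-(t * (p.1 ^ 2 - p.2 ^ 2) ^ 2)) * (ψ p.1 * ψ p.2)
      ∂(μ.prod μ) := by positivity
    linarith
  rw [← hswap, e1] at hneg
  linarith

lemma ae_prod_sq_ne {ν : Measure ℝ} [SFinite ν] (hν : ν ≪ leb) :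
    ∀ᵐ p ∂ν.prod ν, p.1 ^ 2 ≠ p.2 ^ 2 := by
  rw [Measure.ae_prod_iff_ae_ae]
  · filter_upwards [hν.ae_le ae_leb_pos] with x hx
    filter_upwards [hν.ae_le ae_leb_pos, hν.ae_le (ae_leb_ne x)] with z hz hxz
    intro h
    exact hxz (by nlinarith [sq_eq_sq₀ hx.le hz.le |>.1 h])
  · exact (measurableSet_eq_fun (by fun_prop) (by fun_prop)).compl

/-! ### The potential as an operator on `L²(ν)` -/

namespace Adm

variable {ν : Measure ℝ} {w : ℝ → ℝ}

lemma one (hA : Adm ν w) : Adm ν (fun _ => 1) := by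
  refine ⟨measurable_const, fun _ => le_rfl, hA.ac, ?_⟩
  obtain ⟨K, hK⟩ := hA.dom
  refine ⟨K, fun F hF => le_trans (lintegral_mono fun z => ?_) (hK F hF)⟩
  gcongr
  exact hA.one_le z

lemma potl_add {E : Type*} [NormedAddCommGroup E] [NormedSpace ℝ E] (hA : Adm ν w) {h h' : ℝ → E}
    (hh : MemLp (fun z => (w z)⁻¹ • h z) 2 ν) (hh' : MemLp (fun z => (w z)⁻¹ • h' z) 2 ν)
    {x : ℝ} (hx : x ≠ 0) : potl ν (fun z => h z + h' z) x = potl ν h x + potl ν h' x := by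
  have e := integral_add (hA.integrable_lk hh hx) (hA.integrable_lk hh' hx)
  refine Eq.trans ?_ e
  exact integral_congr_ae (Eventually.of_forall fun z => smul_add _ _ _)

lemma potl_sub {E : Type*} [NormedAddCommGroup E] [NormedSpace ℝ E] (hA : Adm ν w) {h h' : ℝ → E}
    (hh : MemLp (fun z => (w z)⁻¹ • h z) 2 ν) (hh' : MemLp (fun z => (w z)⁻¹ • h' z) 2 ν)
    {x : ℝ} (hx : x ≠ 0) : potl ν (fun z => h z - h' z) x = potl ν h x - potl ν h' x := by
  have e := integral_sub (hA.integrable_lk hh hx) (hA.integrable_lk hh' hx)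
  refine Eq.trans ?_ e
  exact integral_congr_ae (Eventually.of_forall fun z => smul_sub _ _ _)

end Adm

lemma potl_const_mul {𝕜 : Type*} [RCLike 𝕜] (ν : Measure ℝ) (c : 𝕜) (h : ℝ → 𝕜) (x : ℝ) :
    potl ν (fun z => c * h z) x = c * potl ν h x := by
  unfold potl
  simp_rw [← mul_smul_comm]
  exact integral_const_mul _ _

lemma weight_cancel {E : Type*} [NormedAddCommGroup E] [NormedSpace ℝ E] {ν : Measure ℝ}
    {w : ℝ → ℝ} (hA : Adm ν w) {g : ℝ → E} (hg : MemLp g 2 ν) :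
    MemLp (fun z => (w z)⁻¹ • (w z • g z)) 2 ν := by
  refine (memLp_congr_ae (Eventually.of_forall fun z => ?_)).1 hg
  rw [smul_smul, inv_mul_cancel₀ (hA.pos z).ne', one_smul]

/-- The operator `g ↦ ∫ ln |x² - z²| w(z) g(z) dν(z)` on `L²(ν)`. -/
def opW {ν : Measure ℝ} {w : ℝ → ℝ} (hA : Adm ν w) (𝕜 : Type*) [RCLike 𝕜] :
    Lp 𝕜 2 ν →L[𝕜] Lp 𝕜 2 ν :=
  LinearMap.mkContinuous
    { toFun := fun g => ((hA.exists_memLp_potl (E := 𝕜)).choose_spec _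
        (weight_cancel hA (Lp.memLp g))).1.toLp _
      map_add' := fun g g' => by
        rw [← MemLp.toLp_add]
        apply MemLp.toLp_congr
        filter_upwards [hA.ae_pos] with x hx
        have e : potl ν (fun z => w z • (g + g' : Lp 𝕜 2 ν) z) =
            potl ν (fun z => w z • g z + w z • g' z) := by
          apply Adm.potl_congr
          filter_upwards [Lp.coeFn_add g g'] with z hz
          rw [hz, Pi.add_apply, smul_add]
        rw [e, hA.potl_add (weight_cancel hA (Lp.memLp g)) (weight_cancel hA (Lp.memLp g')) hx.ne']
        rfl
      map_smul' := fun c g => by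
        rw [← MemLp.toLp_const_smul]
        apply MemLp.toLp_congr
        refine Eventually.of_forall fun x => ?_
        have e : potl ν (fun z => w z • (c • g : Lp 𝕜 2 ν) z) =
            potl ν (fun z => c * (w z • g z)) := by
          apply Adm.potl_congr
          filter_upwards [Lp.coeFn_smul c g] with z hz
          rw [hz, Pi.smul_apply, smul_eq_mul, mul_smul_comm]
        rw [e, potl_const_mul]
        rfl }
    (hA.exists_memLp_potl (E := 𝕜)).choose (fun g => by
      have h := ((hA.exists_memLp_potl (E := 𝕜)).choose_spec _
        (weight_cancel hA (Lp.memLp g))).2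
      simp only [LinearMap.coe_mk, AddHom.coe_mk]
      rw [Lp.norm_toLp]
      refine (ENNReal.toReal_mono ?_ h).trans ?_
      · exact ENNReal.mul_ne_top ENNReal.coe_ne_top (weight_cancel hA (Lp.memLp g)).2.ne
      · rw [ENNReal.toReal_mul, Lp.norm_def, ENNReal.coe_toReal]
        apply le_of_eq
        congr 2
        apply eLpNorm_congr_ae
        refine Eventually.of_forall fun z => ?_
        simp only
        rw [smul_smul, inv_mul_cancel₀ (hA.pos z).ne', one_smul])

lemma opW_coe {ν : Measure ℝ} {w : ℝ → ℝ} (hA : Adm ν w) {𝕜 : Type*} [RCLike 𝕜] (g : Lp 𝕜 2 ν) :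
    opW hA 𝕜 g =ᵐ[ν] potl ν (fun z => w z • g z) :=
  MemLp.coeFn_toLp ((hA.exists_memLp_potl (E := 𝕜)).choose_spec _
    (weight_cancel hA (Lp.memLp g))).1

/-- The operator `g ↦ ∫ ln |x² - z²| g(z) dν(z)` on `L²(ν)`. -/
def opT {ν : Measure ℝ} {w : ℝ → ℝ} (hA : Adm ν w) (𝕜 : Type*) [RCLike 𝕜] :
    Lp 𝕜 2 ν →L[𝕜] Lp 𝕜 2 ν := opW hA.one 𝕜

lemma opT_coe {ν : Measure ℝ} {w : ℝ → ℝ} (hA : Adm ν w) {𝕜 : Type*} [RCLike 𝕜] (g : Lp 𝕜 2 ν) :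
    opT hA 𝕜 g =ᵐ[ν] potl ν g := by
  refine (opW_coe hA.one g).trans (Eventually.of_forall fun x => ?_)
  simp only [one_smul]

namespace Adm

variable {ν : Measure ℝ} {w : ℝ → ℝ} {𝕜 : Type*} [RCLike 𝕜]

lemma integrable_energy (hA : Adm ν w) {f g : ℝ → 𝕜} (hf : MemLp f 2 ν) (hg : MemLp g 2 ν) :
    Integrable (fun p : ℝ × ℝ => lk p.1 p.2 • (f p.1 * g p.2)) (ν.prod ν) := by
  have := hA.isFiniteMeasure
  have hm : AEStronglyMeasurable (fun p : ℝ × ℝ => lk p.1 p.2 • (f p.1 * g p.2)) (ν.prod ν) :=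
    measurable_lk.aestronglyMeasurable.smul (hf.1.comp_fst.mul hg.1.comp_snd)
  refine ⟨hm, ?_⟩
  rw [hasFiniteIntegral_iff_enorm, lintegral_prod _ hm.enorm]
  obtain ⟨C, hC⟩ := hA.one.exists_schur
  obtain ⟨G, hGm, hGe⟩ : AEMeasurable (fun z => ‖g z‖ₑ) ν := hg.1.enorm
  have e : ∀ x, ∫⁻ z, ‖lk x z • (f x * g z)‖ₑ ∂ν =
      ‖f x‖ₑ * ∫⁻ z, ENNReal.ofReal (1 * |lk x z|) * G z ∂ν := by
    intro x
    rw [← lintegral_const_mul' _ _ (by simp)]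
    apply lintegral_congr_ae
    filter_upwards [hGe] with z hz
    rw [enorm_smul, enorm_mul, hz, one_mul, Real.enorm_eq_ofReal_abs]
    ring
  simp_rw [e]
  have hL2 : ∀ {u : ℝ → 𝕜}, MemLp u 2 ν → ∫⁻ x, ‖u x‖ₑ ^ 2 ∂ν < ∞ := fun hu => by
    have := (eLpNorm_lt_top_iff_lintegral_rpow_enorm_lt_top (by norm_num) (by norm_num)).1 hu.2
    simpa using this
  have h1 : ∫⁻ z, G z ^ 2 ∂ν = ∫⁻ z, ‖g z‖ₑ ^ 2 ∂ν := by
    apply lintegral_congr_ae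
    filter_upwards [hGe] with z hz
    rw [hz]
  have hmeas : Measurable fun x => ∫⁻ z, ENNReal.ofReal (1 * |lk x z|) * G z ∂ν := by
    apply Measurable.lintegral_prod_right
      (f := fun x z => ENNReal.ofReal (1 * |lk x z|) * G z)
    exact ((measurable_lk.abs.const_mul 1).ennreal_ofReal).mul (hGm.comp measurable_snd)
  have h2 := lintegral_mul_sq_le (μ := ν) hf.1.enorm hmeas.aemeasurable
  have h3 : (∫⁻ x, ‖f x‖ₑ * ∫⁻ z, ENNReal.ofReal (1 * |lk x z|) * G z ∂ν ∂ν) ^ 2 < ∞ := by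
    refine h2.trans_lt (ENNReal.mul_lt_top (hL2 hf) ?_)
    refine (hC G hGm).trans_lt (ENNReal.mul_lt_top ENNReal.coe_lt_top ?_)
    rw [h1]
    exact hL2 hg
  by_contra hcon
  rw [not_lt, top_le_iff] at hcon
  rw [hcon] at h3
  simp at h3

lemma integral_mul_potl (hA : Adm ν w) {f g : ℝ → 𝕜} (hf : MemLp f 2 ν) (hg : MemLp g 2 ν) :
    ∫ x, f x * potl ν g x ∂ν = ∫ p : ℝ × ℝ, lk p.1 p.2 • (f p.1 * g p.2) ∂(ν.prod ν) := by
  have := hA.isFiniteMeasure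
  rw [integral_prod _ (hA.integrable_energy hf hg)]
  congr 1
  funext x
  unfold potl
  rw [← integral_const_mul]
  simp_rw [mul_smul_comm]

/-- Symmetry of the potential. -/
lemma integral_mul_potl_comm (hA : Adm ν w) {f g : ℝ → 𝕜} (hf : MemLp f 2 ν)
    (hg : MemLp g 2 ν) : ∫ x, f x * potl ν g x ∂ν = ∫ x, potl ν f x * g x ∂ν := by
  have := hA.isFiniteMeasure
  rw [hA.integral_mul_potl hf hg]
  simp_rw [fun x => mul_comm (potl ν f x) (g x)]
  rw [hA.integral_mul_potl hg hf, ← integral_prod_swap]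
  congr 1
  funext p
  simp only [Prod.fst_swap, Prod.snd_swap]
  rw [lk_comm, mul_comm]

lemma integrable_mul_potl (hA : Adm ν w) {f g : ℝ → 𝕜} (hf : MemLp f 2 ν) (hg : MemLp g 2 ν) :
    Integrable (fun x => f x * potl ν g x) ν := by
  obtain ⟨C, hC⟩ := hA.exists_memLp_potl (E := 𝕜)
  exact hf.integrable_mul (hC g (hA.weighted_memLp hg)).1

lemma integral_mul_potl_nonpos (hA : Adm ν w) {y : ℝ → ℝ} (hy : MemLp y 2 ν)
    (h0 : ∫ x, y x ∂ν = 0) : ∫ x, y x * potl ν y x ∂ν ≤ 0 := by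
  have := hA.isFiniteMeasure
  rw [hA.integral_mul_potl hy hy]
  exact integral_lk_nonpos (hy.integrable (by norm_num)) h0 (ae_prod_sq_ne hA.ac)
    (hA.integrable_energy hy hy)

end Adm

/-! ### Strongly monotone equations -/

/-- The map x ↦ x − τ A x contracts by √(1 − 2τα + τ²L²). The choice τ = α/L² is optimal and gives
√(1 − α²/L²). -/
theorem exists_zero_of_strongly_monotone {E : Type*} [NormedAddCommGroup E]
    [InnerProductSpace ℝ E] [CompleteSpace E] {A : E → E} {α L : ℝ} (hα : 0 < α) (hαL : α ≤ L)
    (hL : ∀ x y, ‖A x - A y‖ ≤ L * ‖x - y‖)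
    (hm : ∀ x y, α * ‖x - y‖ ^ 2 ≤ ⟪A x - A y, x - y⟫_ℝ) : ∃ x, A x = 0 := by
  have hL0 : 0 < L := hα.trans_le hαL
  set τ := α / L ^ 2 with hτ
  have hτ0 : 0 < τ := by positivity
  set K := √(1 - α ^ 2 / L ^ 2) with hK
  have hq : 0 ≤ 1 - α ^ 2 / L ^ 2 := by
    rw [sub_nonneg, div_le_one (by positivity)]; gcongr
  have hK1 : K < 1 := by
    rw [hK, Real.sqrt_lt' one_pos]
    have : 0 < α ^ 2 / L ^ 2 := by positivity
    linarith
  have hc : ContractingWith (Real.toNNReal K) (fun x => x - τ • A x) := by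
    refine ⟨by rw [← NNReal.coe_lt_coe, Real.coe_toNNReal _ (Real.sqrt_nonneg _)]; exact hK1, ?_⟩
    apply LipschitzWith.of_dist_le_mul
    intro x y
    rw [Real.coe_toNNReal _ (Real.sqrt_nonneg _), dist_eq_norm, dist_eq_norm]
    have e : x - τ • A x - (y - τ • A y) = (x - y) - τ • (A x - A y) := by
      rw [smul_sub]; abel
    rw [e]
    apply le_of_sq_le_sq _ (by positivity)
    rw [mul_pow, Real.sq_sqrt hq, norm_sub_sq_real, inner_smul_right, norm_smul,
      Real.norm_of_nonneg hτ0.le, real_inner_comm]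
    have h1 := hm x y
    have h2 : ‖A x - A y‖ ^ 2 ≤ L ^ 2 * ‖x - y‖ ^ 2 := by
      rw [← mul_pow]; gcongr; exact hL x y
    have h3 : τ * (α * ‖x - y‖ ^ 2) ≤ τ * ⟪A x - A y, x - y⟫_ℝ := by gcongr
    have h4 : τ ^ 2 * ‖A x - A y‖ ^ 2 ≤ τ ^ 2 * (L ^ 2 * ‖x - y‖ ^ 2) := by gcongr
    have h5 : τ ^ 2 * (L ^ 2 * ‖x - y‖ ^ 2) = α ^ 2 / L ^ 2 * ‖x - y‖ ^ 2 := by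
      rw [hτ]; field_simp
    have h6 : τ * (α * ‖x - y‖ ^ 2) = α ^ 2 / L ^ 2 * ‖x - y‖ ^ 2 := by
      rw [hτ]; field_simp
    rw [mul_pow]
    linarith
  refine ⟨hc.fixedPoint _, ?_⟩
  have := hc.fixedPoint_isFixedPt
  unfold Function.IsFixedPt at this
  have h7 : τ • A (hc.fixedPoint _) = 0 := by
    rwa [sub_eq_self] at this
  exact (smul_eq_zero.1 h7).resolve_left hτ0.ne'

namespace Adm

variable {ν : Measure ℝ} {w : ℝ → ℝ}

/-- Neutral solutions of `ψ(y) = f + ∫ ln |x² - z²| y(z) dν(z) + m` for bi-Lipschitz increasing `ψ`. -/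
theorem exists_neutral_solution (hA : Adm ν w) {ψ : ℝ → ℝ} {L : ℝ≥0} {α : ℝ} (hα : 0 < α)
    (hL : LipschitzWith L ψ) (h0 : ψ 0 = 0)
    (hm : ∀ s t, α * (s - t) ^ 2 ≤ (ψ s - ψ t) * (s - t)) {f : ℝ → ℝ} (hf : MemLp f 2 ν) :
    ∃ (y : ℝ → ℝ) (m : ℝ), MemLp y 2 ν ∧ ∫ x, y x ∂ν = 0 ∧
      ∀ᵐ x ∂ν, ψ (y x) = f x + potl ν y x + m := by
  have := hA.isFiniteMeasure
  set one : Lp ℝ 2 ν := (memLp_const (1 : ℝ)).toLp _ with hone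
  have hone' : (one : ℝ → ℝ) =ᵐ[ν] fun _ => 1 := MemLp.coeFn_toLp _
  have hinner1 : ∀ y : Lp ℝ 2 ν, ⟪one, y⟫_ℝ = ∫ x, y x ∂ν := by
    intro y
    rw [L2.inner_def]
    apply integral_congr_ae
    filter_upwards [hone'] with x hx
    rw [hx]; simp
  -- On the orthogonal complement of the constants the operator −T is nonnegative, so ψ − T inherits
  -- the monotonicity constant of ψ.
  set H := (ℝ ∙ one)ᗮ with hH
  have hH0 : ∀ y : H, ∫ x, (y : Lp ℝ 2 ν) x ∂ν = 0 := by
    intro y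
    rw [← hinner1]
    exact Submodule.mem_orthogonal_singleton_iff_inner_right.1 y.2
  set N : Lp ℝ 2 ν → Lp ℝ 2 ν := fun y => hL.compLp h0 y - opT hA ℝ y - hf.toLp f with hN
  have hTneg : ∀ y : Lp ℝ 2 ν, ∫ x, y x ∂ν = 0 → ⟪opT hA ℝ y, y⟫_ℝ ≤ 0 := by
    intro y hy
    refine le_trans (le_of_eq ?_) (hA.integral_mul_potl_nonpos (Lp.memLp y) hy)
    rw [L2.inner_def]
    apply integral_congr_ae
    filter_upwards [opT_coe hA y] with x hx
    rw [hx]; simp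
  have hψ : ∀ y y' : Lp ℝ 2 ν,
      α * ‖y - y'‖ ^ 2 ≤ ⟪hL.compLp h0 y - hL.compLp h0 y', y - y'⟫_ℝ := by
    intro y y'
    rw [← real_inner_self_eq_norm_sq, L2.inner_def, L2.inner_def, ← integral_const_mul]
    apply integral_mono_ae
    · exact (L2.integrable_inner (𝕜 := ℝ) _ _).const_mul _
    · exact L2.integrable_inner (𝕜 := ℝ) _ _
    · filter_upwards [Lp.coeFn_sub y y', Lp.coeFn_sub (hL.compLp h0 y) (hL.compLp h0 y'),
        hL.coeFn_compLp h0 y, hL.coeFn_compLp h0 y'] with x h1 h2 h3 h4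
      rw [h1, h2, Pi.sub_apply, Pi.sub_apply, h3, h4]
      simp only [Function.comp_apply, RCLike.inner_apply, conj_trivial]
      have := hm (y x) (y' x)
      nlinarith
  set P := H.orthogonalProjectionOnto with hP
  set A : H → H := fun y => P (N y) with hAdef
  obtain ⟨y, hy⟩ := exists_zero_of_strongly_monotone (A := A) (α := α)
    (L := α + (L + ‖opT hA ℝ‖)) hα (le_add_of_nonneg_right (add_nonneg L.2 (norm_nonneg _)))
    (by
      intro y y'
      have e : A y - A y' = P (N y - N y') := (map_sub P _ _).symm
      rw [e]
      refine (Submodule.norm_orthogonalProjectionOnto_apply_le H _).trans ?_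
      have e2 : N y - N y' = (hL.compLp h0 (y : Lp ℝ 2 ν) - hL.compLp h0 (y' : Lp ℝ 2 ν)) -
          opT hA ℝ ((y : Lp ℝ 2 ν) - y') := by
        rw [map_sub]; simp only [hN]; abel
      rw [e2]
      refine (norm_sub_le _ _).trans ?_
      have h1 := hL.norm_compLp_sub_le h0 (y : Lp ℝ 2 ν) (y' : Lp ℝ 2 ν)
      have h2 := (opT hA ℝ).le_opNorm ((y : Lp ℝ 2 ν) - y')
      have h3 : ‖(y : Lp ℝ 2 ν) - y'‖ = ‖y - y'‖ := rfl
      rw [h3] at h1 h2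
      have h4 := norm_nonneg (y - y')
      nlinarith) (by
      intro y y'
      have e : A y - A y' = P (N y - N y') := (map_sub P _ _).symm
      rw [e, Submodule.inner_orthogonalProjectionOnto_eq_of_mem_right]
      have e2 : N y - N y' = (hL.compLp h0 (y : Lp ℝ 2 ν) - hL.compLp h0 (y' : Lp ℝ 2 ν)) -
          opT hA ℝ ((y : Lp ℝ 2 ν) - y') := by
        rw [map_sub]; simp only [hN]; abel
      rw [e2, inner_sub_left]
      have h1 := hψ y y'
      have h2 := hTneg ((y : Lp ℝ 2 ν) - y') (hH0 (y - y'))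
      have h3 : ‖(y : Lp ℝ 2 ν) - y'‖ = ‖y - y'‖ := rfl
      rw [h3] at h1
      simp only [Submodule.coe_sub]
      linarith)
  -- A vanishing projection only says that N y is constant; this constant is the multiplier m.
  have hy' : N y ∈ Hᗮ := (Submodule.orthogonalProjectionOnto_eq_zero_iff).1 hy
  have hHH : Hᗮ = ℝ ∙ one := Submodule.orthogonal_orthogonal _
  rw [hHH, Submodule.mem_span_singleton] at hy'
  obtain ⟨m, hm'⟩ := hy'
  refine ⟨y, m, Lp.memLp _, hH0 y, ?_⟩
  have h2 : (m • one : Lp ℝ 2 ν) =ᵐ[ν] N y := by rw [hm']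
  filter_upwards [h2, Lp.coeFn_smul m one, hone', opT_coe hA (y : Lp ℝ 2 ν), hf.coeFn_toLp,
    hL.coeFn_compLp h0 (y : Lp ℝ 2 ν),
    Lp.coeFn_sub (hL.compLp h0 (y : Lp ℝ 2 ν) - opT hA ℝ y) (hf.toLp f),
    Lp.coeFn_sub (hL.compLp h0 (y : Lp ℝ 2 ν)) (opT hA ℝ y)] with x a1 a2 a3 a4 a5 a6 a7 a8
  simp only [hN] at a1
  rw [a2, a7, Pi.sub_apply, a8, Pi.sub_apply, Pi.smul_apply, a3, a4, a5, a6] at a1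
  simp only [Function.comp_apply, smul_eq_mul, mul_one] at a1
  linarith

/-- Solvability of the bordered linear problem. -/
theorem exists_bordered_real (hA : Adm ν w) (hν : ν ≠ 0) {f : ℝ → ℝ} (hf : MemLp f 2 ν) (b : ℝ) :
    ∃ (h : ℝ → ℝ) (m : ℝ), MemLp h 2 ν ∧ ∫ x, h x ∂ν = b ∧
      ∀ᵐ x ∂ν, h x = f x + potl ν h x + m := by
  have := hA.isFiniteMeasure
  set β := ν.real univ with hβ
  have hβ0 : β ≠ 0 := by rw [hβ, Measure.real, ENNReal.toReal_ne_zero]; simp [hν]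
  obtain ⟨C, hC⟩ := hA.exists_memLp_potl (E := ℝ)
  have hc : MemLp (fun _ : ℝ => b / β) 2 ν := memLp_const _
  have hTc := (hC _ (hA.weighted_memLp hc)).1
  -- The constant b/β carries the whole charge b; its contribution is moved into the source, leaving
  -- a neutral unknown.
  obtain ⟨y, m, hy, hy0, hym⟩ := hA.exists_neutral_solution (ψ := id) (L := 1) one_pos
    LipschitzWith.id rfl (fun s t => by simp only [id]; nlinarith)
    ((hf.add hTc).sub hc)
  refine ⟨fun x => y x + b / β, m, hy.add hc, ?_, ?_⟩
  · rw [integral_add (hy.integrable (by norm_num)) (hc.integrable (by norm_num)), hy0,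
      integral_const, ← hβ, smul_eq_mul]
    field_simp
    ring
  · filter_upwards [hym, hA.ae_pos] with x hx hx0
    rw [hA.potl_add (hA.weighted_memLp hy) (hA.weighted_memLp hc) hx0.ne']
    simp only [id, Pi.sub_apply, Pi.add_apply] at hx
    linarith

end Adm

/-! ### A maximum principle for the long-range part of the potential -/

/-- The long-range part of the potential. -/
def pmax (ν : Measure ℝ) (y : ℝ → ℝ) (x : ℝ) : ℝ :=
  2 * ∫ z, max (Real.log x) (Real.log z) * y z ∂ν

lemma pmax_neg (ν : Measure ℝ) (y : ℝ → ℝ) (x : ℝ) : pmax ν (fun z => -y z) x = -pmax ν y x := by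
  unfold pmax
  simp_rw [mul_neg]
  rw [integral_neg, mul_neg]

namespace Adm

variable {ν : Measure ℝ} {w : ℝ → ℝ} {y : ℝ → ℝ}

lemma continuousOn_pmax (hA : Adm ν w) (hy : MemLp (fun z => (w z)⁻¹ • y z) 2 ν) :
    ContinuousOn (pmax ν y) (Ioi 0) :=
  (hA.continuousOn_max hy).const_smul (2 : ℝ)

/-- The derivative of the long-range potential with respect to ln x is twice the charge to the left
of x. If the charge between the two points is nonnegative, the charge up to the right endpoint is
the largest slope. -/
lemma pmax_sub_le (hA : Adm ν w) (hy : MemLp (fun z => (w z)⁻¹ • y z) 2 ν) {x x₁ : ℝ}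
    (hx : 0 < x) (hxx : x ≤ x₁) (hpos : ∀ᵐ z ∂ν, x < z → z ≤ x₁ → 0 ≤ y z) :
    pmax ν y x₁ - pmax ν y x ≤ 2 * (Real.log x₁ - Real.log x) * ∫ z in Iic x₁, y z ∂ν := by
  have h1 : Integrable (fun z => max (Real.log x₁) (Real.log z) * y z) ν := hA.integrable_max hy x₁
  have h2 : Integrable (fun z => max (Real.log x) (Real.log z) * y z) ν := hA.integrable_max hy x
  have hyi : Integrable y ν := hA.integrable_weighted hy
  have hl := Real.log_le_log hx hxx
  unfold pmax
  rw [← mul_sub, ← integral_sub h1 h2, mul_assoc, ← integral_indicator measurableSet_Iic,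
    ← integral_const_mul (Real.log x₁ - Real.log x)]
  gcongr 2 * ?_
  apply integral_mono_ae (h1.sub h2) ((hyi.indicator measurableSet_Iic).const_mul _)
  filter_upwards [hpos, hA.ae_pos] with z hz hz0
  simp only [Pi.sub_apply, indicator, mem_Iic]
  rw [← sub_mul]
  rcases le_or_gt z x with hzx | hzx
  · have := Real.log_le_log hz0 hzx
    rw [if_pos (hzx.trans hxx), max_eq_left this, max_eq_left (this.trans hl)]
  · have h3 := Real.log_le_log hx hzx.le
    rcases le_or_gt z x₁ with hz1 | hz1
    · have h4 := Real.log_le_log hz0 hz1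
      rw [if_pos hz1, max_eq_right h3, max_eq_left h4]
      have := hz hzx hz1
      gcongr
    · have h4 := Real.log_le_log (hx.trans_le hxx) hz1.le
      rw [if_neg (not_le.2 hz1), max_eq_right h3, max_eq_right h4]
      simp

/-- The counterpart to the right of x₁: a nonnegative charge in between only increases the slope, so
the slope at the left endpoint is a lower bound. -/
lemma le_pmax_sub (hA : Adm ν w) (hy : MemLp (fun z => (w z)⁻¹ • y z) 2 ν) {x x₁ : ℝ}
    (hx : 0 < x₁) (hxx : x₁ ≤ x) (hpos : ∀ᵐ z ∂ν, x₁ < z → z < x → 0 ≤ y z) :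
    2 * (Real.log x - Real.log x₁) * ∫ z in Iic x₁, y z ∂ν ≤ pmax ν y x - pmax ν y x₁ := by
  have h1 : Integrable (fun z => max (Real.log x₁) (Real.log z) * y z) ν := hA.integrable_max hy x₁
  have h2 : Integrable (fun z => max (Real.log x) (Real.log z) * y z) ν := hA.integrable_max hy x
  have hyi : Integrable y ν := hA.integrable_weighted hy
  have hl := Real.log_le_log hx hxx
  unfold pmax
  rw [← mul_sub, ← integral_sub h2 h1, mul_assoc, ← integral_indicator measurableSet_Iic,
    ← integral_const_mul]
  gcongr 2 * ?_
  apply integral_mono_ae ((hyi.indicator measurableSet_Iic).const_mul _) (h2.sub h1)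
  filter_upwards [hpos, hA.ae_pos] with z hz hz0
  simp only [Pi.sub_apply, indicator, mem_Iic]
  rw [← sub_mul]
  rcases le_or_gt z x₁ with hzx | hzx
  · have := Real.log_le_log hz0 hzx
    rw [if_pos hzx, max_eq_left this, max_eq_left (this.trans hl)]
  · have h3 := Real.log_le_log hx hzx.le
    rw [if_neg (not_le.2 hzx), mul_zero, max_eq_right h3]
    rcases lt_or_ge z x with hz1 | hz1
    · have h4 := Real.log_le_log hz0 hz1.le
      rw [max_eq_left h4]
      exact mul_nonneg (by linarith) (hz hzx hz1)
    · have h4 := Real.log_le_log (hx.trans_le hxx) hz1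
      rw [max_eq_right h4]
      simp

/-- While the potential exceeds M the charge density is nonnegative. Starting from a nonpositive
accumulated charge, the potential therefore cannot drop on the way to the left, so it never comes
down to M. -/
lemma pmax_left (hA : Adm ν w) (hy : MemLp (fun z => (w z)⁻¹ • y z) 2 ν) {M x₁ : ℝ}
    (hM : ∀ᵐ z ∂ν, z ≤ x₁ → M < pmax ν y z → 0 ≤ y z)
    (h1 : M < pmax ν y x₁) (hQ : ∫ z in Iic x₁, y z ∂ν ≤ 0) :
    ∀ x, 0 < x → x ≤ x₁ → pmax ν y x₁ ≤ pmax ν y x := by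
  have step : ∀ x, 0 < x → x ≤ x₁ → (∀ z, x < z → z ≤ x₁ → M < pmax ν y z) →
      pmax ν y x₁ ≤ pmax ν y x := by
    intro x hx hxx hall
    have := hA.pmax_sub_le hy hx hxx (by
      filter_upwards [hM] with z hz h2 h3 using hz h3 (hall z h2 h3))
    have hl := Real.log_le_log hx hxx
    nlinarith
  intro x hx hxx
  apply step x hx hxx
  by_contra hcon
  push Not at hcon
  obtain ⟨z, hxz, hzx, hz⟩ := hcon
  have hz0 := hx.trans hxz
  -- Continuation argument: at the last point u where the potential is at most M, the preceding step
  -- still applies and forces it to be at least its value at x₁, which exceeds M.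
  have hcont : ContinuousOn (pmax ν y) (Icc z x₁) :=
    (hA.continuousOn_pmax hy).mono fun u hu => hz0.trans_le hu.1
  have hK : IsCompact (Icc z x₁ ∩ pmax ν y ⁻¹' Iic M) :=
    isCompact_Icc.of_isClosed_subset (hcont.preimage_isClosed_of_isClosed isClosed_Icc isClosed_Iic)
      inter_subset_left
  obtain ⟨u, ⟨hu, huM⟩, hmax⟩ := hK.exists_isGreatest ⟨z, ⟨le_rfl, hzx⟩, hz⟩
  have := step u (hz0.trans_le hu.1) hu.2 (fun v hv hv1 => by
    by_contra hcon
    exact absurd (hmax ⟨⟨hu.1.trans hv.le, hv1⟩, not_lt.1 hcon⟩) (not_le.2 hv))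
  have huM : pmax ν y u ≤ M := huM
  linarith

/-- Mirror image of `pmax_left`: a nonnegative accumulated charge makes the potential nondecreasing
to the right, and staying above M keeps it so. -/
lemma pmax_right (hA : Adm ν w) (hy : MemLp (fun z => (w z)⁻¹ • y z) 2 ν) {M x₁ r : ℝ}
    (hx₁ : 0 < x₁) (hM : ∀ᵐ z ∂ν, z ≤ r → M < pmax ν y z → 0 ≤ y z)
    (h1 : M < pmax ν y x₁) (hQ : 0 ≤ ∫ z in Iic x₁, y z ∂ν) :
    ∀ x, x₁ ≤ x → x ≤ r → pmax ν y x₁ ≤ pmax ν y x := by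
  have step : ∀ x, x₁ ≤ x → x ≤ r → (∀ z, x₁ < z → z < x → M < pmax ν y z) →
      pmax ν y x₁ ≤ pmax ν y x := by
    intro x hxx hxr hall
    have := hA.le_pmax_sub hy hx₁ hxx (by
      filter_upwards [hM] with z hz h2 h3 using hz (h3.le.trans hxr) (hall z h2 h3))
    have hl := Real.log_le_log hx₁ hxx
    nlinarith
  intro x hxx hxr
  apply step x hxx hxr
  by_contra hcon
  push Not at hcon
  obtain ⟨z, hxz, hzx, hz⟩ := hcon
  have hcont : ContinuousOn (pmax ν y) (Icc x₁ z) :=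
    (hA.continuousOn_pmax hy).mono fun u hu => hx₁.trans_le hu.1
  have hK : IsCompact (Icc x₁ z ∩ pmax ν y ⁻¹' Iic M) :=
    isCompact_Icc.of_isClosed_subset (hcont.preimage_isClosed_of_isClosed isClosed_Icc isClosed_Iic)
      inter_subset_left
  obtain ⟨u, ⟨hu, huM⟩, hmin⟩ := hK.exists_isLeast ⟨z, ⟨hxz.le, le_rfl⟩, hz⟩
  have := step u hu.1 (hu.2.trans (hzx.le.trans hxr)) (fun v hv hv1 => by
    by_contra hcon
    exact absurd (hmin ⟨⟨hv.le, hv1.le.trans hu.2⟩, not_lt.1 hcon⟩) (not_le.2 hv1))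
  have huM : pmax ν y u ≤ M := huM
  linarith

/-- A negative accumulated charge would keep the potential above M all the way to the origin. The
density would then be nonnegative there, so its integral could not be negative. -/
lemma charge_nonneg (hA : Adm ν w) (hy : MemLp (fun z => (w z)⁻¹ • y z) 2 ν) {M x₁ : ℝ}
    (hM : ∀ᵐ z ∂ν, z ≤ x₁ → M < pmax ν y z → 0 ≤ y z)
    (h1 : M < pmax ν y x₁) : 0 ≤ ∫ z in Iic x₁, y z ∂ν := by
  by_contra hQ
  push Not at hQ
  have h2 := hA.pmax_left hy hM h1 hQ.le
  refine absurd hQ (not_lt.2 (setIntegral_nonneg_of_ae_restrict ?_))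
  rw [EventuallyLE, ae_restrict_iff' measurableSet_Iic]
  filter_upwards [hM, hA.ae_pos] with z hz hz0 hzx
  exact hz hzx (h1.trans_le (h2 z hz0 hzx))

/-- Maximum principle near the origin. -/
lemma pmax_le_of_local (hA : Adm ν w) (hy : MemLp (fun z => (w z)⁻¹ • y z) 2 ν) {M r : ℝ}
    (hM : ∀ᵐ z ∂ν, z ≤ r → M < pmax ν y z → 0 ≤ y z) {x : ℝ} (hx : 0 < x)
    (hxr : x ≤ r) : pmax ν y x ≤ max M (pmax ν y r) := by
  by_contra hcon
  push Not at hcon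
  have h1 : M < pmax ν y x := (le_max_left _ _).trans_lt hcon
  have hQ := hA.charge_nonneg hy (by
    filter_upwards [hM] with z hz h2 using hz (h2.trans hxr)) h1
  have := hA.pmax_right hy hx hM h1 hQ r hxr le_rfl
  exact absurd ((le_max_right _ _).trans_lt hcon) (not_lt.2 this)

/-- Global maximum principle for neutral charges. -/
lemma pmax_le_of_neutral (hA : Adm ν w) (hν : ν ≠ 0)
    (hy : MemLp (fun z => (w z)⁻¹ • y z) 2 ν) (h0 : ∫ z, y z ∂ν = 0) {M : ℝ}
    (hM : ∀ᵐ z ∂ν, M < pmax ν y z → 0 < y z) {x : ℝ} (hx : 0 < x) : pmax ν y x ≤ M := by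
  by_contra hcon
  push Not at hcon
  have hyi : Integrable y ν := hA.integrable_weighted hy
  have hM' : ∀ r : ℝ, ∀ᵐ z ∂ν, z ≤ r → M < pmax ν y z → 0 ≤ y z := fun r => by
    filter_upwards [hM] with z hz _ h2 using (hz h2).le
  have hQ := hA.charge_nonneg hy (hM' x) hcon
  have hright : ∀ z, x ≤ z → M < pmax ν y z := fun z hz =>
    hcon.trans_le (hA.pmax_right hy hx (hM' z) hcon hQ z hz le_rfl)
  have htail : 0 ≤ ∫ z in Ioi x, y z ∂ν := by
    apply setIntegral_nonneg_of_ae_restrict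
    rw [EventuallyLE, ae_restrict_iff' measurableSet_Ioi]
    filter_upwards [hM] with z hz hzx
    exact (hz (hright z (le_of_lt hzx))).le
  have hsum : (∫ z in Iic x, y z ∂ν) + ∫ z in Ioi x, y z ∂ν = 0 := by
    rw [← h0, ← compl_Iic, integral_add_compl measurableSet_Iic hyi]
  have hleft := hA.pmax_left hy (hM' x) hcon (by linarith)
  -- The potential now exceeds M on the whole half line. Only here is the strict sign in `hM`
  -- needed: a positive density on a nonzero measure cannot be neutral.
  have hpos : ∀ᵐ z ∂ν, 0 < y z := by
    filter_upwards [hM, hA.ae_pos] with z hz hz0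
    apply hz
    rcases le_total z x with h | h
    · exact hcon.trans_le (hleft z hz0 h)
    · exact hright z h
  have h3 : 0 < ∫ z, y z ∂ν := by
    rw [integral_pos_iff_support_of_nonneg_ae (hpos.mono fun z hz => hz.le) hyi]
    have : Function.support y =ᵐ[ν] univ := by
      rw [eventuallyEq_univ]
      exact hpos.mono fun z hz => hz.ne'
    rw [measure_congr this]
    simpa using hν
  exact h3.ne' h0

end Adm

/-! ### A truncated logarithm -/

/-- The values of `1 + y` clamped to `[e⁻ᴺ, eᴺ]`. -/
def clamp (N y : ℝ) : ℝ := max (Real.exp (-N)) (min (1 + y) (Real.exp N))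

/-- `ln (1 + y)` for `e⁻ᴺ ≤ 1 + y ≤ eᴺ`, continued with slope one. -/
def tlog (N y : ℝ) : ℝ := Real.log (clamp N y) + (1 + y - clamp N y)

section tlog

variable {N : ℝ}

lemma exp_neg_le_exp (hN : 0 ≤ N) : Real.exp (-N) ≤ Real.exp N :=
  Real.exp_le_exp.2 (by linarith)

lemma clamp_ge (y : ℝ) : Real.exp (-N) ≤ clamp N y := le_max_left _ _

lemma clamp_le (hN : 0 ≤ N) (y : ℝ) : clamp N y ≤ Real.exp N :=
  max_le (exp_neg_le_exp hN) (min_le_right _ _)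

lemma clamp_pos (y : ℝ) : 0 < clamp N y := (Real.exp_pos _).trans_le (clamp_ge y)

lemma clamp_sub {s t : ℝ} (h : t ≤ s) : 0 ≤ clamp N s - clamp N t ∧
    clamp N s - clamp N t ≤ s - t := by
  unfold clamp
  constructor
  · rw [sub_nonneg]; gcongr
  · rcases le_total (1 + s) (Real.exp N) with h1 | h1 <;>
      rcases le_total (1 + t) (Real.exp N) with h2 | h2 <;>
      simp only [h1, h2, min_eq_left, min_eq_right] <;>
      rcases le_total (Real.exp (-N)) (1 + s) with h3 | h3 <;>
      rcases le_total (Real.exp (-N)) (1 + t) with h4 | h4 <;>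
      rcases le_total (Real.exp (-N)) (Real.exp N) with h5 | h5 <;>
      simp only [h3, h4, h5, max_eq_left, max_eq_right] <;> linarith

/-- On the clamped range the slope of the logarithm lies between e⁻ᴺ and eᴺ; outside it is one,
which lies in the same interval. -/
lemma tlog_sub (hN : 0 ≤ N) {s t : ℝ} (h : t ≤ s) :
    Real.exp (-N) * (s - t) ≤ tlog N s - tlog N t ∧
    tlog N s - tlog N t ≤ Real.exp N * (s - t) := by
  obtain ⟨h1, h2⟩ := clamp_sub (N := N) h
  have hs := clamp_pos (N := N) s
  have ht := clamp_pos (N := N) t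
  set u := clamp N s
  set v := clamp N t
  have e1 : (u - v) * Real.exp (-N) ≤ Real.log u - Real.log v := by
    have := Real.log_le_sub_one_of_pos (div_pos ht hs)
    rw [Real.log_div ht.ne' hs.ne'] at this
    have h3 : Real.exp (-N) ≤ 1 / u := by
      rw [Real.exp_neg, ← one_div]
      exact one_div_le_one_div_of_le hs (clamp_le hN s)
    have h4 : (u - v) * Real.exp (-N) ≤ (u - v) * (1 / u) := by gcongr
    have h5 : (u - v) * (1 / u) = 1 - v / u := by field_simp
    linarith
  have e2 : Real.log u - Real.log v ≤ (u - v) * Real.exp N := by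
    have := Real.log_le_sub_one_of_pos (div_pos hs ht)
    rw [Real.log_div hs.ne' ht.ne'] at this
    have h3 : 1 / v ≤ Real.exp N := by
      rw [one_div, inv_le_comm₀ ht (Real.exp_pos _), ← Real.exp_neg]
      exact clamp_ge t
    have h4 : (u - v) * (1 / v) ≤ (u - v) * Real.exp N := by gcongr
    have h5 : (u - v) * (1 / v) = u / v - 1 := by field_simp
    linarith
  have e3 : Real.exp (-N) ≤ 1 := Real.exp_le_one_iff.2 (by linarith)
  have e4 : 1 ≤ Real.exp N := Real.one_le_exp hN
  have e5 : tlog N s - tlog N t = (Real.log u - Real.log v) + ((s - t) - (u - v)) := by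
    unfold tlog; ring
  rw [e5]
  constructor <;> nlinarith

lemma tlog_zero (hN : 0 ≤ N) : tlog N 0 = 0 := by
  have : clamp N 0 = 1 := by
    unfold clamp
    rw [add_zero, min_eq_left (Real.one_le_exp hN), max_eq_right]
    exact Real.exp_le_one_iff.2 (by linarith)
  unfold tlog; rw [this]; simp

lemma tlog_strictMono (hN : 0 ≤ N) : StrictMono (tlog N) := by
  intro t s h
  have := (tlog_sub hN h.le).1
  have : 0 < Real.exp (-N) * (s - t) := mul_pos (Real.exp_pos _) (by linarith)
  linarith

lemma tlog_lipschitz (hN : 0 ≤ N) : LipschitzWith (Real.toNNReal (Real.exp N)) (tlog N) := by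
  apply LipschitzWith.of_dist_le_mul
  intro s t
  rw [Real.coe_toNNReal _ (Real.exp_pos _).le, Real.dist_eq, Real.dist_eq]
  rcases le_total t s with h | h
  · have := tlog_sub hN h
    rw [abs_of_nonneg (sub_nonneg.2 h), abs_of_nonneg]
    · exact this.2
    · exact sub_nonneg.2 ((tlog_strictMono hN).monotone h)
  · have := tlog_sub hN h
    rw [abs_sub_comm, abs_sub_comm s, abs_of_nonneg (sub_nonneg.2 h), abs_of_nonneg]
    · exact this.2
    · exact sub_nonneg.2 ((tlog_strictMono hN).monotone h)

lemma tlog_mono (hN : 0 ≤ N) (s t : ℝ) :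
    Real.exp (-N) * (s - t) ^ 2 ≤ (tlog N s - tlog N t) * (s - t) := by
  rcases le_total t s with h | h
  · have := (tlog_sub hN h).1
    nlinarith
  · have := (tlog_sub hN h).1
    nlinarith

lemma tlog_exp {v : ℝ} (hv : |v| ≤ N) : tlog N (Real.exp v - 1) = v := by
  obtain ⟨h1, h2⟩ := abs_le.1 hv
  have : clamp N (Real.exp v - 1) = Real.exp v := by
    unfold clamp
    rw [add_sub_cancel, min_eq_left (Real.exp_le_exp.2 h2), max_eq_right (Real.exp_le_exp.2 h1)]
  unfold tlog
  rw [this, Real.log_exp]; ring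

/-- The coercivity that survives the truncation, since N does not appear on the left. For y ≥ 0,
continuing with slope one stays above the logarithm; for y ≤ 0 one has `tlog N y` ≤ y, so the
product is at least y². -/
lemma mul_tlog_ge (hN : 0 ≤ N) (y : ℝ) : |y| * Real.log (1 + |y|) ≤ y * tlog N y := by
  have hc := clamp_pos (N := N) y
  rcases le_total 0 y with h | h
  · rw [abs_of_nonneg h]
    gcongr
    have hu1 : 1 ≤ clamp N y :=
      le_max_of_le_right (le_min (by linarith) (Real.one_le_exp hN))
    have hu2 : clamp N y ≤ 1 + y :=
      max_le ((Real.exp_le_one_iff.2 (by linarith)).trans (by linarith)) (min_le_left _ _)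
    have := Real.log_le_sub_one_of_pos (div_pos (by linarith : 0 < 1 + y) hc)
    rw [Real.log_div (by linarith) hc.ne'] at this
    have h3 : (1 + y) / clamp N y - 1 ≤ 1 + y - clamp N y := by
      rw [div_sub_one hc.ne', div_le_iff₀ hc]
      nlinarith
    unfold tlog
    linarith
  · have h1 : tlog N y ≤ y := by
      unfold tlog
      linarith [Real.log_le_sub_one_of_pos hc]
    have h2 := Real.log_le_sub_one_of_pos (show 0 < 1 + |y| by positivity)
    have h3 : |y| = -y := abs_of_nonpos h
    have h4 : |y| * Real.log (1 + |y|) ≤ |y| * |y| := by gcongr; linarith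
    rw [h3] at h4 ⊢
    nlinarith

end tlog

/-- Superlinearity of the entropy: s is absorbed once ln(1+s) ≥ B + 1, and the remaining range of s
is bounded. -/
lemma mul_log_sub_ge {s B : ℝ} (hs : 0 ≤ s) (hB : 0 ≤ B) :
    s - Real.exp (B + 1) * (B + 1) ≤ s * (Real.log (1 + s) - B) := by
  have hE := Real.exp_pos (B + 1)
  rcases le_total (B + 1) (Real.log (1 + s)) with h | h
  · nlinarith
  · have h1 : 1 + s ≤ Real.exp (B + 1) := by
      rwa [← Real.log_le_iff_le_exp (by linarith)]
    have h2 : 0 ≤ Real.log (1 + s) := Real.log_nonneg (by linarith)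
    nlinarith

/-- Young's inequality for the conjugate pair exp and s ln s. The factor 1/2 in the exponent is the
one for which exp(sk/2) is integrable. -/
lemma young_exp_log {k s : ℝ} (hs : 0 ≤ s) :
    k * s ≤ 2 * (s * Real.log (1 + s)) + 2 * Real.exp (k / 2) := by
  rcases hs.eq_or_lt with rfl | hs
  · have := Real.exp_pos (k / 2); simp [this.le]
  · have h1 := Real.add_one_le_exp (k / 2 - Real.log s)
    have h2 : Real.exp (k / 2 - Real.log s) * s = Real.exp (k / 2) := by
      rw [Real.exp_sub, Real.exp_log hs]; field_simp
    have h3 : Real.log s ≤ Real.log (1 + s) := Real.log_le_log hs (by linarith)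
    nlinarith

/-! ### The a priori bound and the nonlinear equation. -/

namespace Adm

variable {ν : Measure ℝ} {w : ℝ → ℝ}

/-- 1 + `kap` majorizes exp(sk/2), so this bounds the exponential moment of the short-range kernel
uniformly in x. -/
lemma exists_exp_sk_bound (hA : Adm ν w) : ∃ C : ℝ, ∀ x, 0 < x →
    Integrable (fun z => 1 + kap x z) ν ∧ ∫ z, (1 + kap x z) ∂ν ≤ C := by
  have := hA.isFiniteMeasure
  obtain ⟨K, hK⟩ := hA.exists_bound
  refine ⟨ν.real univ + K * 2, fun x hx => ?_⟩
  have h1 : ∫⁻ z, ENNReal.ofReal (kap x z) ∂ν ≤ K * 2 := by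
    refine le_trans (lintegral_mono_ae ?_) (hK (kap x) (measurable_kap_right x) 2 ?_)
    · filter_upwards [hA.ae_pos] with z hz
      apply ENNReal.ofReal_le_ofReal
      exact le_mul_of_one_le_left (kap_nonneg hx hz) (one_le_pow₀ (hA.one_le z))
    · refine le_trans (lintegral_mono_ae ?_) (lintegral_kap_le hx)
      filter_upwards [ae_leb_pos] with z hz
      rw [← ENNReal.ofReal_mul (env_pos hz).le]
      apply ENNReal.ofReal_le_ofReal
      rw [div_eq_mul_one_div, mul_comm]
      exact mul_le_mul_of_nonneg_left (env_le hz) (kap_nonneg hx hz)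
  have h0 : 0 ≤ᵐ[ν] fun z => kap x z := by
    filter_upwards [hA.ae_pos] with z hz using kap_nonneg hx hz
  have hi : Integrable (fun z => kap x z) ν := by
    refine ⟨(measurable_kap_right x).aestronglyMeasurable, ?_⟩
    rw [hasFiniteIntegral_iff_ofReal h0]
    exact h1.trans_lt (ENNReal.mul_lt_top ENNReal.coe_lt_top (by norm_num))
  refine ⟨(integrable_const 1).add hi, ?_⟩
  rw [integral_add (integrable_const 1) hi, integral_const, smul_eq_mul, mul_one]
  gcongr
  rw [integral_eq_lintegral_of_nonneg_ae h0 hi.1]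
  apply ENNReal.toReal_le_of_le_ofReal (by positivity)
  rw [ENNReal.ofReal_mul (by positivity)]
  simpa using h1

/-- A bound for neutral solutions which does not depend on the truncation. -/
lemma exists_apriori_bound (hA : Adm ν w) (hν : ν ≠ 0) {f : ℝ → ℝ} (hf : Measurable f) {B : ℝ}
    (hB : 0 ≤ B) (hfB : ∀ x, 0 < x → |f x| ≤ B) :
    ∃ C : ℝ, 0 ≤ C ∧ ∀ (N : ℝ) (y : ℝ → ℝ) (m : ℝ), 0 ≤ N → MemLp y 2 ν → ∫ x, y x ∂ν = 0 →
      (∀ᵐ x ∂ν, tlog N (y x) = f x + potl ν y x + m) →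
      ∀ x, 0 < x → |f x + potl ν y x + m| ≤ C := by
  have := hA.isFiniteMeasure
  obtain ⟨K, hK⟩ := hA.exists_exp_sk_bound
  set V := ν.real univ with hV
  set D := Real.exp (B + 1) * (B + 1) with hD
  set C₂ := |2 * (B * (V * D)) + 2 * K| with hC₂
  refine ⟨2 * (B + C₂), by positivity, fun N y m hN hy h0 hsol => ?_⟩
  have hyw := hA.weighted_memLp hy
  have hyi : Integrable y ν := hy.integrable (by norm_num)
  have hf2 : Integrable (fun x => f x * y x) ν := by
    refine (hyi.norm.const_mul B).mono' (hf.aestronglyMeasurable.mul hyi.1) ?_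
    filter_upwards [hA.ae_pos] with x hx
    rw [norm_mul]
    gcongr
    exact hfB x hx
  have hlogi : Integrable (fun x => |y x| * Real.log (1 + |y x|)) ν := by
    refine hy.integrable_sq.mono' ?_ (Eventually.of_forall fun x => ?_)
    · have h1 : AEMeasurable y ν := hyi.aemeasurable
      exact AEMeasurable.aestronglyMeasurable (by fun_prop)
    · have h2 := Real.log_le_sub_one_of_pos (show 0 < 1 + |y x| by positivity)
      have h3 : 0 ≤ Real.log (1 + |y x|) := Real.log_nonneg (by linarith [abs_nonneg (y x)])
      rw [Real.norm_of_nonneg (by positivity), ← sq_abs, sq]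
      gcongr
      linarith
  -- The equation is tested with y: neutrality removes m, and the interaction term has the good
  -- sign.
  have hent : ∫ x, |y x| * Real.log (1 + |y x|) ∂ν ≤ B * ∫ x, |y x| ∂ν := by
    calc ∫ x, |y x| * Real.log (1 + |y x|) ∂ν
        ≤ ∫ x, (f x * y x + y x * potl ν y x + m * y x) ∂ν := by
          apply integral_mono_ae hlogi ((hf2.add (hA.integrable_mul_potl hy hy)).add
            (hyi.const_mul m))
          filter_upwards [hsol] with x hx
          have := mul_tlog_ge hN (y x)
          rw [hx] at this
          simp only [Pi.add_apply]
          nlinarith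
      _ = (∫ x, f x * y x ∂ν) + (∫ x, y x * potl ν y x ∂ν) + m * ∫ x, y x ∂ν := by
          rw [integral_add (f := fun x => f x * y x + y x * potl ν y x)
              (hf2.add (hA.integrable_mul_potl hy hy)) (hyi.const_mul m),
            integral_add hf2 (hA.integrable_mul_potl hy hy), integral_const_mul]
      _ ≤ ∫ x, f x * y x ∂ν := by
          rw [h0, mul_zero, add_zero]
          linarith [hA.integral_mul_potl_nonpos hy h0]
      _ ≤ ∫ x, B * |y x| ∂ν := by
          apply integral_mono_ae hf2 (hyi.abs.const_mul B)
          filter_upwards [hA.ae_pos] with x hx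
          refine (le_abs_self _).trans ?_
          rw [abs_mul]
          gcongr
          exact hfB x hx
      _ = _ := integral_const_mul _ _
  -- The entropy is at most B times the mass and is superlinear in it, so the mass is bounded, and
  -- with it the entropy.
  have hmass : ∫ x, |y x| ∂ν ≤ V * D := by
    have h1 : ∫ x, (|y x| - D) ∂ν ≤ ∫ x, (|y x| * Real.log (1 + |y x|) - B * |y x|) ∂ν := by
      apply integral_mono (hyi.abs.sub (integrable_const _)) (hlogi.sub (hyi.abs.const_mul B))
      intro x
      have := mul_log_sub_ge (abs_nonneg (y x)) hB
      simp only [Pi.sub_apply]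
      linarith
    rw [integral_sub hyi.abs (integrable_const _), integral_sub hlogi (hyi.abs.const_mul B),
      integral_const, integral_const_mul, smul_eq_mul] at h1
    linarith
  -- Entropy against exponential moment: an L² bound on y, which would depend on N, is not used.
  have hsk : ∀ x, 0 < x → |∫ z, sk x z * y z ∂ν| ≤ C₂ := by
    intro x hx
    obtain ⟨hKi, hKx⟩ := hK x hx
    refine le_trans ?_ (le_abs_self _)
    calc |∫ z, sk x z * y z ∂ν| ≤ ∫ z, (2 * (|y z| * Real.log (1 + |y z|)) + 2 * (1 + kap x z)) ∂ν := by
          rw [← Real.norm_eq_abs]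
          apply norm_integral_le_of_norm_le ((hlogi.const_mul 2).add (hKi.const_mul 2))
          filter_upwards [hA.ae_pos] with z hz
          rw [norm_mul, Real.norm_of_nonneg (sk_nonneg hx hz), Real.norm_eq_abs]
          have := young_exp_log (k := sk x z) (abs_nonneg (y z))
          have := exp_sk_le hx hz
          simp only [Pi.add_apply]
          linarith
      _ = 2 * (∫ z, |y z| * Real.log (1 + |y z|) ∂ν) + 2 * ∫ z, (1 + kap x z) ∂ν := by
          rw [integral_add (hlogi.const_mul 2) (hKi.const_mul 2), integral_const_mul,
            integral_const_mul]
      _ ≤ 2 * (B * (V * D)) + 2 * K := by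
          have : B * ∫ x, |y x| ∂ν ≤ B * (V * D) := by gcongr
          linarith
  have hdec : ∀ x, 0 < x → potl ν y x = pmax ν y x - ∫ z, sk x z * y z ∂ν := fun x hx =>
    hA.potl_eq hyw hx
  have hsolp : ∀ᵐ z ∂ν, |pmax ν y z + m - tlog N (y z)| ≤ B + C₂ := by
    filter_upwards [hsol, hA.ae_pos] with z hz hz0
    rw [hz, hdec z hz0]
    have h1 := abs_le.1 (hsk z hz0)
    have h2 := abs_le.1 (hfB z hz0)
    rw [abs_le]
    constructor <;> linarith
  -- Where the long-range potential exceeds this value, the equation gives `tlog N (y z)` > 0, hence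
  -- y > 0, and the maximum principle applies. The multiplier m is not bounded by itself; only the
  -- sum of m and the potential is.
  have hup : ∀ x, 0 < x → pmax ν y x ≤ B + C₂ - m := fun x hx => by
    apply hA.pmax_le_of_neutral hν hyw h0 _ hx
    filter_upwards [hsolp] with z hz hM
    have := abs_le.1 hz
    rw [← (tlog_strictMono hN).lt_iff_lt, tlog_zero hN]
    linarith
  have hlow : ∀ x, 0 < x → -(pmax ν y x) ≤ B + C₂ + m := fun x hx => by
    rw [← pmax_neg]
    apply hA.pmax_le_of_neutral hν
      (by convert hyw.neg using 2; simp) (by rw [integral_neg, h0, neg_zero]) _ hx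
    filter_upwards [hsolp] with z hz hM
    have := abs_le.1 hz
    rw [pmax_neg] at hM
    rw [Left.neg_pos_iff, ← (tlog_strictMono hN).lt_iff_lt, tlog_zero hN]
    linarith
  intro x hx
  rw [hdec x hx]
  have h1 := abs_le.1 (hsk x hx)
  have h2 := abs_le.1 (hfB x hx)
  have h3 := hup x hx
  have h4 := hlow x hx
  rw [abs_le]
  constructor <;> linarith

/-- Solvability of `ln (1 + y) = f + ∫ ln |x² - z²| y(z) dν(z) + m` with a neutral `y`. -/
theorem exists_exp_solution (hA : Adm ν w) (hν : ν ≠ 0) {f : ℝ → ℝ} (hf : Measurable f) {B : ℝ}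
    (hfB : ∀ x, 0 < x → |f x| ≤ B) :
    ∃ (v : ℝ → ℝ) (m C : ℝ), Measurable v ∧ (∀ x, 0 < x → |v x| ≤ C) ∧
      ∫ x, (Real.exp (v x) - 1) ∂ν = 0 ∧
      ∀ x, 0 < x → v x = f x + potl ν (fun z => Real.exp (v z) - 1) x + m := by
  have := hA.isFiniteMeasure
  have hB : 0 ≤ B := (abs_nonneg _).trans (hfB 1 one_pos)
  obtain ⟨C, hC0, hC⟩ := hA.exists_apriori_bound hν hf hB hfB
  have hf2 : MemLp f 2 ν := MemLp.of_bound hf.aestronglyMeasurable B (by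
    filter_upwards [hA.ae_pos] with x hx using hfB x hx)
  -- The truncation level is the a priori bound C, which does not depend on the level. On the
  -- solution the truncated logarithm is then the true one.
  obtain ⟨y, m, hy, hy0, hsol⟩ := hA.exists_neutral_solution (Real.exp_pos (-C))
    (tlog_lipschitz hC0) (tlog_zero hC0) (tlog_mono hC0) hf2
  have hb := hC C y m hC0 hy hy0 hsol
  set v : ℝ → ℝ := fun x => f x + potl ν y x + m with hv
  have hye : (fun x => Real.exp (v x) - 1) =ᵐ[ν] y := by
    filter_upwards [hsol, hA.ae_pos] with x hx hx0
    apply (tlog_strictMono hC0).injective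
    rw [tlog_exp (hb x hx0), hx]
  refine ⟨v, m, C, ?_, hb, ?_, fun x _ => ?_⟩
  · exact (hf.add (hA.stronglyMeasurable_potl hy.1).measurable).add_const m
  · rw [integral_congr_ae hye, hy0]
  · rw [potl_congr hye]

end Adm

/-! ### Densities -/

/-- Measurable densities `ϱ ≥ 0` with `w² ϱ` dominated by the envelope. -/
structure Dominated (ϱ w : ℝ → ℝ) : Prop where
  measurable : Measurable ϱ
  nonneg : ∀ z, 0 < z → 0 ≤ ϱ z
  weight_meas : Measurable w
  one_le : ∀ z, 1 ≤ w z
  dom : ∃ C, ∀ z, 0 < z → w z ^ 2 * ϱ z ≤ C * env z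

section density

variable {E : Type*} [NormedAddCommGroup E] [NormedSpace ℝ E] {ϱ : ℝ → ℝ}

lemma integral_meas (hm : Measurable ϱ) (h0 : ∀ z, 0 < z → 0 ≤ ϱ z) (h : ℝ → E) :
    ∫ z, h z ∂(meas ϱ) = ∫ z, ϱ z • h z ∂leb := by
  unfold meas
  rw [integral_withDensity_eq_integral_toReal_smul (by fun_prop)
    (Eventually.of_forall fun _ => ENNReal.ofReal_lt_top)]
  apply integral_congr_ae
  filter_upwards [ae_leb_pos] with z hz
  rw [ENNReal.toReal_ofReal (h0 z hz)]

lemma integrable_meas (hm : Measurable ϱ) (h0 : ∀ z, 0 < z → 0 ≤ ϱ z) {h : ℝ → E} :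
    Integrable h (meas ϱ) ↔ Integrable (fun z => ϱ z • h z) leb := by
  unfold meas
  rw [integrable_withDensity_iff_integrable_smul' (by fun_prop)
    (Eventually.of_forall fun _ => ENNReal.ofReal_lt_top)]
  apply integrable_congr
  filter_upwards [ae_leb_pos] with z hz
  rw [ENNReal.toReal_ofReal (h0 z hz)]

lemma T_eq_potl (hm : Measurable ϱ) (h0 : ∀ z, 0 < z → 0 ≤ ϱ z) (h : ℝ → E) (x : ℝ) :
    T (fun z => ϱ z • h z) x = potl (meas ϱ) h x := by
  unfold T potl
  rw [integral_meas hm h0]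
  congr 1
  funext z
  rw [smul_comm]; rfl

lemma T_density_eq_potl (hm : Measurable ϱ) (h0 : ∀ z, 0 < z → 0 ≤ ϱ z) (x : ℝ) :
    T ϱ x = potl (meas ϱ) (fun _ => (1 : ℝ)) x := by
  rw [← T_eq_potl hm h0]
  simp

lemma ae_meas_of_pos {p : ℝ → Prop} (h : ∀ z, 0 < z → p z) : ∀ᵐ z ∂(meas ϱ), p z := by
  have : meas ϱ ≪ leb := withDensity_absolutelyContinuous _ _
  exact this.ae_le (ae_leb_pos.mono h)

end density

lemma Dominated.adm {ϱ w : ℝ → ℝ} (h : Dominated ϱ w) : Adm (meas ϱ) w := by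
  obtain ⟨C, hC⟩ := h.dom
  refine ⟨h.weight_meas, h.one_le, withDensity_absolutelyContinuous _ _, C.toNNReal,
    fun F hF => ?_⟩
  have hw := h.weight_meas
  have hm := h.measurable
  unfold meas
  rw [lintegral_withDensity_eq_lintegral_mul _ (by fun_prop) (by fun_prop),
    ← lintegral_const_mul]
  · apply lintegral_mono_ae
    filter_upwards [ae_leb_pos] with z hz
    simp only [Pi.mul_apply]
    rw [← mul_assoc, ← mul_assoc, ← ENNReal.ofReal_mul (h.nonneg z hz),
      show ((C.toNNReal : ℝ≥0∞)) = ENNReal.ofReal C from rfl, ← ENNReal.ofReal_mul' (env_pos hz).le]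
    refine mul_le_mul' (ENNReal.ofReal_le_ofReal ?_) le_rfl
    linarith [hC z hz]
  · have := measurable_env
    fun_prop

lemma measurable_of_continuousOn {ϱ : ℝ → ℝ} (hc : ContinuousOn ϱ (Ioi 0))
    (h0 : ∀ x, x ≤ 0 → ϱ x = 0) : Measurable ϱ := by
  classical
  have : ϱ = (Ioi (0 : ℝ)).piecewise ϱ 0 := by
    funext x
    by_cases hx : x ∈ Ioi (0 : ℝ)
    · rw [piecewise_eq_of_mem _ _ _ hx]
    · rw [piecewise_eq_of_notMem _ _ _ hx]
      exact h0 x (not_lt.1 hx)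
  rw [this]
  exact hc.measurable_piecewise continuousOn_const measurableSet_Ioi

/-! ### A reference density -/

/-- `1 / (x (A - ln x)²)`. -/
def rnear (A x : ℝ) : ℝ := 1 / (x * (A - Real.log x) ^ 2)

/-- `e^U x^(2β-1)`. -/
def rfar (β : ℝ) (U : ℝ → ℝ) (x : ℝ) : ℝ := Real.exp (U x + 2 * β * Real.log x) / x

/-- A density with the singularity of the minimizer at the origin and its decay at infinity. -/
def rref (A β C : ℝ) (U : ℝ → ℝ) (x : ℝ) : ℝ :=
  if x ≤ 0 then 0 else if x ≤ 1 then rnear A x else C * rfar β U x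

/-- `e^U` decays faster than any power, even when multiplied by `w²`. -/
structure Confining (U w : ℝ → ℝ) : Prop where
  cont : Continuous U
  weight_cont : Continuous w
  one_le : ∀ x, 1 ≤ w x
  decay : ∀ n : ℕ, ∃ C : ℝ, ∀ x, 1 ≤ x → w x ^ 2 * Real.exp (U x) * x ^ n ≤ C

section reference

variable {A β C : ℝ} {U w : ℝ → ℝ}

lemma sub_log_pos {x : ℝ} (h0 : 0 < x) (h1 : x ≤ 1) : A ≤ A - Real.log x := by
  linarith [Real.log_nonpos h0.le h1]

lemma rnear_pos (hA : 0 < A) {x : ℝ} (h0 : 0 < x) (h1 : x ≤ 1) : 0 < rnear A x := by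
  have := hA.trans_le (sub_log_pos h0 h1)
  unfold rnear; positivity

lemma rfar_pos {x : ℝ} (h : 0 < x) : 0 < rfar β U x := by
  unfold rfar; have := Real.exp_pos (U x + 2 * β * Real.log x); positivity

lemma measurable_rref (hU : Continuous U) : Measurable (rref A β C U) := by
  unfold rref rnear rfar
  have := hU.measurable
  refine Measurable.ite measurableSet_Iic measurable_const
    (Measurable.ite measurableSet_Iic (by fun_prop) (by fun_prop))

lemma rref_near {x : ℝ} (h0 : 0 < x) (h1 : x ≤ 1) : rref A β C U x = rnear A x := by
  unfold rref; rw [if_neg h0.not_ge, if_pos h1]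

lemma rref_far {x : ℝ} (h1 : 1 < x) : rref A β C U x = C * rfar β U x := by
  unfold rref; rw [if_neg (one_pos.trans h1).not_ge, if_neg h1.not_ge]

lemma rref_pos (hA : 0 < A) (hC : 0 < C) {x : ℝ} (h0 : 0 < x) : 0 < rref A β C U x := by
  rcases le_or_gt x 1 with h | h
  · rw [rref_near h0 h]; exact rnear_pos hA h0 h
  · rw [rref_far h]; exact mul_pos hC (rfar_pos h0)

lemma hasDerivAt_inv_sub_log (hA : 0 < A) {x : ℝ} (h0 : 0 < x) (h1 : x ≤ 1) :
    HasDerivAt (fun z => 1 / (A - Real.log z)) (rnear A x) x := by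
  have hp := hA.trans_le (sub_log_pos h0 h1)
  have h := ((Real.hasDerivAt_log h0.ne').const_sub A).inv hp.ne'
  simp_rw [one_div]
  refine h.congr_deriv ?_
  unfold rnear
  field_simp

lemma lintegral_rnear_le (hA : 0 < A) {x : ℝ} (h0 : 0 < x) (h1 : x ≤ 1) :
    ∫⁻ z in Ioc 0 x, ENNReal.ofReal (rnear A z) ≤ ENNReal.ofReal (1 / (A - Real.log x)) := by
  rw [← sub_zero (1 / (A - Real.log x))]
  refine setLIntegral_deriv_le (g := fun z => 1 / (A - Real.log z)) measurableSet_Ioc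
    (convex_Ioc _ _) (fun z hz => hasDerivAt_inv_sub_log hA hz.1 (hz.2.trans h1))
    (fun z hz => (rnear_pos hA hz.1 (hz.2.trans h1)).le) (fun z hz => ?_)
  have hp := hA.trans_le (sub_log_pos hz.1 (hz.2.trans h1))
  have hq := hA.trans_le (sub_log_pos h0 h1)
  refine ⟨by positivity, one_div_le_one_div_of_le hq ?_⟩
  linarith [Real.log_le_log hz.1 hz.2]

lemma integrableOn_rnear (hA : 0 < A) {x : ℝ} (h0 : 0 < x) (h1 : x ≤ 1) :
    IntegrableOn (rnear A) (Ioc 0 x) := by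
  have hm : Measurable (rnear A) := by unfold rnear; fun_prop
  refine ⟨hm.aestronglyMeasurable, ?_⟩
  rw [hasFiniteIntegral_iff_ofReal]
  · exact (lintegral_rnear_le hA h0 h1).trans_lt ENNReal.ofReal_lt_top
  · filter_upwards [ae_restrict_mem measurableSet_Ioc] with z hz
    exact (rnear_pos hA hz.1 (hz.2.trans h1)).le

lemma integral_rnear_le (hA : 0 < A) {x : ℝ} (h0 : 0 < x) (h1 : x ≤ 1) :
    ∫ z in Ioc 0 x, rnear A z ≤ 1 / (A - Real.log x) := by
  have hp := hA.trans_le (sub_log_pos h0 h1)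
  rw [integral_eq_lintegral_of_nonneg_ae _ (integrableOn_rnear hA h0 h1).1]
  · exact ENNReal.toReal_le_of_le_ofReal (by positivity) (lintegral_rnear_le hA h0 h1)
  · filter_upwards [ae_restrict_mem measurableSet_Ioc] with z hz
    exact (rnear_pos hA hz.1 (hz.2.trans h1)).le

/-- An exact value is needed: the divergent term −ln(A − ln x) has to cancel, with its coefficient,
the logarithm of x times the density. -/
lemma integral_log_rnear (hA : 0 < A) {x : ℝ} (h0 : 0 < x) (h1 : x ≤ 1) :
    ∫ z in Ioc x 1, Real.log z * rnear A z =
      Real.log A + 1 - (A / (A - Real.log x) + Real.log (A - Real.log x)) := by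
  rw [← intervalIntegral.integral_of_le h1, intervalIntegral.integral_eq_sub_of_hasDerivAt
    (f := fun z => A / (A - Real.log z) + Real.log (A - Real.log z))]
  · simp [hA.ne']; ring
  · intro z hz
    rw [uIcc_of_le h1] at hz
    have hz0 := h0.trans_le hz.1
    have hp := hA.trans_le (sub_log_pos hz0 hz.2)
    have h2 := (hasDerivAt_inv_sub_log hA hz0 hz.2).const_mul A
    have h3 := ((Real.hasDerivAt_log hz0.ne').const_sub A).log hp.ne'
    have h4 := h2.add h3
    refine (h4.congr_of_eventuallyEq (Eventually.of_forall fun y => ?_)).congr_deriv ?_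
    · simp [div_eq_mul_inv]
    · unfold rnear; field_simp; ring
  · apply ContinuousOn.intervalIntegrable
    rw [uIcc_of_le h1]
    intro z hz
    have hz0 := h0.trans_le hz.1
    have hp := hA.trans_le (sub_log_pos hz0 hz.2)
    have := hz0.ne'
    unfold rnear
    apply ContinuousAt.continuousWithinAt
    have h5 : z * (A - Real.log z) ^ 2 ≠ 0 := by positivity
    fun_prop (disch := assumption)

lemma rref_dom (hA : 0 < A) (hC : 0 < C) (hU : Confining U w) :
    ∃ K, ∀ z, 0 < z → w z ^ 2 * rref A β C U z ≤ K * env z := by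
  obtain ⟨n, hn⟩ := exists_nat_ge (2 * β + 2)
  obtain ⟨D, hD⟩ := hU.decay n
  obtain ⟨M, hM⟩ := (isCompact_Icc (a := (0 : ℝ)) (b := 1)).exists_bound_of_continuousOn
    hU.weight_cont.continuousOn
  refine ⟨max (M ^ 2 * (1 + 1 / A) ^ 2) (C * D), fun z hz => ?_⟩
  have he := env_pos hz
  rcases le_or_gt z 1 with h | h
  · refine le_trans ?_ (mul_le_mul_of_nonneg_right (le_max_left _ _) he.le)
    rw [rref_near hz h]
    have hp := hA.trans_le (sub_log_pos hz h)
    have htt := tt_of_le hz h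
    have htt0 := tt_nonneg z
    have h1 : rnear A z ≤ (1 + 1 / A) ^ 2 * env z := by
      unfold rnear env
      rw [max_eq_left h, htt, div_le_iff₀ (by positivity)]
      rw [htt] at htt0
      have h2 : 1 + -Real.log z ≤ (1 + 1 / A) * (A - Real.log z) := by
        have e : (1 + 1 / A) * (A - Real.log z) =
          1 + -Real.log z + (A + 1 / A * -Real.log z) := by field_simp; ring
        rw [e]
        have : 0 ≤ 1 / A * -Real.log z := by positivity
        linarith
      have h3 : (1 + -Real.log z) ^ 2 ≤ ((1 + 1 / A) * (A - Real.log z)) ^ 2 := by gcongr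
      have h4 : (1 + 1 / A) ^ 2 * (1 / (z * (1 + -Real.log z) ^ 2 * 1 ^ 2)) *
          (z * (A - Real.log z) ^ 2) =
          ((1 + 1 / A) * (A - Real.log z)) ^ 2 / (1 + -Real.log z) ^ 2 := by
        field_simp
      rw [h4, le_div_iff₀ (by positivity)]
      linarith
    have h2 : w z ^ 2 ≤ M ^ 2 := by
      have := hM z ⟨hz.le, h⟩
      have h3 := (abs_nonneg _).trans this
      rw [← sq_abs]
      gcongr
      exact this
    calc w z ^ 2 * rnear A z ≤ M ^ 2 * ((1 + 1 / A) ^ 2 * env z) := by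
          gcongr
          exact (rnear_pos hA hz h).le
      _ = _ := by ring
  · refine le_trans ?_ (mul_le_mul_of_nonneg_right (le_max_right _ _) he.le)
    rw [rref_far h]
    unfold rfar env
    rw [tt_of_ge h.le, max_eq_right h.le, Real.exp_add]
    have h1 : Real.exp (2 * β * Real.log z) * z ^ 2 ≤ z ^ n := by
      rw [mul_comm (2 * β), ← Real.rpow_def_of_pos hz, ← Real.rpow_natCast, ← Real.rpow_natCast,
        ← Real.rpow_add hz]
      exact Real.rpow_le_rpow_of_exponent_le h.le (by push_cast; linarith)
    have h2 := hD z h.le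
    have h3 : w z ^ 2 * Real.exp (U z) * (Real.exp (2 * β * Real.log z) * z ^ 2) ≤ D :=
      le_trans (by gcongr) h2
    have e1 : w z ^ 2 * (C * (Real.exp (U z) * Real.exp (2 * β * Real.log z) / z)) =
      C * (w z ^ 2 * Real.exp (U z) * (Real.exp (2 * β * Real.log z) * z ^ 2)) *
        (1 / (z * (1 + 0) ^ 2 * z ^ 2)) := by field_simp; ring
    rw [e1]
    gcongr

lemma exists_rref (hβ : 0 < β) (hU : Confining U w) :
    ∃ A C, 0 < A ∧ 0 < C ∧ ∫ z, rref A β C U z ∂leb = β := by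
  -- With A = 2/β the part on (0,1] has mass at most 1/A = β/2. A positive multiple of the outer
  -- profile can then supply the rest.
  have hA : 0 < 2 / β := by positivity
  have hdom : Dominated (rref (2 / β) β 1 U) w := ⟨measurable_rref hU.cont,
    fun z hz => (rref_pos hA one_pos hz).le, hU.weight_cont.measurable, hU.one_le,
    rref_dom hA one_pos hU⟩
  have hfin := hdom.adm.isFiniteMeasure
  have hint : Integrable (rref (2 / β) β 1 U) leb := by
    have := (integrable_meas hdom.measurable hdom.nonneg (h := fun _ => (1 : ℝ))).1 (integrable_const 1)
    simpa using this
  unfold leb at hint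
  have hf : IntegrableOn (rfar β U) (Ioi 1) := by
    refine (IntegrableOn.mono_set hint (Ioi_subset_Ioi zero_le_one)).congr_fun (fun z hz => ?_)
      measurableSet_Ioi
    rw [rref_far hz, one_mul]
  have hJ : 0 < ∫ z in Ioi 1, rfar β U z := by
    rw [setIntegral_pos_iff_support_of_nonneg_ae _ hf]
    · have : Function.support (rfar β U) ∩ Ioi 1 = Ioi 1 := by
        rw [inter_eq_right]
        intro z hz
        exact (rfar_pos (one_pos.trans hz)).ne'
      rw [this]; simp
    · filter_upwards [ae_restrict_mem measurableSet_Ioi] with z hz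
      exact (rfar_pos (one_pos.trans hz)).le
  have hn := integral_rnear_le hA one_pos le_rfl
  have hn' : ∫ z in Ioc 0 1, rnear (2 / β) z ≤ β / 2 := by
    refine hn.trans (le_of_eq ?_)
    simp
  refine ⟨2 / β, (β - ∫ z in Ioc 0 1, rnear (2 / β) z) / ∫ z in Ioi 1, rfar β U z, hA,
    div_pos (by linarith) hJ, ?_⟩
  set C := (β - ∫ z in Ioc 0 1, rnear (2 / β) z) / ∫ z in Ioi 1, rfar β U z with hC
  have e1 : EqOn (rref (2 / β) β C U) (rnear (2 / β)) (Ioc 0 1) := fun z hz => rref_near hz.1 hz.2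
  have e2 : EqOn (rref (2 / β) β C U) (fun z => C * rfar β U z) (Ioi 1) := fun z hz => rref_far hz
  unfold leb
  rw [← Ioc_union_Ioi_eq_Ioi (zero_le_one (α := ℝ)), setIntegral_union _ measurableSet_Ioi,
    setIntegral_congr_fun measurableSet_Ioc e1, setIntegral_congr_fun measurableSet_Ioi e2,
    integral_const_mul, hC, div_mul_cancel₀ _ hJ.ne']
  · ring
  · exact (integrableOn_rnear hA one_pos le_rfl).congr_fun e1.symm measurableSet_Ioc
  · exact IntegrableOn.congr_fun (hf.const_mul C) e2.symm measurableSet_Ioi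
  · rw [Set.disjoint_left]
    intro z h1 h2
    exact not_le.2 h2 h1.2

end reference

/-! ### Solutions of the Euler-Lagrange equation -/

/-- Positive solutions of the Euler-Lagrange equation for the external potential `U`, with
`w² ϱ` dominated by the envelope. -/
structure IsEquilibrium (U w : ℝ → ℝ) (ϱ : ℝ → ℝ) (m : ℝ) : Prop where
  cont : ContinuousOn ϱ (Ioi 0)
  zero : ∀ x, x ≤ 0 → ϱ x = 0
  pos : ∀ x, 0 < x → 0 < ϱ x
  dom : ∃ C, ∀ z, 0 < z → w z ^ 2 * ϱ z ≤ C * env z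
  eq : ∀ x, 0 < x → Real.log (x * ϱ x) = T ϱ x + U x + m

/-- The reference density is built so that the unbounded terms cancel. At the origin, the long-range
potential and ln(x `rnear`) both behave like −2 ln(A − ln x); this fixes the profile 1/(x ln² x).
Beyond 1 the potential of a mass β is 2β ln x up to a bounded term, which matches the factor x^{2β}
in `rfar`; here the normalization `hβ` enters. -/
lemma exists_bound_rref {A β C : ℝ} {U w : ℝ → ℝ} (hA : 0 < A) (hC : 0 < C)
    (hU : Confining U w) (hβ : ∫ z, rref A β C U z ∂leb = β) :
    ∃ B, ∀ x, 0 < x →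
      |U x + T (rref A β C U) x - Real.log (x * rref A β C U x)| ≤ B := by
  set r := rref A β C U with hr
  have hdom : Dominated r w := ⟨measurable_rref hU.cont,
    fun z hz => (rref_pos hA hC hz).le, hU.weight_cont.measurable, hU.one_le,
    rref_dom hA hC hU⟩
  have hAd := hdom.adm
  have hfin := hAd.isFiniteMeasure
  have h1w : MemLp (fun z => (w z)⁻¹ • (1 : ℝ)) 2 (meas r) :=
    hAd.weighted_memLp (memLp_const 1)
  obtain ⟨K, hK0, hK⟩ := hAd.exists_skpotl_bound (E := ℝ)
  set S := K * (eLpNorm (fun z => (w z)⁻¹ • (1 : ℝ)) 2 (meas r)).toReal with hS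
  have hsk : ∀ x, 0 < x → |∫ z, sk x z • (1 : ℝ) ∂(meas r)| ≤ S := fun x hx => hK _ h1w x hx
  have hTx : ∀ x, 0 < x → T r x = 2 * (∫ z, max (Real.log x) (Real.log z) * r z ∂leb) -
      ∫ z, sk x z • (1 : ℝ) ∂(meas r) := fun x hx => by
    rw [T_density_eq_potl hdom.measurable hdom.nonneg, hAd.potl_eq h1w hx,
      integral_meas hdom.measurable hdom.nonneg]
    simp [mul_comm]
  have hmaxi : ∀ x, Integrable (fun z => max (Real.log x) (Real.log z) * r z) leb := fun x => by
    have := (integrable_meas hdom.measurable hdom.nonneg).1 (hAd.integrable_max h1w x)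
    simpa [mul_comm] using this
  have hri : Integrable r leb := by
    have := (integrable_meas hdom.measurable hdom.nonneg).1 (hAd.integrable_weighted h1w)
    simpa using this
  have hlli : Integrable (fun z => ll z * r z) leb := by
    have := ((integrable_meas hdom.measurable hdom.nonneg).1 (hAd.integrable_log_weighted h1w))
    refine (this.sub hri).congr (Eventually.of_forall fun z => ?_)
    simp only [Pi.sub_apply, smul_eq_mul]; ring
  obtain ⟨M, hM⟩ := (isCompact_Icc (a := (0 : ℝ)) (b := 1)).exists_bound_of_continuousOn
    hU.cont.continuousOn
  set L := ∫ z in Ioi 1, Real.log z * r z with hL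
  refine ⟨max (M + 2 * (2 + |Real.log A| + |L|) + S)
    (2 * (∫ z, ll z * r z ∂leb) + |Real.log C| + S), fun x hx => ?_⟩
  have hs := abs_le.1 (hsk x hx)
  rcases le_or_gt x 1 with h | h
  · refine le_trans ?_ (le_max_left _ _)
    have hp := hA.trans_le (sub_log_pos (A := A) hx h)
    have hlx := Real.log_nonpos hx.le h
    have e1 : ∫ z, max (Real.log x) (Real.log z) * r z ∂leb =
        Real.log x * (∫ z in Ioc 0 x, rnear A z) +
          (Real.log A + 1 - (A / (A - Real.log x) + Real.log (A - Real.log x))) + L := by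
      rw [← integral_log_rnear hA hx h, ← integral_const_mul, hL]
      have hi := hmaxi x
      unfold leb at hi ⊢
      rw [← Ioc_union_Ioi_eq_Ioi (zero_le_one (α := ℝ)),
        ← Ioc_union_Ioc_eq_Ioc hx.le h] at hi ⊢
      have hi : IntegrableOn _ _ volume := hi
      rw [setIntegral_union _ measurableSet_Ioi (hi.mono_set subset_union_left)
          (hi.mono_set subset_union_right), setIntegral_union _ measurableSet_Ioc
          (hi.mono_set (subset_union_left.trans subset_union_left))
          (hi.mono_set (subset_union_right.trans subset_union_left))]
      · congr 1
        · congr 1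
          · apply setIntegral_congr_fun measurableSet_Ioc
            intro z hz
            simp only
            rw [hr, rref_near hz.1 (hz.2.trans h), max_eq_left (Real.log_le_log hz.1 hz.2)]
          · apply setIntegral_congr_fun measurableSet_Ioc
            intro z hz
            simp only
            rw [hr, rref_near (hx.trans hz.1) hz.2, max_eq_right (Real.log_le_log hx hz.1.le)]
        · apply setIntegral_congr_fun measurableSet_Ioi
          intro z hz
          simp only
          rw [max_eq_right (Real.log_le_log hx (h.trans (le_of_lt hz)))]
      · rw [Set.disjoint_left]
        intro z h1 h2
        exact not_le.2 h2.1 h1.2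
      · rw [Set.disjoint_left]
        rintro z (h1 | h1) h2
        · exact not_le.2 h2 (h1.2.trans h)
        · exact not_le.2 h2 h1.2
    have e2 : Real.log (x * r x) = -2 * Real.log (A - Real.log x) := by
      rw [hr, rref_near hx h]
      unfold rnear
      rw [show x * (1 / (x * (A - Real.log x) ^ 2)) = ((A - Real.log x) ^ 2)⁻¹ by field_simp,
        Real.log_inv, Real.log_pow]
      push_cast; ring
    have e3 : |Real.log x * ∫ z in Ioc 0 x, rnear A z| ≤ 1 := by
      have h0 : 0 ≤ ∫ z in Ioc 0 x, rnear A z :=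
        setIntegral_nonneg measurableSet_Ioc fun z hz => (rnear_pos hA hz.1 (hz.2.trans h)).le
      rw [abs_mul, abs_of_nonpos hlx, abs_of_nonneg h0]
      calc -Real.log x * _ ≤ -Real.log x * (1 / (A - Real.log x)) := by
            gcongr
            · linarith
            · exact integral_rnear_le hA hx h
        _ ≤ 1 := by
            rw [mul_one_div, div_le_one hp]; linarith
    have e4 : 0 ≤ A / (A - Real.log x) ∧ A / (A - Real.log x) ≤ 1 :=
      ⟨by positivity, by rw [div_le_one hp]; linarith⟩
    have e5 := hM x ⟨hx.le, h⟩
    rw [Real.norm_eq_abs, abs_le] at e5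
    rw [hTx x hx, e1, e2]
    have e6 := abs_le.1 e3
    have e7 := abs_le.1 (le_refl |Real.log A|)
    have e8 := abs_le.1 (le_refl |L|)
    rw [abs_le]
    constructor <;> linarith
  · refine le_trans ?_ (le_max_right _ _)
    have hlx := Real.log_nonneg h.le
    have e1 : ∫ z, max (Real.log x) (Real.log z) * r z ∂leb - Real.log x * β =
        ∫ z, (max (Real.log x) (Real.log z) - Real.log x) * r z ∂leb := by
      rw [← hβ, ← integral_const_mul, ← integral_sub (hmaxi x) (hri.const_mul _)]
      congr 1; funext z; ring
    have hn : 0 ≤ ∫ z, (max (Real.log x) (Real.log z) - Real.log x) * r z ∂leb := by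
      apply integral_nonneg_of_ae
      filter_upwards [ae_leb_pos] with z hz
      exact mul_nonneg (sub_nonneg.2 (le_max_left _ _)) (hdom.nonneg z hz)
    have hu : ∫ z, (max (Real.log x) (Real.log z) - Real.log x) * r z ∂leb ≤
        ∫ z, ll z * r z ∂leb := by
      apply integral_mono_ae _ hlli
      · filter_upwards [ae_leb_pos] with z hz
        apply mul_le_mul_of_nonneg_right _ (hdom.nonneg z hz)
        have := ll_nonneg z
        have h2 : Real.log z ≤ ll z := le_max_left _ _
        rw [sub_le_iff_le_add]
        exact max_le (by linarith) (by linarith)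
      · refine ((hmaxi x).sub (hri.const_mul (Real.log x))).congr
          (Eventually.of_forall fun z => ?_)
        simp only [Pi.sub_apply]; ring
    have e2 : Real.log (x * r x) = Real.log C + (U x + 2 * β * Real.log x) := by
      rw [hr, rref_far h]
      unfold rfar
      rw [show x * (C * (Real.exp (U x + 2 * β * Real.log x) / x)) =
        C * Real.exp (U x + 2 * β * Real.log x) by field_simp,
        Real.log_mul hC.ne' (Real.exp_pos _).ne', Real.log_exp]
    rw [hTx x hx, e2]
    have e7 := abs_le.1 (le_refl |Real.log C|)
    rw [abs_le]
    constructor <;> linarith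

/-- The density is sought as r e^v with r of mass β. Then e^v − 1 is neutral for r dx, and the
bounded defect of r in the Euler–Lagrange equation is the source of `exists_exp_solution`. Since v
is bounded, domination by the envelope passes from r to the solution. -/
theorem exists_eulerLagrange {U w : ℝ → ℝ} (hU : Confining U w) {β : ℝ} (hβ : 0 < β) :
    ∃ (ϱ : ℝ → ℝ) (m : ℝ), IsEquilibrium U w ϱ m ∧ ∫ x, ϱ x ∂leb = β := by
  obtain ⟨A, C, hA, hC, hmass⟩ := exists_rref hβ hU
  obtain ⟨B, hB⟩ := exists_bound_rref hA hC hU hmass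
  set r := rref A β C U with hr
  have hrpos : ∀ z, 0 < z → 0 < r z := fun z hz => rref_pos hA hC hz
  have hdom : Dominated r w := ⟨measurable_rref hU.cont,
    fun z hz => (hrpos z hz).le, hU.weight_cont.measurable, hU.one_le, rref_dom hA hC hU⟩
  have hAd := hdom.adm
  have hfin := hAd.isFiniteMeasure
  have hm1 : ∫ _, (1 : ℝ) ∂(meas r) = β := by
    rw [integral_meas hdom.measurable hdom.nonneg]; simpa using hmass
  have hν : meas r ≠ 0 := by
    intro h0
    rw [h0, integral_zero_measure] at hm1
    exact hβ.ne hm1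
  have hTr : ∀ x, T r x = potl (meas r) (fun _ => (1 : ℝ)) x := fun x =>
    T_density_eq_potl hdom.measurable hdom.nonneg x
  have hTm : Measurable (T r) := by
    rw [funext hTr]
    exact (hAd.stronglyMeasurable_potl aestronglyMeasurable_const).measurable
  have hrm := hdom.measurable
  have hUm := hU.cont.measurable
  obtain ⟨v, m, D, hvm, hvb, hv0, hv⟩ := hAd.exists_exp_solution hν
    (f := fun x => U x + T r x - Real.log (x * r x)) (by fun_prop) hB
  have hev2 : MemLp (fun z => Real.exp (v z)) 2 (meas r) := by
    refine MemLp.of_bound (by fun_prop) (Real.exp D) (ae_meas_of_pos fun z hz => ?_)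
    rw [Real.norm_of_nonneg (Real.exp_pos _).le, Real.exp_le_exp]
    exact (abs_le.1 (hvb z hz)).2
  set ϱ : ℝ → ℝ := fun z => r z * Real.exp (v z) with hϱ
  have hTϱ : T ϱ = potl (meas r) (fun z => Real.exp (v z)) := by
    funext x
    exact T_eq_potl hdom.measurable hdom.nonneg _ x
  have heq : ∀ x, 0 < x → Real.log (x * ϱ x) = T ϱ x + U x + m := fun x hx => by
    have h1 := hv x hx
    rw [hAd.potl_sub (h := fun z => Real.exp (v z)) (h' := fun _ => 1)
      (hAd.weighted_memLp hev2) (hAd.weighted_memLp (memLp_const 1)) hx.ne', ← hTϱ, ← hTr] at h1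
    rw [hϱ]
    simp only
    rw [← mul_assoc, Real.log_mul (mul_pos hx (hrpos x hx)).ne' (Real.exp_pos _).ne', Real.log_exp]
    linarith
  have hpos : ∀ x, 0 < x → 0 < ϱ x := fun x hx => mul_pos (hrpos x hx) (Real.exp_pos _)
  have hform : ∀ x ∈ Ioi (0 : ℝ), ϱ x = Real.exp (T ϱ x + U x + m) / x := fun x hx => by
    have hx : 0 < x := hx
    rw [← heq x hx, Real.exp_log (mul_pos hx (hpos x hx))]
    field_simp
  refine ⟨ϱ, m, ⟨?_, ?_, hpos, ?_, heq⟩, ?_⟩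
  · refine ContinuousOn.congr ?_ hform
    have h1 : ContinuousOn (T ϱ) (Ioi 0) := by
      rw [hTϱ]; exact hAd.continuousOn_potl (hAd.weighted_memLp hev2)
    have h2 : ∀ x ∈ Ioi (0 : ℝ), x ≠ 0 := fun x hx => (ne_of_gt hx)
    have h3 := hU.cont.continuousOn (s := Ioi 0)
    exact (((h1.add h3).add continuousOn_const).rexp).div continuousOn_id h2
  · intro x hx
    simp only [hϱ, hr, rref, if_pos hx, zero_mul]
  · obtain ⟨K, hK⟩ := hdom.dom
    refine ⟨K * Real.exp D, fun z hz => ?_⟩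
    calc w z ^ 2 * ϱ z = (w z ^ 2 * r z) * Real.exp (v z) := by rw [hϱ]; ring
      _ ≤ (K * env z) * Real.exp D := by
          have h1 := hK z hz
          have h2 : 0 ≤ w z ^ 2 * r z := mul_nonneg (sq_nonneg _) (hrpos z hz).le
          have h3 := (abs_le.1 (hvb z hz)).2
          gcongr
          exact h2.trans h1
      _ = _ := by ring
  · have e1 : ∫ z, Real.exp (v z) ∂(meas r) = β := by
      rw [integral_sub (hev2.integrable (by norm_num)) (integrable_const 1), hm1] at hv0
      linarith
    rw [← e1, integral_meas hdom.measurable hdom.nonneg]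
    rfl

/-! ### Integrability of interactions -/

instance : SFinite leb := by unfold leb; infer_instance

lemma integrable_prod_meas {ϱ r : ℝ → ℝ} (hϱ : Measurable ϱ) (hr : Measurable r)
    (hϱ0 : ∀ z, 0 < z → 0 ≤ ϱ z) (hr0 : ∀ z, 0 < z → 0 ≤ r z) {k : ℝ × ℝ → ℝ} :
    Integrable k ((meas ϱ).prod (meas r)) ↔
      Integrable (fun p => k p * (ϱ p.1 * r p.2)) (leb.prod leb) := by
  unfold meas
  rw [prod_withDensity (by fun_prop) (by fun_prop),
    integrable_withDensity_iff_integrable_smul' (by fun_prop)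
      (Eventually.of_forall fun _ => ENNReal.mul_lt_top ENNReal.ofReal_lt_top
        ENNReal.ofReal_lt_top)]
  apply integrable_congr
  filter_upwards [Measure.quasiMeasurePreserving_fst.ae ae_leb_pos,
    Measure.quasiMeasurePreserving_snd.ae ae_leb_pos] with p h1 h2
  rw [ENNReal.toReal_mul, ENNReal.toReal_ofReal (hϱ0 _ h1), ENNReal.toReal_ofReal (hr0 _ h2),
    smul_eq_mul, mul_comm]

/-- By the layer-cake formula the integral is ∫ μ{t>s} ν{t>s} ds, and ab ≤ a² + b². Finite
self-interactions thus control the mixed one near the origin. -/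
lemma lintegral_min_prod_le {μ ν : Measure ℝ} [SFinite μ] [SFinite ν] {t : ℝ → ℝ}
    (ht : Measurable t) :
    ∫⁻ p : ℝ × ℝ, ENNReal.ofReal (min (t p.1) (t p.2)) ∂(μ.prod ν) ≤
      (∫⁻ p : ℝ × ℝ, ENNReal.ofReal (min (t p.1) (t p.2)) ∂(μ.prod μ)) +
        ∫⁻ p : ℝ × ℝ, ENNReal.ofReal (min (t p.1) (t p.2)) ∂(ν.prod ν) := by
  have layer : ∀ (μ ν : Measure ℝ) [SFinite μ] [SFinite ν],
      ∫⁻ p : ℝ × ℝ, ENNReal.ofReal (min (t p.1) (t p.2)) ∂(μ.prod ν) =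
        ∫⁻ s in Ici (0 : ℝ), μ {x | s < t x} * ν {x | s < t x} := by
    intro μ ν _ _
    have hS : MeasurableSet {q : (ℝ × ℝ) × ℝ | q.2 < t q.1.1 ∧ q.2 < t q.1.2} :=
      (measurableSet_lt measurable_snd (ht.comp (measurable_fst.comp measurable_fst))).inter
        (measurableSet_lt measurable_snd (ht.comp (measurable_snd.comp measurable_fst)))
    have e : ∀ p : ℝ × ℝ, ENNReal.ofReal (min (t p.1) (t p.2)) =
        ∫⁻ s in Ici (0 : ℝ),
          {q : (ℝ × ℝ) × ℝ | q.2 < t q.1.1 ∧ q.2 < t q.1.2}.indicator 1 (p, s) := by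
      intro p
      have e2 : (fun s : ℝ => {q : (ℝ × ℝ) × ℝ | q.2 < t q.1.1 ∧ q.2 < t q.1.2}.indicator
          (1 : (ℝ × ℝ) × ℝ → ℝ≥0∞) (p, s)) = (Iio (min (t p.1) (t p.2))).indicator 1 := by
        funext s
        simp only [indicator, mem_ofPred_eq, mem_Iio, lt_min_iff, Pi.one_apply]
      rw [e2, lintegral_indicator_one measurableSet_Iio, Measure.restrict_apply measurableSet_Iio,
        inter_comm, Ici_inter_Iio, Real.volume_Ico, sub_zero]
    simp_rw [e]
    rw [lintegral_lintegral_swap]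
    · congr 1
      funext s
      rw [← Measure.prod_prod]
      have hs : MeasurableSet ({x | s < t x} ×ˢ {x | s < t x}) :=
        (measurableSet_lt measurable_const ht).prod (measurableSet_lt measurable_const ht)
      rw [← lintegral_indicator_one hs]
      congr 1
    · exact (measurable_one.indicator hS).aemeasurable
  rw [layer μ ν, layer μ μ, layer ν ν, ← lintegral_add_left]
  · apply lintegral_mono
    intro s
    rcases le_total (μ {x | s < t x}) (ν {x | s < t x}) with h | h
    · exact (mul_le_mul' h le_rfl).trans le_add_self
    · exact (mul_le_mul' le_rfl h).trans le_self_add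
  · have : Measurable fun s : ℝ => μ {x | s < t x} := by
      have hS : MeasurableSet {q : ℝ × ℝ | q.1 < t q.2} :=
        measurableSet_lt (by fun_prop) (by fun_prop)
      exact measurable_measure_prodMk_left hS
    exact this.mul this

/-- On (0,1)² both parts of the kernel are nonpositive and cannot cancel; elsewhere the left side is
zero. Hence a finite self-interaction bounds the long-range part alone. -/
lemma two_min_le_abs_lk {x z : ℝ} (hx : 0 < x) (hz : 0 < z) (h : x ≠ z) :
    2 * min (tt x) (tt z) ≤ |lk x z| := by
  have h1 := sk_nonneg hx hz
  rcases le_or_gt 1 x with hx1 | hx1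
  · rw [tt_of_ge hx1, min_eq_left (tt_nonneg z)]; simp
  rcases le_or_gt 1 z with hz1 | hz1
  · rw [tt_of_ge hz1, min_eq_right (tt_nonneg x)]; simp
  rw [lk_eq hx hz h, max_log, ll_of_le hx hx1.le, ll_of_le hz hz1.le, max_self, ← abs_neg]
  refine le_trans ?_ (le_abs_self _)
  linarith

lemma sk_le_kap {x z : ℝ} (hx : 0 < x) (hz : 0 < z) : sk x z ≤ 2 * kap x z := by
  have h1 := Real.add_one_le_exp (sk x z / 2)
  have h2 := exp_sk_le hx hz
  linarith

lemma ae_prod_pos_ne {μ ν : Measure ℝ} [SFinite μ] [SFinite ν] (hμ : μ ≪ leb) (hν : ν ≪ leb) :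
    ∀ᵐ p : ℝ × ℝ ∂(μ.prod ν), 0 < p.1 ∧ 0 < p.2 ∧ p.1 ≠ p.2 := by
  have hm : MeasurableSet {p : ℝ × ℝ | 0 < p.1 ∧ 0 < p.2 ∧ p.1 ≠ p.2} :=
    (measurableSet_lt measurable_const measurable_fst).inter
      ((measurableSet_lt measurable_const measurable_snd).inter
        (measurableSet_eq_fun measurable_fst measurable_snd).compl)
  rw [Measure.ae_prod_iff_ae_ae hm]
  filter_upwards [hμ.ae_le ae_leb_pos] with x hx
  filter_upwards [hν.ae_le ae_leb_pos, hν.ae_le (ae_leb_ne x)] with z hz hxz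
  exact ⟨hx, hz, hxz⟩

/-- A competitor satisfies no envelope bound, only finiteness of its own terms. Near the origin the
mixed term is controlled by the two self-interactions, at infinity by the moments of `ll`, and on
the diagonal by the uniform bound for `kap` against ν. -/
lemma Adm.integrable_cross {μ ν : Measure ℝ} {w : ℝ → ℝ} [IsFiniteMeasure μ] (hA : Adm ν w)
    (hμ : μ ≪ leb) (hself : Integrable (fun p : ℝ × ℝ => lk p.1 p.2) (μ.prod μ))
    (hll : Integrable ll μ) : Integrable (fun p : ℝ × ℝ => lk p.1 p.2) (μ.prod ν) := by
  have hfin := hA.isFiniteMeasure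
  have hself' : Integrable (fun p : ℝ × ℝ => lk p.1 p.2) (ν.prod ν) := by
    have := hA.integrable_energy (𝕜 := ℝ) (memLp_const 1) (memLp_const 1)
    simpa using this
  have hmin : ∀ {μ : Measure ℝ} [IsFiniteMeasure μ], μ ≪ leb →
      Integrable (fun p : ℝ × ℝ => lk p.1 p.2) (μ.prod μ) →
      ∫⁻ p : ℝ × ℝ, ENNReal.ofReal (min (tt p.1) (tt p.2)) ∂(μ.prod μ) < ∞ := by
    intro μ _ hμ hs
    refine lt_of_le_of_lt (lintegral_mono_ae ?_) hs.2
    filter_upwards [ae_prod_pos_ne hμ hμ] with p hp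
    rw [← ofReal_norm]
    apply ENNReal.ofReal_le_ofReal
    have := two_min_le_abs_lk hp.1 hp.2.1 hp.2.2
    rw [Real.norm_eq_abs]
    linarith [le_min (tt_nonneg p.1) (tt_nonneg p.2)]
  obtain ⟨K, hK⟩ := hA.exists_exp_sk_bound
  have hllν : Integrable ll ν := by
    have h := hA.integrable_log_weighted (hA.weighted_memLp (memLp_const (1 : ℝ)))
    refine (h.sub (integrable_const 1)).congr (Eventually.of_forall fun z => ?_)
    simp
  have i1 : Integrable (fun p : ℝ × ℝ => min (tt p.1) (tt p.2)) (μ.prod ν) := by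
    have mt := measurable_tt
    refine ⟨Measurable.aestronglyMeasurable (by fun_prop), ?_⟩
    rw [hasFiniteIntegral_iff_ofReal
      (Eventually.of_forall fun p => le_min (tt_nonneg _) (tt_nonneg _))]
    exact (lintegral_min_prod_le mt).trans_lt
      (ENNReal.add_lt_top.2 ⟨hmin hμ hself, hmin hA.ac hself'⟩)
  have i2 : Integrable (fun p : ℝ × ℝ => ll p.1) (μ.prod ν) := hll.comp_fst ν
  have i3 : Integrable (fun p : ℝ × ℝ => ll p.2) (μ.prod ν) := hllν.comp_snd μ
  have i4 : Integrable (fun p : ℝ × ℝ => 1 + kap p.1 p.2) (μ.prod ν) := by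
    have hm : Measurable (fun p : ℝ × ℝ => 1 + kap p.1 p.2) := measurable_const.add measurable_kap
    refine ⟨hm.aestronglyMeasurable, ?_⟩
    rw [hasFiniteIntegral_iff_enorm, lintegral_prod _ hm.enorm.aemeasurable]
    calc ∫⁻ x, ∫⁻ z, ‖1 + kap x z‖ₑ ∂ν ∂μ ≤ ∫⁻ x, ENNReal.ofReal K ∂μ := by
          apply lintegral_mono_ae
          filter_upwards [hμ.ae_le ae_leb_pos] with x hx
          obtain ⟨h1, h2⟩ := hK x hx
          have e : ∫⁻ z, ‖1 + kap x z‖ₑ ∂ν = ∫⁻ z, ENNReal.ofReal (1 + kap x z) ∂ν := by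
            apply lintegral_congr_ae
            filter_upwards [hA.ae_pos] with z hz
            have := kap_nonneg hx hz
            rw [Real.enorm_of_nonneg (by linarith)]
          rw [e, ← ofReal_integral_eq_lintegral_ofReal h1]
          · exact ENNReal.ofReal_le_ofReal h2
          · filter_upwards [hA.ae_pos] with z hz
            have := kap_nonneg hx hz
            simp only [Pi.zero_apply]; linarith
      _ < ∞ := by
          rw [lintegral_const]
          exact ENNReal.mul_lt_top ENNReal.ofReal_lt_top (measure_lt_top _ _)
  refine Integrable.mono' ((((i1.const_mul 2).add (i2.const_mul 2)).add (i3.const_mul 2)).add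
    (i4.const_mul 2)) measurable_lk.aestronglyMeasurable ?_
  filter_upwards [ae_prod_pos_ne hμ hA.ac] with p hp
  have h1 := abs_lk_le hp.1 hp.2.1 hp.2.2
  have h2 := sk_le_kap hp.1 hp.2.1
  rw [Real.norm_eq_abs]
  simp only [Pi.add_apply]
  linarith

/-! ### Competitors -/

lemma IsCompetitor.congr {b : ℝ} {V : ℂ[X]} {ϱ r : ℝ → ℝ} (h : IsCompetitor b V ϱ)
    (e : r =ᵐ[leb] ϱ) (hr : ∀ x, 0 < x → 0 ≤ r x) :
    IsCompetitor b V r ∧ energy V r = energy V ϱ := by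
  have e1 : (fun p : ℝ × ℝ => Real.log |p.1 ^ 2 - p.2 ^ 2| * (r p.1 * r p.2)) =ᵐ[leb.prod leb]
      fun p : ℝ × ℝ => Real.log |p.1 ^ 2 - p.2 ^ 2| * (ϱ p.1 * ϱ p.2) := by
    filter_upwards [Measure.quasiMeasurePreserving_fst.ae e,
      Measure.quasiMeasurePreserving_snd.ae e] with p h1 h2
    rw [h1, h2]
  have e2 : (fun x => (ext V x).re * r x) =ᵐ[leb] fun x => (ext V x).re * ϱ x := by
    filter_upwards [e] with x hx; rw [hx]
  have e3 : (fun x => r x * Real.log (x * r x)) =ᵐ[leb] fun x => ϱ x * Real.log (x * ϱ x) := by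
    filter_upwards [e] with x hx; rw [hx]
  refine ⟨⟨hr, (integrable_congr e).2 h.integrable, ?_, (integrable_congr e1).2 h.interaction,
    (integrable_congr e2).2 h.potential, (integrable_congr e3).2 h.entropy⟩, ?_⟩
  · rw [integral_congr_ae e, h.mass]
  · unfold energy
    rw [integral_congr_ae e1, integral_congr_ae e2, integral_congr_ae e3]

lemma IsCompetitor.exists_measurable {b : ℝ} {V : ℂ[X]} {ϱ : ℝ → ℝ} (h : IsCompetitor b V ϱ) :
    ∃ r, Measurable r ∧ r =ᵐ[leb] ϱ ∧ IsCompetitor b V r ∧ energy V r = energy V ϱ := by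
  obtain ⟨s, hs, hse⟩ := h.integrable.aemeasurable
  have e : (fun x => max (s x) 0) =ᵐ[leb] ϱ := by
    filter_upwards [hse, ae_leb_pos] with x hx h0
    rw [← hx, max_eq_left (h.nonneg x h0)]
  exact ⟨fun x => max (s x) 0, by fun_prop, e, h.congr e fun x _ => le_max_right _ _⟩

/-- Confining external potentials, comparable with the weight. -/
structure IsConfined (U w : ℝ → ℝ) : Prop where
  weight_meas : Measurable w
  one_le : ∀ x, 1 ≤ w x
  meas : Measurable U
  le : ∃ C, ∀ x, 0 < x → |U x| ≤ C * w x
  ll_le : ∃ C, ∀ x, 0 < x → ll x ≤ C * (1 + |U x|)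

lemma IsEquilibrium.dominated {U w ϱ : ℝ → ℝ} {m : ℝ} (h : IsEquilibrium U w ϱ m)
    (hU : IsConfined U w) : Dominated ϱ w :=
  ⟨measurable_of_continuousOn h.cont h.zero, fun z hz => (h.pos z hz).le, hU.weight_meas,
    hU.one_le, h.dom⟩

section minimality

variable {b : ℝ} {V : ℂ[X]} {ϱ w : ℝ → ℝ} {m : ℝ}

lemma IsEquilibrium.isCompetitor (h : IsEquilibrium (fun x => (ext V x).re) w ϱ m)
    (hU : IsConfined (fun x => (ext V x).re) w) (hb : ∫ x, ϱ x ∂leb = b) :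
    IsCompetitor b V ϱ := by
  have hd := h.dominated hU
  have hA := hd.adm
  have hfin := hA.isFiniteMeasure
  have h1w := hA.weighted_memLp (memLp_const (1 : ℝ))
  obtain ⟨C, hC⟩ := hU.le
  have hUi : Integrable (fun x => (ext V x).re) (meas ϱ) := by
    refine ((hA.memLp_w.integrable (by norm_num)).const_mul C).mono'
      hU.meas.aestronglyMeasurable (ae_meas_of_pos fun z hz => ?_)
    exact hC z hz
  have hri : Integrable ϱ leb := by
    have := (integrable_meas hd.measurable hd.nonneg).1 (integrable_const (1 : ℝ))
    simpa using this
  have hTi : Integrable (T ϱ) (meas ϱ) := by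
    obtain ⟨K, hK⟩ := hA.exists_memLp_potl (E := ℝ)
    rw [funext (T_density_eq_potl hd.measurable hd.nonneg)]
    exact (hK _ h1w).1.integrable (by norm_num)
  refine ⟨hd.nonneg, hri, hb, ?_, ?_, ?_⟩
  · have := hA.integrable_energy (𝕜 := ℝ) (memLp_const 1) (memLp_const 1)
    simp only [mul_one, smul_eq_mul] at this
    exact (integrable_prod_meas hd.measurable hd.measurable hd.nonneg hd.nonneg).1 this
  · refine ((integrable_meas hd.measurable hd.nonneg).1 hUi).congr
      (Eventually.of_forall fun x => ?_)
    simp [mul_comm]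
  · refine ((integrable_meas hd.measurable hd.nonneg).1
      ((hTi.add hUi).add (integrable_const m))).congr ?_
    filter_upwards [ae_leb_pos] with x hx
    simp only [Pi.add_apply, smul_eq_mul]
    rw [h.eq x hx]

/-- By the Euler–Lagrange equation the first variation vanishes on neutral differences, so the
energy gap is −½ ∬ ln|x²−y²| (r−ϱ)(r−ϱ) plus the relative entropy of r with respect to ϱ. Both terms
are nonnegative, and the entropy vanishes only for r = ϱ almost everywhere. -/
theorem IsEquilibrium.energy_le (h : IsEquilibrium (fun x => (ext V x).re) w ϱ m)
    (hU : IsConfined (fun x => (ext V x).re) w) (hb : ∫ x, ϱ x ∂leb = b) {r : ℝ → ℝ}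
    (hr : IsCompetitor b V r) :
    energy V ϱ ≤ energy V r ∧ (energy V r ≤ energy V ϱ → r =ᵐ[leb] ϱ) := by
  obtain ⟨r', hrm', hre, hrc, hrE⟩ := hr.exists_measurable
  suffices H : energy V ϱ ≤ energy V r' ∧ (energy V r' ≤ energy V ϱ → r' =ᵐ[leb] ϱ) by
    rw [← hrE]
    exact ⟨H.1, fun h => hre.symm.trans (H.2 h)⟩
  clear hre hrE hr
  set r := r'
  have hd := h.dominated hU
  have hA := hd.adm
  have hfin := hA.isFiniteMeasure
  have hc := h.isCompetitor hU hb
  have hfin' : IsFiniteMeasure (meas r) := by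
    unfold meas
    refine isFiniteMeasure_withDensity_ofReal hrc.integrable.2
  have hcross : Integrable (fun p : ℝ × ℝ => lk p.1 p.2 * (r p.1 * ϱ p.2)) (leb.prod leb) := by
    rw [← integrable_prod_meas hrm' hd.measurable hrc.nonneg hd.nonneg]
    apply hA.integrable_cross (μ := meas r) (withDensity_absolutelyContinuous _ _)
    · rw [integrable_prod_meas hrm' hrm' hrc.nonneg hrc.nonneg]
      exact hrc.interaction
    · obtain ⟨C, hC⟩ := hU.ll_le
      have hUr : Integrable (fun x => (ext V x).re) (meas r) := by
        rw [integrable_meas hrm' hrc.nonneg]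
        simpa [mul_comm] using hrc.potential
      refine (((integrable_const 1).add hUr.abs).const_mul C).mono'
        measurable_ll.aestronglyMeasurable (ae_meas_of_pos fun z hz => ?_)
      rw [Real.norm_of_nonneg (ll_nonneg z)]
      exact hC z hz
  have hcross' : Integrable (fun p : ℝ × ℝ => lk p.1 p.2 * (ϱ p.1 * r p.2)) (leb.prod leb) := by
    refine hcross.swap.congr (Eventually.of_forall fun p => ?_)
    simp only [Function.comp_apply, Prod.fst_swap, Prod.snd_swap]
    rw [lk_comm]; ring
  have hswap : ∫ p : ℝ × ℝ, lk p.1 p.2 * (ϱ p.1 * r p.2) ∂(leb.prod leb) =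
      ∫ p : ℝ × ℝ, lk p.1 p.2 * (r p.1 * ϱ p.2) ∂(leb.prod leb) := by
    rw [← integral_prod_swap]
    congr 1; funext p
    simp only [Prod.fst_swap, Prod.snd_swap]
    rw [lk_comm]; ring
  have hTr : (fun x => ∫ z, lk x z * (r x * ϱ z) ∂leb) = fun x => r x * T ϱ x := by
    funext x
    unfold T
    rw [← integral_const_mul]
    congr 1; funext z
    simp only [lk, smul_eq_mul]; ring
  have hTϱ : (fun x => ∫ z, lk x z * (ϱ x * ϱ z) ∂leb) = fun x => ϱ x * T ϱ x := by
    funext x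
    unfold T
    rw [← integral_const_mul]
    congr 1; funext z
    simp only [lk, smul_eq_mul]; ring
  have hTri : Integrable (fun x => r x * T ϱ x) leb := by
    rw [← hTr]; exact hcross.integral_prod_left
  have hTϱi : Integrable (fun x => ϱ x * T ϱ x) leb := by
    rw [← hTϱ]; exact Integrable.integral_prod_left (f := fun p : ℝ × ℝ =>
      lk p.1 p.2 * (ϱ p.1 * ϱ p.2)) hc.interaction
  set I := ∫ p : ℝ × ℝ, lk p.1 p.2 * (r p.1 * ϱ p.2) ∂(leb.prod leb) with hI
  set L := ∫ p : ℝ × ℝ, lk p.1 p.2 * (ϱ p.1 * ϱ p.2) ∂(leb.prod leb) with hL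
  set L' := ∫ p : ℝ × ℝ, lk p.1 p.2 * (r p.1 * r p.2) ∂(leb.prod leb) with hL'
  have hI' : I = ∫ x, r x * T ϱ x ∂leb := by
    rw [← hTr, hI, integral_prod _ hcross]
  have hL'' : L = ∫ x, ϱ x * T ϱ x ∂leb := by
    rw [← hTϱ, hL]; exact integral_prod _ hc.interaction
  have hPD : L' - 2 * I + L ≤ 0 := by
    have hψ := hrc.integrable.sub hc.integrable
    have hexp : ∀ p : ℝ × ℝ, lk p.1 p.2 * ((r - ϱ) p.1 * (r - ϱ) p.2) =
        (lk p.1 p.2 * (r p.1 * r p.2) - lk p.1 p.2 * (r p.1 * ϱ p.2)) -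
          (lk p.1 p.2 * (ϱ p.1 * r p.2) - lk p.1 p.2 * (ϱ p.1 * ϱ p.2)) := fun p => by
      simp only [Pi.sub_apply]; ring
    have j1 : Integrable (fun p : ℝ × ℝ => lk p.1 p.2 * (r p.1 * r p.2) -
      lk p.1 p.2 * (r p.1 * ϱ p.2)) (leb.prod leb) := hrc.interaction.sub hcross
    have j2 : Integrable (fun p : ℝ × ℝ => lk p.1 p.2 * (ϱ p.1 * r p.2) -
      lk p.1 p.2 * (ϱ p.1 * ϱ p.2)) (leb.prod leb) := hcross'.sub hc.interaction
    have := integral_lk_nonpos hψ (by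
      simp only [Pi.sub_apply]
      rw [integral_sub hrc.integrable hc.integrable, hrc.mass, hb, sub_self])
      (ae_prod_sq_ne Measure.AbsolutelyContinuous.rfl) (by
        simp_rw [hexp]; exact j1.sub j2)
    simp_rw [hexp] at this
    rw [integral_sub j1 j2, integral_sub (f := fun p : ℝ × ℝ => lk p.1 p.2 * (r p.1 * r p.2))
      hrc.interaction hcross,
      integral_sub (g := fun p : ℝ × ℝ => lk p.1 p.2 * (ϱ p.1 * ϱ p.2))
      hcross' hc.interaction, hswap] at this
    linarith
  -- After substitution of the Euler–Lagrange equation this is r ln(r/ϱ) − (r − ϱ), which is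
  -- nonnegative pointwise; the correction r − ϱ integrates to zero.
  set k : ℝ → ℝ := fun x => r x * Real.log (x * r x) - (r x * T ϱ x + (ext V x).re * r x + m * r x)
    - (r x - ϱ x) with hk
  have hki : Integrable k leb := (hrc.entropy.sub ((hTri.add hrc.potential).add
    (hrc.integrable.const_mul m))).sub (hrc.integrable.sub hc.integrable)
  have hklem : ∀ x, 0 < x → 0 ≤ k x ∧ (k x = 0 → r x = ϱ x) := fun x hx => by
    have hp := h.pos x hx
    have e : k x = r x * Real.log (x * r x) - r x * Real.log (x * ϱ x) - (r x - ϱ x) := by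
      rw [hk, h.eq x hx]; ring
    rcases (hrc.nonneg x hx).eq_or_lt with h0 | h0
    · rw [e, ← h0]
      simp only [zero_mul, sub_self, zero_sub, neg_neg]
      exact ⟨hp.le, fun h => h.symm⟩
    · rw [e, Real.log_mul hx.ne' h0.ne', Real.log_mul hx.ne' hp.ne']
      have e2 : r x * (Real.log x + Real.log (r x)) - r x * (Real.log x + Real.log (ϱ x)) -
          (r x - ϱ x) = r x * ((ϱ x / r x - 1) - Real.log (ϱ x / r x)) := by
        rw [Real.log_div hp.ne' h0.ne']
        field_simp; ring
      rw [e2]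
      have h3 := Real.log_le_sub_one_of_pos (div_pos hp h0)
      refine ⟨mul_nonneg h0.le (by linarith), fun h4 => ?_⟩
      by_contra hne
      have h5 := Real.log_lt_sub_one_of_pos (div_pos hp h0) (by
        rw [Ne, div_eq_one_iff_eq h0.ne']; exact fun h => hne h.symm)
      rcases mul_eq_zero.1 h4 with h6 | h6
      · exact h0.ne' h6
      · linarith
  have hk0 : 0 ≤ᵐ[leb] k := by
    filter_upwards [ae_leb_pos] with x hx using (hklem x hx).1
  have hkint : ∫ x, k x ∂leb = (∫ x, r x * Real.log (x * r x) ∂leb) -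
      (I + (∫ x, (ext V x).re * r x ∂leb) + m * b) := by
    have s1 : Integrable (fun x => r x * T ϱ x + (ext V x).re * r x) leb := hTri.add hrc.potential
    have s2 : Integrable (fun x => r x * T ϱ x + (ext V x).re * r x + m * r x) leb :=
      s1.add (hrc.integrable.const_mul m)
    have s3 : Integrable (fun x => r x - ϱ x) leb := hrc.integrable.sub hc.integrable
    have s4 : Integrable (fun x => r x * Real.log (x * r x) -
      (r x * T ϱ x + (ext V x).re * r x + m * r x)) leb := hrc.entropy.sub s2
    change ∫ x, (r x * Real.log (x * r x) -
      (r x * T ϱ x + (ext V x).re * r x + m * r x) - (r x - ϱ x)) ∂leb = _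
    rw [integral_sub s4 s3, integral_sub hrc.entropy s2,
      integral_add s1 (hrc.integrable.const_mul m), integral_add hTri hrc.potential,
      integral_const_mul, integral_sub hrc.integrable hc.integrable, hrc.mass, hb, hI']
    ring
  have hEϱ : energy V ϱ = 1 / 2 * L + m * b := by
    have s1 : Integrable (fun x => ϱ x * T ϱ x + (ext V x).re * ϱ x) leb := hTϱi.add hc.potential
    have e1 : ∫ x, ϱ x * Real.log (x * ϱ x) ∂leb =
        ∫ x, (ϱ x * T ϱ x + (ext V x).re * ϱ x + m * ϱ x) ∂leb := by
      apply integral_congr_ae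
      filter_upwards [ae_leb_pos] with x hx
      rw [h.eq x hx]; ring
    unfold energy
    rw [e1, integral_add s1 (hc.integrable.const_mul m), integral_add hTϱi hc.potential,
      integral_const_mul, hb, ← hL'']
    change -(1 / 2) * L - _ + _ = _
    ring
  have hEr : energy V r = -(1 / 2) * L' - (∫ x, (ext V x).re * r x ∂leb) +
    ∫ x, r x * Real.log (x * r x) ∂leb := rfl
  have hdiff : energy V r - energy V ϱ = -(1 / 2) * (L' - 2 * I + L) + ∫ x, k x ∂leb := by
    rw [hEϱ, hEr, hkint]; ring
  have hkn : 0 ≤ ∫ x, k x ∂leb := integral_nonneg_of_ae hk0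
  refine ⟨by linarith, fun hle => ?_⟩
  have hk00 : ∫ x, k x ∂leb = 0 := by linarith
  rw [integral_eq_zero_iff_of_nonneg_ae hk0 hki] at hk00
  filter_upwards [hk00, ae_leb_pos] with x h1 h2
  exact (hklem x h2).2 h1

theorem IsEquilibrium.isMinimizer (h : IsEquilibrium (fun x => (ext V x).re) w ϱ m)
    (hU : IsConfined (fun x => (ext V x).re) w) (hb : ∫ x, ϱ x ∂leb = b) :
    IsMinimizer b V ϱ :=
  ⟨h.isCompetitor hU hb, fun _ hr => (h.energy_le hU hb hr).1, h.cont, h.zero⟩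

theorem IsEquilibrium.eq_of_isMinimizer (h : IsEquilibrium (fun x => (ext V x).re) w ϱ m)
    (hU : IsConfined (fun x => (ext V x).re) w) (hb : ∫ x, ϱ x ∂leb = b) {r : ℝ → ℝ}
    (hr : IsMinimizer b V r) : r = ϱ := by
  have e := (h.energy_le hU hb hr.competitor).2 (hr.min _ (h.isCompetitor hU hb))
  have e2 := Measure.eqOn_open_of_ae_eq e isOpen_Ioi hr.cont h.cont
  funext x
  rcases le_or_gt x 0 with hx | hx
  · rw [hr.zero x hx, h.zero x hx]
  · exact e2 hx

theorem IsEquilibrium.rho_eq (h : IsEquilibrium (fun x => (ext V x).re) w ϱ m)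
    (hU : IsConfined (fun x => (ext V x).re) w) (hb : ∫ x, ϱ x ∂leb = b) : rho b V = ϱ :=
  h.eq_of_isMinimizer hU hb (Classical.epsilon_spec ⟨ϱ, h.isMinimizer hU hb⟩)

theorem IsEquilibrium.eulerLagrange_iff (h : IsEquilibrium (fun x => (ext V x).re) w ϱ m)
    {m' : ℝ} : EulerLagrange V ϱ m' ↔ m' = m + 1 := by
  have e : ∀ x, 0 < x → -T ϱ x - (ext V x).re + Real.log x + Real.log (ϱ x) + 1 - m' =
      m + 1 - m' := fun x hx => by
    have := h.eq x hx
    rw [Real.log_mul hx.ne' (h.pos x hx).ne'] at this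
    linarith
  constructor
  · intro hE
    have := hE 1 one_pos
    rw [e 1 one_pos] at this
    linarith
  · rintro rfl x hx
    rw [e x hx]; ring

theorem IsEquilibrium.mu_eq (h : IsEquilibrium (fun x => (ext V x).re) w ϱ m)
    (hU : IsConfined (fun x => (ext V x).re) w) (hb : ∫ x, ϱ x ∂leb = b) : mu b V = m + 1 := by
  rw [← h.eulerLagrange_iff]
  unfold mu
  rw [h.rho_eq hU hb]
  exact Classical.epsilon_spec (p := EulerLagrange V ϱ) ⟨m + 1, h.eulerLagrange_iff.2 rfl⟩

end minimality

/-! ### Polynomial potentials -/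

/-- The weight `exp (a x^(2ℓ))`. -/
def wt (a : ℝ) (ℓ : ℕ) (x : ℝ) : ℝ := Real.exp (a * x ^ (2 * ℓ))

section potentials

variable {ℓ : ℕ} {c : ℕ → ℝ} {a : ℝ}

lemma continuous_wt : Continuous (wt a ℓ) := by unfold wt; fun_prop

lemma pow_even_nonneg (ℓ : ℕ) (x : ℝ) : 0 ≤ x ^ (2 * ℓ) := by
  rw [pow_mul]; positivity

lemma one_le_wt (ha : 0 ≤ a) (x : ℝ) : 1 ≤ wt a ℓ x :=
  Real.one_le_exp (mul_nonneg ha (pow_even_nonneg ℓ x))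

lemma wt_mul (a b : ℝ) (ℓ : ℕ) (x : ℝ) : wt a ℓ x * wt b ℓ x = wt (a + b) ℓ x := by
  unfold wt; rw [← Real.exp_add]; congr 1; ring

lemma one_add_pow_le_wt (ha : 0 < a) : ∃ C : ℝ, 0 < C ∧ ∀ x, 1 + x ^ (2 * ℓ) ≤ C * wt a ℓ x := by
  refine ⟨1 + 1 / a, by positivity, fun x => ?_⟩
  have h := Real.add_one_le_exp (a * x ^ (2 * ℓ))
  have h0 := pow_even_nonneg ℓ x
  have h1 := one_le_wt (ℓ := ℓ) ha.le x
  have h2 : x ^ (2 * ℓ) ≤ 1 / a * wt a ℓ x := by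
    rw [one_div, ← div_eq_inv_mul, le_div_iff₀ ha]
    unfold wt
    linarith
  linarith

lemma ext_pot (ℓ : ℕ) (c : ℕ → ℝ) (x : ℝ) : ext (pot ℓ c) x =
    ((-2 * c ℓ * x ^ (2 * ℓ) + ∑ j ∈ Finset.Ico 1 ℓ, 2 * (-1) ^ j * c j * x ^ (2 * j) : ℝ) : ℂ) := by
  have hI : ∀ j : ℕ, (Complex.I * x) ^ (2 * j) = (-1) ^ j * (x : ℂ) ^ (2 * j) := fun j => by
    rw [mul_pow, pow_mul Complex.I, Complex.I_sq]
  have hI' : ∀ j : ℕ, (-(Complex.I * x)) ^ (2 * j) = (-1) ^ j * (x : ℂ) ^ (2 * j) := fun j => by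
    rw [pow_mul, neg_sq, ← pow_mul, hI]
  unfold ext pot
  simp only [eval_add, eval_mul, eval_C, eval_pow, eval_X, eval_finsetSum, hI, hI']
  push_cast
  have h1 : ((-1 : ℂ)) ^ (ℓ + 1) * (-1) ^ ℓ = -1 := by
    rw [← pow_add, show ℓ + 1 + ℓ = 2 * ℓ + 1 by ring, pow_succ, pow_mul]; norm_num
  rw [add_add_add_comm, ← Finset.sum_add_distrib]
  congr 1
  · linear_combination (2 * (c ℓ : ℂ) * (x : ℂ) ^ (2 * ℓ)) * h1
  · apply Finset.sum_congr rfl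
    intro j _
    ring

lemma pow_lt_bound {ε : ℝ} (hε : 0 < ε) (ℓ : ℕ) :
    ∃ C, ∀ j < ℓ, ∀ x : ℝ, x ^ (2 * j) ≤ ε * x ^ (2 * ℓ) + C := by
  set A := max 1 (1 / ε) with hA
  have hA1 : 1 ≤ A := le_max_left _ _
  refine ⟨A ^ ℓ, fun j hj x => ?_⟩
  simp only [pow_mul]
  set y := x ^ 2 with hy
  have hy0 : 0 ≤ y := sq_nonneg x
  rcases le_total y A with h | h
  · have h1 : y ^ j ≤ A ^ j := by gcongr
    have h2 : A ^ j ≤ A ^ ℓ := pow_le_pow_right₀ hA1 hj.le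
    have h3 : 0 ≤ ε * y ^ ℓ := by positivity
    linarith
  · have h1 : 1 ≤ ε * y := by
      have : 1 / ε ≤ y := (le_max_right _ _).trans h
      rw [div_le_iff₀ hε] at this
      linarith
    have h2 : y ^ j * y ≤ y ^ ℓ := by
      rw [← pow_succ]
      exact pow_le_pow_right₀ (hA1.trans h) hj
    have h3 : y ^ j * 1 ≤ y ^ j * (ε * y) := by gcongr
    have h4 : ε * (y ^ j * y) ≤ ε * y ^ ℓ := by gcongr
    have h5 : 0 ≤ A ^ ℓ := by positivity
    linarith

lemma lower_le {ε : ℝ} (hε : 0 < ε) (ℓ : ℕ) (d : ℕ → ℝ) : ∃ C, ∀ x : ℝ,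
    |∑ j ∈ Finset.Ico 1 ℓ, d j * x ^ (2 * j)| ≤ ε * x ^ (2 * ℓ) + C := by
  set S := ∑ j ∈ Finset.Ico 1 ℓ, |d j| with hS
  have hS0 : 0 ≤ S := Finset.sum_nonneg fun _ _ => abs_nonneg _
  obtain ⟨C, hC⟩ := pow_lt_bound (ε := ε / (S + 1)) (by positivity) ℓ
  refine ⟨S * C, fun x => ?_⟩
  calc |∑ j ∈ Finset.Ico 1 ℓ, d j * x ^ (2 * j)|
      ≤ ∑ j ∈ Finset.Ico 1 ℓ, |d j| * (ε / (S + 1) * x ^ (2 * ℓ) + C) := by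
        refine (Finset.abs_sum_le_sum_abs _ _).trans (Finset.sum_le_sum fun j hj => ?_)
        rw [abs_mul, abs_of_nonneg (pow_even_nonneg j x)]
        gcongr
        exact hC j (Finset.mem_Ico.1 hj).2 x
    _ = S / (S + 1) * (ε * x ^ (2 * ℓ)) + S * C := by
        rw [← Finset.sum_mul, ← hS]; field_simp
    _ ≤ 1 * (ε * x ^ (2 * ℓ)) + S * C := by
        have := pow_even_nonneg ℓ x
        gcongr
        rw [div_le_one (by positivity)]; linarith
    _ = _ := by ring

lemma ext_pot_re (ℓ : ℕ) (c : ℕ → ℝ) (x : ℝ) : (ext (pot ℓ c) x).re =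
    -2 * c ℓ * x ^ (2 * ℓ) + ∑ j ∈ Finset.Ico 1 ℓ, 2 * (-1) ^ j * c j * x ^ (2 * j) := by
  rw [ext_pot, Complex.ofReal_re]

lemma ext_pot_ofReal (ℓ : ℕ) (c : ℕ → ℝ) (x : ℝ) :
    ext (pot ℓ c) x = ((ext (pot ℓ c) x).re : ℂ) := by
  rw [ext_pot_re, ext_pot]

lemma continuous_ext (V : ℂ[X]) : Continuous (ext V) := by
  unfold ext
  have h := V.continuous
  have h1 : Continuous fun x : ℝ => Complex.I * (x : ℂ) := by fun_prop
  exact (h.comp h1).add (h.comp h1.neg)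

lemma ll_le_pow (hℓ : 1 ≤ ℓ) {x : ℝ} (hx : 0 < x) : ll x ≤ x ^ (2 * ℓ) := by
  rcases le_total x 1 with h | h
  · rw [ll_of_le hx h]; exact pow_even_nonneg ℓ x
  · rw [ll_of_ge h]
    have h1 := Real.log_le_sub_one_of_pos hx
    have h2 : x ≤ x ^ (2 * ℓ) := le_self_pow₀ h (by omega)
    linarith

lemma exists_abs_ext_pot_le (hℓ : 1 ≤ ℓ) (hc : 0 < c ℓ) :
    ∃ C : ℝ, 0 ≤ C ∧ ∀ x, |(ext (pot ℓ c) x).re| ≤ C * (1 + x ^ (2 * ℓ)) ∧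
      x ^ (2 * ℓ) ≤ C * (1 + |(ext (pot ℓ c) x).re|) := by
  obtain ⟨C, hC⟩ := lower_le hc ℓ (fun j => 2 * (-1) ^ j * c j)
  have hC0 : 0 ≤ C := by
    have := (abs_nonneg _).trans (hC 0)
    rwa [zero_pow (by omega), mul_zero, zero_add] at this
  refine ⟨max (3 * c ℓ + C) ((1 + C) / c ℓ), by positivity, fun x => ?_⟩
  have h := abs_le.1 (hC x)
  have h0 := pow_even_nonneg ℓ x
  have h2 := mul_nonneg hC0 h0
  have h3 := mul_nonneg hc.le h0
  constructor
  · refine le_trans ?_ (mul_le_mul_of_nonneg_right (le_max_left _ _) (by linarith))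
    rw [ext_pot_re, abs_le]
    constructor <;> linarith
  · refine le_trans ?_ (mul_le_mul_of_nonneg_right (le_max_right _ _) (by positivity))
    have h1 : c ℓ * x ^ (2 * ℓ) ≤ |(ext (pot ℓ c) x).re| + C := by
      have := neg_abs_le (ext (pot ℓ c) x).re
      rw [ext_pot_re] at this ⊢
      linarith
    have h4 := abs_nonneg (ext (pot ℓ c) x).re
    rw [div_mul_eq_mul_div, le_div_iff₀ hc]
    nlinarith

lemma isConfined_pot (hℓ : 1 ≤ ℓ) (hc : 0 < c ℓ) (ha : 0 < a) :
    IsConfined (fun x => (ext (pot ℓ c) x).re) (wt a ℓ) := by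
  obtain ⟨C, hC0, hC⟩ := exists_abs_ext_pot_le hℓ hc
  obtain ⟨D, hD0, hD⟩ := one_add_pow_le_wt (ℓ := ℓ) ha
  refine ⟨continuous_wt.measurable, one_le_wt ha.le,
    (Complex.continuous_re.comp (continuous_ext _)).measurable, ⟨C * D, fun x _ => ?_⟩,
    ⟨C, fun x hx => (ll_le_pow hℓ hx).trans (hC x).2⟩⟩
  refine (hC x).1.trans ?_
  rw [mul_assoc]
  gcongr
  exact hD x

/-- The potential supplies exp(−2c x^{2ℓ}) with c = `c ℓ`. The squared weight uses c of the rate and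
the lower-order terms c/2, so a rate c/2 is left to beat any power. -/
lemma confining_pot (hc : 0 < c ℓ) (hℓ : 1 ≤ ℓ) :
    Confining (fun x => (ext (pot ℓ c) x).re) (wt (c ℓ / 2) ℓ) := by
  obtain ⟨C, hC⟩ := lower_le (half_pos hc) ℓ (fun j => 2 * (-1) ^ j * c j)
  refine ⟨Complex.continuous_re.comp (continuous_ext _), continuous_wt,
    one_le_wt (half_pos hc).le, fun n => ?_⟩
  refine ⟨Real.exp C * (n.factorial / (c ℓ / 2) ^ n), fun x hx => ?_⟩
  have h := (abs_le.1 (hC x)).2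
  have h1 : wt (c ℓ / 2) ℓ x ^ 2 * Real.exp ((ext (pot ℓ c) x).re) ≤
      Real.exp C * Real.exp (-(c ℓ / 2 * x ^ (2 * ℓ))) := by
    rw [sq, wt_mul]
    unfold wt
    rw [← Real.exp_add, ← Real.exp_add, Real.exp_le_exp, ext_pot_re]
    linarith
  have h2 : (c ℓ / 2) ^ n * x ^ n ≤ n.factorial * Real.exp (c ℓ / 2 * x ^ (2 * ℓ)) := by
    have h3 := Real.pow_div_factorial_le_exp (c ℓ / 2 * x) (by positivity) n
    rw [div_le_iff₀ (by positivity), mul_pow, mul_comm (Real.exp _)] at h3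
    refine h3.trans ?_
    gcongr
    exact le_self_pow₀ hx (by omega)
  have h4 : Real.exp (-(c ℓ / 2 * x ^ (2 * ℓ))) * x ^ n ≤ n.factorial / (c ℓ / 2) ^ n := by
    rw [le_div_iff₀ (by positivity), Real.exp_neg, inv_mul_eq_div, div_mul_eq_mul_div,
      div_le_iff₀ (Real.exp_pos _)]
    linarith
  calc _ ≤ Real.exp C * Real.exp (-(c ℓ / 2 * x ^ (2 * ℓ))) * x ^ n := by gcongr
    _ ≤ _ := by rw [mul_assoc]; gcongr

/-- The minimizer is the equilibrium density. -/
theorem exists_equilibrium (hℓ : 1 ≤ ℓ) (hc : 0 < c ℓ) {b : ℝ} (hb : 0 < b) :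
    IsEquilibrium (fun x => (ext (pot ℓ c) x).re) (wt (c ℓ / 2) ℓ) (rho b (pot ℓ c))
      (mu b (pot ℓ c) - 1) ∧ ∫ x, rho b (pot ℓ c) x ∂leb = b := by
  obtain ⟨ϱ, m, h, hm⟩ := exists_eulerLagrange (confining_pot hc hℓ) hb
  have hU := isConfined_pot hℓ hc (half_pos hc)
  rw [h.rho_eq hU hm, h.mu_eq hU hm]
  simpa using ⟨h, hm⟩

end potentials

/-! ### The bordered operator -/

lemma potl_ofReal (ν : Measure ℝ) (h : ℝ → ℝ) (x : ℝ) :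
    potl ν (fun z => (h z : ℂ)) x = ((potl ν h x : ℝ) : ℂ) := by
  unfold potl
  rw [← integral_complex_ofReal]
  congr 1; funext z
  simp

section bordered

variable {ν : Measure ℝ} {w : ℝ → ℝ}

lemma Adm.re_potl (hA : Adm ν w) {h : ℝ → ℂ} (hh : MemLp (fun z => (w z)⁻¹ • h z) 2 ν) {x : ℝ}
    (hx : x ≠ 0) : (potl ν h x).re = potl ν (fun z => (h z).re) x := by
  unfold potl
  have := integral_re (𝕜 := ℂ) (hA.integrable_lk hh hx)
  simp only [RCLike.re_to_complex] at this
  rw [← this]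
  congr 1; funext z
  simp

lemma Adm.im_potl (hA : Adm ν w) {h : ℝ → ℂ} (hh : MemLp (fun z => (w z)⁻¹ • h z) 2 ν) {x : ℝ}
    (hx : x ≠ 0) : (potl ν h x).im = potl ν (fun z => (h z).im) x := by
  unfold potl
  have := integral_im (𝕜 := ℂ) (hA.integrable_lk hh hx)
  simp only [RCLike.im_to_complex] at this
  rw [← this]
  congr 1; funext z
  simp

theorem Adm.exists_bordered (hA : Adm ν w) (hν : ν ≠ 0) {f : ℝ → ℂ} (hf : MemLp f 2 ν) (b : ℂ) :
    ∃ (h : ℝ → ℂ) (m : ℂ), MemLp h 2 ν ∧ ∫ x, h x ∂ν = b ∧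
      ∀ᵐ x ∂ν, h x = f x + potl ν h x + m := by
  have hfin := hA.isFiniteMeasure
  obtain ⟨h₁, m₁, hh₁, hb₁, he₁⟩ := hA.exists_bordered_real hν hf.re b.re
  obtain ⟨h₂, m₂, hh₂, hb₂, he₂⟩ := hA.exists_bordered_real hν hf.im b.im
  have c₁ : MemLp (fun z => (h₁ z : ℂ)) 2 ν := hh₁.ofReal
  have c₂ : MemLp (fun z => Complex.I * (h₂ z : ℂ)) 2 ν := hh₂.ofReal.const_mul _
  refine ⟨fun z => (h₁ z : ℂ) + Complex.I * (h₂ z : ℂ), m₁ + Complex.I * m₂, c₁.add c₂, ?_, ?_⟩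
  · rw [integral_add (c₁.integrable (by norm_num)) (c₂.integrable (by norm_num)),
      integral_const_mul, integral_complex_ofReal, integral_complex_ofReal, hb₁, hb₂, mul_comm]
    exact Complex.re_add_im b
  · filter_upwards [he₁, he₂, hA.ae_pos] with x h1 h2 hx
    rw [hA.potl_add (hA.weighted_memLp c₁) (hA.weighted_memLp c₂) hx.ne', potl_const_mul,
      potl_ofReal, potl_ofReal, h1, h2]
    push_cast
    have := Complex.re_add_im (f x)
    simp only [RCLike.re_to_complex, RCLike.im_to_complex]
    linear_combination this

/-- Testing with h removes m by neutrality and gives ‖h‖² = ∫ h Th ≤ 0. -/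
theorem Adm.bordered_unique_real (hA : Adm ν w) {h : ℝ → ℝ} {m : ℝ} (hh : MemLp h 2 ν)
    (h0 : ∫ x, h x ∂ν = 0) (he : ∀ᵐ x ∂ν, h x = potl ν h x + m) : h =ᵐ[ν] 0 := by
  have hfin := hA.isFiniteMeasure
  have hhi := hh.integrable (by norm_num : (1 : ℝ≥0∞) ≤ 2)
  have h1 : ∫ x, h x ^ 2 ∂ν = ∫ x, (h x * potl ν h x + m * h x) ∂ν := by
    apply integral_congr_ae
    filter_upwards [he] with x hx
    linear_combination h x * hx
  rw [integral_add (hA.integrable_mul_potl hh hh) (hhi.const_mul m), integral_const_mul, h0,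
    mul_zero, add_zero] at h1
  have h2 := hA.integral_mul_potl_nonpos hh h0
  have h3 : ∫ x, h x ^ 2 ∂ν = 0 :=
    le_antisymm (h1 ▸ h2) (integral_nonneg fun x => sq_nonneg _)
  rw [integral_eq_zero_iff_of_nonneg (fun x => sq_nonneg _) hh.integrable_sq] at h3
  filter_upwards [h3] with x hx
  exact pow_eq_zero_iff (two_ne_zero) |>.1 hx

theorem Adm.bordered_unique (hA : Adm ν w) {h : ℝ → ℂ} {m : ℂ} (hh : MemLp h 2 ν)
    (h0 : ∫ x, h x ∂ν = 0) (he : ∀ᵐ x ∂ν, h x = potl ν h x + m) : h =ᵐ[ν] 0 := by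
  have hfin := hA.isFiniteMeasure
  have hhi := hh.integrable (by norm_num : (1 : ℝ≥0∞) ≤ 2)
  have r := hA.bordered_unique_real (m := m.re) hh.re (by
      have := integral_re (𝕜 := ℂ) hhi
      rw [this, h0]; simp) (by
      filter_upwards [he, hA.ae_pos] with x hx hx0
      have := congrArg Complex.re hx
      rw [Complex.add_re, hA.re_potl (hA.weighted_memLp hh) hx0.ne'] at this
      exact this)
  have i := hA.bordered_unique_real (m := m.im) hh.im (by
      have := integral_im (𝕜 := ℂ) hhi
      rw [this, h0]; simp) (by
      filter_upwards [he, hA.ae_pos] with x hx hx0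
      have := congrArg Complex.im hx
      rw [Complex.add_im, hA.im_potl (hA.weighted_memLp hh) hx0.ne'] at this
      exact this)
  filter_upwards [r, i] with x h1 h2
  exact Complex.ext h1 h2

/-- `h ↦ ∫ h dν` on `L²(ν)`. -/
def intL (ν : Measure ℝ) [IsFiniteMeasure ν] : Lp ℂ 2 ν →L[ℂ] ℂ :=
  LinearMap.mkContinuous
    { toFun := fun h => ∫ x, h x ∂ν
      map_add' := fun h h' => by
        rw [integral_congr_ae (Lp.coeFn_add h h')]
        exact integral_add ((Lp.memLp h).integrable (by norm_num))
          ((Lp.memLp h').integrable (by norm_num))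
      map_smul' := fun c h => by
        rw [integral_congr_ae (Lp.coeFn_smul c h)]
        exact integral_const_mul c _ }
    (eLpNorm (fun _ : ℝ => (1 : ℝ)) 2 ν).toReal (fun h => by
      have h1 : eLpNorm h 1 ν ≤ eLpNorm (fun _ : ℝ => (1 : ℝ)) 2 ν * eLpNorm h 2 ν := by
        have := eLpNorm_smul_le_mul_eLpNorm (p := 2) (q := 2) (r := 1) (Lp.memLp h).1
          (aestronglyMeasurable_const (b := (1 : ℝ)) (μ := ν))
        refine le_trans (le_of_eq ?_) this
        congr 1; funext x; simp
      have h2 : ‖∫ x, h x ∂ν‖ ≤ (eLpNorm h 1 ν).toReal := by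
        rw [eLpNorm_one_eq_lintegral_enorm]
        simpa [ofReal_norm] using norm_integral_le_lintegral_norm (μ := ν) (fun x => h x)
      refine h2.trans ?_
      rw [Lp.norm_def, ← ENNReal.toReal_mul]
      exact ENNReal.toReal_mono (ENNReal.mul_ne_top (memLp_const 1).2.ne (Lp.memLp h).2.ne) h1)

/-- The constant function `m`. -/
def constL (ν : Measure ℝ) [IsFiniteMeasure ν] : ℂ →L[ℂ] Lp ℂ 2 ν :=
  (ContinuousLinearMap.id ℂ ℂ).smulRight ((memLp_const (1 : ℂ)).toLp (fun _ : ℝ => (1 : ℂ)))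

lemma constL_coe (ν : Measure ℝ) [IsFiniteMeasure ν] (m : ℂ) : constL ν m =ᵐ[ν] fun _ => m := by
  unfold constL
  simp only [ContinuousLinearMap.smulRight_apply, ContinuousLinearMap.coe_id', id]
  filter_upwards [Lp.coeFn_smul m ((memLp_const (1 : ℂ)).toLp (fun _ : ℝ => (1 : ℂ)) (μ := ν)),
    MemLp.coeFn_toLp (memLp_const (1 : ℂ) (μ := ν) (p := 2))] with x h1 h2
  rw [h1, Pi.smul_apply, h2, smul_eq_mul, mul_one]

/-- `(h, m) ↦ (h - 𝒯 h - m, ∫ h)`. -/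
def bordL (hA : Adm ν w) [IsFiniteMeasure ν] : (Lp ℂ 2 ν × ℂ) →L[ℂ] (Lp ℂ 2 ν × ℂ) :=
  ((ContinuousLinearMap.fst ℂ (Lp ℂ 2 ν) ℂ) - (opT hA ℂ) ∘L ContinuousLinearMap.fst ℂ (Lp ℂ 2 ν) ℂ
    - (constL ν) ∘L ContinuousLinearMap.snd ℂ (Lp ℂ 2 ν) ℂ).prod
    (intL ν ∘L ContinuousLinearMap.fst ℂ (Lp ℂ 2 ν) ℂ)

lemma bordL_fst (hA : Adm ν w) [IsFiniteMeasure ν] (h : Lp ℂ 2 ν) (m : ℂ) :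
    (bordL hA (h, m)).1 =ᵐ[ν] fun x => h x - potl ν h x - m := by
  have e : (bordL hA (h, m)).1 = h - opT hA ℂ h - constL ν m := rfl
  rw [e]
  filter_upwards [Lp.coeFn_sub (h - opT hA ℂ h) (constL ν m), Lp.coeFn_sub h (opT hA ℂ h),
    opT_coe hA h, constL_coe ν m] with x h1 h2 h3 h4
  rw [h1, Pi.sub_apply, h2, Pi.sub_apply, h3, h4]

lemma bordL_snd (hA : Adm ν w) [IsFiniteMeasure ν] (h : Lp ℂ 2 ν) (m : ℂ) :
    (bordL hA (h, m)).2 = ∫ x, h x ∂ν := rfl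

/-- The bordered system is uniquely solvable. -/
def bordE (hA : Adm ν w) [IsFiniteMeasure ν] (hν : ν ≠ 0) :
    (Lp ℂ 2 ν × ℂ) ≃L[ℂ] (Lp ℂ 2 ν × ℂ) :=
  ContinuousLinearEquiv.ofBijective (bordL hA)
    (by
      rw [LinearMap.ker_eq_bot']
      rintro ⟨h, m⟩ h0
      have h0 : bordL hA (h, m) = 0 := h0
      have h1 := bordL_fst hA h m
      have h2 := bordL_snd hA h m
      rw [h0] at h1 h2
      have h3 : ∀ᵐ x ∂ν, h x = potl ν h x + m := by
        filter_upwards [h1, Lp.coeFn_zero ℂ 2 ν] with x h4 h5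
        rw [show (0 : Lp ℂ 2 ν × ℂ).1 = 0 from rfl, h5, Pi.zero_apply] at h4
        linear_combination -h4
      have h4 := hA.bordered_unique (Lp.memLp h) h2.symm h3
      have h5 : potl ν h = potl ν (fun _ => (0 : ℂ)) := Adm.potl_congr h4
      have hh : h = 0 := by
        rw [← Lp.toLp_coeFn h (Lp.memLp h), ← (MemLp.zero' (ε := ℂ)).toLp_zero]
        exact MemLp.toLp_congr _ _ h4
      have hm : m = 0 := by
        have : (ae ν).NeBot := ae_neBot.2 hν
        obtain ⟨x, h6, h7⟩ := (h3.and h4).exists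
        rw [h5, h7] at h6
        simpa [potl] using h6.symm
      rw [hh, hm]; rfl)
    (by
      rw [LinearMap.range_eq_top]
      rintro ⟨f, b⟩
      obtain ⟨h, m, hh, hb, he⟩ := hA.exists_bordered hν (Lp.memLp f) b
      refine ⟨(hh.toLp h, m), ?_⟩
      have e1 := hh.coeFn_toLp
      refine Prod.ext (Lp.ext ?_) ?_
      · refine (bordL_fst hA _ m).trans ?_
        filter_upwards [e1, he] with x h1 h2
        rw [Adm.potl_congr e1, h1, h2]; ring
      · refine (bordL_snd hA _ m).trans ?_
        rw [integral_congr_ae e1, hb])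

lemma bordE_symm_spec (hA : Adm ν w) [IsFiniteMeasure ν] (hν : ν ≠ 0) (p : Lp ℂ 2 ν × ℂ) :
    ∫ x, ((bordE hA hν).symm p).1 x ∂ν = p.2 ∧
      ∀ᵐ x ∂ν, ((bordE hA hν).symm p).1 x =
        p.1 x + potl ν ((bordE hA hν).symm p).1 x + ((bordE hA hν).symm p).2 := by
  set q := (bordE hA hν).symm p with hq
  have e : bordL hA q = p := (bordE hA hν).apply_symm_apply p
  constructor
  · rw [← e]; rfl
  · have h1 := bordL_fst hA q.1 q.2
    rw [Prod.mk.eta, e] at h1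
    filter_upwards [h1] with x hx
    rw [hx]; ring

end bordered

/-! ### Pointwise bounds -/

section pointwise

variable {ν : Measure ℝ} {w : ℝ → ℝ}

/-- For a general L² charge, `exists_potl_bound` allows growth like |ln x| at the origin. If y
differs from its potential by a bounded amount there, y has the sign of the long-range potential
wherever that is large. The maximum principle near the origin then bounds it by its value at 1,
which the L² norm controls. -/
lemma Adm.exists_local_bound (hA : Adm ν w) : ∃ C : ℝ, 0 ≤ C ∧ ∀ (y : ℝ → ℝ) (B m : ℝ),
    MemLp y 2 ν → 0 ≤ B → (∀ᵐ z ∂ν, z ≤ 1 → |y z - potl ν y z - m| ≤ B) → ∀ x, 0 < x → x ≤ 1 →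
    |potl ν y x| ≤ B + |m| + C * (eLpNorm y 2 ν).toReal := by
  obtain ⟨C₁, hC₁0, hC₁⟩ := hA.one.exists_skpotl_bound (E := ℝ)
  obtain ⟨C₂, hC₂0, hC₂⟩ := hA.one.exists_potl_bound (E := ℝ)
  refine ⟨2 * C₁ + C₂, by positivity, fun y B m hy hB hloc x hx hx1 => ?_⟩
  have hyw := hA.one.weighted_memLp hy
  set N := (eLpNorm y 2 ν).toReal with hN
  have hN0 : 0 ≤ N := ENNReal.toReal_nonneg
  have e : (eLpNorm (fun z => ((1 : ℝ))⁻¹ • y z) 2 ν).toReal = N := by simp [hN]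
  have hsk : ∀ z, 0 < z → |∫ t, sk z t * y t ∂ν| ≤ C₁ * N := fun z hz => by
    have := hC₁ y hyw z hz
    rwa [e] at this
  have hdec : ∀ z, 0 < z → potl ν y z = pmax ν y z - ∫ t, sk z t * y t ∂ν := fun z hz =>
    hA.one.potl_eq hyw hz
  have hone : |potl ν y 1| ≤ C₂ * N := by
    have := hC₂ y hyw 1 one_pos
    rw [tt_of_ge le_rfl, ll_of_le one_pos le_rfl, e] at this
    simpa using this
  have hp1 : |pmax ν y 1| ≤ (C₁ + C₂) * N := by
    have h1 := hdec 1 one_pos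
    have h2 := abs_le.1 (hsk 1 one_pos)
    have h3 := abs_le.1 hone
    rw [abs_le]
    constructor <;> linarith
  have hm := abs_le.1 (le_refl |m|)
  have hup : pmax ν y x ≤ B + |m| + (C₁ + C₂) * N := by
    refine (hA.one.pmax_le_of_local hyw (M := B + |m| + C₁ * N) ?_ hx hx1).trans (max_le ?_ ?_)
    · filter_upwards [hloc, hA.ae_pos] with z h1 h2 h3 h4
      have h5 := abs_le.1 (h1 h3)
      have h6 := abs_le.1 (hsk z h2)
      have h7 := hdec z h2
      linarith
    · have := mul_nonneg hC₂0 hN0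
      linarith
    · linarith [(abs_le.1 hp1).2, abs_nonneg m]
  have hlow : -(pmax ν y x) ≤ B + |m| + (C₁ + C₂) * N := by
    rw [← pmax_neg]
    refine (hA.one.pmax_le_of_local (by convert hyw.neg using 2; simp)
      (M := B + |m| + C₁ * N) ?_ hx hx1).trans (max_le ?_ ?_)
    · filter_upwards [hloc, hA.ae_pos] with z h1 h2 h3 h4
      rw [pmax_neg] at h4
      have h5 := abs_le.1 (h1 h3)
      have h6 := abs_le.1 (hsk z h2)
      have h7 := hdec z h2
      linarith
    · have := mul_nonneg hC₂0 hN0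
      linarith
    · rw [pmax_neg]
      linarith [(abs_le.1 hp1).1, abs_nonneg m]
  have h1 := hdec x hx
  have h2 := abs_le.1 (hsk x hx)
  rw [abs_le]
  constructor <;> linarith

/-- Potentials of charges which are locally a bounded perturbation of their potential. -/
lemma Adm.exists_global_bound (hA : Adm ν w) : ∃ C : ℝ, 0 ≤ C ∧ ∀ (h : ℝ → ℂ) (B : ℝ) (m : ℂ),
    MemLp h 2 ν → 0 ≤ B → (∀ᵐ z ∂ν, z ≤ 1 → ‖h z - potl ν h z - m‖ ≤ B) → ∀ x, 0 < x →
    ‖potl ν h x‖ ≤ C * (B + ‖m‖ + (eLpNorm h 2 ν).toReal) * (1 + ll x) := by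
  obtain ⟨C₁, hC₁0, hC₁⟩ := hA.exists_local_bound
  obtain ⟨C₂, hC₂0, hC₂⟩ := hA.one.exists_potl_bound (E := ℂ)
  refine ⟨max (2 + 2 * C₁) C₂, by positivity, fun h B m hh hB hloc x hx => ?_⟩
  have hhw := hA.one.weighted_memLp hh
  set N := (eLpNorm h 2 ν).toReal with hN
  have hN0 : 0 ≤ N := ENNReal.toReal_nonneg
  have hm := norm_nonneg m
  rcases le_total x 1 with hx1 | hx1
  · have hr : (eLpNorm (fun z => (h z).re) 2 ν).toReal ≤ N :=
      ENNReal.toReal_mono hh.2.ne (eLpNorm_mono fun z => Complex.abs_re_le_norm _)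
    have hi : (eLpNorm (fun z => (h z).im) 2 ν).toReal ≤ N :=
      ENNReal.toReal_mono hh.2.ne (eLpNorm_mono fun z => Complex.abs_im_le_norm _)
    have h1 := hC₁ (fun z => (h z).re) B m.re hh.re hB (by
      filter_upwards [hloc, hA.ae_pos] with z h1 h2 h3
      rw [← hA.one.re_potl hhw h2.ne']
      exact (Complex.abs_re_le_norm (h z - potl ν h z - m)).trans (h1 h3)) x hx hx1
    have h2 := hC₁ (fun z => (h z).im) B m.im hh.im hB (by
      filter_upwards [hloc, hA.ae_pos] with z h1 h2 h3
      rw [← hA.one.im_potl hhw h2.ne']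
      exact (Complex.abs_im_le_norm (h z - potl ν h z - m)).trans (h1 h3)) x hx hx1
    rw [← hA.one.re_potl hhw hx.ne'] at h1
    rw [← hA.one.im_potl hhw hx.ne'] at h2
    have h3 := Complex.norm_le_abs_re_add_abs_im (potl ν h x)
    have h4 := Complex.abs_re_le_norm m
    have h5 := Complex.abs_im_le_norm m
    have h6 := mul_le_mul_of_nonneg_left hr hC₁0
    have h7 := mul_le_mul_of_nonneg_left hi hC₁0
    rw [ll_of_le hx hx1, add_zero, mul_one]
    have h8 : (2 + 2 * C₁) * (B + ‖m‖ + N) ≤ max (2 + 2 * C₁) C₂ * (B + ‖m‖ + N) := by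
      gcongr; exact le_max_left _ _
    have h9 : 0 ≤ C₁ * B + C₁ * ‖m‖ := by positivity
    nlinarith
  · have h1 := hC₂ h hhw x hx
    rw [tt_of_ge hx1, add_zero] at h1
    simp only [inv_one, one_smul] at h1
    refine h1.trans ?_
    have h2 := ll_nonneg x
    calc C₂ * (1 + ll x) * N = C₂ * N * (1 + ll x) := by ring
      _ ≤ _ := by
        gcongr
        · exact le_max_right _ _
        · linarith

end pointwise

/-! ### The response operator on bounded functions -/

/-- Extension by zero of a function on `(0, ∞)`. -/
def extF (F : Ioi (0 : ℝ) →ᵇ ℂ) : ℝ → ℂ := Function.extend Subtype.val F 0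

lemma extF_apply (F : Ioi (0 : ℝ) →ᵇ ℂ) (x : Ioi (0 : ℝ)) : extF F x = F x :=
  Subtype.val_injective.extend_apply _ _ _

lemma extF_pos (F : Ioi (0 : ℝ) →ᵇ ℂ) {x : ℝ} (hx : 0 < x) : extF F x = F ⟨x, hx⟩ :=
  extF_apply F ⟨x, hx⟩

lemma measurable_extF (F : Ioi (0 : ℝ) →ᵇ ℂ) : Measurable (extF F) :=
  (MeasurableEmbedding.subtype_coe measurableSet_Ioi).measurable_extend F.continuous.measurable
    measurable_const

lemma norm_extF_le (F : Ioi (0 : ℝ) →ᵇ ℂ) {x : ℝ} (hx : 0 < x) : ‖extF F x‖ ≤ ‖F‖ := by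
  rw [extF_pos F hx]; exact F.norm_coe_le_norm _

section response

variable {ν : Measure ℝ} {w : ℝ → ℝ}

lemma Adm.memLp_mul_extF (hA : Adm ν w) (F : Ioi (0 : ℝ) →ᵇ ℂ) :
    MemLp (fun x => w x • extF F x) 2 ν ∧
      (eLpNorm (fun x => w x • extF F x) 2 ν).toReal ≤ ‖F‖ * (eLpNorm w 2 ν).toReal := by
  have hb : ∀ᵐ x ∂ν, ‖w x • extF F x‖ ≤ ‖F‖ * ‖w x‖ := by
    filter_upwards [hA.ae_pos] with x hx
    rw [norm_smul, mul_comm]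
    gcongr
    exact norm_extF_le F hx
  refine ⟨hA.memLp_w.of_le_mul (hA.meas.aestronglyMeasurable.smul
    (measurable_extF F).aestronglyMeasurable) hb, ?_⟩
  have h := eLpNorm_le_mul_eLpNorm_of_ae_le_mul hb 2
  refine (ENNReal.toReal_mono (ENNReal.mul_ne_top ENNReal.ofReal_ne_top hA.memLp_w.2.ne) h).trans ?_
  rw [ENNReal.toReal_mul, ENNReal.toReal_ofReal (norm_nonneg _)]

/-- Multiplication by the weight, from bounded functions to `L²(ν)`. -/
def multW (hA : Adm ν w) : (Ioi (0 : ℝ) →ᵇ ℂ) →L[ℂ] Lp ℂ 2 ν :=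
  LinearMap.mkContinuous
    { toFun := fun F => (hA.memLp_mul_extF F).1.toLp _
      map_add' := fun F G => by
        rw [← MemLp.toLp_add]
        apply MemLp.toLp_congr
        filter_upwards [hA.ae_pos] with x hx
        simp only [Pi.add_apply, extF_pos _ hx, BoundedContinuousFunction.coe_add, smul_add]
      map_smul' := fun c F => by
        rw [← MemLp.toLp_const_smul]
        apply MemLp.toLp_congr
        filter_upwards [hA.ae_pos] with x hx
        simp only [Pi.smul_apply, extF_pos _ hx, BoundedContinuousFunction.coe_smul,
          RingHom.id_apply]
        rw [smul_comm] }
    (eLpNorm w 2 ν).toReal (fun F => by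
      simp only [LinearMap.coe_mk, AddHom.coe_mk]
      rw [Lp.norm_toLp, mul_comm]
      exact (hA.memLp_mul_extF F).2)

lemma multW_coe (hA : Adm ν w) (F : Ioi (0 : ℝ) →ᵇ ℂ) :
    multW hA F =ᵐ[ν] fun x => w x • extF F x := (hA.memLp_mul_extF F).1.coeFn_toLp

/-- `(F, b) ↦ (u / λ, m)` where `u = 𝒯 h + m` for the solution of `h = w F + 𝒯 h + m`, `∫ h = b`. -/
theorem Adm.exists_response (hA : Adm ν w) [IsFiniteMeasure ν] (hν : ν ≠ 0) (hw : Continuous w)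
    {lam : ℝ → ℝ}
    (hlc : Continuous lam) (hl1 : ∀ x, 1 ≤ lam x) (hll : ∀ x, 0 < x → ll x ≤ lam x) :
    ∃ K : (Ioi (0 : ℝ) →ᵇ ℂ) × ℂ →L[ℂ] (Ioi (0 : ℝ) →ᵇ ℂ), ∀ p, ∀ x : Ioi (0 : ℝ),
      (lam x : ℂ) * K p x = potl ν ((bordE hA hν).symm (multW hA p.1, p.2)).1 x +
        ((bordE hA hν).symm (multW hA p.1, p.2)).2 := by
  set S : (Ioi (0 : ℝ) →ᵇ ℂ) × ℂ →L[ℂ] Lp ℂ 2 ν × ℂ :=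
    ((bordE hA hν).symm : (Lp ℂ 2 ν × ℂ) →L[ℂ] (Lp ℂ 2 ν × ℂ)) ∘L
    ((multW hA).prodMap (ContinuousLinearMap.id ℂ ℂ)) with hS
  have hSe : ∀ p, S p = (bordE hA hν).symm (multW hA p.1, p.2) := fun p => rfl
  obtain ⟨C, hC0, hC⟩ := hA.exists_global_bound
  obtain ⟨W, hW⟩ := (isCompact_Icc (a := (0 : ℝ)) (b := 1)).exists_bound_of_continuousOn
    hw.continuousOn
  have hW0 : 0 ≤ W := (norm_nonneg _).trans (hW 0 (by simp))
  set D := 2 * (C * (W + ‖S‖ + ‖S‖)) + ‖S‖ with hD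
  have hD0 : 0 ≤ D := by positivity
  have hmem : ∀ g : Lp ℂ 2 ν, MemLp (fun z => (w z)⁻¹ • g z) 2 ν := fun g =>
    hA.weighted_memLp (Lp.memLp g)
  have hpot : ∀ p, ∀ x : Ioi (0 : ℝ), ‖(lam x : ℂ)⁻¹ * (potl ν (S p).1 x + (S p).2)‖ ≤
      D * ‖p‖ := by
    intro p x
    have hx : (0 : ℝ) < x := x.2
    obtain ⟨-, he⟩ := bordE_symm_spec hA hν (multW hA p.1, p.2)
    rw [← hSe] at he
    have h1 : ‖(S p).1‖ ≤ ‖S‖ * ‖p‖ := (norm_fst_le _).trans (S.le_opNorm p)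
    have h2 : ‖(S p).2‖ ≤ ‖S‖ * ‖p‖ := (norm_snd_le _).trans (S.le_opNorm p)
    -- On (0,1] the source w F is bounded, since w is continuous; this is the local hypothesis of
    -- `exists_global_bound`.
    have h3 := hC (S p).1 (W * ‖p‖) (S p).2 (Lp.memLp _) (by positivity) (by
      filter_upwards [he, multW_coe hA p.1, hA.ae_pos] with z hz h4 h5 h6
      rw [hz, h4]
      have : w z • extF p.1 z + potl ν (S p).1 z + (S p).2 - potl ν (S p).1 z - (S p).2 =
        w z • extF p.1 z := by ring
      rw [this, norm_smul]
      exact mul_le_mul (hW z ⟨h5.le, h6⟩) ((norm_extF_le _ h5).trans (norm_fst_le p))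
        (norm_nonneg _) hW0) x hx
    rw [← Lp.norm_def] at h3
    have hl0 : 0 < lam x := one_pos.trans_le (hl1 x)
    rw [norm_mul, norm_inv, Complex.norm_real, Real.norm_of_nonneg hl0.le, inv_mul_le_iff₀ hl0]
    have h4 : 1 + ll x ≤ 2 * lam x := by linarith [hll x hx, hl1 x]
    calc ‖potl ν (S p).1 x + (S p).2‖ ≤ ‖potl ν (S p).1 x‖ + ‖(S p).2‖ := norm_add_le _ _
      _ ≤ C * (W * ‖p‖ + ‖S‖ * ‖p‖ + ‖S‖ * ‖p‖) * (2 * lam x) + ‖S‖ * ‖p‖ * lam x := by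
          refine add_le_add (h3.trans ?_) (h2.trans (le_mul_of_one_le_right (by positivity)
            (hl1 x)))
          have := ll_nonneg (x : ℝ)
          gcongr
      _ = lam x * (D * ‖p‖) := by rw [hD]; ring
  have hcont : ∀ p, Continuous fun x : Ioi (0 : ℝ) =>
      (lam x : ℂ)⁻¹ * (potl ν (S p).1 x + (S p).2) := by
    intro p
    have h1 : Continuous fun x : Ioi (0 : ℝ) => potl ν (S p).1 x :=
      (hA.continuousOn_potl (hmem _)).domRestrict
    have h2 : Continuous fun x : Ioi (0 : ℝ) => (lam x : ℂ)⁻¹ := by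
      refine Continuous.inv₀ (by fun_prop) fun x => ?_
      exact_mod_cast (one_pos.trans_le (hl1 x)).ne'
    fun_prop
  refine ⟨LinearMap.mkContinuous
    { toFun := fun p => BoundedContinuousFunction.ofNormedAddCommGroup _ (hcont p) (D * ‖p‖) (hpot p)
      map_add' := fun p q => ?_
      map_smul' := fun c p => ?_ } D (fun p => ?_), fun p x => ?_⟩
  · ext x
    have hx : (x : ℝ) ≠ 0 := ne_of_gt x.2
    have e : potl ν (S (p + q)).1 x = potl ν (S p).1 x + potl ν (S q).1 x := by
      rw [← hA.potl_add (hmem _) (hmem _) hx, map_add]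
      exact congrFun (Adm.potl_congr (Lp.coeFn_add _ _)) _
    simp only [BoundedContinuousFunction.coe_ofNormedAddCommGroup,
      BoundedContinuousFunction.coe_add, Pi.add_apply]
    rw [e, map_add, Prod.snd_add]; ring
  · ext x
    have e : potl ν (S (c • p)).1 x = c * potl ν (S p).1 x := by
      rw [← potl_const_mul, map_smul]
      exact congrFun (Adm.potl_congr (Lp.coeFn_smul _ _)) _
    simp only [BoundedContinuousFunction.coe_ofNormedAddCommGroup,
      BoundedContinuousFunction.coe_smul, RingHom.id_apply, smul_eq_mul]
    rw [e, map_smul, Prod.smul_snd, smul_eq_mul]; ring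
  · exact BoundedContinuousFunction.norm_ofNormedAddCommGroup_le (hcont p) (by positivity) (hpot p)
  · have hl0 : (lam x : ℂ) ≠ 0 := by exact_mod_cast (one_pos.trans_le (hl1 x)).ne'
    simp only [LinearMap.mkContinuous_apply, LinearMap.coe_mk, AddHom.coe_mk,
      BoundedContinuousFunction.coe_ofNormedAddCommGroup]
    rw [mul_inv_cancel_left₀ hl0, hSe]

end response

/-! ### Smoothness of a weighted exponential -/

lemma norm_exp_sub_one_le (z : ℂ) : ‖Complex.exp z - 1‖ ≤ ‖z‖ * max 1 (Real.exp z.re) := by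
  have h := norm_image_sub_le_of_norm_deriv_le_segment_01' (f := fun t : ℝ => Complex.exp (t * z))
    (f' := fun t : ℝ => Complex.exp (t * z) * z) (C := ‖z‖ * max 1 (Real.exp z.re)) ?_ ?_
  · simpa using h
  · intro t _
    have h1 : HasDerivAt (fun t : ℝ => (t : ℂ) * z) z t := by
      simpa using (Complex.ofRealCLM.hasDerivAt (x := t)).mul_const z
    exact h1.cexp.hasDerivWithinAt
  · intro t ht
    rw [norm_mul, Complex.norm_exp, mul_comm]
    gcongr
    rw [show ((t : ℂ) * z).re = t * z.re by simp]
    rcases le_total z.re 0 with h0 | h0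
    · exact le_max_of_le_left (Real.exp_le_one_iff.2 (mul_nonpos_of_nonneg_of_nonpos ht.1 h0))
    · exact le_max_of_le_right (Real.exp_le_exp.2 (mul_le_of_le_one_left h0 ht.2.le))

lemma norm_exp_sub_one_sub_le (z : ℂ) :
    ‖Complex.exp z - 1 - z‖ ≤ ‖z‖ ^ 2 * max 1 (Real.exp z.re) := by
  have h := norm_image_sub_le_of_norm_deriv_le_segment_01'
    (f := fun t : ℝ => Complex.exp (t * z) - t * z)
    (f' := fun t : ℝ => Complex.exp (t * z) * z - z) (C := ‖z‖ ^ 2 * max 1 (Real.exp z.re)) ?_ ?_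
  · refine le_trans (le_of_eq ?_) h
    congr 1; simp; ring
  · intro t _
    have h1 : HasDerivAt (fun t : ℝ => (t : ℂ) * z) z t := by
      simpa using (Complex.ofRealCLM.hasDerivAt (x := t)).mul_const z
    exact (h1.cexp.sub h1).hasDerivWithinAt
  · intro t ht
    have h1 := norm_exp_sub_one_le (t * z)
    rw [show ((t : ℂ) * z).re = t * z.re by simp, norm_mul, Complex.norm_real,
      Real.norm_of_nonneg ht.1] at h1
    have h2 : max 1 (Real.exp (t * z.re)) ≤ max 1 (Real.exp z.re) := by
      refine max_le (le_max_left _ _) ?_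
      rcases le_total z.re 0 with h0 | h0
      · exact le_max_of_le_left (Real.exp_le_one_iff.2 (mul_nonpos_of_nonneg_of_nonpos ht.1 h0))
      · exact le_max_of_le_right (Real.exp_le_exp.2 (mul_le_of_le_one_left h0 ht.2.le))
    calc ‖Complex.exp (t * z) * z - z‖ = ‖Complex.exp (t * z) - 1‖ * ‖z‖ := by
          rw [← norm_mul]; congr 1; ring
      _ ≤ (1 * ‖z‖ * max 1 (Real.exp z.re)) * ‖z‖ := by
          gcongr
          refine h1.trans ?_
          gcongr
          exact ht.2.le
      _ = _ := by ring

/-- A family of exponents `B x v`, linear in `v`, whose real parts are controlled by `lam`. -/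
structure Exponents (X V : Type*) [TopologicalSpace X] [NormedAddCommGroup V]
    [NormedSpace ℝ V] where
  /-- the exponents -/
  B : X → V →L[ℝ] ℂ
  /-- the control of the real part -/
  lam : X → ℝ
  /-- the control of the modulus -/
  q : X → ℝ
  /-- the constant in the control of the real part -/
  C : ℝ
  B_cont : ∀ v, Continuous fun x => B x v
  lam_cont : Continuous lam
  lam_nonneg : ∀ x, 0 ≤ lam x
  C_pos : 0 < C
  norm_le : ∀ x v, ‖B x v‖ ≤ q x * ‖v‖
  one_le : ∀ x, 1 ≤ q x
  re_le : ∀ x v, (B x v).re ≤ C * lam x * ‖v‖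
  decay : ∀ ε > 0, ∃ M, 0 ≤ M ∧ ∀ x, q x ^ 2 * Real.exp (-(ε * lam x)) ≤ M

namespace Exponents

variable {X V : Type*} [TopologicalSpace X] [NormedAddCommGroup V] [NormedSpace ℝ V]
  (S : Exponents X V)

lemma norm_exp_le {a : ℝ} {v : V} (x : X) :
    ‖Complex.exp (-(a * S.lam x : ℝ) + S.B x v)‖ ≤ Real.exp (-((a - S.C * ‖v‖) * S.lam x)) := by
  rw [Complex.norm_exp, Real.exp_le_exp, Complex.add_re, Complex.neg_re, Complex.ofReal_re]
  linarith [S.re_le x v]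

open Classical in
/-- `exp (-a lam + B v)`, for small `v`. -/
def E (a : ℝ) (v : V) : X →ᵇ ℂ :=
  if h : S.C * ‖v‖ ≤ a then
    BoundedContinuousFunction.ofNormedAddCommGroup
      (fun x => Complex.exp (-(a * S.lam x : ℝ) + S.B x v))
      (by have := S.B_cont v; have := S.lam_cont; fun_prop) 1
      (fun x => (S.norm_exp_le x).trans (Real.exp_le_one_iff.2 (by
        have := mul_nonneg (sub_nonneg.2 h) (S.lam_nonneg x); linarith)))
  else 0

lemma E_apply {a : ℝ} {v : V} (h : S.C * ‖v‖ ≤ a) (x : X) :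
    S.E a v x = Complex.exp (-(a * S.lam x : ℝ) + S.B x v) := by
  unfold E; rw [dif_pos h]; rfl

lemma q_exp_le {ε M : ℝ} (hM : ∀ x, S.q x ^ 2 * Real.exp (-(ε * S.lam x)) ≤ M) (x : X) :
    S.q x * Real.exp (-(ε * S.lam x)) ≤ M := by
  refine le_trans ?_ (hM x)
  gcongr
  exact le_self_pow₀ (S.one_le x) (by norm_num)

/-- `v ↦ exp (-ε lam) B v`. -/
def L {ε : ℝ} (hε : 0 < ε) : V →L[ℝ] (X →ᵇ ℂ) :=
  have hb : ∀ v x, ‖Complex.exp (-(ε * S.lam x : ℝ)) * S.B x v‖ ≤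
      (S.decay ε hε).choose * ‖v‖ := fun v x => by
    obtain ⟨-, hM⟩ := (S.decay ε hε).choose_spec
    rw [norm_mul, Complex.norm_exp, Complex.neg_re, Complex.ofReal_re]
    calc _ ≤ Real.exp (-(ε * S.lam x)) * (S.q x * ‖v‖) := by gcongr; exact S.norm_le x v
      _ = (S.q x * Real.exp (-(ε * S.lam x))) * ‖v‖ := by ring
      _ ≤ _ := by gcongr; exact S.q_exp_le hM x
  LinearMap.mkContinuous
    { toFun := fun v => BoundedContinuousFunction.ofNormedAddCommGroup
        (fun x => Complex.exp (-(ε * S.lam x : ℝ)) * S.B x v)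
        (by have := S.B_cont v; have := S.lam_cont; fun_prop)
        ((S.decay ε hε).choose * ‖v‖) (hb v)
      map_add' := fun v v' => by
        ext x
        simp only [BoundedContinuousFunction.coe_ofNormedAddCommGroup,
          BoundedContinuousFunction.coe_add, Pi.add_apply, map_add]
        ring
      map_smul' := fun c v => by
        ext x
        simp only [BoundedContinuousFunction.coe_ofNormedAddCommGroup,
          BoundedContinuousFunction.coe_smul, RingHom.id_apply, map_smul, Complex.real_smul]
        ring }
    (S.decay ε hε).choose (fun v => BoundedContinuousFunction.norm_ofNormedAddCommGroup_le _
      (mul_nonneg (S.decay ε hε).choose_spec.1 (norm_nonneg v)) (hb v))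

/-- `F ↦ (v ↦ F exp (-ε lam) B v)`. -/
def D {ε : ℝ} (hε : 0 < ε) : (X →ᵇ ℂ) →L[ℝ] V →L[ℝ] (X →ᵇ ℂ) :=
  ((ContinuousLinearMap.compL ℝ V (X →ᵇ ℂ) (X →ᵇ ℂ)).flip (S.L hε)) ∘L
    ContinuousLinearMap.mul ℝ (X →ᵇ ℂ)

lemma D_apply {ε : ℝ} (hε : 0 < ε) (F : X →ᵇ ℂ) (v : V) (x : X) :
    S.D hε F v x = F x * (Complex.exp (-(ε * S.lam x : ℝ)) * S.B x v) := rfl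

/-- The exponents are unbounded in x, so differentiation costs a factor of size q. It is paid for by
giving up ε of the decay rate: the derivative is `E` at rate a − ε multiplied by exp(−ε lam) B. -/
lemma hasFDerivAt_E {a ε : ℝ} (hε : 0 < ε) {v : V} (h : S.C * ‖v‖ < a - ε) :
    HasFDerivAt (S.E a) (S.D hε (S.E (a - ε) v)) v := by
  -- The rest of the decay rate absorbs the growth of exp(Re B(y − v)) in the Taylor remainder,
  -- while ε absorbs q².
  set δ := a - ε - S.C * ‖v‖ with hδ
  have hδ0 : 0 < δ := by rw [hδ]; linarith
  obtain ⟨M, hM0, hM⟩ := S.decay ε hε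
  have hev : ∀ᶠ y in 𝓝 v, S.C * ‖y - v‖ < δ := by
    have : Continuous fun y => S.C * ‖y - v‖ := by fun_prop
    apply this.continuousAt.eventually (gt_mem_nhds _)
    simpa using hδ0
  have key : (fun y => S.E a y - S.E a v - S.D hε (S.E (a - ε) v) (y - v)) =O[𝓝 v]
      fun y => ‖y - v‖ ^ 2 := by
    apply Asymptotics.IsBigO.of_bound M
    filter_upwards [hev] with y hy
    rw [norm_pow, norm_norm]
    rw [BoundedContinuousFunction.norm_le (by positivity)]
    intro x
    have hyv : ‖y‖ ≤ ‖v‖ + ‖y - v‖ := by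
      calc ‖y‖ = ‖v + (y - v)‖ := by congr 1; abel
        _ ≤ _ := norm_add_le _ _
    have hya : S.C * ‖y‖ ≤ a := by
      have := mul_le_mul_of_nonneg_left hyv S.C_pos.le
      linarith
    have hl := S.lam_nonneg x
    simp only [BoundedContinuousFunction.coe_sub, Pi.sub_apply]
    rw [S.D_apply, S.E_apply hya, S.E_apply (by linarith), S.E_apply h.le]
    have e : Complex.exp (-(a * S.lam x : ℝ) + S.B x y) -
        Complex.exp (-(a * S.lam x : ℝ) + S.B x v) -
        Complex.exp (-((a - ε) * S.lam x : ℝ) + S.B x v) *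
          (Complex.exp (-(ε * S.lam x : ℝ)) * S.B x (y - v)) =
        Complex.exp (-(a * S.lam x : ℝ) + S.B x v) *
          (Complex.exp (S.B x (y - v)) - 1 - S.B x (y - v)) := by
      have e1 : Complex.exp (-(a * S.lam x : ℝ) + S.B x y) =
          Complex.exp (-(a * S.lam x : ℝ) + S.B x v) * Complex.exp (S.B x (y - v)) := by
        rw [← Complex.exp_add, map_sub]; congr 1; ring
      have e2 : Complex.exp (-(a * S.lam x : ℝ) + S.B x v) =
          Complex.exp (-((a - ε) * S.lam x : ℝ) + S.B x v) *
            Complex.exp (-(ε * S.lam x : ℝ)) := by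
        rw [← Complex.exp_add]; congr 1; push_cast; ring
      rw [e1, ← mul_assoc, ← e2]; ring
    rw [e, norm_mul]
    have h1 := norm_exp_sub_one_sub_le (S.B x (y - v))
    have h2 := S.norm_le x (y - v)
    have h3 : max 1 (Real.exp (S.B x (y - v)).re) ≤ Real.exp (δ * S.lam x) := by
      refine max_le (Real.one_le_exp (by positivity)) (Real.exp_le_exp.2 ?_)
      refine (S.re_le x (y - v)).trans ?_
      have := mul_le_mul_of_nonneg_right hy.le hl
      linarith
    calc _ ≤ Real.exp (-((a - S.C * ‖v‖) * S.lam x)) *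
          ((S.q x * ‖y - v‖) ^ 2 * Real.exp (δ * S.lam x)) := by
          gcongr
          · exact S.norm_exp_le x
          · refine h1.trans ?_
            gcongr
      _ = (S.q x ^ 2 * Real.exp (-(ε * S.lam x))) * ‖y - v‖ ^ 2 := by
          rw [mul_pow, show -(ε * S.lam x) = -((a - S.C * ‖v‖) * S.lam x) + δ * S.lam x by
            rw [hδ]; ring, Real.exp_add]
          ring
      _ ≤ _ := by gcongr; exact hM x
  rw [hasFDerivAt_iff_isLittleO]
  refine key.trans_isLittleO ?_
  have h2 : (fun y : V => ‖y - v‖) =o[𝓝 v] fun _ => (1 : ℝ) := by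
    rw [Asymptotics.isLittleO_one_iff]
    have : Continuous fun y : V => ‖y - v‖ := by fun_prop
    simpa using this.tendsto v
  have h3 := (Asymptotics.isBigO_refl (fun y : V => ‖y - v‖) (𝓝 v)).mul_isLittleO h2
  simp only [mul_one] at h3
  refine (Asymptotics.IsLittleO.congr_left h3 fun y => ?_).norm_right.trans_isBigO ?_
  · ring
  · simpa using (Asymptotics.isBigO_refl (fun y : V => y - v) (𝓝 v))

/-- Each derivative gives up half of the remaining gap a − C‖v‖, so any finite order can be reached.
The induction runs over all rates at once, since the derivative involves a smaller one. -/
lemma contDiffAt_E (n : ℕ) : ∀ {a : ℝ} {v : V}, S.C * ‖v‖ < a → ContDiffAt ℝ n (S.E a) v := by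
  induction n with
  | zero =>
    intro a v h
    have hε : 0 < (a - S.C * ‖v‖) / 2 := by linarith
    rw [Nat.cast_zero, contDiffAt_zero]
    have hev : ∀ᶠ y in 𝓝 v, S.C * ‖y‖ < a - (a - S.C * ‖v‖) / 2 := by
      have : Continuous fun y : V => S.C * ‖y‖ := by fun_prop
      exact this.continuousAt.eventually (gt_mem_nhds (by linarith))
    exact ⟨_, hev, fun y hy => (S.hasFDerivAt_E hε hy).continuousAt.continuousWithinAt⟩
  | succ n ih =>
    intro a v h
    have hε : 0 < (a - S.C * ‖v‖) / 2 := by linarith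
    rw [Nat.cast_add, Nat.cast_one, contDiffAt_succ_iff_hasFDerivAt]
    have hev : ∀ᶠ y in 𝓝 v, S.C * ‖y‖ < a - (a - S.C * ‖v‖) / 2 := by
      have : Continuous fun y : V => S.C * ‖y‖ := by fun_prop
      exact this.continuousAt.eventually (gt_mem_nhds (by linarith))
    refine ⟨fun y => S.D hε (S.E (a - (a - S.C * ‖v‖) / 2) y),
      ⟨_, hev, fun y hy => S.hasFDerivAt_E hε hy⟩, ?_⟩
    have hD : ContDiff ℝ n (fun F => S.D hε F) :=
      ContinuousLinearMap.contDiff (E := X →ᵇ ℂ) (F := V →L[ℝ] (X →ᵇ ℂ)) (S.D hε)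
    exact hD.contDiffAt.comp v (ih (by linarith))

end Exponents

/-! ### Directions -/

/-- `1 + x^(2ℓ)`. -/
def lam (ℓ : ℕ) (x : ℝ) : ℝ := 1 + x ^ (2 * ℓ)

section directions

variable {ℓ : ℕ}

lemma continuous_lam : Continuous (lam ℓ) := by unfold lam; fun_prop

lemma one_le_lam (x : ℝ) : 1 ≤ lam ℓ x := by
  unfold lam; linarith [pow_even_nonneg ℓ x]

lemma lam_pos (x : ℝ) : 0 < lam ℓ x := one_pos.trans_le (one_le_lam x)

lemma le_lam (hℓ : 1 ≤ ℓ) (x : ℝ) : x ≤ lam ℓ x := by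
  unfold lam
  rcases le_total x 1 with h | h
  · linarith [pow_even_nonneg ℓ x]
  · linarith [le_self_pow₀ h (show 2 * ℓ ≠ 0 by omega)]

lemma ext_add (V W : ℂ[X]) (x : ℝ) : ext (V + W) x = ext V x + ext W x := by
  unfold ext; simp only [eval_add]; ring

lemma ext_C_mul (s : ℂ) (W : ℂ[X]) (x : ℝ) : ext (C s * W) x = s * ext W x := by
  unfold ext; simp only [eval_mul, eval_C]; ring

/-- Each monomial contributes its coefficient times a real number. So Re `ext W` depends only on the
real parts of the coefficients; the imaginary ones of degree above 2ℓ produce mere oscillation,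
which is why such directions are admissible. -/
lemma ext_eq_sum (W : ℂ[X]) (x : ℝ) : ext W x =
    ∑ k ∈ Finset.range (W.natDegree + 1), W.coeff k * ((2 * ((Complex.I * x) ^ k).re : ℝ) : ℂ) := by
  unfold ext
  rw [eval_eq_sum_range, eval_eq_sum_range, ← Finset.sum_add_distrib]
  apply Finset.sum_congr rfl
  intro k _
  rw [← mul_add]
  congr 1
  rw [← Complex.add_conj, map_pow]
  simp

lemma abs_re_pow_le (x : ℝ) (k : ℕ) : |2 * ((Complex.I * x) ^ k).re| ≤ 2 * |x| ^ k := by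
  rw [abs_mul, abs_two]
  gcongr
  refine (Complex.abs_re_le_norm _).trans (le_of_eq ?_)
  simp

lemma exists_norm_ext_le (hℓ : 1 ≤ ℓ) (W : ℂ[X]) :
    ∃ C : ℝ, 0 ≤ C ∧ ∀ x, 0 < x → ‖ext W x‖ ≤ C * lam ℓ x ^ W.natDegree := by
  refine ⟨∑ k ∈ Finset.range (W.natDegree + 1), ‖W.coeff k‖ * 2, by positivity, fun x hx => ?_⟩
  rw [ext_eq_sum, Finset.sum_mul]
  refine (norm_sum_le _ _).trans (Finset.sum_le_sum fun k hk => ?_)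
  rw [norm_mul, mul_assoc, Complex.norm_real, Real.norm_eq_abs]
  gcongr
  refine (abs_re_pow_le x k).trans ?_
  rw [abs_of_pos hx]
  gcongr
  have h1 : x ^ k ≤ lam ℓ x ^ k := by gcongr; exact le_lam hℓ x
  exact h1.trans (pow_le_pow_right₀ (one_le_lam x) (by simpa [Nat.lt_succ_iff] using hk))

lemma IsDirection.exists_re_ext_le {W : ℂ[X]} (hW : IsDirection ℓ W) :
    ∃ C : ℝ, 0 ≤ C ∧ ∀ x, 0 < x → |(ext W x).re| ≤ C * lam ℓ x := by
  refine ⟨∑ k ∈ Finset.range (W.natDegree + 1), |(W.coeff k).re| * 2, by positivity,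
    fun x hx => ?_⟩
  rw [ext_eq_sum, Complex.re_sum, Finset.sum_mul]
  refine (Finset.abs_sum_le_sum_abs _ _).trans (Finset.sum_le_sum fun k _ => ?_)
  rw [Complex.re_mul_ofReal, abs_mul, mul_assoc]
  rcases lt_or_ge (2 * ℓ) k with h | h
  · rw [hW k h]; simp
  · gcongr
    refine (abs_re_pow_le x k).trans ?_
    rw [abs_of_pos hx]
    gcongr
    unfold lam
    rcases le_total x 1 with h1 | h1
    · linarith [pow_le_one₀ hx.le h1 (n := k), pow_even_nonneg ℓ x]
    · linarith [pow_le_pow_right₀ h1 h]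

/-- The exponents `s (W(ix) + W(-ix)) + (1 + x^(2ℓ)) η(x)`. -/
def exps (hℓ : 1 ≤ ℓ) {W : ℂ[X]} (hW : IsDirection ℓ W) :
    Exponents (Ioi (0 : ℝ)) (ℝ × (Ioi (0 : ℝ) →ᵇ ℂ)) where
  B x := (ContinuousLinearMap.fst ℝ ℝ (Ioi (0 : ℝ) →ᵇ ℂ)).smulRight (ext W x) +
    lam ℓ x • (BoundedContinuousFunction.evalCLM ℝ x ∘L
      ContinuousLinearMap.snd ℝ ℝ (Ioi (0 : ℝ) →ᵇ ℂ))
  lam x := lam ℓ x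
  q x := lam ℓ x + ‖ext W x‖
  C := hW.exists_re_ext_le.choose + 1
  B_cont v := by
    have h1 : Continuous fun x : Ioi (0 : ℝ) => ext W x := (continuous_ext W).comp continuous_subtype_val
    have h2 : Continuous fun x : Ioi (0 : ℝ) => lam ℓ x := continuous_lam.comp continuous_subtype_val
    have h3 := v.2.continuous
    simp only [add_apply, ContinuousLinearMap.smulRight_apply, smul_apply, ContinuousLinearMap.comp_apply]
    exact (continuous_const.smul h1).add (h2.smul h3)
  lam_cont := continuous_lam.comp continuous_subtype_val
  lam_nonneg x := (lam_pos _).le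
  C_pos := by linarith [hW.exists_re_ext_le.choose_spec.1]
  norm_le x v := by
    refine (norm_add_le _ _).trans ?_
    have h1 : ‖v.1 • ext W x‖ ≤ ‖v‖ * ‖ext W x‖ := by
      rw [norm_smul]; gcongr; exact norm_fst_le v
    have h2 : ‖lam ℓ x • v.2 x‖ ≤ lam ℓ x * ‖v‖ := by
      rw [norm_smul, Real.norm_of_nonneg (lam_pos _).le]
      gcongr
      · exact (lam_pos _).le
      · exact (v.2.norm_coe_le_norm x).trans (norm_snd_le v)
    exact (add_le_add h1 h2).trans (le_of_eq (by ring))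
  one_le x := by linarith [one_le_lam (ℓ := ℓ) x, norm_nonneg (ext W x)]
  re_le x v := by
    obtain ⟨h0, h⟩ := hW.exists_re_ext_le.choose_spec
    have h1 : (v.1 • ext W x + lam ℓ x • v.2 x).re ≤
        ‖v‖ * (hW.exists_re_ext_le.choose * lam ℓ x) + lam ℓ x * ‖v‖ := by
      rw [Complex.add_re, Complex.real_smul, Complex.real_smul, Complex.re_ofReal_mul,
        Complex.re_ofReal_mul]
      refine add_le_add ?_ (mul_le_mul_of_nonneg_left ?_ (lam_pos _).le)
      · refine (le_abs_self _).trans ?_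
        rw [abs_mul]
        gcongr
        · exact norm_fst_le v
        · exact h x x.2
      · exact (Complex.re_le_norm _).trans ((v.2.norm_coe_le_norm x).trans (norm_snd_le v))
    exact h1.trans (le_of_eq (by ring))
  decay ε hε := by
    obtain ⟨C, hC0, hC⟩ := exists_norm_ext_le hℓ W
    set n := 2 * (W.natDegree + 1) with hn
    refine ⟨(1 + C) ^ 2 * (n.factorial / ε ^ n), by positivity, fun x => ?_⟩
    have hl := one_le_lam (ℓ := ℓ) x
    have h1 : lam ℓ x + ‖ext W x‖ ≤ (1 + C) * lam ℓ x ^ (W.natDegree + 1) := by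
      have h2 := hC x x.2
      have h3 : lam ℓ x ^ W.natDegree ≤ lam ℓ x ^ (W.natDegree + 1) :=
        pow_le_pow_right₀ hl (by omega)
      have h4 : lam ℓ x ≤ lam ℓ x ^ (W.natDegree + 1) := le_self_pow₀ hl (by omega)
      nlinarith
    have h2 : lam ℓ x ^ n * Real.exp (-(ε * lam ℓ x)) ≤ n.factorial / ε ^ n := by
      have h3 := Real.pow_div_factorial_le_exp (ε * lam ℓ x) (by positivity) n
      rw [div_le_iff₀ (by positivity), mul_pow] at h3
      rw [le_div_iff₀ (by positivity), Real.exp_neg, ← div_eq_mul_inv, div_mul_eq_mul_div,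
        div_le_iff₀ (Real.exp_pos _)]
      linarith
    calc _ ≤ ((1 + C) * lam ℓ x ^ (W.natDegree + 1)) ^ 2 * Real.exp (-(ε * lam ℓ x)) := by
          gcongr
      _ = (1 + C) ^ 2 * (lam ℓ x ^ n * Real.exp (-(ε * lam ℓ x))) := by
          rw [mul_pow, ← pow_mul, hn]; ring
      _ ≤ _ := by gcongr

lemma exps_B (hℓ : 1 ≤ ℓ) {W : ℂ[X]} (hW : IsDirection ℓ W) (x : Ioi (0 : ℝ)) (s : ℝ)
    (η : Ioi (0 : ℝ) →ᵇ ℂ) : (exps hℓ hW).B x (s, η) = s * ext W x + lam ℓ x * η x := rfl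

end directions

/-! ### The implicit equation -/

section implicit

variable {ℓ : ℕ} {a : ℝ} {W : ℂ[X]} {ν : Measure ℝ}

/-- `w⁻¹ (exp (s P + λ η) - 1 - λ η)`. -/
def gmap (hℓ : 1 ≤ ℓ) (hW : IsDirection ℓ W) (ha : 0 < a) (v : ℝ × (Ioi (0 : ℝ) →ᵇ ℂ)) :
    Ioi (0 : ℝ) →ᵇ ℂ :=
  Real.exp a • ((exps hℓ hW).E a v - (exps hℓ hW).E a 0 -
    (exps hℓ hW).D (half_pos ha) ((exps hℓ hW).E (a - a / 2) 0)
      ((ContinuousLinearMap.inr ℝ ℝ (Ioi (0 : ℝ) →ᵇ ℂ) ∘L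
        ContinuousLinearMap.snd ℝ ℝ (Ioi (0 : ℝ) →ᵇ ℂ)) v))

lemma wt_eq (a : ℝ) (ℓ : ℕ) (x : ℝ) : wt a ℓ x = Real.exp (-a) * Real.exp (a * lam ℓ x) := by
  unfold wt lam; rw [← Real.exp_add]; congr 1; ring

lemma exp_mul_E (hℓ : 1 ≤ ℓ) (hW : IsDirection ℓ W) {v : ℝ × (Ioi (0 : ℝ) →ᵇ ℂ)}
    (h : (exps hℓ hW).C * ‖v‖ ≤ a) (x : Ioi (0 : ℝ)) :
    (wt a ℓ x : ℂ) * (Real.exp a * (exps hℓ hW).E a v x) = Complex.exp ((exps hℓ hW).B x v) := by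
  rw [(exps hℓ hW).E_apply h, wt_eq]
  push_cast
  rw [mul_mul_mul_comm, ← Complex.exp_add, ← Complex.exp_add, ← Complex.exp_add]
  congr 1
  change -(a : ℂ) + a + (a * (lam ℓ x : ℂ) + (-(a * (lam ℓ x : ℂ)) + _)) = _
  ring

lemma gmap_apply (hℓ : 1 ≤ ℓ) (hW : IsDirection ℓ W) (ha : 0 < a) {v : ℝ × (Ioi (0 : ℝ) →ᵇ ℂ)}
    (h : (exps hℓ hW).C * ‖v‖ ≤ a) (x : Ioi (0 : ℝ)) :
    (wt a ℓ x : ℂ) * gmap hℓ hW ha v x =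
      Complex.exp ((exps hℓ hW).B x v) - 1 - lam ℓ x * v.2 x := by
  have e1 := exp_mul_E hℓ hW h x
  have e2 := exp_mul_E (a := a) hℓ hW (v := 0) (by simp [ha.le]) x
  have e3 : (exps hℓ hW).E (a - a / 2) 0 x * Complex.exp (-(a / 2 * (exps hℓ hW).lam x : ℝ)) =
      (exps hℓ hW).E a 0 x := by
    rw [(exps hℓ hW).E_apply (by simp; linarith), (exps hℓ hW).E_apply (by simp [ha.le]),
      ← Complex.exp_add]
    congr 1; push_cast; ring
  rw [map_zero, Complex.exp_zero] at e2
  unfold gmap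
  simp only [BoundedContinuousFunction.coe_smul, BoundedContinuousFunction.coe_sub, Pi.sub_apply,
    ContinuousLinearMap.comp_apply, ContinuousLinearMap.coe_snd', ContinuousLinearMap.inr_apply,
    Complex.real_smul]
  rw [(exps hℓ hW).D_apply, ← mul_assoc ((exps hℓ hW).E (a - a / 2) 0 x), e3, exps_B,
    mul_sub, mul_sub, mul_sub, mul_sub, e1, e2]
  rw [Complex.ofReal_zero]
  linear_combination (-(lam ℓ x : ℂ) * v.2 x) * e2

lemma gmap_zero (hℓ : 1 ≤ ℓ) (hW : IsDirection ℓ W) (ha : 0 < a) : gmap hℓ hW ha 0 = 0 := by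
  unfold gmap; rw [map_zero, map_zero, sub_self, sub_zero, smul_zero]

lemma contDiffAt_gmap (hℓ : 1 ≤ ℓ) (hW : IsDirection ℓ W) (ha : 0 < a) (n : ℕ) :
    ContDiffAt ℝ n (gmap hℓ hW ha) 0 := by
  unfold gmap
  have h1 := (exps hℓ hW).contDiffAt_E n (a := a) (v := 0) (by simpa using ha)
  have h2 : ContDiffAt ℝ n (fun v : ℝ × (Ioi (0 : ℝ) →ᵇ ℂ) =>
    (exps hℓ hW).D (half_pos ha) ((exps hℓ hW).E (a - a / 2) 0)
      ((ContinuousLinearMap.inr ℝ ℝ (Ioi (0 : ℝ) →ᵇ ℂ) ∘L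
        ContinuousLinearMap.snd ℝ ℝ (Ioi (0 : ℝ) →ᵇ ℂ)) v)) 0 :=
    (((exps hℓ hW).D (half_pos ha) ((exps hℓ hW).E (a - a / 2) 0)) ∘L
      (ContinuousLinearMap.inr ℝ ℝ (Ioi (0 : ℝ) →ᵇ ℂ) ∘L
        ContinuousLinearMap.snd ℝ ℝ (Ioi (0 : ℝ) →ᵇ ℂ))).contDiff.contDiffAt
  exact ((h1.sub contDiffAt_const).sub h2).const_smul _

/-- The linear part λη has been subtracted, so only terms of second order in η are left. This makes
the linearization of the implicit equation the identity. -/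
lemma hasFDerivAt_gmap_snd (hℓ : 1 ≤ ℓ) (hW : IsDirection ℓ W) (ha : 0 < a) :
    HasFDerivAt (fun η => gmap hℓ hW ha (0, η)) (0 : (Ioi (0 : ℝ) →ᵇ ℂ) →L[ℝ] _) 0 := by
  have h1 := (exps hℓ hW).hasFDerivAt_E (a := a) (v := 0) (half_pos ha) (by simp; linarith)
  set L := (exps hℓ hW).D (half_pos ha) ((exps hℓ hW).E (a - a / 2) 0) with hL
  have h2 : HasFDerivAt (fun η : Ioi (0 : ℝ) →ᵇ ℂ => ((0 : ℝ), η))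
    (ContinuousLinearMap.inr ℝ ℝ (Ioi (0 : ℝ) →ᵇ ℂ)) 0 :=
    (ContinuousLinearMap.inr ℝ ℝ (Ioi (0 : ℝ) →ᵇ ℂ)).hasFDerivAt
  have h3 : HasFDerivAt ((exps hℓ hW).E a ∘ fun η : Ioi (0 : ℝ) →ᵇ ℂ => ((0 : ℝ), η))
    (L ∘L ContinuousLinearMap.inr ℝ ℝ (Ioi (0 : ℝ) →ᵇ ℂ)) 0 :=
    HasFDerivAt.comp (g := (exps hℓ hW).E a) (g' := L) 0 h1 h2
  have h4 : HasFDerivAt (fun η : Ioi (0 : ℝ) →ᵇ ℂ => L (0, η))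
    (L ∘L ContinuousLinearMap.inr ℝ ℝ (Ioi (0 : ℝ) →ᵇ ℂ)) 0 :=
    (L ∘L ContinuousLinearMap.inr ℝ ℝ (Ioi (0 : ℝ) →ᵇ ℂ)).hasFDerivAt
  have h5 := ((h3.sub_const ((exps hℓ hW).E a 0)).sub h4).const_smul (Real.exp a)
  rw [sub_self, smul_zero] at h5
  exact h5

/-- The charge `exp (s P + λ η) - 1`. -/
def charge (ℓ : ℕ) (W : ℂ[X]) (s : ℝ) (η : Ioi (0 : ℝ) →ᵇ ℂ) (z : ℝ) : ℂ :=
  Complex.exp (s * ext W z + lam ℓ z * extF η z) - 1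

lemma measurable_charge (s : ℝ) (η : Ioi (0 : ℝ) →ᵇ ℂ) : Measurable (charge ℓ W s η) := by
  have h1 := (continuous_ext W).measurable
  have h2 := measurable_extF η
  have h3 := (continuous_lam (ℓ := ℓ)).measurable
  unfold charge
  fun_prop

lemma charge_eq (hℓ : 1 ≤ ℓ) (hW : IsDirection ℓ W) (s : ℝ) (η : Ioi (0 : ℝ) →ᵇ ℂ)
    (x : Ioi (0 : ℝ)) : charge ℓ W s η x = Complex.exp ((exps hℓ hW).B x (s, η)) - 1 := by
  unfold charge; rw [extF_apply, exps_B]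

lemma charge_eq_gmap (hℓ : 1 ≤ ℓ) (hW : IsDirection ℓ W) (ha : 0 < a) {s : ℝ}
    {η : Ioi (0 : ℝ) →ᵇ ℂ} (h : (exps hℓ hW).C * ‖(s, η)‖ ≤ a) {x : ℝ} (hx : 0 < x) :
    charge ℓ W s η x = wt a ℓ x • extF (gmap hℓ hW ha (s, η)) x + lam ℓ x * extF η x := by
  have h1 := gmap_apply hℓ hW ha h ⟨x, hx⟩
  rw [extF_pos _ hx, extF_pos _ hx, Complex.real_smul, h1,
    ← charge_eq hℓ hW s η ⟨x, hx⟩]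
  ring

lemma norm_charge_add_one_le (hℓ : 1 ≤ ℓ) (hW : IsDirection ℓ W) {s : ℝ}
    {η : Ioi (0 : ℝ) →ᵇ ℂ} (h : (exps hℓ hW).C * ‖(s, η)‖ ≤ a) {x : ℝ} (hx : 0 < x) :
    ‖charge ℓ W s η x + 1‖ ≤ Real.exp a * wt a ℓ x := by
  rw [charge_eq hℓ hW s η ⟨x, hx⟩, sub_add_cancel, Complex.norm_exp, wt_eq, ← mul_assoc,
    ← Real.exp_add, add_neg_cancel, Real.exp_zero, one_mul, Real.exp_le_exp]
  refine ((exps hℓ hW).re_le _ _).trans ?_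
  change (exps hℓ hW).C * lam ℓ x * _ ≤ _
  have := mul_le_mul_of_nonneg_right h (lam_pos (ℓ := ℓ) x).le
  linarith

lemma memLp_charge (hA : Adm ν (wt a ℓ)) (hℓ : 1 ≤ ℓ) (hW : IsDirection ℓ W) {s : ℝ}
    {η : Ioi (0 : ℝ) →ᵇ ℂ} (h : (exps hℓ hW).C * ‖(s, η)‖ ≤ a) :
    MemLp (charge ℓ W s η) 2 ν := by
  refine (hA.memLp_w.const_mul (Real.exp a + 1)).of_le
    (measurable_charge s η).aestronglyMeasurable ?_
  filter_upwards [hA.ae_pos] with x hx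
  have h1 := norm_charge_add_one_le hℓ hW h hx
  have h2 : ‖charge ℓ W s η x‖ ≤ ‖charge ℓ W s η x + 1‖ + 1 := by
    calc ‖charge ℓ W s η x‖ = ‖(charge ℓ W s η x + 1) - 1‖ := by congr 1; ring
      _ ≤ _ := by simpa using norm_sub_le (charge ℓ W s η x + 1) 1
  refine le_trans ?_ (le_abs_self _)
  linarith [hA.one_le x]

/-- The equation solved by the logarithm `λ η` of the perturbed density. -/
def Solves (ν : Measure ℝ) (ℓ : ℕ) (W : ℂ[X]) (s : ℝ) (b : ℂ) (η : Ioi (0 : ℝ) →ᵇ ℂ) (m : ℂ) :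
    Prop :=
  (∀ x : Ioi (0 : ℝ), lam ℓ x * η x = potl ν (charge ℓ W s η) x + m) ∧
    ∫ z, charge ℓ W s η z ∂ν = b

/-- Since the charge is wG(s,η) + λη, the equation says that the charge solves the bordered system
with source wG. With the response operator K it becomes η = K(G(s,η), b − β), an equation between
bounded functions to which the implicit function theorem applies. The eventual uniqueness over all
nearby η is needed later for reality. -/
theorem exists_implicit (hA : Adm ν (wt a ℓ)) (hν : ν ≠ 0) (hℓ : 1 ≤ ℓ) (hW : IsDirection ℓ W)
    (ha : 0 < a) (β : ℝ) : ∃ (η : ℝ × ℝ → (Ioi (0 : ℝ) →ᵇ ℂ)) (μ : ℝ × ℝ → ℂ),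
      ContDiffAt ℝ 2 η (β, 0) ∧ ContDiffAt ℝ 2 μ (β, 0) ∧ η (β, 0) = 0 ∧
      (∀ᶠ p in 𝓝 ((β, 0) : ℝ × ℝ), (exps hℓ hW).C * ‖(p.2, η p)‖ ≤ a ∧
        Solves ν ℓ W p.2 (p.1 - β : ℝ) (η p) (μ p)) ∧
      ∀ᶠ v in 𝓝 (((β, 0), 0) : (ℝ × ℝ) × (Ioi (0 : ℝ) →ᵇ ℂ)), ∀ m,
        Solves ν ℓ W v.1.2 (v.1.1 - β : ℝ) v.2 m → v.2 = η v.1 ∧ m = μ v.1 := by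
  have hfin := hA.isFiniteMeasure
  obtain ⟨K, hK⟩ := hA.exists_response hν continuous_wt (continuous_lam (ℓ := ℓ)) one_le_lam
    (fun x hx => (ll_le_pow hℓ hx).trans (by unfold lam; linarith))
  set S := exps hℓ hW with hS
  set G := gmap hℓ hW ha with hG
  set Q : (Ioi (0 : ℝ) →ᵇ ℂ) × ℂ → Lp ℂ 2 ν × ℂ :=
    fun p => (bordE hA hν).symm (multW hA p.1, p.2) with hQ
  have small : ∀ᶠ v in 𝓝 (((β, 0), 0) : (ℝ × ℝ) × (Ioi (0 : ℝ) →ᵇ ℂ)),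
      S.C * ‖(v.1.2, v.2)‖ ≤ a := by
    have : Continuous fun v : (ℝ × ℝ) × (Ioi (0 : ℝ) →ᵇ ℂ) => S.C * ‖(v.1.2, v.2)‖ := by fun_prop
    refine (this.continuousAt (x := ((β, 0), 0))).tendsto.eventually_le_const ?_
    simpa using ha
  -- Uniqueness for the bordered system identifies the charge, and with it the multiplier; hence m
  -- need not be an unknown of the implicit equation.
  have iff : ∀ (s : ℝ) (η : Ioi (0 : ℝ) →ᵇ ℂ) (b m : ℂ), S.C * ‖(s, η)‖ ≤ a →
      (Solves ν ℓ W s b η m ↔ η = K (G (s, η), b) ∧ m = (Q (G (s, η), b)).2) := by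
    intro s η b m hsm
    constructor
    · rintro ⟨h1, h2⟩
      have hmem := memLp_charge hA hℓ hW hsm
      have e : bordL hA (hmem.toLp _, m) = (multW hA (G (s, η)), b) := by
        refine Prod.ext (Lp.ext ?_) ?_
        · refine (bordL_fst hA _ m).trans ?_
          filter_upwards [hmem.coeFn_toLp, multW_coe hA (G (s, η)), hA.ae_pos] with x h3 h4 h5
          rw [Adm.potl_congr hmem.coeFn_toLp, h3, h4, charge_eq_gmap hℓ hW ha hsm h5,
            extF_pos η h5, h1 ⟨x, h5⟩]
          ring
        · refine (bordL_snd hA _ m).trans ?_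
          rw [integral_congr_ae hmem.coeFn_toLp, h2]
      have e2 : Q (G (s, η), b) = (hmem.toLp _, m) := by
        rw [hQ]; simp only
        rw [← e]
        exact (bordE hA hν).symm_apply_apply _
      refine ⟨?_, by rw [e2]⟩
      ext x
      have h3 := hK (G (s, η), b) x
      change _ = potl ν (Q (G (s, η), b)).1 x + (Q (G (s, η), b)).2 at h3
      rw [e2, Adm.potl_congr hmem.coeFn_toLp, ← h1 x] at h3
      have hl0 : (lam ℓ x : ℂ) ≠ 0 := by exact_mod_cast (lam_pos _).ne'
      exact (mul_left_cancel₀ hl0 h3).symm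
    · rintro ⟨h1, rfl⟩
      have h3 : ∀ x : Ioi (0 : ℝ), lam ℓ x * η x =
          potl ν (Q (G (s, η), b)).1 x + (Q (G (s, η), b)).2 := fun x => by
        rw [← hK (G (s, η), b) x, ← h1]
      obtain ⟨h4, h5⟩ := bordE_symm_spec hA hν (multW hA (G (s, η)), b)
      have h6 : (Q (G (s, η), b)).1 =ᵐ[ν] charge ℓ W s η := by
        filter_upwards [h5, multW_coe hA (G (s, η)), hA.ae_pos] with x h6 h7 h8
        rw [charge_eq_gmap hℓ hW ha hsm h8, extF_pos η h8, h3 ⟨x, h8⟩, hQ]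
        simp only
        rw [h6, h7]; ring
      refine ⟨fun x => ?_, ?_⟩
      · rw [h3 x, Adm.potl_congr h6]
      · rw [← integral_congr_ae h6]; exact h4
  set Ψ : (ℝ × ℝ) × (Ioi (0 : ℝ) →ᵇ ℂ) → (Ioi (0 : ℝ) →ᵇ ℂ) :=
    fun v => v.2 - K (G (v.1.2, v.2), ((v.1.1 - β : ℝ) : ℂ)) with hΨ
  have hGc : ContDiffAt ℝ 2 G 0 := contDiffAt_gmap hℓ hW ha 2
  have harg : ContDiffAt ℝ 2 (fun v : (ℝ × ℝ) × (Ioi (0 : ℝ) →ᵇ ℂ) =>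
      (G (v.1.2, v.2), ((v.1.1 - β : ℝ) : ℂ))) ((β, 0), 0) := by
    refine ContDiffAt.prodMk ?_ ?_
    · refine ContDiffAt.comp (g := G) (f := fun v : (ℝ × ℝ) × (Ioi (0 : ℝ) →ᵇ ℂ) =>
        (v.1.2, v.2)) _ hGc ?_
      fun_prop
    · have h1 : ContDiffAt ℝ 2 (fun v : (ℝ × ℝ) × (Ioi (0 : ℝ) →ᵇ ℂ) => v.1.1 - β)
        ((β, 0), 0) := by fun_prop
      exact Complex.ofRealCLM.contDiff.contDiffAt.comp _ h1
  have hΨc : ContDiffAt ℝ 2 Ψ ((β, 0), 0) := by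
    refine contDiffAt_snd.sub ?_
    exact (ContinuousLinearMap.contDiff (K.restrictScalars ℝ)).contDiffAt.comp _ harg
  have hΨ0 : Ψ ((β, 0), 0) = 0 := by
    have e0 : G (0, 0) = 0 := gmap_zero hℓ hW ha
    rw [hΨ]; simp only
    rw [e0, sub_self, Complex.ofReal_zero, show ((0 : Ioi (0 : ℝ) →ᵇ ℂ), (0 : ℂ)) = 0 from rfl,
      map_zero, sub_zero]
  -- The partial derivative in η is the identity because G has vanishing η-derivative at the base
  -- point; no condition on κ enters.
  have hder : fderiv ℝ Ψ ((β, 0), 0) ∘L ContinuousLinearMap.inr ℝ (ℝ × ℝ) (Ioi (0 : ℝ) →ᵇ ℂ) =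
      ContinuousLinearMap.id ℝ _ := by
    have h1 : HasFDerivAt (fun η : Ioi (0 : ℝ) →ᵇ ℂ => (((β, 0) : ℝ × ℝ), η))
      (ContinuousLinearMap.inr ℝ (ℝ × ℝ) (Ioi (0 : ℝ) →ᵇ ℂ)) 0 := hasFDerivAt_prodMk_right _ _
    have h2 : HasFDerivAt (Ψ ∘ fun η : Ioi (0 : ℝ) →ᵇ ℂ => (((β, 0) : ℝ × ℝ), η))
      (fderiv ℝ Ψ ((β, 0), 0) ∘L ContinuousLinearMap.inr ℝ (ℝ × ℝ) (Ioi (0 : ℝ) →ᵇ ℂ)) 0 :=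
      HasFDerivAt.comp (g := Ψ) 0 (hΨc.differentiableAt (by norm_num)).hasFDerivAt h1
    have h3 : HasFDerivAt (fun η : Ioi (0 : ℝ) →ᵇ ℂ => (G (0, η), ((β - β : ℝ) : ℂ)))
        ((0 : (Ioi (0 : ℝ) →ᵇ ℂ) →L[ℝ] (Ioi (0 : ℝ) →ᵇ ℂ)).prod 0) 0 :=
      (hasFDerivAt_gmap_snd hℓ hW ha).prodMk (hasFDerivAt_const _ _)
    have h4 : HasFDerivAt (Ψ ∘ fun η : Ioi (0 : ℝ) →ᵇ ℂ => (((β, 0) : ℝ × ℝ), η))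
        (ContinuousLinearMap.id ℝ _ - (K.restrictScalars ℝ) ∘L
          ((0 : (Ioi (0 : ℝ) →ᵇ ℂ) →L[ℝ] (Ioi (0 : ℝ) →ᵇ ℂ)).prod 0)) 0 :=
      (hasFDerivAt_id _).sub ((K.restrictScalars ℝ).hasFDerivAt.comp _ h3)
    rw [h2.unique h4]
    have hK0 : K (0, 0) = 0 := map_zero K
    ext v x
    simp [hK0]
  have hinv : (fderiv ℝ Ψ ((β, 0), 0) ∘L
      ContinuousLinearMap.inr ℝ (ℝ × ℝ) (Ioi (0 : ℝ) →ᵇ ℂ)).IsInvertible := by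
    rw [hder]; exact ⟨ContinuousLinearEquiv.refl ℝ _, rfl⟩
  have h2ne : (2 : WithTop ℕ∞) ≠ 0 := by norm_num
  set η := hΨc.implicitFunction h2ne hinv with hη
  have hηc : ContDiffAt ℝ 2 η (β, 0) := hΨc.contDiffAt_implicitFunction h2ne hinv
  have hη0 : η (β, 0) = 0 := hΨc.implicitFunction_apply_self h2ne hinv
  set μ : ℝ × ℝ → ℂ := fun p => (Q (G (p.2, η p), ((p.1 - β : ℝ) : ℂ))).2 with hμ
  have hηt : Tendsto (fun p : ℝ × ℝ => (p, η p)) (𝓝 (β, 0)) (𝓝 ((β, 0), 0)) := by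
    have := (continuousAt_id (x := ((β, 0) : ℝ × ℝ))).prodMk hηc.continuousAt
    rw [ContinuousAt, hη0] at this
    exact this
  refine ⟨η, μ, hηc, ?_, hη0, ?_, ?_⟩
  · have hcomp : ContDiffAt ℝ 2 (fun p : ℝ × ℝ => (G (p.2, η p), ((p.1 - β : ℝ) : ℂ))) (β, 0) := by
      have h1 : ContDiffAt ℝ 2 (fun p : ℝ × ℝ => (p, η p)) (β, 0) := contDiffAt_id.prodMk hηc
      rw [← hη0] at harg
      exact ContDiffAt.comp (g := fun v : (ℝ × ℝ) × (Ioi (0 : ℝ) →ᵇ ℂ) =>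
        (G (v.1.2, v.2), ((v.1.1 - β : ℝ) : ℂ))) (f := fun p : ℝ × ℝ => (p, η p)) (β, 0) harg h1
    set L : (Ioi (0 : ℝ) →ᵇ ℂ) × ℂ →L[ℂ] ℂ := (ContinuousLinearMap.snd ℂ (Lp ℂ 2 ν) ℂ) ∘L
      ((bordE hA hν).symm : (Lp ℂ 2 ν × ℂ) →L[ℂ] (Lp ℂ 2 ν × ℂ)) ∘L
      ((multW hA).prodMap (ContinuousLinearMap.id ℂ ℂ))
    have hL : ContDiff ℝ 2 (fun q => L q) := ContinuousLinearMap.contDiff (L.restrictScalars ℝ)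
    exact ContDiffAt.comp (g := fun q => L q) (f := fun p : ℝ × ℝ => (G (p.2, η p),
      ((p.1 - β : ℝ) : ℂ))) (β, 0) hL.contDiffAt hcomp
  · filter_upwards [hΨc.eventually_apply_implicitFunction h2ne hinv, hηt.eventually small]
      with p h1 h2
    refine ⟨h2, (iff _ _ _ _ h2).2 ⟨?_, rfl⟩⟩
    rw [hΨ0] at h1
    exact sub_eq_zero.1 h1
  · filter_upwards [hΨc.eventually_apply_eq_iff_implicitFunction h2ne hinv, small]
      with v h1 h2 m hm
    obtain ⟨h3, h4⟩ := (iff _ _ _ _ h2).1 hm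
    have h5 : η v.1 = v.2 := h1.1 (by rw [hΨ0]; exact sub_eq_zero.2 h3)
    refine ⟨h5.symm, ?_⟩
    rw [h4, hμ]; simp only
    rw [h5]

end implicit

/-! ### Branches -/

section branch

variable {ℓ : ℕ} {c : ℕ → ℝ} {β : ℝ} {W : ℂ[X]}

lemma rho_dominated (hℓ : 1 ≤ ℓ) (hc : 0 < c ℓ) (hβ : 0 < β) :
    Dominated (rho β (pot ℓ c)) (wt (c ℓ / 2) ℓ) :=
  (exists_equilibrium hℓ hc hβ).1.dominated (isConfined_pot hℓ hc (half_pos hc))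

lemma rho_adm (hℓ : 1 ≤ ℓ) (hc : 0 < c ℓ) (hβ : 0 < β) :
    Adm (meas (rho β (pot ℓ c))) (wt (c ℓ / 2) ℓ) := (rho_dominated hℓ hc hβ).adm

lemma integral_one_meas_rho (hℓ : 1 ≤ ℓ) (hc : 0 < c ℓ) (hβ : 0 < β) :
    ∫ _, (1 : ℂ) ∂(meas (rho β (pot ℓ c))) = β := by
  have hd := rho_dominated hℓ hc hβ
  have e := congrArg Complex.ofReal (exists_equilibrium hℓ hc hβ).2
  rw [← integral_complex_ofReal] at e
  rw [integral_meas hd.measurable hd.nonneg, ← e]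
  simp

lemma meas_rho_ne_zero (hℓ : 1 ≤ ℓ) (hc : 0 < c ℓ) (hβ : 0 < β) :
    meas (rho β (pot ℓ c)) ≠ 0 := by
  intro h0
  have := integral_one_meas_rho hℓ hc hβ
  rw [h0, integral_zero_measure] at this
  exact hβ.ne (by exact_mod_cast this)

/-- The perturbed density with logarithm `s P + λ η`, relative to the minimizer. -/
def branchR (ℓ : ℕ) (c : ℕ → ℝ) (β : ℝ) (W : ℂ[X]) (s : ℝ) (η : Ioi (0 : ℝ) →ᵇ ℂ) (x : ℝ) : ℂ :=
  rho β (pot ℓ c) x • (charge ℓ W s η x + 1)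

lemma avg_branchR (hℓ : 1 ≤ ℓ) (hc : 0 < c ℓ) (hβ : 0 < β) (hW : IsDirection ℓ W) {s : ℝ}
    {b : ℝ} {η : Ioi (0 : ℝ) →ᵇ ℂ} {m : ℂ} (hs : (exps hℓ hW).C * ‖(s, η)‖ ≤ c ℓ / 2)
    (h : Solves (meas (rho β (pot ℓ c))) ℓ W s (b - β : ℝ) η m) :
    avg (branchR ℓ c β W s η) = b := by
  have hd := rho_dominated hℓ hc hβ
  have hA := hd.adm
  have hfin := hA.isFiniteMeasure
  unfold avg branchR
  rw [← integral_meas hd.measurable hd.nonneg, integral_add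
    ((memLp_charge hA hℓ hW hs).integrable (by norm_num)) (integrable_const 1), h.2,
    integral_one_meas_rho hℓ hc hβ]
  push_cast; ring

lemma T_branchR (hℓ : 1 ≤ ℓ) (hc : 0 < c ℓ) (hβ : 0 < β) (hW : IsDirection ℓ W) {s : ℝ}
    {b m : ℂ} {η : Ioi (0 : ℝ) →ᵇ ℂ} (hs : (exps hℓ hW).C * ‖(s, η)‖ ≤ c ℓ / 2)
    (h : Solves (meas (rho β (pot ℓ c))) ℓ W s b η m) {x : ℝ} (hx : 0 < x) :
    T (branchR ℓ c β W s η) x = ((T (rho β (pot ℓ c)) x : ℝ) : ℂ) + lam ℓ x * extF η x - m := by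
  have hd := rho_dominated hℓ hc hβ
  have hA := hd.adm
  have hfin := hA.isFiniteMeasure
  have e1 : potl (meas (rho β (pot ℓ c))) (fun _ => (1 : ℂ)) x = ((T (rho β (pot ℓ c)) x : ℝ) : ℂ) := by
    rw [T_density_eq_potl hd.measurable hd.nonneg, ← potl_ofReal]
    simp
  unfold branchR
  rw [T_eq_potl hd.measurable hd.nonneg, hA.potl_add (hA.weighted_memLp (memLp_charge hA hℓ hW hs))
    (hA.weighted_memLp (memLp_const 1)) hx.ne', e1, extF_pos η hx, h.1 ⟨x, hx⟩]
  ring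

lemma eulerLagrange_branchR (hℓ : 1 ≤ ℓ) (hc : 0 < c ℓ) (hβ : 0 < β) (hW : IsDirection ℓ W) {s : ℝ}
    {b m : ℂ} {η : Ioi (0 : ℝ) →ᵇ ℂ} (hs : (exps hℓ hW).C * ‖(s, η)‖ ≤ c ℓ / 2)
    (h : Solves (meas (rho β (pot ℓ c))) ℓ W s b η m) {x : ℝ} (hx : 0 < x) :
    (x : ℂ) * branchR ℓ c β W s η x = Complex.exp (T (branchR ℓ c β W s η) x +
      ext (pot ℓ c + C (s : ℂ) * W) x + (mu β (pot ℓ c) + m) - 1) := by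
  have hE := (exists_equilibrium hℓ hc hβ).1
  rw [T_branchR hℓ hc hβ hW hs h hx, ext_add, ext_C_mul, ext_pot_ofReal]
  unfold branchR charge
  have h1 : (x * rho β (pot ℓ c) x : ℝ) = Real.exp (T (rho β (pot ℓ c)) x +
      (ext (pot ℓ c) x).re + (mu β (pot ℓ c) - 1)) := by
    rw [← hE.eq x hx, Real.exp_log (mul_pos hx (hE.pos x hx))]
  rw [sub_add_cancel, Complex.real_smul, ← mul_assoc, ← Complex.ofReal_mul, h1,
    Complex.ofReal_exp, ← Complex.exp_add]
  congr 1
  push_cast; ring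

lemma continuousOn_extF (F : Ioi (0 : ℝ) →ᵇ ℂ) : ContinuousOn (extF F) (Ioi 0) := by
  rw [continuousOn_iff_continuous_domRestrict]
  have : (Ioi (0 : ℝ)).domRestrict (extF F) = F := by
    funext x; exact extF_apply F x
  rw [this]; exact F.continuous

lemma potl_conj (ν : Measure ℝ) (h : ℝ → ℂ) (x : ℝ) :
    potl ν (fun z => (starRingEnd ℂ) (h z)) x = (starRingEnd ℂ) (potl ν h x) := by
  unfold potl
  rw [← integral_conj]
  congr 1; funext z
  simp

/-- The kernel is real, so when sP is real the equation commutes with conjugation. Combined with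
local uniqueness, this forces η and m to be real. -/
lemma Solves.conj {ν : Measure ℝ} (hν : ∀ᵐ z ∂ν, 0 < z) {s b : ℝ} {η : Ioi (0 : ℝ) →ᵇ ℂ} {m : ℂ}
    (h : Solves ν ℓ W s b η m) (hP : ∀ x, ((s : ℂ) * ext W x).im = 0) :
    Solves ν ℓ W s b (star η) ((starRingEnd ℂ) m) := by
  have e : charge ℓ W s (star η) =ᵐ[ν] fun z => (starRingEnd ℂ) (charge ℓ W s η z) := by
    filter_upwards [hν] with z hz
    unfold charge
    have h1 := Complex.conj_eq_iff_im.2 (hP z)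
    rw [extF_pos _ hz, extF_pos _ hz, map_sub, ← Complex.exp_conj, map_add, h1, map_mul, map_one,
      Complex.conj_ofReal]
    rfl
  refine ⟨fun x => ?_, ?_⟩
  · rw [Adm.potl_congr e, potl_conj, ← map_add, ← h.1 x, map_mul, Complex.conj_ofReal]
    rfl
  · rw [integral_congr_ae e, integral_conj, h.2, Complex.conj_ofReal]

lemma im_eq_zero_of_potential (V' : ℂ[X]) (h' : IsPotential V') (x : ℝ) : (ext V' x).im = 0 := by
  obtain ⟨ℓ', c', -, -, rfl⟩ := h'
  rw [ext_pot_ofReal, Complex.ofReal_im]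

/-- A real solution is an equilibrium density for the new potential, hence its minimizer. The new
potential has its own ℓ′ and c′ by definition, so a weight adapted to ℓ′ must be found that the old
domination controls. -/
lemma solves_minimizer (hℓ : 1 ≤ ℓ) (hc : 0 < c ℓ) (hβ : 0 < β) (hW : IsDirection ℓ W) {s : ℝ}
    {b : ℝ} {m : ℂ} {η : Ioi (0 : ℝ) →ᵇ ℂ} (hs : (exps hℓ hW).C * ‖(s, η)‖ ≤ c ℓ / 2)
    (h : Solves (meas (rho β (pot ℓ c))) ℓ W s (b - β : ℝ) η m)
    (hV : IsPotential (pot ℓ c + C (s : ℂ) * W)) (hη : star η = η)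
    (hm : (starRingEnd ℂ) m = m) :
    (∀ x : ℝ, 0 < x →
      branchR ℓ c β W s η x = (rho b (pot ℓ c + C (s : ℂ) * W) x : ℂ)) ∧
    (mu β (pot ℓ c) + m : ℂ) = (mu b (pot ℓ c + C (s : ℂ) * W) : ℂ) := by
  have hE := (exists_equilibrium hℓ hc hβ).1
  have hd := rho_dominated hℓ hc hβ
  set V' := pot ℓ c + C (s : ℂ) * W with hV'
  have hsP : ∀ x, (s : ℂ) * ext W x = ext V' x - ext (pot ℓ c) x := fun x => by
    rw [hV', ext_add, ext_C_mul]; ring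
  have hBre : ∀ x, 0 < x → (s : ℂ) * ext W x + lam ℓ x * extF η x =
      (((s : ℂ) * ext W x + lam ℓ x * extF η x).re : ℂ) := fun x hx => by
    have h1 : (extF η x).im = 0 := by
      rw [extF_pos η hx]
      exact Complex.conj_eq_iff_im.1 (DFunLike.congr_fun hη ⟨x, hx⟩)
    refine (Complex.conj_eq_iff_re.1 (Complex.conj_eq_iff_im.2 ?_)).symm
    rw [Complex.add_im, hsP, Complex.sub_im, im_eq_zero_of_potential _ hV, ext_pot_ofReal,
      Complex.ofReal_im, Complex.im_ofReal_mul, h1]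
    simp
  set r : ℝ → ℝ := fun x => rho β (pot ℓ c) x *
    Real.exp (((s : ℂ) * ext W x + lam ℓ x * extF η x).re) with hr
  have hRr : ∀ x, 0 < x → branchR ℓ c β W s η x = (r x : ℂ) := fun x hx => by
    unfold branchR charge
    rw [sub_add_cancel, hBre x hx, Complex.real_smul, hr]
    push_cast
    rw [← hBre x hx]
  have hTr : ∀ x, 0 < x → ((T r x : ℝ) : ℂ) = T (branchR ℓ c β W s η) x := fun x _ => by
    unfold T
    rw [← integral_complex_ofReal]
    apply integral_congr_ae
    filter_upwards [ae_leb_pos] with z hz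
    rw [hRr z hz]
    simp
  have hmass : ∫ x, r x ∂leb = b := by
    have h1 := avg_branchR hℓ hc hβ hW hs h
    unfold avg at h1
    rw [← Complex.ofReal_inj, ← integral_complex_ofReal, ← h1]
    apply integral_congr_ae
    filter_upwards [ae_leb_pos] with z hz
    rw [hRr z hz]
  obtain ⟨ℓ', c', hℓ', hc', hpot⟩ := hV
  obtain ⟨C₁, hC₁0, hC₁⟩ := exists_abs_ext_pot_le hℓ' hc'
  obtain ⟨C₂, hC₂0, hC₂⟩ := exists_abs_ext_pot_le hℓ hc
  obtain ⟨C₃, hC₃0, hC₃⟩ := hW.exists_re_ext_le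
  set A := C₁ * (1 + (C₂ + |s| * C₃)) with hAdef
  have hpow : ∀ x, 0 < x → x ^ (2 * ℓ') ≤ A * lam ℓ x := fun x hx => by
    have h1 : |(ext V' x).re| ≤ (C₂ + |s| * C₃) * lam ℓ x := by
      have h2 : ext V' x = ext (pot ℓ c) x + s * ext W x := by rw [hsP]; ring
      rw [h2, Complex.add_re, Complex.re_ofReal_mul, add_mul]
      refine (abs_add_le _ _).trans (add_le_add (hC₂ x).1 ?_)
      rw [abs_mul, mul_assoc]
      gcongr
      exact hC₃ x hx
    have h3 := (hC₁ x).2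
    rw [← hpot] at h3
    have h4 := one_le_lam (ℓ := ℓ) x
    calc x ^ (2 * ℓ') ≤ C₁ * (1 + |(ext V' x).re|) := h3
      _ ≤ C₁ * (lam ℓ x + (C₂ + |s| * C₃) * lam ℓ x) := by gcongr
      _ = _ := by rw [hAdef]; ring
  have hA0 : 0 ≤ A := by positivity
  -- With x^{2ℓ′} ≤ Aλ, this rate makes the square of the new weight at most exp((c/2)λ), c = `c ℓ`.
  -- That is a constant times the old weight; the other factor of the old weight bounds exp(sP +
  -- λη).
  set a' := c ℓ / 2 / (2 * (A + 1)) with ha'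
  have ha'0 : 0 < a' := by positivity
  have hEr : IsEquilibrium (fun x => (ext V' x).re) (wt a' ℓ') r (mu β (pot ℓ c) - 1 + m.re) := by
    refine ⟨?_, fun x hx => ?_, fun x hx => mul_pos (hE.pos x hx) (Real.exp_pos _), ?_,
      fun x hx => ?_⟩
    · have h1 := (continuous_ext W).continuousOn (s := Ioi 0)
      have h2 := continuousOn_extF η
      have h3 := (continuous_lam (ℓ := ℓ)).continuousOn (s := Ioi 0)
      have h4 : ContinuousOn (fun x => (s : ℂ) * ext W x + lam ℓ x * extF η x) (Ioi 0) :=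
        (continuousOn_const.mul h1).add ((Complex.continuous_ofReal.comp_continuousOn h3).mul h2)
      exact hE.cont.mul (Complex.continuous_re.comp_continuousOn h4).rexp
    · rw [hr]; simp only
      rw [hE.zero x hx, zero_mul]
    · obtain ⟨K, hK⟩ := hE.dom
      refine ⟨Real.exp (c ℓ / 2) * Real.exp (c ℓ / 2) * K, fun z hz => ?_⟩
      have h1 : Real.exp (((s : ℂ) * ext W z + lam ℓ z * extF η z).re) ≤
          Real.exp (c ℓ / 2) * wt (c ℓ / 2) ℓ z := by
        have := norm_charge_add_one_le hℓ hW hs hz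
        unfold charge at this
        rwa [sub_add_cancel, Complex.norm_exp] at this
      have h2 : wt a' ℓ' z ^ 2 ≤ Real.exp (c ℓ / 2) * wt (c ℓ / 2) ℓ z := by
        rw [wt_eq (c ℓ / 2), ← mul_assoc, ← Real.exp_add, add_neg_cancel, Real.exp_zero, one_mul,
          sq, wt_mul]
        unfold wt
        rw [Real.exp_le_exp]
        calc (a' + a') * z ^ (2 * ℓ') ≤ (a' + a') * (A * lam ℓ z) := by
              gcongr; exact hpow z hz
          _ = c ℓ / 2 * (A / (A + 1)) * lam ℓ z := by rw [ha']; field_simp; ring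
          _ ≤ c ℓ / 2 * 1 * lam ℓ z := by
              have := (lam_pos (ℓ := ℓ) z).le
              gcongr
              rw [div_le_one (by positivity)]; linarith
          _ = _ := by ring
      have h3 := (hE.pos z hz).le
      have h4 := one_le_wt (ℓ := ℓ) (half_pos hc).le z
      calc wt a' ℓ' z ^ 2 * r z ≤ (Real.exp (c ℓ / 2) * wt (c ℓ / 2) ℓ z) *
            (rho β (pot ℓ c) z * (Real.exp (c ℓ / 2) * wt (c ℓ / 2) ℓ z)) := by
              rw [hr]; simp only
              gcongr
        _ = Real.exp (c ℓ / 2) * Real.exp (c ℓ / 2) *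
            (wt (c ℓ / 2) ℓ z ^ 2 * rho β (pot ℓ c) z) := by ring
        _ ≤ Real.exp (c ℓ / 2) * Real.exp (c ℓ / 2) * (K * env z) := by
            exact mul_le_mul_of_nonneg_left (hK z hz) (by positivity)
        _ = _ := by ring
    · rw [hr]; simp only
      rw [← mul_assoc, Real.log_mul (mul_pos hx (hE.pos x hx)).ne' (Real.exp_pos _).ne',
        Real.log_exp, hE.eq x hx]
      have h1 := hTr x hx
      rw [T_branchR hℓ hc hβ hW hs h hx] at h1
      have h2 := congrArg Complex.re h1
      simp only [Complex.ofReal_re, Complex.sub_re, Complex.add_re] at h2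
      have h3 := congrArg Complex.re (hsP x)
      rw [Complex.sub_re] at h3
      rw [Complex.add_re]
      linarith
  have hconf : IsConfined (fun x => (ext V' x).re) (wt a' ℓ') := by
    rw [hpot]; exact isConfined_pot hℓ' hc' ha'0
  refine ⟨fun x hx => ?_, ?_⟩
  · rw [hRr x hx, hEr.rho_eq hconf hmass]
  · rw [hEr.mu_eq hconf hmass]
    have := (Complex.conj_eq_iff_re.1 hm)
    push_cast
    rw [this]; ring

/-- The implicit solution is exponentiated. Since R/(ϱw) is a multiple of the
bounded-function-valued map `E`, the required smoothness in the weighted norm is that of `E`. At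
real potentials the conjugate of η is again small, so uniqueness identifies it with η. -/
theorem exists_isBranch (hℓ : 1 ≤ ℓ) (hc : 0 < c ℓ) (hβ : 0 < β) (hW : IsDirection ℓ W) :
    ∃ R M, IsBranch ℓ c β W R M := by
  have hd := rho_dominated hℓ hc hβ
  have hA := hd.adm
  have ha := half_pos hc
  obtain ⟨η, μ, hη, hμ, hη0, hsol, huniq⟩ :=
    exists_implicit hA (meas_rho_ne_zero hℓ hc hβ) hℓ hW ha β
  refine ⟨fun b s => branchR ℓ c β W s (η (b, s)), fun b s => mu β (pot ℓ c) + μ (b, s),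
    ⟨fun p => Real.exp (c ℓ / 2) • (exps hℓ hW).E (c ℓ / 2) (p.2, η p), ?_, ?_⟩, ?_, ?_, ?_, ?_⟩
  · have h1 : ContDiffAt ℝ 2 (fun p : ℝ × ℝ => (p.2, η p)) (β, 0) := contDiffAt_snd.prodMk hη
    have h2 : ContDiffAt ℝ 2 ((exps hℓ hW).E (c ℓ / 2)) (0, η (β, 0)) := by
      rw [hη0]
      exact (exps hℓ hW).contDiffAt_E 2 (by simpa using hc)
    exact (ContDiffAt.comp (g := (exps hℓ hW).E (c ℓ / 2)) (f := fun p : ℝ × ℝ => (p.2, η p))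
      (β, 0) h2 h1).const_smul _
  · filter_upwards [hsol] with p hp x
    have h1 := exp_mul_E hℓ hW hp.1 x
    change branchR ℓ c β W p.2 (η p) x = _
    unfold branchR
    rw [charge_eq hℓ hW, sub_add_cancel, ← h1, BoundedContinuousFunction.coe_smul]
    simp only [Complex.real_smul]
    unfold wt
    push_cast; ring
  · exact contDiffAt_const.add hμ
  · filter_upwards [hsol] with p hp
    exact avg_branchR hℓ hc hβ hW hp.1 hp.2
  · filter_upwards [hsol] with p hp x hx
    exact eulerLagrange_branchR hℓ hc hβ hW hp.1 hp.2 hx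
  · have hstar : Tendsto (fun p : ℝ × ℝ => (p, star (η p))) (𝓝 (β, 0)) (𝓝 ((β, 0), 0)) := by
      have h1 : Tendsto (fun p : ℝ × ℝ => star (η p)) (𝓝 (β, 0)) (𝓝 0) := by
        rw [tendsto_zero_iff_norm_tendsto_zero]
        simp_rw [norm_star]
        rw [← tendsto_zero_iff_norm_tendsto_zero, ← hη0]
        exact hη.continuousAt
      exact tendsto_id.prodMk_nhds h1
    filter_upwards [hsol, hstar.eventually huniq] with p hp hu hV
    have hP : ∀ x, ((p.2 : ℂ) * ext W x).im = 0 := fun x => by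
      have : (p.2 : ℂ) * ext W x = ext (pot ℓ c + C (p.2 : ℂ) * W) x - ext (pot ℓ c) x := by
        rw [ext_add, ext_C_mul]; ring
      rw [this, Complex.sub_im, im_eq_zero_of_potential _ hV, ext_pot_ofReal, Complex.ofReal_im,
        sub_zero]
    obtain ⟨h1, h2⟩ := hu _ (hp.2.conj hA.ae_pos hP)
    exact solves_minimizer hℓ hc hβ hW hp.1 hp.2 hV h1 h2

end branch

/-! ### Dressing -/

/-- A positive dominated density whose response `h₁` to a unit charge is non-degenerate. -/
structure Dressable (ϱ w : ℝ → ℝ) (h₁ : ℝ → ℂ) (κ : ℂ) : Prop where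
  dominated : Dominated ϱ w
  pos : ∀ x, 0 < x → 0 < ϱ x
  memLp : MemLp h₁ 2 (meas ϱ)
  mass : ∫ x, h₁ x ∂(meas ϱ) = 1
  response : ∀ x, 0 < x → h₁ x = potl (meas ϱ) h₁ x + κ
  ne : κ ≠ 0

lemma T_ofReal_mul {ϱ w : ℝ → ℝ} (hd : Dominated ϱ w) (g : ℝ → ℂ) (x : ℝ) :
    T (fun z => (ϱ z : ℂ) * g z) x = potl (meas ϱ) g x := by
  rw [← T_eq_potl hd.measurable hd.nonneg]
  simp only [Complex.real_smul]

lemma T_congr {f g : ℝ → ℂ} (h : ∀ z, 0 < z → f z = g z) (x : ℝ) : T f x = T g x := by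
  unfold T
  apply integral_congr_ae
  filter_upwards [ae_leb_pos] with z hz
  rw [h z hz]

namespace Dressable

variable {ϱ w : ℝ → ℝ} {h₁ : ℝ → ℂ} {κ : ℂ}

/-- If b is the integral of g, then g − b h₁ is neutral and solves the homogeneous bordered system
with multiplier −bκ, so it vanishes. Comparing the equations of g and b h₁ gives bκ = 0, hence b =
0. -/
lemma eq_zero (hD : Dressable ϱ w h₁ κ) {g : ℝ → ℂ} (hg : MemLp g 2 (meas ϱ))
    (he : ∀ᵐ x ∂(meas ϱ), g x = potl (meas ϱ) g x) : g =ᵐ[meas ϱ] 0 := by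
  have hA := hD.dominated.adm
  have hfin := hA.isFiniteMeasure
  set b := ∫ x, g x ∂(meas ϱ) with hb
  have hbh : MemLp (fun x => b * h₁ x) 2 (meas ϱ) := hD.memLp.const_mul b
  have hpot : ∀ x, potl (meas ϱ) (fun z => b * h₁ z) x = b * potl (meas ϱ) h₁ x :=
    potl_const_mul _ b h₁
  have h1 := hA.bordered_unique (h := fun x => g x - b * h₁ x) (m := -(b * κ)) (hg.sub hbh) (by
      rw [integral_sub (hg.integrable (by norm_num)) (hbh.integrable (by norm_num)),
        integral_const_mul, hD.mass, mul_one, sub_self]) (by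
      filter_upwards [he, hA.ae_pos] with x hx hx0
      rw [hA.potl_sub (hA.weighted_memLp hg) (hA.weighted_memLp hbh) hx0.ne', hpot, hx,
        hD.response x hx0]
      ring)
  have h2 : g =ᵐ[meas ϱ] fun x => b * h₁ x := by
    filter_upwards [h1] with x hx
    exact sub_eq_zero.1 hx
  have hne : meas ϱ ≠ 0 := fun h0 => by
    have := hD.mass
    rw [h0, integral_zero_measure] at this
    exact zero_ne_one this
  have : (ae (meas ϱ)).NeBot := ae_neBot.2 hne
  have h3 : ∀ᵐ x ∂(meas ϱ), b * κ = 0 := by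
    filter_upwards [he, h2, hA.ae_pos] with x hx hx2 hx0
    rw [Adm.potl_congr h2, hpot] at hx
    rw [hx, hD.response x hx0] at hx2
    linear_combination hx2.symm
  obtain ⟨_, h4⟩ := h3.exists
  have hb0 : b = 0 := (mul_eq_zero.1 h4).resolve_right hD.ne
  filter_upwards [h2] with x hx
  rw [hx, hb0, zero_mul]; rfl

/-- The bordered solution misses the equation by a constant m. Subtracting (m/κ) h₁, whose own
defect is m, removes it. -/
lemma exists_solution (hD : Dressable ϱ w h₁ κ) {f : ℝ → ℂ} (hf : MemLp f 2 (meas ϱ)) :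
    ∃ g, MemLp g 2 (meas ϱ) ∧ ∀ x, g x = f x + potl (meas ϱ) g x := by
  have hA := hD.dominated.adm
  have hne : meas ϱ ≠ 0 := fun h0 => by
    have := hD.mass
    rw [h0, integral_zero_measure] at this
    exact zero_ne_one this
  obtain ⟨h, m, hh, -, he⟩ := hA.exists_bordered hne hf 0
  have hmh : MemLp (fun x => m / κ * h₁ x) 2 (meas ϱ) := hD.memLp.const_mul _
  have hg : MemLp (fun x => h x - m / κ * h₁ x) 2 (meas ϱ) := hh.sub hmh
  have e : (fun x => f x + potl (meas ϱ) (fun z => h z - m / κ * h₁ z) x) =ᵐ[meas ϱ]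
      fun x => h x - m / κ * h₁ x := by
    filter_upwards [he, hA.ae_pos] with x hx hx0
    rw [hA.potl_sub (hA.weighted_memLp hh) (hA.weighted_memLp hmh) hx0.ne', potl_const_mul, hx,
      hD.response x hx0]
    have := hD.ne
    field_simp
    ring
  -- The equation is required at every point, not only almost everywhere, so its right-hand side is
  -- taken as the representative.
  refine ⟨fun x => f x + potl (meas ϱ) (fun z => h z - m / κ * h₁ z) x,
    (memLp_congr_ae e).2 hg, fun x => ?_⟩
  rw [Adm.potl_congr e]

lemma isDressed_iff (hd : Dominated ϱ w) (f g : ℝ → ℂ) :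
    IsDressed ϱ (fun z => (ϱ z : ℂ)) f g ↔
      MemLp g 2 (meas ϱ) ∧ ∀ x, g x = f x + potl (meas ϱ) g x := by
  unfold IsDressed
  simp only [T_ofReal_mul hd]

lemma existsUnique_isDressed (hD : Dressable ϱ w h₁ κ) {f : ℝ → ℂ} (hf : MemLp f 2 (meas ϱ)) :
    ∃! g, IsDressed ϱ (fun z => (ϱ z : ℂ)) f g := by
  have hA := hD.dominated.adm
  simp only [isDressed_iff hD.dominated]
  obtain ⟨g, hg, hge⟩ := hD.exists_solution hf
  refine ⟨g, ⟨hg, hge⟩, fun g' ⟨hg', hge'⟩ => ?_⟩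
  have h1 := hD.eq_zero (g := fun x => g' x - g x) (hg'.sub hg) (by
    filter_upwards [hA.ae_pos] with x hx
    rw [hA.potl_sub (hA.weighted_memLp hg') (hA.weighted_memLp hg) hx.ne']
    linear_combination hge' x - hge x)
  have h2 : g' =ᵐ[meas ϱ] g := by
    filter_upwards [h1] with x hx
    exact sub_eq_zero.1 hx
  funext x
  rw [hge', hge, Adm.potl_congr h2]

lemma dress_spec (hD : Dressable ϱ w h₁ κ) {f : ℝ → ℂ} (hf : MemLp f 2 (meas ϱ)) :
    MemLp (dress ϱ f) 2 (meas ϱ) ∧ ∀ x, dress ϱ f x = f x + potl (meas ϱ) (dress ϱ f) x := by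
  rw [← isDressed_iff hD.dominated]
  exact Classical.epsilon_spec (hD.existsUnique_isDressed hf).exists

lemma dress_ae_eq (hD : Dressable ϱ w h₁ κ) {f g : ℝ → ℂ} (hg : MemLp g 2 (meas ϱ))
    (hge : ∀ᵐ x ∂(meas ϱ), g x = f x + potl (meas ϱ) g x) :
    MemLp f 2 (meas ϱ) ∧ dress ϱ f =ᵐ[meas ϱ] g := by
  have hA := hD.dominated.adm
  have hf : MemLp f 2 (meas ϱ) := by
    obtain ⟨C, hC⟩ := hA.exists_memLp_potl (E := ℂ)
    refine (memLp_congr_ae ?_).2 (hg.sub (hC g (hA.weighted_memLp hg)).1)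
    filter_upwards [hge] with x hx
    rw [Pi.sub_apply]
    linear_combination -hx
  refine ⟨hf, ?_⟩
  obtain ⟨hd, hde⟩ := hD.dress_spec hf
  have h1 := hD.eq_zero (g := fun x => dress ϱ f x - g x) (hd.sub hg) (by
    filter_upwards [hA.ae_pos, hge] with x hx hx2
    rw [hA.potl_sub (hA.weighted_memLp hd) (hA.weighted_memLp hg) hx.ne']
    linear_combination hde x - hx2)
  filter_upwards [h1] with x hx
  exact sub_eq_zero.1 hx

/-- Dividing h₁ = Th₁ + κ by κ gives the equation of the dressed constant. -/
lemma dress_one (hD : Dressable ϱ w h₁ κ) {x : ℝ} (hx : 0 < x) :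
    dress ϱ (fun _ => 1) x = κ⁻¹ * h₁ x := by
  have hA := hD.dominated.adm
  have hfin := hA.isFiniteMeasure
  have h1 := (hD.dress_ae_eq (f := fun _ => 1) (g := fun x => κ⁻¹ * h₁ x)
    (hD.memLp.const_mul _) (by
      filter_upwards [hA.ae_pos] with x hx
      rw [potl_const_mul, hD.response x hx, mul_add, inv_mul_cancel₀ hD.ne, add_comm])).2
  rw [(hD.dress_spec (memLp_const 1)).2 x, Adm.potl_congr h1, potl_const_mul, hD.response x hx,
    mul_add, inv_mul_cancel₀ hD.ne, add_comm]

/-! #### The dual side -/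

lemma memDual_mul (hpos : ∀ x, 0 < x → 0 < ϱ x) {u : ℝ → ℂ} (hu : MemLp u 2 (meas ϱ)) :
    MemDual ϱ (fun z => (ϱ z : ℂ) * u z) := by
  unfold MemDual
  refine (memLp_congr_ae ?_).2 hu
  refine ae_meas_of_pos fun z hz => ?_
  have h0 : (ϱ z : ℂ) ≠ 0 := by exact_mod_cast (hpos z hz).ne'
  exact mul_div_cancel_left₀ _ h0

lemma _root_.Volterra.MemDual.congr {f g : ℝ → ℂ} (hg : MemDual ϱ g)
    (h : ∀ z, 0 < z → f z = g z) : MemDual ϱ f := by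
  refine (memLp_congr_ae (ae_meas_of_pos fun z hz => ?_)).2 hg
  rw [h z hz]

lemma mul_div_ofReal (hpos : ∀ x, 0 < x → 0 < ϱ x) (f : ℝ → ℂ) {z : ℝ} (hz : 0 < z) :
    (ϱ z : ℂ) * (f z / ϱ z) = f z := by
  rw [mul_div_cancel₀]
  exact_mod_cast (hpos z hz).ne'

lemma T_dual (hd : Dominated ϱ w) (hpos : ∀ x, 0 < x → 0 < ϱ x) (h : ℝ → ℂ) (x : ℝ) :
    T h x = potl (meas ϱ) (fun z => h z / ϱ z) x := by
  rw [← T_ofReal_mul hd]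
  exact T_congr (fun z hz => (mul_div_ofReal hpos h hz).symm) x

/-- The substitution h = ϱu turns the dual equation into the dressing equation for u with source
f/ϱ. The representative is again fixed pointwise by the equation itself. -/
lemma existsUnique_isCodressed (hD : Dressable ϱ w h₁ κ) {f : ℝ → ℂ} (hf : MemDual ϱ f) :
    ∃! h, IsCodressed ϱ f h := by
  have hA := hD.dominated.adm
  obtain ⟨u, hu, hue⟩ := hD.exists_solution hf
  have e : ∀ z, 0 < z → f z + ϱ z * potl (meas ϱ) u z = ϱ z * u z := fun z hz => by
    rw [hue z, mul_add, mul_div_ofReal hD.pos f hz]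
  refine ⟨fun x => f x + ϱ x * potl (meas ϱ) u x, ⟨?_, fun x => ?_⟩, fun h' ⟨hh', he'⟩ => ?_⟩
  · exact (memDual_mul hD.pos hu).congr e
  · rw [T_congr e, T_ofReal_mul hD.dominated]
  · have h1 := hD.eq_zero (g := fun x => h' x / ϱ x - u x) (hh'.sub hu) (by
      filter_upwards [hA.ae_pos] with x hx
      have h0 : (ϱ x : ℂ) ≠ 0 := by exact_mod_cast (hD.pos x hx).ne'
      rw [hA.potl_sub (hA.weighted_memLp hh') (hA.weighted_memLp hu) hx.ne',
        ← T_dual hD.dominated hD.pos]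
      have h2 : h' x / ϱ x = f x / ϱ x + T h' x := by
        rw [he' x]; field_simp
      linear_combination h2 - hue x)
    have h2 : (fun x => h' x / (ϱ x : ℂ)) =ᵐ[meas ϱ] u := by
      filter_upwards [h1] with x hx
      exact sub_eq_zero.1 hx
    funext x
    rw [he' x, T_dual hD.dominated hD.pos, Adm.potl_congr h2]

lemma codress_spec (hD : Dressable ϱ w h₁ κ) {f : ℝ → ℂ} (hf : MemDual ϱ f) :
    IsCodressed ϱ f (codress ϱ f) :=
  Classical.epsilon_spec (hD.existsUnique_isCodressed hf).exists

lemma codress_mul (hD : Dressable ϱ w h₁ κ) {f : ℝ → ℂ} (hf : MemLp f 2 (meas ϱ)) (x : ℝ) :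
    codress ϱ (fun z => (ϱ z : ℂ) * f z) x = ϱ x * dress ϱ f x := by
  obtain ⟨hd, hde⟩ := hD.dress_spec hf
  have h1 : IsCodressed ϱ (fun z => (ϱ z : ℂ) * f z) (fun z => (ϱ z : ℂ) * dress ϱ f z) := by
    refine ⟨memDual_mul hD.pos hd, fun w => ?_⟩
    rw [T_ofReal_mul hD.dominated, ← mul_add, ← hde w]
  have hf' := memDual_mul hD.pos hf
  exact congrFun ((hD.existsUnique_isCodressed hf').unique (hD.codress_spec hf') h1) x

/-- Recognizing the codressing on the half line. -/
lemma codress_eq (hD : Dressable ϱ w h₁ κ) {f u : ℝ → ℂ} (hu : MemLp u 2 (meas ϱ))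
    (he : ∀ x, 0 < x → (ϱ x : ℂ) * u x = f x + ϱ x * potl (meas ϱ) u x) :
    MemDual ϱ f ∧ ∀ x, 0 < x → codress ϱ f x = ϱ x * u x := by
  have hA := hD.dominated.adm
  have h1 : IsCodressed ϱ f (fun x => f x + ϱ x * potl (meas ϱ) u x) := by
    refine ⟨?_, fun x => ?_⟩
    · exact (memDual_mul hD.pos hu).congr fun z hz => (he z hz).symm
    · rw [T_congr (fun z hz => (he z hz).symm), T_ofReal_mul hD.dominated]
  have hf : MemDual ϱ f := by
    obtain ⟨C, hC⟩ := hA.exists_memLp_potl (E := ℂ)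
    refine (memLp_congr_ae (ae_meas_of_pos fun z hz => ?_)).2
      (hu.sub (hC u (hA.weighted_memLp hu)).1)
    have h0 : (ϱ z : ℂ) ≠ 0 := by exact_mod_cast (hD.pos z hz).ne'
    rw [Pi.sub_apply, div_eq_iff h0]
    linear_combination -he z hz
  refine ⟨hf, fun x hx => ?_⟩
  rw [(hD.existsUnique_isCodressed hf).unique (hD.codress_spec hf) h1, he x hx]

/-- With u the codressing of f divided by ϱ, the left side is the integral of u(1 − T)g^dr against ϱ
dx and the right side that of ((1 − T)u) g^dr. They agree by symmetry of the kernel. -/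
lemma adjoint (hD : Dressable ϱ w h₁ κ) {f g : ℝ → ℂ} (hf : MemDual ϱ f)
    (hg : MemLp g 2 (meas ϱ)) :
    Integrable (fun x => codress ϱ f x * g x) leb ∧ Integrable (fun x => f x * dress ϱ g x) leb ∧
      avg (fun x => codress ϱ f x * g x) = avg (fun x => f x * dress ϱ g x) := by
  have hA := hD.dominated.adm
  have hm := hD.dominated.measurable
  have h0 := hD.dominated.nonneg
  obtain ⟨hdg, hdge⟩ := hD.dress_spec hg
  obtain ⟨hu, hue⟩ := hD.codress_spec hf
  have e1 : (fun x => ϱ x • (codress ϱ f x / ϱ x * g x)) =ᵐ[leb] fun x => codress ϱ f x * g x := by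
    filter_upwards [ae_leb_pos] with x hx
    rw [Complex.real_smul, ← mul_assoc, mul_div_ofReal hD.pos _ hx]
  have e2 : (fun x => ϱ x • (f x / ϱ x * dress ϱ g x)) =ᵐ[leb] fun x => f x * dress ϱ g x := by
    filter_upwards [ae_leb_pos] with x hx
    rw [Complex.real_smul, ← mul_assoc, mul_div_ofReal hD.pos _ hx]
  have i1 : Integrable (fun x => codress ϱ f x / ϱ x * g x) (meas ϱ) := hu.integrable_mul hg
  have i2 : Integrable (fun x => f x / ϱ x * dress ϱ g x) (meas ϱ) := hf.integrable_mul hdg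
  refine ⟨((integrable_meas hm h0).1 i1).congr e1, ((integrable_meas hm h0).1 i2).congr e2, ?_⟩
  unfold avg
  rw [← integral_congr_ae e1, ← integral_congr_ae e2, ← integral_meas hm h0, ← integral_meas hm h0]
  set u : ℝ → ℂ := fun x => codress ϱ f x / ϱ x with hudef
  have hu' : MemLp u 2 (meas ϱ) := hu
  have k1 : ∫ x, u x * g x ∂(meas ϱ) = ∫ x, u x * dress ϱ g x ∂(meas ϱ) -
      ∫ x, u x * potl (meas ϱ) (dress ϱ g) x ∂(meas ϱ) := by
    rw [← integral_sub (f := fun x => u x * dress ϱ g x) (hu'.integrable_mul hdg)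
      (hA.integrable_mul_potl hu' hdg)]
    congr 1; funext x
    linear_combination (-u x) * hdge x
  have k2 : ∫ x, f x / ϱ x * dress ϱ g x ∂(meas ϱ) = ∫ x, u x * dress ϱ g x ∂(meas ϱ) -
      ∫ x, potl (meas ϱ) u x * dress ϱ g x ∂(meas ϱ) := by
    have h3 : Integrable (fun x => potl (meas ϱ) u x * dress ϱ g x) (meas ϱ) := by
      simpa only [mul_comm] using hA.integrable_mul_potl hdg hu'
    rw [← integral_sub (f := fun x => u x * dress ϱ g x) (hu'.integrable_mul hdg) h3]
    apply integral_congr_ae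
    filter_upwards [hA.ae_pos] with x hx
    have h0 : (ϱ x : ℂ) ≠ 0 := by exact_mod_cast (hD.pos x hx).ne'
    have h2 : u x = f x / ϱ x + potl (meas ϱ) u x := by
      rw [← T_dual hD.dominated hD.pos (codress ϱ f), hudef]
      simp only
      rw [hue x]
      field_simp
    linear_combination (-dress ϱ g x) * h2
  rw [k1, k2, hA.integral_mul_potl_comm hu' hdg]

end Dressable

/-! ### Functionals and multiplications -/

section functionals

variable {ν : Measure ℝ} {w : ℝ → ℝ}

/-- The pairing `u ↦ ∫ f u dν`. -/
def pairL {f : ℝ → ℂ} (hf : MemLp f 2 ν) : Lp ℂ 2 ν →L[ℂ] ℂ :=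
  innerSL ℂ (hf.star.toLp (star f))

lemma pairL_apply {f : ℝ → ℂ} (hf : MemLp f 2 ν) (u : Lp ℂ 2 ν) :
    pairL hf u = ∫ x, f x * u x ∂ν := by
  unfold pairL
  rw [innerSL_apply_apply, L2.inner_def]
  apply integral_congr_ae
  filter_upwards [hf.star.coeFn_toLp] with x hx
  rw [hx]
  simp [mul_comm]

lemma Adm.memLp_extF_mul (hA : Adm ν w) (F : Ioi (0 : ℝ) →ᵇ ℂ) {g : ℝ → ℂ} (hg : MemLp g 2 ν) :
    MemLp (fun x => extF F x * g x) 2 ν ∧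
      (eLpNorm (fun x => extF F x * g x) 2 ν).toReal ≤ ‖F‖ * (eLpNorm g 2 ν).toReal := by
  have hb : ∀ᵐ x ∂ν, ‖extF F x * g x‖ ≤ ‖F‖ * ‖g x‖ := by
    filter_upwards [hA.ae_pos] with x hx
    rw [norm_mul]
    gcongr
    exact norm_extF_le F hx
  refine ⟨hg.of_le_mul ((measurable_extF F).aestronglyMeasurable.mul hg.1) hb, ?_⟩
  have h1 := eLpNorm_le_mul_eLpNorm_of_ae_le_mul hb 2
  have h2 := ENNReal.toReal_mono (ENNReal.mul_ne_top ENNReal.ofReal_ne_top hg.2.ne) h1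
  rwa [ENNReal.toReal_mul, ENNReal.toReal_ofReal (norm_nonneg _)] at h2

/-- Multiplication by bounded functions on the half line. -/
def multL (hA : Adm ν w) : (Ioi (0 : ℝ) →ᵇ ℂ) →L[ℂ] Lp ℂ 2 ν →L[ℂ] Lp ℂ 2 ν :=
  LinearMap.mkContinuous₂
    (LinearMap.mk₂ ℂ (fun F g => (hA.memLp_extF_mul F (Lp.memLp g)).1.toLp _)
      (fun F G g => by
        rw [← MemLp.toLp_add]
        apply MemLp.toLp_congr
        filter_upwards [hA.ae_pos] with x hx
        rw [Pi.add_apply, extF_pos _ hx, extF_pos _ hx, extF_pos _ hx, BoundedContinuousFunction.add_apply,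
          add_mul])
      (fun k F g => by
        rw [← MemLp.toLp_const_smul]
        apply MemLp.toLp_congr
        filter_upwards [hA.ae_pos] with x hx
        rw [Pi.smul_apply, extF_pos _ hx, extF_pos _ hx]
        exact mul_assoc _ _ _)
      (fun F g h => by
        rw [← MemLp.toLp_add]
        apply MemLp.toLp_congr
        filter_upwards [Lp.coeFn_add g h] with x hx
        rw [Pi.add_apply, hx, Pi.add_apply, mul_add])
      (fun k F g => by
        rw [← MemLp.toLp_const_smul]
        apply MemLp.toLp_congr
        filter_upwards [Lp.coeFn_smul k g] with x hx
        rw [Pi.smul_apply, hx, Pi.smul_apply, smul_eq_mul, smul_eq_mul, mul_left_comm]))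
    1 (fun F g => by
      rw [one_mul]
      change ‖(hA.memLp_extF_mul F (Lp.memLp g)).1.toLp _‖ ≤ _
      rw [Lp.norm_toLp, Lp.norm_def]
      exact (hA.memLp_extF_mul F (Lp.memLp g)).2)

lemma multL_coe (hA : Adm ν w) (F : Ioi (0 : ℝ) →ᵇ ℂ) (g : Lp ℂ 2 ν) :
    multL hA F g =ᵐ[ν] fun x => extF F x * g x := (hA.memLp_extF_mul F (Lp.memLp g)).1.coeFn_toLp

/-- The weighted extension `w F`. -/
def wext (w : ℝ → ℝ) (F : Ioi (0 : ℝ) →ᵇ ℂ) (x : ℝ) : ℂ := w x • extF F x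

lemma memLp_wext (hA : Adm ν w) (F : Ioi (0 : ℝ) →ᵇ ℂ) : MemLp (wext w F) 2 ν :=
  (hA.memLp_mul_extF F).1

/-- Evaluation of `w F`. -/
def evL (w : ℝ → ℝ) {x : ℝ} (hx : 0 < x) : (Ioi (0 : ℝ) →ᵇ ℂ) →L[ℂ] ℂ :=
  (w x : ℂ) • BoundedContinuousFunction.evalCLM ℂ ⟨x, hx⟩

lemma evL_apply (w : ℝ → ℝ) {x : ℝ} (hx : 0 < x) (F : Ioi (0 : ℝ) →ᵇ ℂ) :
    evL w hx F = wext w F x := by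
  unfold evL wext
  rw [extF_pos F hx, Complex.real_smul]; rfl

lemma Adm.memLp_lk_ofReal (hA : Adm ν w) {x : ℝ} (hx : x ≠ 0) :
    MemLp (fun z => ((w z * lk x z : ℝ) : ℂ)) 2 ν := (hA.memLp_lk hx).ofReal

lemma Adm.memLp_lk_ofReal_one (hA : Adm ν w) {x : ℝ} (hx : x ≠ 0) :
    MemLp (fun z => (lk x z : ℂ)) 2 ν := by
  simpa using hA.one.memLp_lk_ofReal hx

/-- The potential of `w F` at a point. -/
def potL (hA : Adm ν w) {x : ℝ} (hx : 0 < x) : (Ioi (0 : ℝ) →ᵇ ℂ) →L[ℂ] ℂ :=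
  (pairL (hA.memLp_lk_ofReal_one hx.ne')).comp (multW hA)

lemma potL_apply (hA : Adm ν w) {x : ℝ} (hx : 0 < x) (F : Ioi (0 : ℝ) →ᵇ ℂ) :
    potL hA hx F = potl ν (wext w F) x := by
  unfold potL potl
  rw [ContinuousLinearMap.comp_apply, pairL_apply]
  apply integral_congr_ae
  filter_upwards [multW_coe hA F] with z hz
  rw [hz, Complex.real_smul]; rfl

lemma pairL_multW {f : ℝ → ℂ} (hf : MemLp f 2 ν) (hA : Adm ν w) (F : Ioi (0 : ℝ) →ᵇ ℂ) :
    (pairL hf).comp (multW hA) F = ∫ x, f x * wext w F x ∂ν := by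
  rw [ContinuousLinearMap.comp_apply, pairL_apply]
  apply integral_congr_ae
  filter_upwards [multW_coe hA F] with z hz
  rw [hz]; rfl

end functionals

/-! ### Expansion of a branch -/

section expansion

variable {ℓ : ℕ} {c : ℕ → ℝ} {β : ℝ} {W : ℂ[X]} {R : ℝ → ℝ → ℝ → ℂ} {M : ℝ → ℝ → ℂ}
  {F : ℝ × ℝ → (Ioi (0 : ℝ) →ᵇ ℂ)}

/-- `R = ϱ w F` near `(β, 0)` with `F` smooth. -/
structure IsExpansion (ℓ : ℕ) (c : ℕ → ℝ) (β : ℝ) (W : ℂ[X]) (R : ℝ → ℝ → ℝ → ℂ)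
    (M : ℝ → ℝ → ℂ) (F : ℝ × ℝ → (Ioi (0 : ℝ) →ᵇ ℂ)) : Prop where
  contDiff : ContDiffAt ℝ 2 F (β, 0)
  contDiff_mult : ContDiffAt ℝ 2 (fun p : ℝ × ℝ => M p.1 p.2) (β, 0)
  density : ∀ᶠ p in 𝓝 ((β, 0) : ℝ × ℝ), ∀ x, 0 < x →
    R p.1 p.2 x = rho β (pot ℓ c) x * wext (wt (c ℓ / 2) ℓ) (F p) x
  eq : ∀ᶠ p in 𝓝 ((β, 0) : ℝ × ℝ), ∀ x, 0 < x →
    (x * rho β (pot ℓ c) x : ℂ) * wext (wt (c ℓ / 2) ℓ) (F p) x =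
      Complex.exp (potl (meas (rho β (pot ℓ c))) (wext (wt (c ℓ / 2) ℓ) (F p)) x +
        (ext (pot ℓ c) x + p.2 * ext W x) + M p.1 p.2 - 1)
  mass : ∀ᶠ p in 𝓝 ((β, 0) : ℝ × ℝ),
    ∫ x, wext (wt (c ℓ / 2) ℓ) (F p) x ∂(meas (rho β (pot ℓ c))) = p.1
  one : ∀ x, 0 < x → wext (wt (c ℓ / 2) ℓ) (F (β, 0)) x = 1

lemma IsBranch.exists_expansion (hℓ : 1 ≤ ℓ) (hc : 0 < c ℓ) (hβ : 0 < β)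
    (hB : IsBranch ℓ c β W R M) : ∃ F, IsExpansion ℓ c β W R M F := by
  have hd := rho_dominated hℓ hc hβ
  have hE := (exists_equilibrium hℓ hc hβ).1
  obtain ⟨F, hF, hRF⟩ := hB.smooth
  have hden : ∀ᶠ p in 𝓝 ((β, 0) : ℝ × ℝ), ∀ x, 0 < x →
      R p.1 p.2 x = rho β (pot ℓ c) x * wext (wt (c ℓ / 2) ℓ) (F p) x := by
    filter_upwards [hRF] with p hp x hx
    rw [hp ⟨x, hx⟩]
    unfold wext wt
    rw [extF_pos _ hx, Complex.real_smul]
    push_cast; ring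
  refine ⟨F, hF, hB.smooth_mult, hden, ?_, ?_, fun x hx => ?_⟩
  · filter_upwards [hden, hB.eulerLagrange] with p hp hpe x hx
    rw [mul_assoc, ← hp x hx, hpe x hx, ext_add, ext_C_mul, T_congr hp, T_ofReal_mul hd]
  · filter_upwards [hden, hB.mass] with p hp hpm
    rw [← hpm, integral_meas hd.measurable hd.nonneg]
    unfold avg
    apply integral_congr_ae
    filter_upwards [ae_leb_pos] with x hx
    rw [hp x hx, Complex.real_smul]
  · have h1 := (hB.minimizer.self_of_nhds ⟨ℓ, c, hℓ, hc, by simp⟩).1 x hx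
    have h2 := hden.self_of_nhds x hx
    have h3 : pot ℓ c + C (((β, 0) : ℝ × ℝ).2 : ℂ) * W = pot ℓ c := by simp
    rw [h3] at h1
    rw [h1] at h2
    have h0 : (rho β (pot ℓ c) x : ℂ) ≠ 0 := by exact_mod_cast (hE.pos x hx).ne'
    exact mul_left_cancel₀ h0 (h2.symm.trans (mul_one _).symm)

/-- The exponential form reproduces itself under differentiation, and the factor xϱ cancels.
Evaluation and the potential at a point are continuous linear functionals of F, so the chain rule
applies pointwise. The identity is kept in a neighbourhood because it is differentiated once more.
-/
lemma IsExpansion.first_order (hℓ : 1 ≤ ℓ) (hc : 0 < c ℓ) (hβ : 0 < β)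
    (hX : IsExpansion ℓ c β W R M F) : ∀ᶠ p in 𝓝 ((β, 0) : ℝ × ℝ), ∀ v : ℝ × ℝ,
      (∀ x, 0 < x → wext (wt (c ℓ / 2) ℓ) (fderiv ℝ F p v) x =
        wext (wt (c ℓ / 2) ℓ) (F p) x *
          (potl (meas (rho β (pot ℓ c))) (wext (wt (c ℓ / 2) ℓ) (fderiv ℝ F p v)) x +
            v.2 * ext W x + fderiv ℝ (fun p : ℝ × ℝ => M p.1 p.2) p v)) ∧
      ∫ x, wext (wt (c ℓ / 2) ℓ) (fderiv ℝ F p v) x ∂(meas (rho β (pot ℓ c))) = v.1 := by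
  have hE := (exists_equilibrium hℓ hc hβ).1
  have hA := rho_adm hℓ hc hβ
  have hfin := hA.isFiniteMeasure
  set w := wt (c ℓ / 2) ℓ
  set ϱ := rho β (pot ℓ c)
  have hdF : ∀ᶠ p in 𝓝 ((β, 0) : ℝ × ℝ), DifferentiableAt ℝ F p :=
    ((hX.contDiff.eventually (by simp)).mono fun p hp => hp.differentiableAt (by norm_num))
  have hdM : ∀ᶠ p in 𝓝 ((β, 0) : ℝ × ℝ),
      DifferentiableAt ℝ (fun p : ℝ × ℝ => M p.1 p.2) p :=
    ((hX.contDiff_mult.eventually (by simp)).mono fun p hp => hp.differentiableAt (by norm_num))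
  filter_upwards [hdF, hdM, hX.eq.eventually_nhds, hX.mass.eventually_nhds] with p hF hM heq hmass v
  have hcomp : ∀ Φ : (Ioi (0 : ℝ) →ᵇ ℂ) →L[ℂ] ℂ, HasFDerivAt (fun q => Φ (F q))
      ((Φ.restrictScalars ℝ).comp (fderiv ℝ F p)) p := fun Φ =>
    (Φ.restrictScalars ℝ).hasFDerivAt.comp p hF.hasFDerivAt
  constructor
  · intro x hx
    have h1 := (hcomp (evL w hx)).const_mul (x * ϱ x : ℂ)
    have hs : HasFDerivAt (fun q : ℝ × ℝ => (q.2 : ℂ) * ext W x)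
        (((Complex.ofRealCLM.comp (ContinuousLinearMap.snd ℝ ℝ ℝ))).smulRight (ext W x)) p :=
      ((Complex.ofRealCLM.comp (ContinuousLinearMap.snd ℝ ℝ ℝ)).hasFDerivAt).mul_const' _
    have h2 := ((((hcomp (potL hA hx)).add (hs.const_add (ext (pot ℓ c) x))).add
      hM.hasFDerivAt).sub_const 1).cexp
    have h3 := h1.unique (h2.congr_of_eventuallyEq (heq.mono fun q hq => by
      have := hq x hx
      simp only [evL_apply, potL_apply, Pi.add_apply]
      exact this))
    have h4 := DFunLike.congr_fun h3 v
    have h5 := heq.self_of_nhds x hx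
    simp only [smul_apply, add_apply, ContinuousLinearMap.comp_apply,
      ContinuousLinearMap.coe_restrictScalars', ContinuousLinearMap.smulRight_apply, Pi.add_apply,
      evL_apply, potL_apply, smul_eq_mul, Complex.ofRealCLM_apply, ContinuousLinearMap.coe_snd'] at h4
    rw [← h5] at h4
    have h0 : (x * ϱ x : ℂ) ≠ 0 := by
      exact_mod_cast (mul_pos hx (hE.pos x hx)).ne'
    rw [mul_assoc (x * ϱ x : ℂ)] at h4
    exact mul_left_cancel₀ h0 h4
  · have h1 := hcomp ((pairL (memLp_const (1 : ℂ))).comp (multW hA))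
    have h2 : HasFDerivAt (fun q : ℝ × ℝ => (q.1 : ℂ))
        (Complex.ofRealCLM.comp (ContinuousLinearMap.fst ℝ ℝ ℝ)) p :=
      (Complex.ofRealCLM.comp (ContinuousLinearMap.fst ℝ ℝ ℝ)).hasFDerivAt
    have h3 := h1.unique (h2.congr_of_eventuallyEq (hmass.mono fun q hq => by
      beta_reduce
      rw [pairL_multW, ← hq]
      simp only [one_mul, w, ϱ]))
    have h4 := DFunLike.congr_fun h3 v
    rw [ContinuousLinearMap.comp_apply, ContinuousLinearMap.coe_restrictScalars', pairL_multW] at h4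
    simp only [one_mul] at h4
    exact h4

end expansion

/-! ### Derivatives along a branch -/

lemma hasDerivAt_re_of_eventuallyEq {f : ℝ → ℂ} {g : ℝ → ℝ} {f' : ℂ} {b : ℝ}
    (hf : HasDerivAt f f' b) (h : ∀ᶠ y in 𝓝 b, f y = g y) :
    HasDerivAt g f'.re b ∧ ((deriv g b : ℝ) : ℂ) = f' := by
  have h1 : HasDerivAt g f'.re b := by
    have := Complex.reCLM.hasFDerivAt.comp_hasDerivAt b hf
    refine this.congr_of_eventuallyEq (h.mono fun y hy => ?_)
    simp [hy]
  refine ⟨h1, ?_⟩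
  rw [h1.deriv]
  exact h1.ofReal_comp.unique (hf.congr_of_eventuallyEq (h.mono fun y hy => hy.symm))

section derivatives

variable {ℓ : ℕ} {c : ℕ → ℝ} {β : ℝ} {W : ℂ[X]} {R : ℝ → ℝ → ℝ → ℂ} {M : ℝ → ℝ → ℂ}
  {F : ℝ × ℝ → (Ioi (0 : ℝ) →ᵇ ℂ)}

lemma IsExpansion.eventually_differentiableAt (hX : IsExpansion ℓ c β W R M F) :
    ∀ᶠ p in 𝓝 ((β, 0) : ℝ × ℝ), DifferentiableAt ℝ F p ∧
      DifferentiableAt ℝ (fun p : ℝ × ℝ => M p.1 p.2) p :=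
  (hX.contDiff.eventually (by simp)).and (hX.contDiff_mult.eventually (by simp)) |>.mono
    fun _ hp => ⟨hp.1.differentiableAt (by norm_num), hp.2.differentiableAt (by norm_num)⟩

lemma hasDerivAt_comp_evL {F : ℝ × ℝ → (Ioi (0 : ℝ) →ᵇ ℂ)} {γ : ℝ → ℝ × ℝ} {γ' p : ℝ × ℝ} {s : ℝ}
    (hF : DifferentiableAt ℝ F p) (hγ : HasDerivAt γ γ' s) (hp : γ s = p) (w : ℝ → ℝ) {x : ℝ}
    (hx : 0 < x) :
    HasDerivAt (fun s => wext w (F (γ s)) x) (wext w (fderiv ℝ F p γ') x) s := by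
  subst hp
  have h1 := ((evL w hx).restrictScalars ℝ).hasFDerivAt.comp_hasDerivAt s
    (hF.hasFDerivAt.comp_hasDerivAt s hγ)
  have h2 := h1.congr_of_eventuallyEq (f₁ := fun s => wext w (F (γ s)) x)
    (Eventually.of_forall fun s => by simp [evL_apply])
  simpa [evL_apply] using h2

lemma hasDerivAt_line (b s : ℝ) : HasDerivAt (fun b' : ℝ => (b', s)) ((1, 0) : ℝ × ℝ) b :=
  (hasDerivAt_id b).prodMk (hasDerivAt_const b s)

lemma tendsto_line (b s : ℝ) : Tendsto (fun b' : ℝ => (b', s)) (𝓝 b) (𝓝 ((b, s) : ℝ × ℝ)) :=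
  (hasDerivAt_line b s).continuousAt

lemma IsBranch.eventually_minimizer (hℓ : 1 ≤ ℓ) (hc : 0 < c ℓ) (hB : IsBranch ℓ c β W R M) :
    ∀ᶠ b in 𝓝 β, (∀ x, 0 < x → R b 0 x = rho b (pot ℓ c) x) ∧ M b 0 = mu b (pot ℓ c) := by
  filter_upwards [(tendsto_line β 0).eventually hB.minimizer] with b hb
  have h3 : pot ℓ c + C (((b, 0) : ℝ × ℝ).2 : ℂ) * W = pot ℓ c := by simp
  rw [h3] at hb
  exact hb ⟨ℓ, c, hℓ, hc, rfl⟩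

/-- At s = 0 every branch, whatever its direction, is the minimizer. Smoothness of the branch thus
yields differentiability in the mass and identifies κ with the b-derivative of the multiplier. -/
lemma IsBranch.eventually_mass_derivatives (hℓ : 1 ≤ ℓ) (hc : 0 < c ℓ)
    (hB : IsBranch ℓ c β W R M) (hX : IsExpansion ℓ c β W R M F) :
    ∀ᶠ b in 𝓝 β, DifferentiableAt ℝ (fun b' => mu b' (pot ℓ c)) b ∧
      (kappa b (pot ℓ c) : ℂ) = fderiv ℝ (fun p : ℝ × ℝ => M p.1 p.2) (b, 0) (1, 0) ∧
      ∀ x, 0 < x → DifferentiableAt ℝ (fun b' => rho b' (pot ℓ c) x) b ∧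
        ((deriv (fun b' => rho b' (pot ℓ c) x) b : ℝ) : ℂ) =
          rho β (pot ℓ c) x * wext (wt (c ℓ / 2) ℓ) (fderiv ℝ F (b, 0) (1, 0)) x := by
  filter_upwards [(tendsto_line β 0).eventually hX.eventually_differentiableAt,
    (hB.eventually_minimizer hℓ hc).eventually_nhds,
    ((tendsto_line β 0).eventually hX.density).eventually_nhds] with b hb hmin hden
  have h1 : HasDerivAt (fun b' => M b' 0) (fderiv ℝ (fun p : ℝ × ℝ => M p.1 p.2) (b, 0) (1, 0)) b :=
    hb.2.hasFDerivAt.comp_hasDerivAt (f := fun b' => (b', (0 : ℝ))) b (hasDerivAt_line b 0)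
  obtain ⟨h2, h3⟩ := hasDerivAt_re_of_eventuallyEq h1 (hmin.mono fun y hy => hy.2)
  refine ⟨h2.differentiableAt, h3, fun x hx => ?_⟩
  have h4 := (hasDerivAt_comp_evL (γ := fun b' => (b', (0 : ℝ))) hb.1 (hasDerivAt_line b 0)
    rfl (wt (c ℓ / 2) ℓ) hx).const_mul (rho β (pot ℓ c) x : ℂ)
  obtain ⟨h5, h6⟩ := hasDerivAt_re_of_eventuallyEq (g := fun b' => rho b' (pot ℓ c) x) h4 (by
    filter_upwards [hmin, hden] with y hy hyd
    rw [← hy.1 x hx, hyd x hx])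
  exact ⟨h5.differentiableAt, h6⟩

/-- `∂_μ ϱ = ϱ w S` with `S` as follows. -/
def muDeriv (M : ℝ → ℝ → ℂ) (F : ℝ × ℝ → (Ioi (0 : ℝ) →ᵇ ℂ)) (p : ℝ × ℝ) : Ioi (0 : ℝ) →ᵇ ℂ :=
  (fderiv ℝ (fun p : ℝ × ℝ => M p.1 p.2) p (1, 0))⁻¹ • fderiv ℝ F p (1, 0)

lemma wext_smul (w : ℝ → ℝ) (k : ℂ) (G : Ioi (0 : ℝ) →ᵇ ℂ) {x : ℝ} (hx : 0 < x) :
    wext w (k • G) x = k * wext w G x := by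
  rw [← evL_apply w hx, ← evL_apply w hx, map_smul, smul_eq_mul]

lemma potl_wext_smul {ν : Measure ℝ} {w : ℝ → ℝ} (hA : Adm ν w) (k : ℂ) (G : Ioi (0 : ℝ) →ᵇ ℂ)
    {x : ℝ} (hx : 0 < x) : potl ν (wext w (k • G)) x = k * potl ν (wext w G) x := by
  rw [← potL_apply hA hx, ← potL_apply hA hx, map_smul, smul_eq_mul]

/-- The first-order equation in the direction (1,0) is the response to a unit of mass at fixed
potential; its multiplier is κ. -/
lemma IsExpansion.dressable (hℓ : 1 ≤ ℓ) (hc : 0 < c ℓ) (hβ : 0 < β)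
    (hB : IsBranch ℓ c β W R M) (hX : IsExpansion ℓ c β W R M F)
    (hκ : kappa β (pot ℓ c) ≠ 0) :
    Dressable (rho β (pot ℓ c)) (wt (c ℓ / 2) ℓ)
      (wext (wt (c ℓ / 2) ℓ) (fderiv ℝ F (β, 0) (1, 0))) (kappa β (pot ℓ c)) := by
  have h1 := (hX.first_order hℓ hc hβ).self_of_nhds (1, 0)
  refine ⟨rho_dominated hℓ hc hβ, (exists_equilibrium hℓ hc hβ).1.pos,
    memLp_wext (rho_adm hℓ hc hβ) _, by simpa using h1.2, fun x hx => ?_, by exact_mod_cast hκ⟩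
  have h2 := h1.1 x hx
  rw [hX.one x hx, one_mul, ← ((hB.eventually_mass_derivatives hℓ hc hX).self_of_nhds).2.1] at h2
  simpa using h2

lemma IsExpansion.dress_one (hℓ : 1 ≤ ℓ) (hc : 0 < c ℓ) (hβ : 0 < β)
    (hB : IsBranch ℓ c β W R M) (hX : IsExpansion ℓ c β W R M F)
    (hκ : kappa β (pot ℓ c) ≠ 0) {x : ℝ} (hx : 0 < x) :
    dress (rho β (pot ℓ c)) (fun _ => 1) x = wext (wt (c ℓ / 2) ℓ) (muDeriv M F (β, 0)) x := by
  rw [(hX.dressable hℓ hc hβ hB hκ).dress_one hx, muDeriv, wext_smul _ _ _ hx,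
    ← ((hB.eventually_mass_derivatives hℓ hc hX).self_of_nhds).2.1]

lemma IsExpansion.differentiableAt_muDeriv (hℓ : 1 ≤ ℓ) (hc : 0 < c ℓ)
    (hB : IsBranch ℓ c β W R M) (hX : IsExpansion ℓ c β W R M F)
    (hκ : kappa β (pot ℓ c) ≠ 0) : DifferentiableAt ℝ (muDeriv M F) (β, 0) := by
  have h1 : DifferentiableAt ℝ (fun p => fderiv ℝ F p (1, 0)) (β, 0) :=
    ((hX.contDiff.fderiv_right (m := 1) (by norm_num)).differentiableAt one_ne_zero).clm_apply
      (differentiableAt_const _)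
  have h2 : DifferentiableAt ℝ
      (fun p => fderiv ℝ (fun p : ℝ × ℝ => M p.1 p.2) p (1, 0)) (β, 0) :=
    ((hX.contDiff_mult.fderiv_right (m := 1) (by norm_num)).differentiableAt one_ne_zero).clm_apply
      (differentiableAt_const _)
  refine (h2.inv ?_).smul h1
  rw [← ((hB.eventually_mass_derivatives hℓ hc hX).self_of_nhds).2.1]
  exact_mod_cast hκ

lemma IsExpansion.eventually_ne (hℓ : 1 ≤ ℓ) (hc : 0 < c ℓ)
    (hB : IsBranch ℓ c β W R M) (hX : IsExpansion ℓ c β W R M F)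
    (hκ : kappa β (pot ℓ c) ≠ 0) : ∀ᶠ p in 𝓝 ((β, 0) : ℝ × ℝ),
      fderiv ℝ (fun p : ℝ × ℝ => M p.1 p.2) p (1, 0) ≠ 0 := by
  have h2 : ContinuousAt
      (fun p => fderiv ℝ (fun p : ℝ × ℝ => M p.1 p.2) p (1, 0)) (β, 0) :=
    (((hX.contDiff_mult.fderiv_right (m := 1) (by norm_num)).differentiableAt
      one_ne_zero).clm_apply (differentiableAt_const _)).continuousAt
  refine h2.eventually_ne ?_
  rw [← ((hB.eventually_mass_derivatives hℓ hc hX).self_of_nhds).2.1]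
  exact_mod_cast hκ

/-- The second derivatives `∂_v ∂_μ ϱ` solve the codressing equation. -/
lemma IsExpansion.second_order (hℓ : 1 ≤ ℓ) (hc : 0 < c ℓ) (hβ : 0 < β)
    (hB : IsBranch ℓ c β W R M) (hX : IsExpansion ℓ c β W R M F)
    (hκ : kappa β (pot ℓ c) ≠ 0) (v : ℝ × ℝ) {x : ℝ} (hx : 0 < x) :
    wext (wt (c ℓ / 2) ℓ) (fderiv ℝ (muDeriv M F) (β, 0) v) x =
      wext (wt (c ℓ / 2) ℓ) (fderiv ℝ F (β, 0) v) x * dress (rho β (pot ℓ c)) (fun _ => 1) x +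
        potl (meas (rho β (pot ℓ c)))
          (wext (wt (c ℓ / 2) ℓ) (fderiv ℝ (muDeriv M F) (β, 0) v)) x := by
  have hA := rho_adm hℓ hc hβ
  -- Dividing the first-order equation by the derivative of the multiplier turns the constant into
  -- 1. The product rule at the base point, where wF = 1 and the bracket is the dressed constant,
  -- gives the claim.
  have key : ∀ᶠ p in 𝓝 ((β, 0) : ℝ × ℝ), evL (wt (c ℓ / 2) ℓ) hx (muDeriv M F p) =
      evL (wt (c ℓ / 2) ℓ) hx (F p) * (potL hA hx (muDeriv M F p) + 1) := by
    filter_upwards [hX.first_order hℓ hc hβ, hX.eventually_ne hℓ hc hB hκ] with p hp h0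
    have h1 := (hp (1, 0)).1 x hx
    rw [evL_apply, evL_apply, potL_apply, muDeriv, wext_smul _ _ _ hx, potl_wext_smul hA _ _ hx, h1]
    field_simp
    push_cast
    ring
  have hS := (hX.differentiableAt_muDeriv hℓ hc hB hκ).hasFDerivAt
  have hF := (hX.eventually_differentiableAt.self_of_nhds).1.hasFDerivAt
  have hcomp : ∀ (Φ : (Ioi (0 : ℝ) →ᵇ ℂ) →L[ℂ] ℂ) {G : ℝ × ℝ → (Ioi (0 : ℝ) →ᵇ ℂ)}
      {G' : ℝ × ℝ →L[ℝ] (Ioi (0 : ℝ) →ᵇ ℂ)}, HasFDerivAt G G' (β, 0) →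
      HasFDerivAt (fun q => Φ (G q)) ((Φ.restrictScalars ℝ).comp G') (β, 0) := fun Φ _ _ h =>
    (Φ.restrictScalars ℝ).hasFDerivAt.comp (β, 0) h
  have h1 := hcomp (evL (wt (c ℓ / 2) ℓ) hx) hS
  have h2 := (hcomp (evL (wt (c ℓ / 2) ℓ) hx) hF).mul
    ((hcomp (potL hA hx) hS).add_const 1)
  have h3 := DFunLike.congr_fun (h1.unique (h2.congr_of_eventuallyEq key)) v
  have h4 := key.self_of_nhds
  simp only [smul_apply, add_apply, ContinuousLinearMap.comp_apply,
    ContinuousLinearMap.coe_restrictScalars', evL_apply, potL_apply, smul_eq_mul,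
    hX.one x hx] at h3 h4
  rw [hX.dress_one hℓ hc hβ hB hκ hx, h4, h3]
  ring

lemma IsExpansion.codress_eq (hℓ : 1 ≤ ℓ) (hc : 0 < c ℓ) (hβ : 0 < β)
    (hB : IsBranch ℓ c β W R M) (hX : IsExpansion ℓ c β W R M F)
    (hκ : kappa β (pot ℓ c) ≠ 0) (v : ℝ × ℝ) {D : ℝ → ℂ}
    (hD : ∀ x, 0 < x →
      D x = rho β (pot ℓ c) x * wext (wt (c ℓ / 2) ℓ) (fderiv ℝ F (β, 0) v) x) :
    MemDual (rho β (pot ℓ c)) (fun z => D z * dress (rho β (pot ℓ c)) (fun _ => 1) z) ∧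
    ∀ x, 0 < x →
      codress (rho β (pot ℓ c)) (fun z => D z * dress (rho β (pot ℓ c)) (fun _ => 1) z) x =
        rho β (pot ℓ c) x * wext (wt (c ℓ / 2) ℓ) (fderiv ℝ (muDeriv M F) (β, 0) v) x :=
  (hX.dressable hℓ hc hβ hB hκ).codress_eq (memLp_wext (rho_adm hℓ hc hβ) _) fun x hx => by
    rw [hX.second_order hℓ hc hβ hB hκ v hx, hD x hx]
    ring

end derivatives

/-! ### Derivatives of the density, the averages and the multiplier -/

section results

variable {ℓ : ℕ} {c : ℕ → ℝ} {β : ℝ} {W : ℂ[X]} {R : ℝ → ℝ → ℝ → ℂ} {M : ℝ → ℝ → ℂ}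
  {F : ℝ × ℝ → (Ioi (0 : ℝ) →ᵇ ℂ)}

lemma hasDerivAt_ray (β b₀ : ℝ) :
    HasDerivAt (fun s : ℝ => (β + s * b₀, s)) ((b₀, 1) : ℝ × ℝ) 0 := by
  simpa using (((hasDerivAt_id (0 : ℝ)).mul_const b₀).const_add β).prodMk (hasDerivAt_id (0 : ℝ))

lemma IsExpansion.hasDerivAt_density (hX : IsExpansion ℓ c β W R M F) (b₀ : ℝ) {x : ℝ}
    (hx : 0 < x) : HasDerivAt (fun s : ℝ => R (β + s * b₀) s x)
      (rho β (pot ℓ c) x * wext (wt (c ℓ / 2) ℓ) (fderiv ℝ F (β, 0) (b₀, 1)) x) 0 := by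
  have h1 := (hasDerivAt_comp_evL (hX.eventually_differentiableAt.self_of_nhds).1
    (hasDerivAt_ray β b₀) (by simp) (wt (c ℓ / 2) ℓ) hx).const_mul (rho β (pot ℓ c) x : ℂ)
  refine h1.congr_of_eventuallyEq ?_
  have ht : Tendsto (fun s : ℝ => (β + s * b₀, s)) (𝓝 0) (𝓝 ((β, 0) : ℝ × ℝ)) := by
    simpa [ContinuousAt] using (hasDerivAt_ray β b₀).continuousAt
  filter_upwards [ht.eventually hX.density] with s hs
  exact hs x hx

lemma IsExpansion.eventually_deriv (hX : IsExpansion ℓ c β W R M F) :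
    ∀ᶠ p in 𝓝 ((β, 0) : ℝ × ℝ), ∀ x, 0 < x →
      (deriv (fun b : ℝ => M b p.2) p.1)⁻¹ * deriv (fun b : ℝ => R b p.2 x) p.1 =
        rho β (pot ℓ c) x * wext (wt (c ℓ / 2) ℓ) (muDeriv M F p) x := by
  filter_upwards [hX.eventually_differentiableAt, hX.density.eventually_nhds] with p hp hden x hx
  have h1 : HasDerivAt (fun b' => M b' p.2) (fderiv ℝ (fun p : ℝ × ℝ => M p.1 p.2) p (1, 0)) p.1 :=
    hp.2.hasFDerivAt.comp_hasDerivAt (f := fun b' => (b', p.2)) p.1 (hasDerivAt_line p.1 p.2)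
  have h2 := (hasDerivAt_comp_evL (γ := fun b' => (b', p.2)) hp.1 (hasDerivAt_line p.1 p.2)
    rfl (wt (c ℓ / 2) ℓ) hx).const_mul (rho β (pot ℓ c) x : ℂ)
  have h3 := h2.congr_of_eventuallyEq (f₁ := fun b : ℝ => R b p.2 x) (by
    filter_upwards [(tendsto_line p.1 p.2).eventually hden] with b hb
    exact hb x hx)
  rw [h1.deriv, h3.deriv, muDeriv, wext_smul _ _ _ hx]
  ring

theorem IsBranch.deriv_muDeriv (hℓ : 1 ≤ ℓ) (hc : 0 < c ℓ) (hβ : 0 < β)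
    (hB : IsBranch ℓ c β W R M) (hκ : kappa β (pot ℓ c) ≠ 0) (b₀ : ℝ) :
    ∃ D : ℝ → ℂ, (∀ x, 0 < x → HasDerivAt (fun s : ℝ => R (β + s * b₀) s x) (D x) 0) ∧
      MemDual (rho β (pot ℓ c)) (fun z => D z * dress (rho β (pot ℓ c)) (fun _ => 1) z) ∧
      ∀ x, 0 < x → HasDerivAt
        (fun s : ℝ => (deriv (fun b : ℝ => M b s) (β + s * b₀))⁻¹ *
          deriv (fun b : ℝ => R b s x) (β + s * b₀))
        (codress (rho β (pot ℓ c)) (fun z => D z * dress (rho β (pot ℓ c)) (fun _ => 1) z) x) 0 := by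
  obtain ⟨F, hX⟩ := hB.exists_expansion hℓ hc hβ
  obtain ⟨h1, h2⟩ := hX.codress_eq hℓ hc hβ hB hκ (b₀, 1) fun x _ => rfl
  refine ⟨_, fun x hx => hX.hasDerivAt_density b₀ hx, h1, fun x hx => ?_⟩
  rw [h2 x hx]
  have h3 := (hasDerivAt_comp_evL (hX.differentiableAt_muDeriv hℓ hc hB hκ)
    (hasDerivAt_ray β b₀) (by simp) (wt (c ℓ / 2) ℓ) hx).const_mul (rho β (pot ℓ c) x : ℂ)
  refine h3.congr_of_eventuallyEq ?_
  have ht : Tendsto (fun s : ℝ => (β + s * b₀, s)) (𝓝 0) (𝓝 ((β, 0) : ℝ × ℝ)) := by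
    simpa [ContinuousAt] using (hasDerivAt_ray β b₀).continuousAt
  filter_upwards [ht.eventually hX.eventually_deriv] with s hs
  exact hs x hx

lemma IsExpansion.eventually_sigma (hℓ : 1 ≤ ℓ) (hc : 0 < c ℓ)
    (hB : IsBranch ℓ c β W R M) (hX : IsExpansion ℓ c β W R M F) :
    ∀ᶠ b in 𝓝 β, ∀ x, 0 < x → (sigma b (pot ℓ c) x : ℂ) =
      rho β (pot ℓ c) x * wext (wt (c ℓ / 2) ℓ) (muDeriv M F (b, 0)) x := by
  filter_upwards [hB.eventually_mass_derivatives hℓ hc hX] with b hb x hx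
  unfold sigma
  rw [Complex.ofReal_mul, Complex.ofReal_inv, (hb.2.2 x hx).2, hb.2.1, muDeriv,
    wext_smul _ _ _ hx]
  ring

lemma IsExpansion.sigma_eq (hℓ : 1 ≤ ℓ) (hc : 0 < c ℓ) (hβ : 0 < β)
    (hB : IsBranch ℓ c β W R M) (hX : IsExpansion ℓ c β W R M F)
    (hκ : kappa β (pot ℓ c) ≠ 0) {x : ℝ} (hx : 0 < x) : (sigma β (pot ℓ c) x : ℂ) =
      rho β (pot ℓ c) x * dress (rho β (pot ℓ c)) (fun _ => 1) x := by
  rw [hX.dress_one hℓ hc hβ hB hκ hx, (hX.eventually_sigma hℓ hc hB).self_of_nhds x hx]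

lemma isDirection_zero : IsDirection ℓ 0 := fun k _ => by simp

/-- The average is a continuous functional of the smooth family `muDeriv`, so it may be
differentiated under the integral. This gives the pairing of f with the codressing of ∂_bϱ · 1^dr;
adjointness moves the dressing onto f, and ∂_bϱ = κσ. The trivial direction W = 0 suffices. -/
theorem deriv_avg_sigma (hℓ : 1 ≤ ℓ) (hc : 0 < c ℓ) (hβ : 0 < β)
    (hκ : kappa β (pot ℓ c) ≠ 0) {f : ℝ → ℂ} (hf : MemLp f 2 (meas (rho β (pot ℓ c)))) :
    (∀ᶠ b in 𝓝 β, Integrable (fun x => (sigma b (pot ℓ c) x : ℂ) * f x) leb) ∧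
    Integrable (fun x => (sigma β (pot ℓ c) x : ℂ) * dress (rho β (pot ℓ c)) (fun _ => 1) x *
      dress (rho β (pot ℓ c)) f x) leb ∧
    DifferentiableAt ℝ (fun b => avg (fun x => (sigma b (pot ℓ c) x : ℂ) * f x)) β ∧
    (kappa β (pot ℓ c) : ℂ)⁻¹ *
        deriv (fun b => avg (fun x => (sigma b (pot ℓ c) x : ℂ) * f x)) β =
      avg (fun x => (sigma β (pot ℓ c) x : ℂ) * dress (rho β (pot ℓ c)) (fun _ => 1) x *
        dress (rho β (pot ℓ c)) f x) := by
  obtain ⟨R, M, hB⟩ := exists_isBranch hℓ hc hβ isDirection_zero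
  obtain ⟨F, hX⟩ := hB.exists_expansion hℓ hc hβ
  have hd := rho_dominated hℓ hc hβ
  have hA := hd.adm
  have hDr := hX.dressable hℓ hc hβ hB hκ
  have hκ' : (kappa β (pot ℓ c) : ℂ) ≠ 0 := by exact_mod_cast hκ
  set ϱ := rho β (pot ℓ c) with hϱ
  set w := wt (c ℓ / 2) ℓ with hw
  have hsig := hX.eventually_sigma hℓ hc hB
  have esig : ∀ᶠ b in 𝓝 β, (fun x => (sigma b (pot ℓ c) x : ℂ) * f x) =ᵐ[leb]
      fun x => ϱ x • (f x * wext w (muDeriv M F (b, 0)) x) := by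
    filter_upwards [hsig] with b hb
    filter_upwards [ae_leb_pos] with x hx
    rw [hb x hx, Complex.real_smul]
    ring
  obtain ⟨hdual, hcod⟩ := hX.codress_eq hℓ hc hβ hB hκ (1, 0) fun x _ => rfl
  rw [← hϱ, ← hw] at hdual hcod
  obtain ⟨i1, i2, hadj⟩ := hDr.adjoint hdual hf
  have eD : ∀ x, 0 < x → ϱ x * wext w (fderiv ℝ F (β, 0) (1, 0)) x * dress ϱ (fun _ => 1) x *
      dress ϱ f x = kappa β (pot ℓ c) *
        ((sigma β (pot ℓ c) x : ℂ) * dress ϱ (fun _ => 1) x * dress ϱ f x) := fun x hx => by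
    rw [hX.sigma_eq hℓ hc hβ hB hκ hx, hDr.dress_one hx]
    field_simp
    rw [← hϱ]
    ring
  have eD' : (fun x => ϱ x * wext w (fderiv ℝ F (β, 0) (1, 0)) x * dress ϱ (fun _ => 1) x *
      dress ϱ f x) =ᵐ[leb] fun x => (kappa β (pot ℓ c) : ℂ) *
        ((sigma β (pot ℓ c) x : ℂ) * dress ϱ (fun _ => 1) x * dress ϱ f x) := by
    filter_upwards [ae_leb_pos] with x hx using eD x hx
  have hder : HasDerivAt (fun b => avg (fun x => (sigma b (pot ℓ c) x : ℂ) * f x))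
      (avg (fun x => codress ϱ (fun z => ϱ z * wext w (fderiv ℝ F (β, 0) (1, 0)) z *
        dress ϱ (fun _ => 1) z) x * f x)) β := by
    set Φ := (pairL hf).comp (multW hA) with hΦ
    have h1 : HasDerivAt (fun b : ℝ => muDeriv M F (b, 0)) (fderiv ℝ (muDeriv M F) (β, 0) (1, 0)) β :=
      (hX.differentiableAt_muDeriv hℓ hc hB hκ).hasFDerivAt.comp_hasDerivAt
        (f := fun b : ℝ => (b, (0 : ℝ))) β (hasDerivAt_line β 0)
    have h2 := (Φ.restrictScalars ℝ).hasFDerivAt.comp_hasDerivAt β h1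
    have h3 := h2.congr_of_eventuallyEq
      (f₁ := fun b => avg (fun x => (sigma b (pot ℓ c) x : ℂ) * f x)) (by
        filter_upwards [esig] with b hb
        unfold avg
        rw [integral_congr_ae hb, ← integral_meas hd.measurable hd.nonneg]
        exact (pairL_multW hf hA _).symm)
    refine h3.congr_deriv ?_
    symm
    rw [ContinuousLinearMap.coe_restrictScalars', pairL_multW,
      integral_meas hd.measurable hd.nonneg]
    unfold avg
    apply integral_congr_ae
    filter_upwards [ae_leb_pos] with x hx
    rw [hcod x hx, Complex.real_smul]
    ring
  refine ⟨?_, ?_, hder.differentiableAt, ?_⟩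
  · filter_upwards [esig] with b hb
    refine Integrable.congr ?_ hb.symm
    exact (integrable_meas hd.measurable hd.nonneg).1 (hf.integrable_mul (memLp_wext hA _))
  · refine ((i2.congr eD').const_mul (kappa β (pot ℓ c) : ℂ)⁻¹).congr
      (Eventually.of_forall fun x => ?_)
    exact inv_mul_cancel_left₀ hκ' _
  · rw [hder.deriv, hadj]
    unfold avg
    rw [integral_congr_ae eD', integral_const_mul, inv_mul_cancel_left₀ hκ']

lemma ext_timeDir (n : ℕ) (x : ℝ) : ext (timeDir n) x = -2 * Complex.I * x ^ (2 * n) := by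
  unfold ext timeDir
  simp only [eval_mul, eval_C, eval_pow, eval_X]
  rw [Even.neg_pow (even_two_mul n), mul_pow, pow_mul Complex.I, Complex.I_sq]
  have h : ((-1 : ℂ) ^ n) * (-1) ^ n = 1 := by rw [← mul_pow]; simp
  rw [pow_succ]
  linear_combination (-2 * Complex.I * (x : ℂ) ^ (2 * n)) * h

lemma isDirection_timeDir (n : ℕ) : IsDirection ℓ (timeDir n) := by
  intro k _
  unfold timeDir
  rw [coeff_C_mul, coeff_X_pow]
  split_ifs
  · rcases neg_one_pow_eq_or ℂ (n + 1) with h | h <;> simp [h]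
  · simp

/-- The logarithmic derivative u = ∂_tϱ/ϱ solves u = −2i x^{2n} + m′ + Tu and has zero total charge,
as the mass is fixed. Pairing with g = 1^dr gives 0 = ∫u = ∫((1 − T)u) g = −2i ∫x^{2n} g + m′/κ, all
against ϱ dx; and σ = ϱg. -/
theorem IsBranch.deriv_mult_time (hℓ : 1 ≤ ℓ) (hc : 0 < c ℓ) (hβ : 0 < β)
    (hκ : kappa β (pot ℓ c) ≠ 0) {n : ℕ} (hB : IsBranch ℓ c β (timeDir n) R M) :
    Integrable (fun x => sigma β (pot ℓ c) x * x ^ (2 * n)) leb ∧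
    HasDerivAt (fun t : ℝ => M β t) (2 * Complex.I * (q n β (pot ℓ c) : ℂ)) 0 := by
  obtain ⟨F, hX⟩ := hB.exists_expansion hℓ hc hβ
  have hd := rho_dominated hℓ hc hβ
  have hA := hd.adm
  have hfin := hA.isFiniteMeasure
  have hDr := hX.dressable hℓ hc hβ hB hκ
  have hκ' : (kappa β (pot ℓ c) : ℂ) ≠ 0 := by exact_mod_cast hκ
  set ϱ := rho β (pot ℓ c) with hϱ
  set w := wt (c ℓ / 2) ℓ with hw
  set m' := fderiv ℝ (fun p : ℝ × ℝ => M p.1 p.2) (β, 0) (0, 1) with hm'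
  set u := wext w (fderiv ℝ F (β, 0) (0, 1)) with hu
  have hum : MemLp u 2 (meas ϱ) := memLp_wext hA _
  obtain ⟨h1, h2⟩ := (hX.first_order hℓ hc hβ).self_of_nhds (0, 1)
  have hue : ∀ x, 0 < x → u x = (-2 * Complex.I * x ^ (2 * n) + m') + potl (meas ϱ) u x :=
    fun x hx => by
      have h3 := h1 x hx
      rw [hX.one x hx, one_mul, ext_timeDir] at h3
      rw [hu, h3, hm']
      push_cast; ring
  have hu0 : ∫ x, u x ∂(meas ϱ) = 0 := by simpa using h2
  set g := dress ϱ (fun _ => 1) with hg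
  obtain ⟨hgm, hge⟩ := hDr.dress_spec (memLp_const 1)
  have hsrc := (hDr.dress_ae_eq (f := fun x : ℝ => -2 * Complex.I * x ^ (2 * n) + m') hum
    (ae_meas_of_pos hue)).1
  -- Square integrability of the monomial is read off from the equation: the source u − Tu lies in
  -- L², and so do constants.
  have hxn : MemLp (fun x : ℝ => (x : ℂ) ^ (2 * n)) 2 (meas ϱ) := by
    have := (hsrc.sub (memLp_const m')).const_mul (-2 * Complex.I)⁻¹
    refine (memLp_congr_ae (Eventually.of_forall fun x => ?_)).1 this
    change (-2 * Complex.I)⁻¹ * ((-2 * Complex.I * (x : ℂ) ^ (2 * n) + m') - m') = _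
    rw [add_sub_cancel_right, inv_mul_cancel_left₀ (by simp)]
  have hgi : Integrable g (meas ϱ) := hgm.integrable (by norm_num)
  have hxi : Integrable (fun x : ℝ => (x : ℂ) ^ (2 * n) * g x) (meas ϱ) := hxn.integrable_mul hgm
  have hsx : (fun x : ℝ => ((sigma β (pot ℓ c) x * x ^ (2 * n) : ℝ) : ℂ)) =ᵐ[leb]
      fun x : ℝ => ϱ x • ((x : ℂ) ^ (2 * n) * g x) := by
    filter_upwards [ae_leb_pos] with x hx
    rw [Complex.ofReal_mul, hX.sigma_eq hℓ hc hβ hB hκ hx, Complex.real_smul]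
    push_cast; ring
  have hsi : Integrable (fun x : ℝ => ((sigma β (pot ℓ c) x * x ^ (2 * n) : ℝ) : ℂ)) leb :=
    ((integrable_meas hd.measurable hd.nonneg).1 hxi).congr hsx.symm
  have hgint : ∫ x, g x ∂(meas ϱ) = (kappa β (pot ℓ c) : ℂ)⁻¹ := by
    rw [integral_congr_ae (ae_meas_of_pos fun x hx => hDr.dress_one hx), integral_const_mul,
      hDr.mass, mul_one]
  have hq : (q n β (pot ℓ c) : ℂ) = kappa β (pot ℓ c) *
      ∫ x : ℝ, (x : ℂ) ^ (2 * n) * g x ∂(meas ϱ) := by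
    unfold q
    rw [Complex.ofReal_mul, ← integral_complex_ofReal, integral_congr_ae hsx,
      ← integral_meas hd.measurable hd.nonneg]
  -- Replaces 1 by (1 − T)g and moves 1 − T onto u by symmetry.
  have hpair : ∫ x, u x ∂(meas ϱ) =
      ∫ x : ℝ, (-2 * Complex.I * ((x : ℂ) ^ (2 * n) * g x) + m' * g x) ∂(meas ϱ) := by
    have k1 : ∫ x, u x ∂(meas ϱ) = ∫ x, u x * g x ∂(meas ϱ) -
        ∫ x, u x * potl (meas ϱ) g x ∂(meas ϱ) := by
      rw [← integral_sub (f := fun x => u x * g x) (hum.integrable_mul hgm)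
        (hA.integrable_mul_potl hum hgm)]
      congr 1; funext x
      linear_combination (-u x) * hge x
    have h3 : Integrable (fun x => potl (meas ϱ) u x * g x) (meas ϱ) := by
      simpa only [mul_comm] using hA.integrable_mul_potl hgm hum
    rw [k1, hA.integral_mul_potl_comm hum hgm,
      ← integral_sub (f := fun x => u x * g x) (hum.integrable_mul hgm) h3]
    apply integral_congr_ae
    refine ae_meas_of_pos fun x hx => ?_
    linear_combination g x * hue x hx
  rw [hu0, integral_add (hxi.const_mul _) (hgi.const_mul _), integral_const_mul,
    integral_const_mul, hgint] at hpair
  refine ⟨?_, ?_⟩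
  · simpa only [RCLike.re_to_complex, Complex.ofReal_re] using hsi.re
  have hM : HasDerivAt (fun t : ℝ => M β t) m' 0 :=
    (hX.eventually_differentiableAt.self_of_nhds).2.hasFDerivAt.comp_hasDerivAt
      (f := fun t : ℝ => (β, t)) 0 ((hasDerivAt_const (0 : ℝ) β).prodMk (hasDerivAt_id (0 : ℝ)))
  refine hM.congr_deriv ?_
  rw [hq]
  field_simp at hpair
  linear_combination -hpair

end results

/-! ### Derivatives of dressed functions -/

section dressing

variable {ϱ w : ℝ → ℝ}

/-- `g ↦ T (ϱ w G g)` on `L²(ϱ dx)`. -/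
def dressL {ν : Measure ℝ} (hA : Adm ν w) :
    (Ioi (0 : ℝ) →ᵇ ℂ) →L[ℂ] Lp ℂ 2 ν →L[ℂ] Lp ℂ 2 ν :=
  (ContinuousLinearMap.compL ℂ (Lp ℂ 2 ν) (Lp ℂ 2 ν) (Lp ℂ 2 ν) (opW hA ℂ)).comp (multL hA)

lemma wext_mul_congr {ν : Measure ℝ} (hA : Adm ν w) (G : Ioi (0 : ℝ) →ᵇ ℂ) (g : Lp ℂ 2 ν) :
    (fun z => w z • multL hA G g z) =ᵐ[ν] fun z => wext w G z * g z := by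
  filter_upwards [multL_coe hA G g] with z hz
  rw [hz]
  unfold wext
  rw [smul_mul_assoc]

lemma dressL_coe {ν : Measure ℝ} (hA : Adm ν w) (G : Ioi (0 : ℝ) →ᵇ ℂ) (g : Lp ℂ 2 ν) :
    dressL hA G g =ᵐ[ν] potl ν (fun z => wext w G z * g z) := by
  have h1 := opW_coe hA (multL hA G g)
  rw [Adm.potl_congr (wext_mul_congr hA G g)] at h1
  exact h1

lemma pairL_multL {ν : Measure ℝ} (hA : Adm ν w) {x : ℝ} (hx : x ≠ 0) (G : Ioi (0 : ℝ) →ᵇ ℂ)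
    (g : Lp ℂ 2 ν) : pairL (hA.memLp_lk_ofReal hx) (multL hA G g) =
      potl ν (fun z => wext w G z * g z) x := by
  rw [pairL_apply, ← Adm.potl_congr (wext_mul_congr hA G g)]
  unfold potl
  congr 1; funext z
  simp only [Complex.real_smul]
  push_cast; ring

lemma isDressed_iff_potl (hd : Dominated ϱ w) {r : ℝ → ℂ} {G : Ioi (0 : ℝ) →ᵇ ℂ}
    (hr : ∀ z, 0 < z → r z = ϱ z * wext w G z) (f g : ℝ → ℂ) :
    IsDressed ϱ r f g ↔
      MemLp g 2 (meas ϱ) ∧ ∀ x, g x = f x + potl (meas ϱ) (fun z => wext w G z * g z) x := by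
  unfold IsDressed
  have : ∀ x, T (fun z => r z * g z) x = potl (meas ϱ) (fun z => wext w G z * g z) x := fun x => by
    rw [← T_ofReal_mul hd]
    exact T_congr (fun z hz => by rw [hr z hz, mul_assoc]) x
  simp only [this]

lemma coe_eq_of_sub_dressL {ν : Measure ℝ} (hA : Adm ν w) {G : Ioi (0 : ℝ) →ᵇ ℂ} {f g : Lp ℂ 2 ν}
    (h : (1 - dressL hA G) g = f) :
    g =ᵐ[ν] fun x => f x + potl ν (fun z => wext w G z * g z) x := by
  subst h
  have e : (1 - dressL hA G) g = g - dressL hA G g := rfl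
  rw [e]
  filter_upwards [Lp.coeFn_sub g (dressL hA G g), dressL_coe hA G g] with x h1 h2
  rw [h1, Pi.sub_apply, h2, sub_add_cancel]

lemma sub_dressL_eq {ν : Measure ℝ} (hA : Adm ν w) {G : Ioi (0 : ℝ) →ᵇ ℂ} {f g : Lp ℂ 2 ν}
    (h : g =ᵐ[ν] fun x => f x + potl ν (fun z => wext w G z * g z) x) :
    (1 - dressL hA G) g = f := by
  have e : (1 - dressL hA G) g = g - dressL hA G g := rfl
  rw [e]
  apply Lp.ext
  filter_upwards [Lp.coeFn_sub g (dressL hA G g), dressL_coe hA G g, h] with x h1 h2 h3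
  rw [h1, Pi.sub_apply, h2, h3, add_sub_cancel_right]

lemma isDressed_ae_eq (hd : Dominated ϱ w) {r : ℝ → ℂ} {G : Ioi (0 : ℝ) →ᵇ ℂ}
    (hr : ∀ z, 0 < z → r z = ϱ z * wext w G z) (hu : IsUnit (1 - dressL hd.adm G))
    {f g : ℝ → ℂ} (hf : MemLp f 2 (meas ϱ)) (hg : IsDressed ϱ r f g) :
    g =ᵐ[meas ϱ] Ring.inverse (1 - dressL hd.adm G) (hf.toLp f) := by
  obtain ⟨hgm, hge⟩ := (isDressed_iff_potl hd hr f g).1 hg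
  have h1 : (1 - dressL hd.adm G) (hgm.toLp g) = hf.toLp f := by
    apply sub_dressL_eq
    have e : (fun z => wext w G z * hgm.toLp g z) =ᵐ[meas ϱ] fun z => wext w G z * g z := by
      filter_upwards [hgm.coeFn_toLp] with z hz
      rw [hz]
    rw [Adm.potl_congr e]
    filter_upwards [hgm.coeFn_toLp, hf.coeFn_toLp] with x h2 h3
    rw [h2, h3, hge x]
  have h2 : hgm.toLp g = Ring.inverse (1 - dressL hd.adm G) (hf.toLp f) := by
    rw [← h1, ← mul_apply_eq_comp, Ring.inverse_mul_cancel _ hu]; rfl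
  rw [← h2]
  exact hgm.coeFn_toLp.symm

lemma existsUnique_isDressed_of_isUnit (hd : Dominated ϱ w) {r : ℝ → ℂ} {G : Ioi (0 : ℝ) →ᵇ ℂ}
    (hr : ∀ z, 0 < z → r z = ϱ z * wext w G z) (hu : IsUnit (1 - dressL hd.adm G))
    {f : ℝ → ℂ} (hf : MemLp f 2 (meas ϱ)) : ∃! g, IsDressed ϱ r f g := by
  set g₀ := Ring.inverse (1 - dressL hd.adm G) (hf.toLp f) with hg₀
  have h1 : (1 - dressL hd.adm G) g₀ = hf.toLp f := by
    rw [hg₀, ← mul_apply_eq_comp, Ring.mul_inverse_cancel _ hu]; rfl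
  have h2 : g₀ =ᵐ[meas ϱ] fun x => f x + potl (meas ϱ) (fun z => wext w G z * g₀ z) x := by
    filter_upwards [coe_eq_of_sub_dressL hd.adm h1, hf.coeFn_toLp] with x h3 h4
    rw [h3, h4]
  refine ⟨fun x => f x + potl (meas ϱ) (fun z => wext w G z * g₀ z) x,
    (isDressed_iff_potl hd hr _ _).2 ⟨(memLp_congr_ae h2).1 (Lp.memLp g₀), fun x => ?_⟩,
    fun g' hg' => ?_⟩
  · congr 1
    refine congrFun (Adm.potl_congr ?_) x
    filter_upwards [h2] with z hz
    rw [← hz]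
  · have h5 := isDressed_ae_eq hd hr hu hf hg'
    funext x
    rw [((isDressed_iff_potl hd hr _ _).1 hg').2 x]
    congr 1
    refine congrFun (Adm.potl_congr ?_) x
    filter_upwards [h5] with z hz
    rw [hz]

/-- Expresses the value at a point through a continuous functional of the operator inverse, so that
an L² derivative becomes a pointwise one. The functional is the kernel at x, for which square
integrability is available when x ≠ 0. -/
lemma dressBy_eq (hd : Dominated ϱ w) {r : ℝ → ℂ} {G : Ioi (0 : ℝ) →ᵇ ℂ}
    (hr : ∀ z, 0 < z → r z = ϱ z * wext w G z) (hu : IsUnit (1 - dressL hd.adm G))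
    {f : ℝ → ℂ} (hf : MemLp f 2 (meas ϱ)) :
    dressBy ϱ r f =ᵐ[meas ϱ] Ring.inverse (1 - dressL hd.adm G) (hf.toLp f) ∧
    ∀ x (hx : x ≠ 0), dressBy ϱ r f x = f x + pairL (hd.adm.memLp_lk_ofReal hx)
      (multL hd.adm G (Ring.inverse (1 - dressL hd.adm G) (hf.toLp f))) := by
  have h1 : IsDressed ϱ r f (dressBy ϱ r f) :=
    Classical.epsilon_spec (existsUnique_isDressed_of_isUnit hd hr hu hf).exists
  have h2 := isDressed_ae_eq hd hr hu hf h1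
  refine ⟨h2, fun x hx => ?_⟩
  rw [pairL_multL _ hx, ((isDressed_iff_potl hd hr _ _).1 h1).2 x]
  congr 1
  refine congrFun (Adm.potl_congr ?_) x
  filter_upwards [h2] with z hz
  rw [hz]

lemma Dressable.isUnit {h₁ : ℝ → ℂ} {κ : ℂ} (hD : Dressable ϱ w h₁ κ) {G : Ioi (0 : ℝ) →ᵇ ℂ}
    (hG : ∀ z, 0 < z → wext w G z = 1) : IsUnit (1 - dressL hD.dominated.adm G) := by
  have hA := hD.dominated.adm
  have e : ∀ g : ℝ → ℂ, potl (meas ϱ) (fun z => wext w G z * g z) = potl (meas ϱ) g := fun g =>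
    Adm.potl_congr (ae_meas_of_pos fun z hz => by simp only [hG z hz, one_mul])
  rw [ContinuousLinearMap.isUnit_iff_bijective]
  constructor
  · rw [injective_iff_map_eq_zero]
    intro g hg
    have h1 := coe_eq_of_sub_dressL hA hg
    apply Lp.ext
    refine (hD.eq_zero (Lp.memLp g) ?_).trans (Lp.coeFn_zero ℂ 2 (meas ϱ)).symm
    filter_upwards [h1, Lp.coeFn_zero ℂ 2 (meas ϱ)] with x h2 h3
    rw [e] at h2
    rw [h2, h3, Pi.zero_apply, zero_add]
  · intro f
    obtain ⟨g, hg, hge⟩ := hD.exists_solution (Lp.memLp f)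
    refine ⟨hg.toLp g, sub_dressL_eq hA ?_⟩
    rw [e, Adm.potl_congr hg.coeFn_toLp]
    filter_upwards [hg.coeFn_toLp] with x hx
    rw [hx, hge x]

/-- The resolvent derivative: d(1 − L)⁻¹ = (1 − L)⁻¹ dL (1 − L)⁻¹. -/
lemma hasFDerivAt_inverse_apply {X Y : Type*} [NormedAddCommGroup X] [NormedSpace ℂ X]
    [NormedAddCommGroup Y] [NormedSpace ℂ Y] [CompleteSpace Y] (L : X →L[ℂ] Y →L[ℂ] Y) (G : X)
    (hu : IsUnit (1 - L G)) (f : Y) :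
    ∃ Ψ : X →L[ℂ] Y, HasFDerivAt (fun G => Ring.inverse (1 - L G) f) Ψ G ∧
      ∀ H, Ψ H = Ring.inverse (1 - L G) (L H (Ring.inverse (1 - L G) f)) := by
  obtain ⟨U, hU⟩ := hu
  have h1 := hasFDerivAt_ringInverse (𝕜 := ℂ) U
  rw [hU] at h1
  have h2 : HasFDerivAt (fun G => 1 - L G) (-L) G := L.hasFDerivAt.const_sub 1
  have h3 := (h1.comp G h2).clm_apply (hasFDerivAt_const f G)
  refine ⟨_, h3, fun H => ?_⟩
  rw [← hU, Ring.inverse_unit]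
  simp

end dressing

section time

variable {ℓ : ℕ} {c : ℕ → ℝ} {β : ℝ} {W : ℂ[X]} {R : ℝ → ℝ → ℝ → ℂ} {M : ℝ → ℝ → ℂ}

/-- Along the branch the operator is 1 minus a continuous linear function of F, invertible at t = 0
because κ ≠ 0. Invertibility is an open condition, which gives unique solvability for small t, and
the resolvent derivative gives the formula. -/
theorem IsBranch.deriv_dressBy (hℓ : 1 ≤ ℓ) (hc : 0 < c ℓ) (hβ : 0 < β)
    (hκ : kappa β (pot ℓ c) ≠ 0) (hB : IsBranch ℓ c β W R M) {ψ : ℝ → ℂ}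
    (hψ : MemLp ψ 2 (meas (rho β (pot ℓ c)))) :
    (∀ᶠ t in 𝓝 (0 : ℝ), ∃! g, IsDressed (rho β (pot ℓ c)) (R β t) ψ g) ∧
    ∃ D : ℝ → ℂ, (∀ x, 0 < x → HasDerivAt (fun t : ℝ => R β t x) (D x) 0) ∧
      MemLp (T (fun z => D z * dress (rho β (pot ℓ c)) ψ z)) 2 (meas (rho β (pot ℓ c))) ∧
      ∀ x : ℝ, x ≠ 0 → HasDerivAt (fun t : ℝ => dressBy (rho β (pot ℓ c)) (R β t) ψ x)
        (dress (rho β (pot ℓ c)) (T (fun z => D z * dress (rho β (pot ℓ c)) ψ z)) x) 0 := by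
  obtain ⟨F, hX⟩ := hB.exists_expansion hℓ hc hβ
  have hDr := hX.dressable hℓ hc hβ hB hκ
  have hd := rho_dominated hℓ hc hβ
  have hA := hd.adm
  set ϱ := rho β (pot ℓ c) with hϱ
  set w := wt (c ℓ / 2) ℓ with hw
  set G := F (β, 0) with hG
  set H := fderiv ℝ F (β, 0) (0, 1) with hH
  have hu : IsUnit (1 - dressL hA G) := hDr.isUnit hX.one
  have hr₀ : ∀ z, 0 < z → (ϱ z : ℂ) = ϱ z * wext w G z := fun z hz => by
    rw [hX.one z hz, mul_one]
  have hF : HasDerivAt (fun t : ℝ => F (β, t)) H 0 :=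
    (hX.eventually_differentiableAt.self_of_nhds).1.hasFDerivAt.comp_hasDerivAt
      (f := fun t : ℝ => (β, t)) 0 ((hasDerivAt_const (0 : ℝ) β).prodMk (hasDerivAt_id (0 : ℝ)))
  have ht : Tendsto (fun t : ℝ => (β, t)) (𝓝 0) (𝓝 ((β, 0) : ℝ × ℝ)) :=
    ((hasDerivAt_const (0 : ℝ) β).prodMk (hasDerivAt_id (0 : ℝ))).continuousAt
  have hden := ht.eventually hX.density
  have hunit : ∀ᶠ t in 𝓝 (0 : ℝ), IsUnit (1 - dressL hA (F (β, t))) := by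
    have h1 : ContinuousAt (fun t : ℝ => 1 - dressL hA (F (β, t))) 0 :=
      continuousAt_const.sub ((dressL hA).continuous.continuousAt.comp hF.continuousAt)
    exact h1.eventually (Units.isOpen.mem_nhds hu)
  set g₀ := Ring.inverse (1 - dressL hA G) (hψ.toLp ψ) with hg₀
  have hdress : dress ϱ ψ =ᵐ[meas ϱ] g₀ := (dressBy_eq hd hr₀ hu hψ).1
  have hT : T (fun z => ϱ z * wext w H z * dress ϱ ψ z) =
      potl (meas ϱ) (fun z => wext w H z * g₀ z) := by
    funext x
    simp_rw [mul_assoc]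
    rw [T_ofReal_mul hd]
    refine congrFun (Adm.potl_congr ?_) x
    filter_upwards [hdress] with z hz
    rw [hz]
  have hTm : MemLp (T (fun z => ϱ z * wext w H z * dress ϱ ψ z)) 2 (meas ϱ) := by
    rw [hT]
    exact (memLp_congr_ae (dressL_coe hA H g₀)).1 (Lp.memLp _)
  refine ⟨?_, fun z => ϱ z * wext w H z, fun x hx => ?_, hTm, fun x hx => ?_⟩
  · filter_upwards [hunit, hden] with t hut hdt
    exact existsUnique_isDressed_of_isUnit hd hdt hut hψ
  · simpa using hX.hasDerivAt_density 0 hx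
  · obtain ⟨Ψ, hΨ, hΨe⟩ := hasFDerivAt_inverse_apply (dressL hA) G hu (hψ.toLp ψ)
    set Λ := pairL (hA.memLp_lk_ofReal hx) with hΛ
    have h1 := Λ.hasFDerivAt.comp G ((multL hA).hasFDerivAt.clm_apply hΨ)
    have h2 := (h1.restrictScalars ℝ).comp_hasDerivAt_of_eq (0 : ℝ) hF rfl
    have h3 := (h2.const_add (ψ x)).congr_of_eventuallyEq
      (f₁ := fun t : ℝ => dressBy ϱ (R β t) ψ x) (by
        filter_upwards [hunit, hden] with t hut hdt
        exact (dressBy_eq hd hdt hut hψ).2 x hx)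
    refine h3.congr_deriv ?_
    have h4 := (dressBy_eq hd hr₀ hu hTm).2 x hx
    have h5 : hTm.toLp _ = dressL hA H g₀ := by
      apply Lp.ext
      refine hTm.coeFn_toLp.trans ?_
      rw [hT]
      exact (dressL_coe hA H g₀).symm
    rw [h5, ← hΨe] at h4
    refine Eq.trans ?_ h4.symm
    rw [hT, ← pairL_multL hA hx]
    -- The product rule yields two terms. Varying the explicit density gives the source T(∂_tϱ ψ^dr)
    -- itself, and varying the inverse gives T applied to the dressing of that source; together they
    -- are its dressing at x.
    change Λ (multL hA G (Ψ H) + multL hA H g₀) = _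
    rw [map_add, add_comm]

end time

end Volterra

end

/-! ### The proposition. -/

theorem proposition5p1 (ℓ : ℕ) (hℓ : 1 ≤ ℓ) (c : ℕ → ℝ) (hc : 0 < c ℓ) (β : ℝ) (hβ : 0 < β)
    (V : Polynomial ℂ) (hV : V = Volterra.pot ℓ c) (ϱ : ℝ → ℝ) (hϱ : ϱ = Volterra.rho β V) :
    -- the minimizer and its multiplier are well defined, and differentiable in the mass
    ((∃! ϱ' : ℝ → ℝ, Volterra.IsMinimizer β V ϱ') ∧ Volterra.IsMinimizer β V ϱ ∧
      Volterra.EulerLagrange V ϱ (Volterra.mu β V) ∧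
      DifferentiableAt ℝ (fun b => Volterra.mu b V) β ∧
      ∀ x : ℝ, 0 < x → DifferentiableAt ℝ (fun b => Volterra.rho b V x) β) ∧
    (Volterra.kappa β V ≠ 0 →
      -- the two inverses exist
      ((∀ f : ℝ → ℂ, MemLp f 2 (Volterra.meas ϱ) →
          ∃! g, Volterra.IsDressed ϱ (fun z => (ϱ z : ℂ)) f g) ∧
        (∀ f : ℝ → ℂ, Volterra.MemDual ϱ f → ∃! h, Volterra.IsCodressed ϱ f h)) ∧
      -- intertwining of the two inverses
      (∀ f : ℝ → ℂ, MemLp f 2 (Volterra.meas ϱ) →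
        Volterra.MemDual ϱ (fun z => (ϱ z : ℂ) * f z) ∧
        ∀ w, Volterra.codress ϱ (fun z => (ϱ z : ℂ) * f z) w = (ϱ w : ℂ) * Volterra.dress ϱ f w) ∧
      -- adjointness
      (∀ f g : ℝ → ℂ, Volterra.MemDual ϱ f → MemLp g 2 (Volterra.meas ϱ) →
        Integrable (fun x => Volterra.codress ϱ f x * g x) Volterra.leb ∧
        Integrable (fun x => f x * Volterra.dress ϱ g x) Volterra.leb ∧
        Volterra.avg (fun x => Volterra.codress ϱ f x * g x) =
          Volterra.avg (fun x => f x * Volterra.dress ϱ g x)) ∧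
      -- in every admissible direction the perturbed density and multiplier exist
      (∀ W : Polynomial ℂ, Volterra.IsDirection ℓ W → ∃ R M, Volterra.IsBranch ℓ c β W R M) ∧
      -- the formula for `∂_⊙ ∂_μ ϱ`, for the variable ⊙ moving the mass and the potential along `(β + s b₀, V + s W)`
      (∀ W : Polynomial ℂ, Volterra.IsDirection ℓ W → ∀ R M, Volterra.IsBranch ℓ c β W R M →
        ∀ b₀ : ℝ, ∃ D : ℝ → ℂ,
          (∀ x : ℝ, 0 < x → HasDerivAt (fun s : ℝ => R (β + s * b₀) s x) (D x) 0) ∧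
          Volterra.MemDual ϱ (fun z => D z * Volterra.dress ϱ (fun _ => 1) z) ∧
          ∀ x : ℝ, 0 < x →
            HasDerivAt
              (fun s : ℝ => (deriv (fun b : ℝ => M b s) (β + s * b₀))⁻¹ *
                deriv (fun b : ℝ => R b s x) (β + s * b₀))
              (Volterra.codress ϱ (fun z => D z * Volterra.dress ϱ (fun _ => 1) z) x) 0) ∧
      -- the formula for `∂_μ ⟨σ f⟩`, with `∂_μ = κ⁻¹ ∂_β`
      (∀ f : ℝ → ℂ, MemLp f 2 (Volterra.meas ϱ) →
        (∀ᶠ b in 𝓝 β, Integrable (fun x => (Volterra.sigma b V x : ℂ) * f x) Volterra.leb) ∧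
        Integrable (fun x => (Volterra.sigma β V x : ℂ) * Volterra.dress ϱ (fun _ => 1) x *
          Volterra.dress ϱ f x) Volterra.leb ∧
        DifferentiableAt ℝ
          (fun b => Volterra.avg (fun x => (Volterra.sigma b V x : ℂ) * f x)) β ∧
        (Volterra.kappa β V : ℂ)⁻¹ *
            deriv (fun b => Volterra.avg (fun x => (Volterra.sigma b V x : ℂ) * f x)) β =
          Volterra.avg (fun x => (Volterra.sigma β V x : ℂ) * Volterra.dress ϱ (fun _ => 1) x *
            Volterra.dress ϱ f x)) ∧
      -- `∂_{t_n} μ = 2 i q_n`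
      (∀ n : ℕ, 1 ≤ n → Integrable (fun w => Volterra.sigma β V w * w ^ (2 * n)) Volterra.leb ∧
        ∀ R M, Volterra.IsBranch ℓ c β (Volterra.timeDir n) R M →
          HasDerivAt (fun t : ℝ => M β t) (2 * Complex.I * (Volterra.q n β V : ℂ)) 0) ∧
      -- the `t_n`-derivative of a dressed function
      (∀ n : ℕ, 1 ≤ n → ∀ R M, Volterra.IsBranch ℓ c β (Volterra.timeDir n) R M →
        ∀ ψ : ℝ → ℂ, MemLp ψ 2 (Volterra.meas ϱ) →
          (∀ᶠ t in 𝓝 (0 : ℝ), ∃! g, Volterra.IsDressed ϱ (R β t) ψ g) ∧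
          ∃ D : ℝ → ℂ,
            (∀ x : ℝ, 0 < x → HasDerivAt (fun t : ℝ => R β t x) (D x) 0) ∧
            MemLp (Volterra.T (fun z => D z * Volterra.dress ϱ ψ z)) 2 (Volterra.meas ϱ) ∧
            ∀ x : ℝ, x ≠ 0 →
              HasDerivAt (fun t : ℝ => Volterra.dressBy ϱ (R β t) ψ x)
                (Volterra.dress ϱ (Volterra.T (fun z => D z * Volterra.dress ϱ ψ z)) x) 0)) := by
  subst hV hϱ
  have hE := Volterra.exists_equilibrium hℓ hc hβ
  have hU := Volterra.isConfined_pot hℓ hc (half_pos hc)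
  have hmin := hE.1.isMinimizer hU hE.2
  have hEL : Volterra.EulerLagrange (Volterra.pot ℓ c) (Volterra.rho β (Volterra.pot ℓ c))
      (Volterra.mu β (Volterra.pot ℓ c)) := hE.1.eulerLagrange_iff.2 (by ring)
  -- The branch in the zero direction varies the mass alone. It gives differentiability in b, and it
  -- exists without the assumption on κ.
  obtain ⟨R₀, M₀, hB₀⟩ := Volterra.exists_isBranch hℓ hc hβ (Volterra.isDirection_zero (ℓ := ℓ))
  obtain ⟨F₀, hX₀⟩ := hB₀.exists_expansion hℓ hc hβ
  obtain ⟨hmu, -, hrho⟩ := (hB₀.eventually_mass_derivatives hℓ hc hX₀).self_of_nhds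
  refine ⟨⟨⟨_, hmin, fun r hr => hE.1.eq_of_isMinimizer hU hE.2 hr⟩, hmin, hEL, hmu,
    fun x hx => (hrho x hx).1⟩, fun hκ => ?_⟩
  have hD := hX₀.dressable hℓ hc hβ hB₀ hκ
  refine ⟨⟨fun f hf => hD.existsUnique_isDressed hf, fun f hf => hD.existsUnique_isCodressed hf⟩,
    fun f hf => ⟨Volterra.Dressable.memDual_mul hD.pos hf, fun w => hD.codress_mul hf w⟩,
    fun f g hf hg => hD.adjoint hf hg, fun W hW => Volterra.exists_isBranch hℓ hc hβ hW,
    fun W _ R M hB b₀ => hB.deriv_muDeriv hℓ hc hβ hκ b₀,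
    fun f hf => Volterra.deriv_avg_sigma hℓ hc hβ hκ hf, fun n _ => ⟨?_, fun R M hB =>
      (hB.deriv_mult_time hℓ hc hβ hκ).2⟩, fun n _ R M hB ψ hψ => hB.deriv_dressBy hℓ hc hβ hκ hψ⟩
  -- Integrability of the moments of σ does not refer to a branch, so one is supplied by the
  -- existence theorem.
  obtain ⟨R, M, hB⟩ := Volterra.exists_isBranch hℓ hc hβ (Volterra.isDirection_timeDir (ℓ := ℓ) n)
  exact (hB.deriv_mult_time hℓ hc hβ hκ).1
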